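/- A \emph{dual fullerene} is a simple triangulation of the sphere (with its embedding) in which every vertex has degree $5$ or $6$; a vertex of degree $k$ is called a $k$-vertex. \emph{Expansions and reductions.} For $i,j\ge 0$, an expansion of type $L_i$ or $B_{i,j}$ (or its mirror image) turns a dual fullerene $G$ into a dual fullerene $G'$ by replacing a patch, all of whose vertices are distinct, by a larger patch with the same boundary cycle. The boundary consists of two paths (sides) $f_0,f_1,\dots$ (upper, from left to right) and $g_0,g_1,\dots$ (lower, from left to right), joined by the edges $f_0g_0$ and $f_{\mathrm{last}}g_{\mathrm{last}}$. \begin{itemize} \item $L_i$: each side has $i+3$ vertices. The initial patch has no inner vertices and has the triangles $f_kg_kf_{k+1}$ and $g_kg_{k+1}f_{k+1}$ for $0\le k\le i+1$. The extended patch has as inner vertices a straight path $p_0,\dots,p_{i+1}$, where $p_k$ is adjacent to $f_k,f_{k+1},g_k,g_{k+1}$. The expansion turns the $5$-vertices $f_0$ and $g_{i+2}$ of $G$ into $6$-vertices. \item $B_{i,j}$: the sides have $i+j+3$ and $i+j+5$ vertices, respectively. The initial patch has no inner vertices, and in it $f_k$ is adjacent to $g_k,g_{k+1}$ for $k\le i$,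 to $g_{i+1},g_{i+2},g_{i+3}$ for $k=i+1$, and to $g_{k+1},g_{k+2}$ for $k\ge i+2$. The extended patch has as inner vertices a path $p_0,\dots,p_{i+j+2}$ with one bend, at $p_{i+1}$: $p_k$ is adjacent to $f_k,f_{k+1},g_k,g_{k+1}$ for $k\le i$, to $f_{i+1},g_{i+1},g_{i+2},g_{i+3}$ for $k=i+1$, and to $f_{k-1},f_k,g_{k+1},g_{k+2}$ for $k\ge i+2$. The expansion turns the $5$-vertices $g_0$ and $g_{i+j+4}$ of $G$ into $6$-vertices. \end{itemize} In $G'$ the two ends of the path $p$ are $5$-vertices and its other vertices are $6$-vertices. A \emph{reduction} of a dual fullerene is the inverse of such an expansion leading to it. \emph{The $5$-vertices of the reduction} are the two ends of the path $p$, and its \emph{length} is the number of edges of $p$, that is, $i+1$ for $L_i$ and $i+j+2$ for $B_{i,j}$. \emph{Canonical children.} A reduction is represented by triples $(e,x,d)$, where $e$ is the first directed edge of the path $p$ (starting at either end), $x$ is the type with its parameters and $d$ is the direction (orientation). To each representing triple one assigns a tuple $(x_0,\dots,x_5)$, where $x_0$ is the length of the reduction, $x_1$ is minus the length of the longest straight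 part of $p$ (that is, $-(i+1)$ for $L_i$ and $-\max\{i,j\}-1$ for $B_{i,j}$), and $x_2,\dots,x_5$ are strings depending on the triple, used to break ties; the choice of these strings is arbitrary. A reduction of $G'$ is \emph{canonical} if it has a representing triple whose tuple is lexicographically smallest among all representing triples of all reductions of $G'$. A dual fullerene $G'$ is a \emph{canonical child} of $G$ if it is obtained from $G$ by an expansion that is the inverse of a canonical reduction of $G'$. \textbf{Lemma.} If a dual fullerene $G$ has at least three reductions of length $2$ such that the sets of $5$-vertices of these reductions are pairwise disjoint, then every canonical child $G'$ of $G$ has a reduction of length at most $2$. -/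

import Mathlib

universe u v

/-- A connected simple graph with finitely many vertices, embedded in the sphere.  The embedding is
given by its rotation system: `rot v w` is the neighbour of `v` that follows the neighbour `w` in
clockwise order around `v` (the value is irrelevant when `w` is not a neighbour of `v`). -/
structure RotationSystem (V : Type u) where
  graph : SimpleGraph V
  finite : Finite V
  connected : graph.Connected
  rot : V → V → V
  rot_adj : ∀ {v w : V}, graph.Adj v w → graph.Adj v (rot v w)
  /-- The rotation at `v` permutes the neighbours of `v` in one cycle. -/
  rot_cyclic : ∀ {v w w' : V}, graph.Adj v w → graph.Adj v w' → ∃ k : ℕ, (rot v)^[k] w = w'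

namespace RotationSystem

variable {V : Type u} (M : RotationSystem V)

/-- The directed edge that follows `d` on the face lying to the left of `d`. -/
def faceNext (d : M.graph.Dart) : M.graph.Dart :=
  ⟨(d.snd, M.rot d.snd d.fst), M.rot_adj d.adj.symm⟩

/-- The number of faces: the number of cycles of `faceNext` on the directed edges. -/
noncomputable def faceCount : ℕ :=
  Nat.card (Quot fun d e : M.graph.Dart => M.faceNext d = e)

/-- The surface carrying the embedding is the sphere (Euler's formula `n + f = e + 2`). -/
def IsPlane : Prop :=
  Nat.card V + M.faceCount = M.graph.edgeSet.ncard + 2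

/-- Every face is a triangle. -/
def IsTriangulation : Prop :=
  ∀ d : M.graph.Dart, M.faceNext^[3] d = d

noncomputable def degree (v : V) : ℕ := (M.graph.neighborSet v).ncard

end RotationSystem

/-- A dual fullerene: a simple plane triangulation all of whose vertices have degree `5` or `6`. -/
structure DualFullerene (V : Type u) extends RotationSystem V where
  plane : toRotationSystem.IsPlane
  triangulation : toRotationSystem.IsTriangulation
  degree_eq : ∀ v, toRotationSystem.degree v = 5 ∨ toRotationSystem.degree v = 6

namespace DualFullerene

variable {V : Type u} (G : DualFullerene V)

/-- `a, b, c` are the vertices of a face, in counterclockwise order. -/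
def IsFace (a b c : V) : Prop :=
  G.graph.Adj a b ∧ G.rot b a = c

/-- `IsFace` for the orientation `d` of the sphere: for `d = true` it is that of `G`, for
`d = false` it is the opposite one (that of the mirror image). -/
def IsFaceDir : Bool → V → V → V → Prop
  | true, a, b, c => G.IsFace a b c
  | false, a, b, c => G.IsFace a c b

end DualFullerene

/-- The types of expansions and reductions: `L_i` and `B_{i,j}` for `i, j ≥ 0`. -/
inductive OpKind where
  | L (i : ℕ) : OpKind
  | B (i j : ℕ) : OpKind

namespace OpKind

/-- The length of the operation, i.e. the length of the path between its two (new) 5-vertices. -/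
def length : OpKind → ℕ
  | L i => i + 1
  | B i j => i + j + 2

/-- The length of the longest straight part of that path. -/
def straight : OpKind → ℕ
  | L i => i + 1
  | B i j => max i j + 1

/-- The number of vertices on the side `f` of the boundary of the patch. -/
def sizeF : OpKind → ℕ
  | L i => i + 3
  | B i j => i + j + 3

/-- The number of vertices on the side `g` of the boundary of the patch. -/
def sizeG : OpKind → ℕ
  | L i => i + 3
  | B i j => i + j + 5

/-- The boundary vertex at the first end of the patch whose degree grows from 5 to 6. -/
def firstEnd {α : Type u} (f g : ℕ → α) : OpKind → α
  | L _ => f 0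
  | B _ _ => g 0

/-- The boundary vertex at the last end of the patch whose degree grows from 5 to 6. -/
def lastEnd {α : Type u} (_f g : ℕ → α) : OpKind → α
  | L i => g (i + 2)
  | B i j => g (i + j + 4)

end OpKind

/-- The initial (small) patch of an operation.  Its boundary is the cycle
`g 0, g 1, ..., g last, f last, ..., f 1, f 0` (counterclockwise), and it has no inner vertices.
`SmallFace x f g a b c` says that `a, b, c` is one of its triangles, in counterclockwise order.
* For `L_i` the diagonals form the zigzag `g 0, f 1, g 1, f 2, ..., g (i+1), f (i+2)`.
* For `B_{i,j}`, put `c = i + 1`.  The diagonals form the zigzag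
  `g 1, f 0`, `g 1, f 1`, ..., `g c, f c`, then `f c, g (c+1)`, then `f c, g (c+2)`,
  `g (c+2), f (c+1)`, .... -/
inductive SmallFace {α : Type u} (f g : ℕ → α) : OpKind → α → α → α → Prop
  | L_up {i k : ℕ} (h : k ≤ i + 1) : SmallFace f g (.L i) (f k) (g k) (f (k + 1))
  | L_down {i k : ℕ} (h : k ≤ i + 1) : SmallFace f g (.L i) (g k) (g (k + 1)) (f (k + 1))
  | B_down₁ {i j k : ℕ} (h : k ≤ i + 1) : SmallFace f g (.B i j) (f k) (g k) (g (k + 1))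
  | B_up₁ {i j k : ℕ} (h : k ≤ i) : SmallFace f g (.B i j) (f k) (g (k + 1)) (f (k + 1))
  | B_down₂ {i j k : ℕ} (h₁ : i + 1 ≤ k) (h₂ : k ≤ i + j + 2) :
      SmallFace f g (.B i j) (f k) (g (k + 1)) (g (k + 2))
  | B_up₂ {i j k : ℕ} (h₁ : i + 1 ≤ k) (h₂ : k ≤ i + j + 1) :
      SmallFace f g (.B i j) (f k) (g (k + 2)) (f (k + 1))
  | rotate {x : OpKind} {a b c : α} (h : SmallFace f g x a b c) : SmallFace f g x b c a

/-- The extended (large) patch of an operation.  It has the same boundary cycle as the initial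
patch, and its inner vertices form a path `p 0, p 1, ..., p length`, the side `f` lying to the left
and the side `g` to the right of the path.  The path is straight for `L_i`; for `B_{i,j}` it turns
left at `p (i+1)` (where it leaves one neighbour of `p (i+1)` on its left and three on its right).
The two ends of the path have degree 5 and its other vertices have degree 6.
`LargeFace f g p x a b c` says that `a, b, c` is one of the triangles, in counterclockwise order. -/
inductive LargeFace {α : Type u} (f g p : ℕ → α) : OpKind → α → α → α → Prop
  | start {x : OpKind} : LargeFace f g p x (f 0) (g 0) (p 0)
  -- the straight patch
  | L_f {i k : ℕ} (h : k ≤ i + 1) : LargeFace f g p (.L i) (f k) (p k) (f (k + 1))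
  | L_g {i k : ℕ} (h : k ≤ i + 1) : LargeFace f g p (.L i) (g k) (g (k + 1)) (p k)
  | L_pf {i k : ℕ} (h : k ≤ i) : LargeFace f g p (.L i) (p k) (p (k + 1)) (f (k + 1))
  | L_pg {i k : ℕ} (h : k ≤ i) : LargeFace f g p (.L i) (p k) (g (k + 1)) (p (k + 1))
  | L_stop {i : ℕ} : LargeFace f g p (.L i) (g (i + 2)) (f (i + 2)) (p (i + 1))
  -- the bent patch, before the turn
  | B_f₁ {i j k : ℕ} (h : k ≤ i) : LargeFace f g p (.B i j) (f k) (p k) (f (k + 1))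
  | B_g₁ {i j k : ℕ} (h : k ≤ i) : LargeFace f g p (.B i j) (g k) (g (k + 1)) (p k)
  | B_pf₁ {i j k : ℕ} (h : k ≤ i) : LargeFace f g p (.B i j) (p k) (p (k + 1)) (f (k + 1))
  | B_pg₁ {i j k : ℕ} (h : k ≤ i) : LargeFace f g p (.B i j) (p k) (g (k + 1)) (p (k + 1))
  -- the bent patch, at the turn
  | B_turn₁ {i j : ℕ} : LargeFace f g p (.B i j) (g (i + 1)) (g (i + 2)) (p (i + 1))
  | B_turn₂ {i j : ℕ} : LargeFace f g p (.B i j) (g (i + 2)) (g (i + 3)) (p (i + 1))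
  -- the bent patch, after the turn
  | B_pf₂ {i j k : ℕ} (h₁ : i + 1 ≤ k) (h₂ : k ≤ i + j + 1) :
      LargeFace f g p (.B i j) (p k) (p (k + 1)) (f k)
  | B_f₂ {i j k : ℕ} (h₁ : i + 1 ≤ k) (h₂ : k ≤ i + j + 1) :
      LargeFace f g p (.B i j) (f k) (p (k + 1)) (f (k + 1))
  | B_pg₂ {i j k : ℕ} (h₁ : i + 1 ≤ k) (h₂ : k ≤ i + j + 1) :
      LargeFace f g p (.B i j) (p k) (g (k + 2)) (p (k + 1))
  | B_g₂ {i j k : ℕ} (h₁ : i + 1 ≤ k) (h₂ : k ≤ i + j + 1) :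
      LargeFace f g p (.B i j) (g (k + 2)) (g (k + 3)) (p (k + 1))
  | B_stop {i j : ℕ} :
      LargeFace f g p (.B i j) (g (i + j + 4)) (f (i + j + 2)) (p (i + j + 2))
  | rotate {x : OpKind} {a b c : α} (h : LargeFace f g p x a b c) : LargeFace f g p x b c a

/-- An expansion of type `L` or `B` leading from the dual fullerene `G` to the dual fullerene `G'`
(together with a choice of the end at which the description of the patch starts): the triangles of
an initial patch of `G` are replaced by those of the extended patch.  `dir = true` means that the
patch is positioned as drawn, `dir = false` that it is positioned as its mirror image. -/
structure Expansion {V : Type u} {W : Type v} (G : DualFullerene V) (G' : DualFullerene W) where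
  kind : OpKind
  dir : Bool
  /-- The two sides of the boundary of the patch; only `f k` with `k < kind.sizeF` and `g k` with
  `k < kind.sizeG` matter. -/
  f : ℕ → V
  g : ℕ → V
  /-- The path of new vertices; only `p k` with `k ≤ kind.length` matters. -/
  p : ℕ → W
  /-- The vertices of `G`, as vertices of `G'`. -/
  old : V → W
  old_injective : Function.Injective old
  /-- The vertices of the patch are pairwise distinct. -/
  f_injOn : Set.InjOn f {k | k < kind.sizeF}
  g_injOn : Set.InjOn g {k | k < kind.sizeG}
  f_ne_g : ∀ k l, k < kind.sizeF → l < kind.sizeG → f k ≠ g l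
  p_injOn : Set.InjOn p {k | k ≤ kind.length}
  /-- The new vertices are exactly those on the path `p`. -/
  new_iff : ∀ w, (∃ k ≤ kind.length, p k = w) ↔ w ∉ Set.range old
  /-- The initial patch is a part of `G`. -/
  small_isFace : ∀ a b c, SmallFace f g kind a b c → G.IsFaceDir dir a b c
  /-- The faces of `G'` are those of `G` outside the initial patch and those of the extended
  patch. -/
  isFace_iff : ∀ a b c, G'.IsFaceDir dir a b c ↔
    (∃ a₀ b₀ c₀, G.IsFaceDir dir a₀ b₀ c₀ ∧ ¬ SmallFace f g kind a₀ b₀ c₀ ∧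
      old a₀ = a ∧ old b₀ = b ∧ old c₀ = c) ∨
    LargeFace (old ∘ f) (old ∘ g) p kind a b c
  /-- The two 5-vertices of `G` that become 6-vertices. -/
  first_old : G.degree (kind.firstEnd f g) = 5
  last_old : G.degree (kind.lastEnd f g) = 5
  /-- The two new 5-vertices; the other new vertices are 6-vertices. -/
  first_new : G'.degree (p 0) = 5
  last_new : G'.degree (p kind.length) = 5
  inner_new : ∀ k, 0 < k → k < kind.length → G'.degree (p k) = 6

/-- A reduction of a dual fullerene `G`: the inverse of an expansion (of type `L` or `B`) that leads
from some dual fullerene to `G`. -/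
structure Reduction {W : Type u} (G : DualFullerene W) where
  V : Type u
  parent : DualFullerene V
  expansion : Expansion parent G

/-- The triples `(e, x, d)` that represent reductions: `e` is the first directed edge of the path
between the two 5-vertices, `x` is the parameter set, `d` is the direction. -/
structure RepTriple (W : Type u) where
  edge : W × W
  kind : OpKind
  dir : Bool

namespace Reduction

variable {W : Type u} {G : DualFullerene W} (R : Reduction G)

/-- The length of a reduction: `i + 1` for `L_i` and `i + j + 2` for `B_{i,j}`. -/
def length : ℕ := R.expansion.kind.length

/-- The two 5-vertices of a reduction. -/
def fiveVertices : Set W :=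
  {R.expansion.p 0, R.expansion.p R.expansion.kind.length}

/-- The representing triple of a reduction that starts at the chosen end of the path. -/
def triple : RepTriple W where
  edge := (R.expansion.p 0, R.expansion.p 1)
  kind := R.expansion.kind
  dir := R.expansion.dir

/-- The 6-tuple `(x₀, ..., x₅)`, ordered lexicographically: `x₀` is the length of the reduction,
`x₁` is the negative of the length of its longest straight path, and `x₂, ..., x₅` are given
strings that depend on the representing triple. -/
def sixTuple (x₂ x₃ x₄ x₅ : RepTriple W → List ℕ) :
    ℕ ×ₗ ℤ ×ₗ List ℕ ×ₗ List ℕ ×ₗ List ℕ ×ₗ List ℕ :=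
  toLex (R.length, toLex (-(R.expansion.kind.straight : ℤ),
    toLex (x₂ R.triple, toLex (x₃ R.triple, toLex (x₄ R.triple, x₅ R.triple)))))

/-- A reduction of `G` is canonical (with respect to `x₂, ..., x₅`) if its 6-tuple is the smallest
one that occurs among all reductions of `G`. -/
def IsCanonical (x₂ x₃ x₄ x₅ : RepTriple W → List ℕ) : Prop :=
  ∀ R' : Reduction G, R.sixTuple x₂ x₃ x₄ x₅ ≤ R'.sixTuple x₂ x₃ x₄ x₅

end Reduction

/-- `G'` is a canonical child of `G`: it is obtained from `G` by an expansion that is the inverse of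
a canonical reduction of `G'`. -/
def IsCanonicalChild {V W : Type u} (x₂ x₃ x₄ x₅ : RepTriple W → List ℕ)
    (G : DualFullerene V) (G' : DualFullerene W) : Prop :=
  ∃ E : Expansion G G', (Reduction.mk V G E).IsCanonical x₂ x₃ x₄ x₅

/-! Let `E` be the expansion whose inverse is the canonical reduction, and suppose that `G'` has no
reduction of length at most 2. Then `E` has length at least 3. Since the length is the first entry
of the 6-tuple, no reduction of `G'` is shorter than `E`.

This forces degree 6 on the whole boundary of the extended patch, except possibly at the vertex `g
(i + 2)` outside the bend (`Expansion.bdrySix`). A side vertex of degree 5 followed by one of degree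
6 allows the path to turn off early towards it, which gives a shorter reduction
(`Ray.hasRed_of_side`). A run of 5-vertices on a side, preceded by a 6-vertex, contains the path of
an `L_0` reduction (`Ray.hasRed_of_run`). Near the ends of the path, the absence of reductions of
length at most 2 forces a cluster of 5-vertices. In one case the cluster closes up in an impossible
way (`Ray.degree_A_one`). In the other it contains seven 5-vertices of `G`, each with three
consecutive neighbours of degree 5 in `G` (`Ray.degree_B_zero`). Such a vertex is not an end of a
reduction of length 2 of `G`, so these seven and the six ends given by the hypothesis would be 13
vertices of degree 5, while Euler's formula allows only 12 (`Expansion.not_blocked_of_cyc5`).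

Each of the two vertices whose degree grows under `E` lies in at most one of the three disjoint sets
of ends, so one of the three reductions, with path `u v w`, has neither of them as an end. The
expansion changes links only by cutting diagonals of the initial patch, and the only diagonal with
an end that still has degree 5 joins `f (i + 1)` to `g (i + 2)`. If neither edge of the path is this
diagonal, the reduction survives in `G'` (`BdrySix.path2_old`). If one is, the path becomes a
straight path of length 3 and `G'` has an `L_2` reduction (`BdrySix.exists_reduction_of_bend`). It
is either shorter than the bent `E` or equally long with a longer straight part, against canonicity.

Reductions are produced by one principle, `IsPatch.exists_reduction`: an embedded extended patch
whose two end vertices have degree 6 can be replaced by the initial patch. That the result is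
simple, and that patches read off from links have distinct vertices, rests on the absence of
separating triangles and quadrilaterals (`face_of_adj`, `split_of_adj`). These come from a Jordan
curve statement, proved by homology modulo 2, and an induction that pushes a closed curve inwards.
-/

namespace DualFullerene

/-! ### Rotations and links of vertices. -/

variable {V : Type u} {G : DualFullerene V} {d : Bool} {a b c v w : V}

theorem IsFace.rotate (h : G.IsFace a b c) : G.IsFace b c a := by
  obtain ⟨hab, rfl⟩ := h
  refine ⟨G.rot_adj hab.symm, ?_⟩
  have := congrArg (fun D : G.graph.Dart => D.fst) (G.triangulation ⟨(a, b), hab⟩)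
  simpa [RotationSystem.faceNext] using this

theorem isFaceDir_not : G.IsFaceDir (!d) a c b ↔ G.IsFaceDir d a b c := by
  cases d <;> rfl

theorem IsFaceDir.rotate (h : G.IsFaceDir d a b c) : G.IsFaceDir d b c a := by
  cases d
  · exact IsFace.rotate (IsFace.rotate h)
  · exact IsFace.rotate h

theorem IsFaceDir.rotate₂ (h : G.IsFaceDir d a b c) : G.IsFaceDir d c a b := h.rotate.rotate

theorem IsFaceDir.adj (h : G.IsFaceDir d a b c) : G.graph.Adj a b := by
  cases d
  · exact (IsFace.rotate (IsFace.rotate h)).1.symm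
  · exact h.1

theorem IsFaceDir.unique {c' : V} (h : G.IsFaceDir d a b c) (h' : G.IsFaceDir d a b c') :
    c = c' := by
  cases d
  · have h₁ : G.IsFace b a c := IsFace.rotate (IsFace.rotate h)
    have h₂ : G.IsFace b a c' := IsFace.rotate (IsFace.rotate h')
    exact h₁.2.symm.trans h₂.2
  · exact h.2.symm.trans h'.2

theorem exists_isFaceDir (d : Bool) (h : G.graph.Adj a b) : ∃ c, G.IsFaceDir d a b c := by
  cases d
  · have h' : G.IsFace b a (G.rot a b) := ⟨h.symm, rfl⟩
    exact ⟨_, h'.rotate⟩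
  · exact ⟨_, h, rfl⟩

theorem IsFaceDir.ne₁₂ (h : G.IsFaceDir d a b c) : a ≠ b := h.adj.ne
theorem IsFaceDir.ne₂₃ (h : G.IsFaceDir d a b c) : b ≠ c := h.rotate.adj.ne
theorem IsFaceDir.ne₁₃ (h : G.IsFaceDir d a b c) : a ≠ c := h.rotate₂.adj.ne.symm


theorem isFaceDir_not' : G.IsFaceDir (!d) c b a ↔ G.IsFaceDir d a b c :=
  ⟨fun h => (isFaceDir_not.1 h).rotate, fun h => isFaceDir_not.2 h.rotate₂⟩

/-- The neighbour of `v` that follows `w` in the rotation at `v` in direction `d`. -/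
noncomputable def next (G : DualFullerene V) (d : Bool) (v w : V) : V :=
  open Classical in if h : ∃ c, G.IsFaceDir d w v c then h.choose else w

theorem isFaceDir_next (h : G.graph.Adj v w) : G.IsFaceDir d w v (G.next d v w) := by
  have h' := exists_isFaceDir d h.symm
  rw [next, dif_pos h']
  exact h'.choose_spec

theorem IsFaceDir.next_eq (h : G.IsFaceDir d a v b) : G.next d v a = b :=
  (isFaceDir_next h.adj.symm).unique h

theorem adj_next (h : G.graph.Adj v w) : G.graph.Adj v (G.next d v w) :=
  (isFaceDir_next h).rotate.adj

theorem adj_iterate_next (h : G.graph.Adj v w) (k : ℕ) : G.graph.Adj v ((G.next d v)^[k] w) := by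
  induction k with
  | zero => exact h
  | succ k ih => rw [Function.iterate_succ_apply']; exact adj_next ih

theorem next_not_next (h : G.graph.Adj v w) : G.next (!d) v (G.next d v w) = w :=
  (isFaceDir_not'.2 (isFaceDir_next h)).next_eq

/-- For `d = true` the map `next` is `rot` on neighbours. For `d = false` it is the inverse, so a
walk from `b` to `a` is read backwards. -/
theorem next_cyclic (d : Bool) (h : G.graph.Adj v a) (h' : G.graph.Adj v b) :
    ∃ k, (G.next d v)^[k] a = b := by
  have key : ∀ k w, G.graph.Adj v w → (G.next true v)^[k] w = (G.rot v)^[k] w := by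
    intro k w hw
    induction k with
    | zero => rfl
    | succ k ih =>
      rw [Function.iterate_succ_apply', Function.iterate_succ_apply', ← ih]
      exact (isFaceDir_next (d := true) (adj_iterate_next hw k)).2.symm
  cases d
  · obtain ⟨k, hk⟩ := G.rot_cyclic h' h
    refine ⟨k, ?_⟩
    rw [← key k b h'] at hk
    clear h
    induction k generalizing b with
    | zero => exact hk.symm
    | succ k ih =>
      rw [Function.iterate_succ_apply] at hk
      rw [Function.iterate_succ_apply', ih (adj_next h') hk]
      exact next_not_next (d := true) h'
  · obtain ⟨k, hk⟩ := G.rot_cyclic h h'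
    exact ⟨k, (key k a h).trans hk⟩

/-- The rotation is transitive on the neighbours of `v`, so these are exactly the distinct iterates
of `w` below its period. -/
theorem minimalPeriod_next (h : G.graph.Adj v w) :
    Function.minimalPeriod (G.next d v) w = G.degree v := by
  have hfin := G.finite
  have hset : G.graph.neighborSet v =
      (fun k => (G.next d v)^[k] w) '' (Finset.range (Function.minimalPeriod (G.next d v) w)) := by
    ext x
    constructor
    · intro hx
      obtain ⟨k, hk⟩ := next_cyclic d h hx
      have hp : 0 < Function.minimalPeriod (G.next d v) w := by
        obtain ⟨l, hl⟩ := next_cyclic d (adj_next (d := d) h) h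
        exact Function.IsPeriodicPt.minimalPeriod_pos (n := l + 1) (Nat.succ_pos _) hl
      refine ⟨k % Function.minimalPeriod (G.next d v) w, ?_, ?_⟩
      · simpa using Nat.mod_lt _ hp
      · simpa only [Function.iterate_mod_minimalPeriod_eq] using hk
    · rintro ⟨k, -, rfl⟩
      exact adj_iterate_next h k
  have hinj : Set.InjOn (fun k => (G.next d v)^[k] w)
      (Finset.range (Function.minimalPeriod (G.next d v) w)) := by
    have := Function.iterate_injOn_Iio_minimalPeriod (f := G.next d v) (x := w)
    simpa using this
  rw [RotationSystem.degree, hset, hinj.ncard_image, Set.ncard_coe_finset,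
    Finset.card_range]

theorem degree_dvd (h : G.graph.Adj v w) {k : ℕ} (hk : (G.next d v)^[k] w = w) :
    G.degree v ∣ k := by
  rw [← minimalPeriod_next (d := d) h]
  exact Function.IsPeriodicPt.minimalPeriod_dvd hk

theorem iterate_degree (h : G.graph.Adj v w) : (G.next d v)^[G.degree v] w = w := by
  rw [← minimalPeriod_next (d := d) h]
  exact Function.iterate_minimalPeriod

section chains

variable {e f g : V}

/-- A chain of consecutive faces around `v` that returns to its start has a length divisible by the
degree. Degrees 5 and 6 therefore exclude the lengths 2, 3 and 4; many contradictions below take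
this form. -/
theorem not_close_two (h₁ : G.IsFaceDir d a v b) (h₂ : G.IsFaceDir d b v a) : False := by
  have := degree_dvd (d := d) (k := 2) h₁.adj.symm (by
    simp [Function.iterate_succ_apply, h₁.next_eq, h₂.next_eq])
  rcases G.degree_eq v with h | h <;> rw [h] at this <;> omega

theorem not_close_three (h₁ : G.IsFaceDir d a v b) (h₂ : G.IsFaceDir d b v c)
    (h₃ : G.IsFaceDir d c v a) : False := by
  have := degree_dvd (d := d) (k := 3) h₁.adj.symm (by
    simp [Function.iterate_succ_apply, h₁.next_eq, h₂.next_eq, h₃.next_eq])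
  rcases G.degree_eq v with h | h <;> rw [h] at this <;> omega

theorem not_close_four (h₁ : G.IsFaceDir d a v b) (h₂ : G.IsFaceDir d b v c)
    (h₃ : G.IsFaceDir d c v e) (h₄ : G.IsFaceDir d e v a) : False := by
  have := degree_dvd (d := d) (k := 4) h₁.adj.symm (by
    simp [Function.iterate_succ_apply, h₁.next_eq, h₂.next_eq, h₃.next_eq, h₄.next_eq])
  rcases G.degree_eq v with h | h <;> rw [h] at this <;> omega

/-- The neighbours of the vertex `v` of degree 5 are `a, b, c, e, f`, in this cyclic order. -/
structure Cyc5 (G : DualFullerene V) (d : Bool) (v a b c e f : V) : Prop where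
  f₁ : G.IsFaceDir d a v b
  f₂ : G.IsFaceDir d b v c
  f₃ : G.IsFaceDir d c v e
  f₄ : G.IsFaceDir d e v f
  f₅ : G.IsFaceDir d f v a

/-- The neighbours of the vertex `v` of degree 6 are `a, b, c, e, f, g`, in this cyclic order. -/
structure Cyc6 (G : DualFullerene V) (d : Bool) (v a b c e f g : V) : Prop where
  f₁ : G.IsFaceDir d a v b
  f₂ : G.IsFaceDir d b v c
  f₃ : G.IsFaceDir d c v e
  f₄ : G.IsFaceDir d e v f
  f₅ : G.IsFaceDir d f v g
  f₆ : G.IsFaceDir d g v a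

theorem Cyc5.turn (h : Cyc5 G d v a b c e f) : Cyc5 G d v b c e f a :=
  ⟨h.f₂, h.f₃, h.f₄, h.f₅, h.f₁⟩

theorem Cyc6.turn (h : Cyc6 G d v a b c e f g) : Cyc6 G d v b c e f g a :=
  ⟨h.f₂, h.f₃, h.f₄, h.f₅, h.f₆, h.f₁⟩

theorem Cyc5.flip (h : Cyc5 G d v a b c e f) : Cyc5 G (!d) v a f e c b :=
  ⟨isFaceDir_not'.2 h.f₅, isFaceDir_not'.2 h.f₄, isFaceDir_not'.2 h.f₃, isFaceDir_not'.2 h.f₂,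
    isFaceDir_not'.2 h.f₁⟩

theorem Cyc6.flip (h : Cyc6 G d v a b c e f g) : Cyc6 G (!d) v a g f e c b :=
  ⟨isFaceDir_not'.2 h.f₆, isFaceDir_not'.2 h.f₅, isFaceDir_not'.2 h.f₄, isFaceDir_not'.2 h.f₃,
    isFaceDir_not'.2 h.f₂, isFaceDir_not'.2 h.f₁⟩

theorem Cyc5.degree (h : Cyc5 G d v a b c e f) : G.degree v = 5 := by
  have := degree_dvd (d := d) (k := 5) h.f₁.adj.symm (by
    simp [Function.iterate_succ_apply, h.f₁.next_eq, h.f₂.next_eq, h.f₃.next_eq, h.f₄.next_eq,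
      h.f₅.next_eq])
  rcases G.degree_eq v with h | h <;> (rw [h] at this ⊢; try omega)

theorem Cyc6.degree (h : Cyc6 G d v a b c e f g) : G.degree v = 6 := by
  have := degree_dvd (d := d) (k := 6) h.f₁.adj.symm (by
    simp [Function.iterate_succ_apply, h.f₁.next_eq, h.f₂.next_eq, h.f₃.next_eq, h.f₄.next_eq,
      h.f₅.next_eq, h.f₆.next_eq])
  rcases G.degree_eq v with h | h <;> (rw [h] at this ⊢; try omega)

theorem exists_cyc5 (d : Bool) (hv : G.degree v = 5) (h : G.graph.Adj v a) :
    ∃ b c e f, Cyc5 G d v a b c e f := by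
  have hp := iterate_degree (d := d) h
  rw [hv] at hp
  have h₁ := isFaceDir_next (d := d) h
  have h₂ := isFaceDir_next (d := d) h₁.rotate.adj
  have h₃ := isFaceDir_next (d := d) h₂.rotate.adj
  have h₄ := isFaceDir_next (d := d) h₃.rotate.adj
  have h₅ := isFaceDir_next (d := d) h₄.rotate.adj
  simp only [Function.iterate_succ_apply, Function.iterate_zero, id] at hp
  rw [hp] at h₅
  exact ⟨_, _, _, _, h₁, h₂, h₃, h₄, h₅⟩

theorem exists_cyc6 (d : Bool) (hv : G.degree v = 6) (h : G.graph.Adj v a) :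
    ∃ b c e f g, Cyc6 G d v a b c e f g := by
  have hp := iterate_degree (d := d) h
  rw [hv] at hp
  have h₁ := isFaceDir_next (d := d) h
  have h₂ := isFaceDir_next (d := d) h₁.rotate.adj
  have h₃ := isFaceDir_next (d := d) h₂.rotate.adj
  have h₄ := isFaceDir_next (d := d) h₃.rotate.adj
  have h₅ := isFaceDir_next (d := d) h₄.rotate.adj
  have h₆ := isFaceDir_next (d := d) h₅.rotate.adj
  simp only [Function.iterate_succ_apply, Function.iterate_zero, id] at hp
  rw [hp] at h₆
  exact ⟨_, _, _, _, _, h₁, h₂, h₃, h₄, h₅, h₆⟩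

/-- The rotation at `v` is a single cycle, so a property of neighbours spreads to all of them once
it passes from each neighbour to the next. -/
theorem mem_of_closed (d : Bool) {S : Set V} (ha : G.graph.Adj v a) (haS : a ∈ S)
    (hS : ∀ x ∈ S, ∀ y, G.IsFaceDir d x v y → y ∈ S) (hw : G.graph.Adj v w) : w ∈ S := by
  obtain ⟨k, rfl⟩ := next_cyclic d ha hw
  clear hw
  induction k with
  | zero => exact haS
  | succ k ih =>
    rw [Function.iterate_succ_apply']
    exact hS _ ih _ (isFaceDir_next (adj_iterate_next ha k))

theorem Cyc5.mem (h : Cyc5 G d v a b c e f) (hw : G.graph.Adj v w) :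
    w = a ∨ w = b ∨ w = c ∨ w = e ∨ w = f := by
  refine mem_of_closed d (S := {w | w = a ∨ w = b ∨ w = c ∨ w = e ∨ w = f}) h.f₁.adj.symm
    (Or.inl rfl) ?_ hw
  rintro x (rfl | rfl | rfl | rfl | rfl) y hy
  · simp [hy.unique h.f₁]
  · simp [hy.unique h.f₂]
  · simp [hy.unique h.f₃]
  · simp [hy.unique h.f₄]
  · simp [hy.unique h.f₅]

theorem Cyc6.mem (h : Cyc6 G d v a b c e f g) (hw : G.graph.Adj v w) :
    w = a ∨ w = b ∨ w = c ∨ w = e ∨ w = f ∨ w = g := by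
  refine mem_of_closed d (S := {w | w = a ∨ w = b ∨ w = c ∨ w = e ∨ w = f ∨ w = g})
    h.f₁.adj.symm (Or.inl rfl) ?_ hw
  rintro x (rfl | rfl | rfl | rfl | rfl | rfl) y hy
  · simp [hy.unique h.f₁]
  · simp [hy.unique h.f₂]
  · simp [hy.unique h.f₃]
  · simp [hy.unique h.f₄]
  · simp [hy.unique h.f₅]
  · simp [hy.unique h.f₆]

theorem Cyc5.ne₁₂ (h : Cyc5 G d v a b c e f) : a ≠ b := h.f₁.ne₁₃

theorem Cyc5.ne₁₃ (h : Cyc5 G d v a b c e f) : a ≠ c := by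
  rintro rfl
  exact not_close_two h.f₁ h.f₂

theorem Cyc5.ne₁₄ (h : Cyc5 G d v a b c e f) : a ≠ e := h.turn.turn.turn.ne₁₃.symm

theorem Cyc5.ne₁₅ (h : Cyc5 G d v a b c e f) : a ≠ f := h.f₅.ne₁₃.symm

theorem Cyc6.ne₁₂ (h : Cyc6 G d v a b c e f g) : a ≠ b := h.f₁.ne₁₃

theorem Cyc6.ne₁₃ (h : Cyc6 G d v a b c e f g) : a ≠ c := by
  rintro rfl
  exact not_close_two h.f₁ h.f₂

theorem Cyc6.ne₁₄ (h : Cyc6 G d v a b c e f g) : a ≠ e := by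
  rintro rfl
  exact not_close_three h.f₁ h.f₂ h.f₃

theorem Cyc6.ne₁₅ (h : Cyc6 G d v a b c e f g) : a ≠ f := h.turn.turn.turn.turn.ne₁₃.symm

theorem Cyc6.ne₁₆ (h : Cyc6 G d v a b c e f g) : a ≠ g := h.f₆.ne₁₃.symm

theorem Cyc5.nodup (h : Cyc5 G d v a b c e f) : [a, b, c, e, f].Nodup := by
  have h₂ := h.turn
  have h₃ := h₂.turn
  have h₄ := h₃.turn
  simp [h.ne₁₂, h.ne₁₃, h.ne₁₄, h.ne₁₅, h₂.ne₁₂, h₂.ne₁₃, h₂.ne₁₄, h₃.ne₁₂, h₃.ne₁₃, h₄.ne₁₂]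

theorem Cyc6.nodup (h : Cyc6 G d v a b c e f g) : [a, b, c, e, f, g].Nodup := by
  have h₂ := h.turn
  have h₃ := h₂.turn
  have h₄ := h₃.turn
  have h₅ := h₄.turn
  simp [h.ne₁₂, h.ne₁₃, h.ne₁₄, h.ne₁₅, h.ne₁₆, h₂.ne₁₂, h₂.ne₁₃, h₂.ne₁₄, h₂.ne₁₅, h₃.ne₁₂,
    h₃.ne₁₃, h₃.ne₁₄, h₄.ne₁₂, h₄.ne₁₃, h₅.ne₁₂]

end chains

end DualFullerene

/-! ### Euler's formula and the number of 5-vertices. -/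

namespace RotationSystem

variable {V : Type u} (M : RotationSystem V)

theorem faceNext_ne (D : M.graph.Dart) : M.faceNext D ≠ D := fun h =>
  D.adj.ne (congrArg (fun D : M.graph.Dart => D.fst) h).symm

theorem quot_mk_eq_iff (ht : M.IsTriangulation) (D D' : M.graph.Dart) :
    Quot.mk (fun d e : M.graph.Dart => M.faceNext d = e) D' = Quot.mk _ D ↔
      D' = D ∨ D' = M.faceNext D ∨ D' = M.faceNext (M.faceNext D) := by
  have h3 : ∀ D, M.faceNext (M.faceNext (M.faceNext D)) = D := ht
  constructor
  · intro h
    rw [Quot.eq] at h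
    induction h with
    | rel x y h => subst h; simp [h3]
    | refl x => exact Or.inl rfl
    | symm x y _ ih => rcases ih with rfl | rfl | rfl <;> simp [h3]
    | trans x y z _ _ ih₁ ih₂ =>
      rcases ih₁ with rfl | rfl | rfl <;> rcases ih₂ with rfl | rfl | rfl <;> simp [h3]
  · have h1 : ∀ D, Quot.mk (fun d e : M.graph.Dart => M.faceNext d = e) (M.faceNext D) =
        Quot.mk _ D := fun D =>
      (Quot.sound (r := fun d e : M.graph.Dart => M.faceNext d = e) rfl).symm
    rintro (rfl | rfl | rfl)
    · rfl
    · exact h1 _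
    · rw [h1, h1]

/-- Each class is an orbit of `faceNext`, whose cube is the identity and which has no fixed point,
so all classes have exactly three elements. -/
theorem card_dart_eq_three_mul_faceCount (ht : M.IsTriangulation) :
    Nat.card M.graph.Dart = 3 * M.faceCount := by
  classical
  have := M.finite
  have hfD : Finite M.graph.Dart :=
    Finite.of_injective (fun D : M.graph.Dart => D.toProd) SimpleGraph.Dart.toProd_injective
  have h3 : ∀ D, M.faceNext (M.faceNext (M.faceNext D)) = D := ht
  let r := fun d e : M.graph.Dart => M.faceNext d = e
  have hfib : ∀ q : Quot r, Nat.card {D // Quot.mk r D = q} = 3 := by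
    intro q
    induction q using Quot.ind with
    | mk D =>
      have hs : {D' | Quot.mk r D' = Quot.mk r D} =
          {D, M.faceNext D, M.faceNext (M.faceNext D)} := by
        ext D'
        exact M.quot_mk_eq_iff ht D D'
      change Nat.card ↥{D' | Quot.mk r D' = Quot.mk r D} = 3
      rw [hs, Nat.card_coe_set_eq]
      apply Set.ncard_eq_three.2
      refine ⟨_, _, _, (M.faceNext_ne D).symm, ?_, (M.faceNext_ne _).symm, rfl⟩
      intro h
      have := congrArg M.faceNext h
      rw [h3] at this
      exact M.faceNext_ne _ this
  rw [Nat.card_congr (Equiv.sigmaFiberEquiv (Quot.mk r)).symm]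
  have : Fintype (Quot r) := Fintype.ofFinite _
  rw [Nat.card_sigma, Finset.sum_congr rfl (fun q _ => hfib q)]
  simp [faceCount, r, mul_comm]

/-- Counting directed edges by faces, edges and vertices gives `3f = 2e = 6n - n₅`, which turns `n +
f = e + 2` into `n₅ = 12`. The converse direction is needed as well: the planarity of a reduced
triangulation is obtained by counting its 5-vertices. -/
theorem isPlane_iff (ht : M.IsTriangulation) (hd : ∀ v, M.degree v = 5 ∨ M.degree v = 6) :
    M.IsPlane ↔ {v | M.degree v = 5}.ncard = 12 := by
  classical
  have := M.finite
  have : Fintype V := Fintype.ofFinite V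
  have h₁ := M.card_dart_eq_three_mul_faceCount ht
  rw [Nat.card_eq_fintype_card] at h₁
  have h₂ := M.graph.dart_card_eq_twice_card_edges
  have h₃ := M.graph.dart_card_eq_sum_degrees
  have h₄ : M.graph.edgeSet.ncard = M.graph.edgeFinset.card := by
    rw [← SimpleGraph.coe_edgeFinset, Set.ncard_coe_finset]
  have h₅ : ∀ v, M.graph.degree v = if M.degree v = 5 then 5 else 6 := by
    intro v
    have : M.graph.degree v = M.degree v := by
      rw [degree, ← Nat.card_coe_set_eq, Nat.card_eq_fintype_card,
        SimpleGraph.card_neighborSet_eq_degree]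
    rw [this]
    rcases hd v with h | h <;> simp [h]
  have h₆ : {v | M.degree v = 5}.ncard = (Finset.univ.filter fun v => M.degree v = 5).card := by
    rw [← Set.ncard_coe_finset]; simp
  have h₇ : (∑ v, M.graph.degree v) + (Finset.univ.filter fun v => M.degree v = 5).card =
      6 * Fintype.card V := by
    rw [Finset.card_filter, ← Finset.sum_add_distrib, Finset.sum_congr rfl (g := fun _ => 6)]
    · simp [mul_comm]
    · intro v _
      rw [h₅]
      split_ifs <;> rfl
  rw [IsPlane, h₄, h₆, Nat.card_eq_fintype_card]
  omega

end RotationSystem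

theorem DualFullerene.ncard_five {V : Type u} (G : DualFullerene V) :
    {v | G.degree v = 5}.ncard = 12 :=
  (G.isPlane_iff G.triangulation G.degree_eq).1 G.plane

/-! ### Homology of the sphere modulo 2. -/

namespace RotationSystem

variable {V : Type u} (M : RotationSystem V)

/-- The edge-face incidences modulo 2. -/
noncomputable def coboundary [Fintype M.graph.Dart] [DecidableEq V] :
    ((Quot fun d e : M.graph.Dart => M.faceNext d = e) → ZMod 2) →ₗ[ZMod 2]
      (M.graph.edgeSet → ZMod 2) where
  toFun s e := ∑ D : M.graph.Dart with D.edge = e.1, s (Quot.mk _ D)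
  map_add' s t := by ext e; simp [Finset.sum_add_distrib]
  map_smul' c s := by ext e; simp [Finset.mul_sum]

/-- The vertex-edge incidences modulo 2. -/
noncomputable def incidence [DecidableEq V] : Matrix V M.graph.edgeSet (ZMod 2) :=
  Matrix.of fun v e => if v ∈ e.1 then 1 else 0

theorem coboundary_apply [Fintype M.graph.Dart] [DecidableEq V] [DecidableRel M.graph.Adj]
    (s : (Quot fun d e : M.graph.Dart => M.faceNext d = e) → ZMod 2) (D : M.graph.Dart) :
    M.coboundary s ⟨D.edge, D.edge_mem⟩ = s (Quot.mk _ D) + s (Quot.mk _ D.symm) := by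
  have : (Finset.univ.filter fun D' : M.graph.Dart => D'.edge = D.edge) = {D, D.symm} := by
    ext D'
    simp [SimpleGraph.dart_edge_eq_iff]
  simp only [coboundary, LinearMap.coe_mk, AddHom.coe_mk]
  rw [this, Finset.sum_pair D.symm_ne.symm]

theorem eq_of_forall_adj {α : Type*} (y : V → α) (h : ∀ u v, M.graph.Adj u v →
    y u = y v) (u v : V) :
    y u = y v := by
  obtain ⟨p⟩ := M.connected.preconnected u v
  induction p with
  | nil => rfl
  | cons hadj _ ih => exact (h _ _ hadj).trans ih

theorem zmod_two_add_eq_zero (a b : ZMod 2) : a + b = 0 ↔ a = b := by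
  revert a b; decide

theorem finrank_le_one_of_const {ι : Type*} [Fintype ι] (N : Submodule (ZMod 2) (ι → ZMod 2))
    (h : ∀ y ∈ N, ∀ i j, y i = y j) : Module.finrank (ZMod 2) N ≤ 1 := by
  apply finrank_le_one_iff.2
  by_cases h1 : (fun _ => 1 : ι → ZMod 2) ∈ N
  · refine ⟨⟨_, h1⟩, fun w => ?_⟩
    rcases isEmpty_or_nonempty ι with hι | ⟨⟨i⟩⟩
    · exact ⟨0, Subsingleton.elim _ _⟩
    · refine ⟨w.1 i, Subtype.ext (funext fun j => ?_)⟩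
      simp [h w.1 w.2 i j]
  · refine ⟨0, fun w => ⟨0, ?_⟩⟩
    have key : ∀ a : ZMod 2, a = 0 ∨ a = 1 := by decide
    simp only [smul_zero]
    refine Subtype.ext (funext fun j => ?_)
    rcases key (w.1 j) with h0 | h0
    · simp [h0]
    · exact (h1 (by
        have : w.1 = fun _ => 1 := funext fun i => (h w.1 w.2 i j).trans h0
        rw [← this]; exact w.2)).elim

/-- On the sphere, every cycle modulo 2 bounds. -/
theorem exists_coboundary_eq (hp : M.IsPlane) (φ : M.graph.edgeSet → ZMod 2)
    (hφ : ∀ v, ∑ᶠ e : {e : M.graph.edgeSet // v ∈ e.1}, φ e.1 = 0) :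
    ∃ s : M.graph.Dart → ZMod 2, (∀ D, s (M.faceNext D) = s D) ∧
      ∀ D, s D + s D.symm = φ ⟨D.edge, D.edge_mem⟩ := by
  classical
  have := M.finite
  have : Fintype V := Fintype.ofFinite V
  have hq : ∀ D, (Quot.mk (fun d e : M.graph.Dart => M.faceNext d = e) (M.faceNext D)) =
      Quot.mk _ D := fun D =>
    (Quot.sound (r := fun d e : M.graph.Dart => M.faceNext d = e) rfl).symm
  let r := fun d e : M.graph.Dart => M.faceNext d = e
  have : Fintype (Quot r) := Fintype.ofFinite _
  set A := M.coboundary with hA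
  set B := M.incidence with hB
  -- A set of faces with empty boundary is constant: consecutive faces around a vertex share an edge
  -- and hence agree, and the graph is connected.
  have kerA : Module.finrank (ZMod 2) (LinearMap.ker A) ≤ 1 := by
    refine finrank_le_one_of_const (ι := Quot r) _ fun s hs => ?_
    have h1 : ∀ D : M.graph.Dart, s (Quot.mk _ D) = s (Quot.mk _ D.symm) := by
      intro D
      have := congrFun (LinearMap.mem_ker.1 hs) ⟨D.edge, D.edge_mem⟩
      rw [hA, coboundary_apply] at this
      exact (zmod_two_add_eq_zero _ _).1 this
    have h2 : ∀ (v w w' : V) (h : M.graph.Adj v w) (h' : M.graph.Adj v w'),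
        s (Quot.mk _ ⟨(v, w), h⟩) = s (Quot.mk _ ⟨(v, w'), h'⟩) := by
      intro v w w' h h'
      obtain ⟨k, rfl⟩ := M.rot_cyclic h h'
      clear hφ
      induction k with
      | zero => rfl
      | succ k ih =>
        have hk : M.graph.Adj v ((M.rot v)^[k] w) := by
          clear ih h'
          induction k with
          | zero => exact h
          | succ k ih => rw [Function.iterate_succ_apply']; exact M.rot_adj ih
        rw [ih hk, h1, ← hq]
        congr 2
        simp [faceNext, Function.iterate_succ_apply']
    let t : V → ZMod 2 := fun v => if h : ∃ w, M.graph.Adj v w then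
      s (Quot.mk _ ⟨(v, h.choose), h.choose_spec⟩) else 0
    have ht : ∀ D : M.graph.Dart, t D.fst = s (Quot.mk _ D) := by
      intro D
      have h : ∃ w, M.graph.Adj D.fst w := ⟨_, D.adj⟩
      simp only [t, dif_pos h]
      exact h2 _ _ _ _ D.adj
    have ht' : ∀ u v, t u = t v := by
      refine M.eq_of_forall_adj t fun u v h => ?_
      have h3 := ht ⟨(u, v), h⟩
      have h4 := ht ⟨(v, u), h.symm⟩
      rw [h1] at h3
      exact h3.trans h4.symm
    intro q q'
    induction q using Quot.ind with
    | mk D =>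
      induction q' using Quot.ind with
      | mk D' => rw [← ht, ← ht, ht']
  have rankA := LinearMap.finrank_range_add_finrank_ker A
  -- Dually, a set of vertices that no edge leaves is empty or everything.
  have kerB : Module.finrank (ZMod 2) (LinearMap.ker B.transpose.mulVecLin) ≤ 1 := by
    refine finrank_le_one_of_const (ι := V) _ fun y hy => M.eq_of_forall_adj y fun u v h => ?_
    have := congrFun (LinearMap.mem_ker.1 hy) ⟨s(u, v), h⟩
    simp only [Matrix.mulVecLin_apply, Matrix.mulVec, dotProduct, Matrix.transpose_apply, hB,
      incidence, Matrix.of_apply, ite_mul, one_mul, zero_mul, Pi.zero_apply] at this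
    rw [← Finset.sum_filter] at this
    have hf : (Finset.univ.filter fun x => x ∈ s(u, v)) = {u, v} := by ext x; simp
    rw [hf, Finset.sum_pair h.ne] at this
    exact (zmod_two_add_eq_zero _ _).1 this
  have rankBt := LinearMap.finrank_range_add_finrank_ker B.transpose.mulVecLin
  have rankB := LinearMap.finrank_range_add_finrank_ker B.mulVecLin
  have htr : B.transpose.rank = B.rank := B.rank_transpose
  rw [Matrix.rank, Matrix.rank] at htr
  -- A boundary meets every vertex evenly: a face that enters `v` by one directed edge leaves it by
  -- the next, and `faceNext` pairs the two contributions.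
  have hle : LinearMap.range A ≤ LinearMap.ker B.mulVecLin := by
    rintro _ ⟨s, rfl⟩
    ext v
    have h1 : B.mulVecLin (A s) v = ∑ D : M.graph.Dart,
      if v ∈ D.edge then s (Quot.mk _ D) else 0 := by
      rw [← Finset.sum_fiberwise (s := Finset.univ) (g := fun D : M.graph.Dart =>
        (⟨D.edge, D.edge_mem⟩ : M.graph.edgeSet))]
      simp only [Matrix.mulVecLin_apply, Matrix.mulVec, dotProduct, hB, incidence, Matrix.of_apply]
      refine Finset.sum_congr rfl fun e _ => ?_
      simp only [hA, coboundary, LinearMap.coe_mk, AddHom.coe_mk, Finset.mul_sum]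
      have : (Finset.univ.filter fun D : M.graph.Dart => D.edge = e.1) =
        Finset.univ.filter fun D : M.graph.Dart => (⟨D.edge,
          D.edge_mem⟩ : M.graph.edgeSet) = e := by
        ext D; simp [Subtype.ext_iff]
      rw [this]
      refine Finset.sum_congr rfl fun D hD => ?_
      have : D.edge = e.1 := congrArg Subtype.val (Finset.mem_filter.1 hD).2
      rw [this]
      split_ifs <;> simp
    have h2 : ∀ D : M.graph.Dart, (if v ∈ D.edge then s (Quot.mk _ D) else 0) =
        (if D.fst = v then s (Quot.mk _ D) else 0) +
        (if D.snd = v then s (Quot.mk _ D) else 0) := by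
      rintro ⟨⟨x, y⟩, h⟩
      have hne : x ≠ y := h.ne
      simp only [SimpleGraph.Dart.edge, Sym2.mem_iff]
      by_cases hx : x = v
      · subst hx; simp [hne.symm]
      · by_cases hy : y = v
        · subst hy; simp [hne]
        · simp [hx, hy, Ne.symm hx, Ne.symm hy]
    have hinj : Function.Bijective M.faceNext := by
      refine Finite.injective_iff_bijective.1 ?_
      rintro ⟨⟨x, y⟩, h⟩ ⟨⟨x', y'⟩, h'⟩ he
      have e1 : y = y' := congrArg (fun D : M.graph.Dart => D.fst) he
      subst e1
      have e2 : M.rot y x = M.rot y x' := congrArg (fun D : M.graph.Dart => D.snd) he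
      have hfin : Finite (M.graph.neighborSet y) := inferInstance
      have hsurj : Function.Surjective (fun z : M.graph.neighborSet y =>
          (⟨M.rot y z.1, M.rot_adj z.2⟩ : M.graph.neighborSet y)) := by
        rintro ⟨z, hz⟩
        obtain ⟨k, hk⟩ := M.rot_cyclic (M.rot_adj hz) hz
        have hadj : M.graph.Adj y ((M.rot y)^[k] z) := by
          clear hk
          induction k with
          | zero => exact hz
          | succ k ih => rw [Function.iterate_succ_apply']; exact M.rot_adj ih
        refine ⟨⟨(M.rot y)^[k] z, hadj⟩, Subtype.ext ?_⟩
        rw [← Function.iterate_succ_apply] at hk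
        rw [Function.iterate_succ_apply'] at hk
        exact hk
      have := (Finite.injective_iff_surjective.2 hsurj) (a₁ := ⟨x, h.symm⟩) (a₂ := ⟨x', h'.symm⟩)
        (Subtype.ext e2)
      have : x = x' := congrArg Subtype.val this
      subst this
      rfl
    have h3 : (∑ D : M.graph.Dart, if D.snd = v then s (Quot.mk _ D) else 0) =
        ∑ D : M.graph.Dart, if D.fst = v then s (Quot.mk _ D) else 0 := by
      refine Fintype.sum_bijective M.faceNext hinj _ _ fun D => ?_
      rw [hq]; rfl
    rw [h1, Finset.sum_congr rfl (fun D _ => h2 D), Finset.sum_add_distrib, h3]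
    exact (zmod_two_add_eq_zero _ _).2 rfl
  -- The image has dimension at least `f - 1` and the cycle space at most `e - n + 1`. Euler's
  -- formula makes these numbers equal, so the inclusion is an equality.
  have heq : LinearMap.range A = LinearMap.ker B.mulVecLin := by
    refine Submodule.eq_of_le_of_finrank_le hle ?_
    have h1 : Module.finrank (ZMod 2) (Quot r → ZMod 2) = M.faceCount := by
      rw [Module.finrank_fintype_fun_eq_card, ← Nat.card_eq_fintype_card]; rfl
    have h2 : Module.finrank (ZMod 2) (M.graph.edgeSet → ZMod 2) = M.graph.edgeSet.ncard := by
      rw [Module.finrank_fintype_fun_eq_card, ← Nat.card_eq_fintype_card]; rfl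
    have h3 : Module.finrank (ZMod 2) (V → ZMod 2) = Nat.card V := by
      rw [Module.finrank_fintype_fun_eq_card, ← Nat.card_eq_fintype_card]
    have hp' : Nat.card V + M.faceCount = M.graph.edgeSet.ncard + 2 := hp
    rw [h1] at rankA
    rw [h2] at rankB
    rw [h3] at rankBt
    omega
  have hmem : φ ∈ LinearMap.ker B.mulVecLin := by
    ext v
    have h1 := hφ v
    simp only [Matrix.mulVecLin_apply, Matrix.mulVec, dotProduct, hB, incidence, Matrix.of_apply,
      ite_mul, one_mul, zero_mul, Pi.zero_apply]
    rw [finsum_eq_sum_of_fintype] at h1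
    rw [← Finset.sum_filter, ← h1]
    exact Finset.sum_subtype _ (by simp) _
  rw [← heq] at hmem
  obtain ⟨s, rfl⟩ := hmem
  refine ⟨fun D => s (Quot.mk _ D), fun D => congrArg s (hq D), fun D => ?_⟩
  rw [hA, coboundary_apply]

end RotationSystem

/-! ### The two sides of a closed curve. -/

namespace DualFullerene

variable {V : Type u} {G : DualFullerene V} {d : Bool} {a b c v w : V}

/-- A set of directed edges that consists of the sides of some of the faces. -/
structure IsSide (G : DualFullerene V) (d : Bool) (S : V → V → Prop) : Prop where
  adj : ∀ {x y}, S x y → G.graph.Adj x y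
  face : ∀ {x y z}, S x y → G.IsFaceDir d x y z → S y z

/-- The relation `R` is a disjoint union of directed cycles. -/
structure IsCycleRel (G : DualFullerene V) (R : V → V → Prop) : Prop where
  adj : ∀ {x y}, R x y → G.graph.Adj x y
  out_unique : ∀ {x y z}, R x y → R x z → y = z
  in_unique : ∀ {x y z}, R y x → R z x → y = z
  exists_out : ∀ {x y}, R x y → ∃ z, R y z
  exists_in : ∀ {x y}, R y x → ∃ z, R z y
  asymm : ∀ {x y}, R x y → ¬ R y x

/-- A Jordan curve statement. The edges of `R` form a cycle modulo 2 and hence are the boundary of a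
set of faces, that is, they separate two colours of faces. The side consists of the directed edges
whose face has the colour found at `a b`. The third conclusion says that this side stays on the same
hand along the curve. -/
theorem exists_side {R : V → V → Prop} (hR : IsCycleRel G R) (hab : R a b) :
    ∃ S, IsSide G true S ∧ S a b ∧ (∀ u v w, R u v → R v w → S u v → S v w) ∧
      ∀ x y, G.graph.Adj x y → (((S x y ↔ ¬ S y x)) ↔ (R x y ∨ R y x)) := by
  classical
  have := G.finite
  obtain ⟨s, hs, hφ⟩ := G.exists_coboundary_eq G.plane
    (fun e => if ∃ x y, R x y ∧ e.1 = s(x, y) then 1 else 0) (by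
      intro v
      have : Fintype {e : G.graph.edgeSet // v ∈ e.1} := Fintype.ofFinite _
      rw [finsum_eq_sum_of_fintype, ← Finset.sum_filter]
      by_cases hv : ∃ u, R u v
      · obtain ⟨u, hu⟩ := hv
        obtain ⟨w, hw⟩ := hR.exists_out hu
        have hne : u ≠ w := by
          rintro rfl
          exact hR.asymm hu hw
        have : (Finset.univ.filter fun e : {e : G.graph.edgeSet // v ∈ e.1} =>
            ∃ x y, R x y ∧ e.1.1 = s(x, y)) =
            {⟨⟨s(u, v), hR.adj hu⟩, by simp⟩, ⟨⟨s(v, w), hR.adj hw⟩, by simp⟩} := by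
          ext ⟨⟨e, he⟩, hve⟩
          simp only [Finset.mem_filter, Finset.mem_univ, true_and, Finset.mem_insert,
            Finset.mem_singleton, Subtype.mk.injEq]
          constructor
          · rintro ⟨x, y, hxy, rfl⟩
            rcases Sym2.mem_iff.1 hve with rfl | rfl
            · exact Or.inr (Subtype.ext (congrArg (fun y => s(v, y)) (hR.out_unique hxy hw)))
            · exact Or.inl (Subtype.ext (congrArg (fun x => s(x, v)) (hR.in_unique hxy hu)))
          · rintro (h | h)
            · exact ⟨_, _, hu, congrArg Subtype.val h⟩
            · exact ⟨_, _, hw, congrArg Subtype.val h⟩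
        rw [this, Finset.sum_pair]
        · decide
        · intro h
          have h' : s(u, v) = s(v, w) := congrArg (fun e => e.1.1) h
          rw [Sym2.eq_swap, Sym2.congr_right] at h'
          exact hne h'
      · have : (Finset.univ.filter fun e : {e : G.graph.edgeSet // v ∈ e.1} =>
            ∃ x y, R x y ∧ e.1.1 = s(x, y)) = ∅ := by
          ext ⟨⟨e, he⟩, hve⟩
          simp only [Finset.mem_filter, Finset.mem_univ, true_and, Finset.notMem_empty, iff_false]
          rintro ⟨x, y, hxy, rfl⟩
          rcases Sym2.mem_iff.1 hve with rfl | rfl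
          · exact hv (hR.exists_in hxy)
          · exact hv ⟨_, hxy⟩
        rw [this, Finset.sum_empty])
  have key : ∀ p q r : ZMod 2, (p + q = 1 ↔ (p = r ↔ ¬ q = r)) := by decide
  let t : V → V → ZMod 2 := fun x y => if h : G.graph.Adj x y then s ⟨(x, y), h⟩ else 0
  have ht : ∀ {x y} (h : G.graph.Adj x y), t x y = s ⟨(x, y), h⟩ := fun h => dif_pos h
  have hface : ∀ {x y z}, G.IsFaceDir true x y z → t y z = t x y := by
    rintro x y z ⟨h, rfl⟩
    rw [ht h, ht (G.rot_adj h.symm)]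
    exact hs ⟨(x, y), h⟩
  have hsum : ∀ {x y}, G.graph.Adj x y → (t x y + t y x = 1 ↔ (R x y ∨ R y x)) := by
    intro x y h
    have h1 := hφ ⟨(x, y), h⟩
    rw [ht h, ht h.symm]
    change s ⟨(x, y), h⟩ + s ⟨(y, x), h.symm⟩ = _ at h1
    rw [h1]
    split_ifs with h2
    · obtain ⟨x', y', h3, h4⟩ := h2
      simp only [true_iff]
      have h5 : s(x, y) = s(x', y') := h4
      rw [Sym2.eq_iff] at h5
      rcases h5 with ⟨rfl, rfl⟩ | ⟨rfl, rfl⟩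
      · exact Or.inl h3
      · exact Or.inr h3
    · simp only [zero_ne_one, false_iff]
      rintro (h3 | h3)
      · exact h2 ⟨x, y, h3, rfl⟩
      · exact h2 ⟨y, x, h3, Sym2.eq_swap⟩
  have heq : ∀ {x y}, G.graph.Adj x y → ¬ (R x y ∨ R y x) → t x y = t y x := by
    intro x y h h'
    rw [← hsum h] at h'
    revert h'
    generalize t x y = p
    generalize t y x = q
    revert p q
    decide
  -- Turn around `v` from `u` to `w`. Colours change only across edges of `R`, and before `w` the
  -- turn crosses no such edge other than the one it started from.
  have hstep : ∀ u v w, R u v → R v w → t v w = t u v := by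
    intro u v w hu hw
    have hne : u ≠ w := by
      rintro rfl
      exact hR.asymm hu hw
    obtain ⟨k, hk⟩ := next_cyclic true (hR.adj hu).symm (hR.adj hw)
    have hP : ∀ k, ((G.next true v)^[k] u ≠ w ∧ t ((G.next true v)^[k] u) v = t u v) ∨
        t v w = t u v := by
      intro k
      induction k with
      | zero => exact Or.inl ⟨hne, rfl⟩
      | succ k ih =>
        rcases ih with ⟨h1, h2⟩ | h1
        · rw [Function.iterate_succ_apply']
          have hadj := adj_iterate_next (d := true) (hR.adj hu).symm k
          revert h1 h2 hadj
          generalize (G.next true v)^[k] u = x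
          intro h1 h2 hadj
          have hf := isFaceDir_next (d := true) hadj
          have h3 := hface hf
          by_cases h4 : G.next true v x = w
          · right; rw [← h4, h3, h2]
          · left
            refine ⟨h4, ?_⟩
            by_cases h5 : G.next true v x = u
            · rw [h5]
            · rw [← h2, ← h3]
              refine (heq hf.rotate.adj ?_).symm
              rintro (h6 | h6)
              · exact h4 (hR.out_unique h6 hw)
              · exact h5 (hR.in_unique h6 hu)
        · exact Or.inr h1
    rcases hP k with h | h
    · exact (h.1 hk).elim
    · exact h
  refine ⟨fun x y => G.graph.Adj x y ∧ t x y = t a b, ⟨fun h => h.1, fun h hf =>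
    ⟨hf.rotate.adj, (hface hf).trans h.2⟩⟩, ⟨hR.adj hab, rfl⟩, ?_, ?_⟩
  · exact fun u v w hu hw h => ⟨hR.adj hw, (hstep u v w hu hw).trans h.2⟩
  · intro x y h
    rw [← hsum h, key _ _ (t a b)]
    simp [h, h.symm]

/-- The interior edges at `v`. -/
def interior (S : V → V → Prop) (v : V) : Set V := {x | S v x ∧ S x v}

/-- The boundary edges. -/
def bdry (S : V → V → Prop) (x y : V) : Prop := S x y ∧ ¬ S y x

section sides

variable {S : V → V → Prop} (hS : IsSide G d S) {u x y z y₁ y₂ : V}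
include hS

theorem IsSide.step (hw' : ∀ x, bdry S v x → x = w) (hx : S x v)
    (h : G.IsFaceDir d x v y) : y = w ∨ y ∈ interior S v := by
  by_cases hy : S y v
  · exact Or.inr ⟨hS.face hx h, hy⟩
  · exact Or.inl (hw' _ ⟨hS.face hx h, hy⟩)

end sides

theorem IsFaceDir.prev_unique {x x' y v : V} (h : G.IsFaceDir d x v y) (h' : G.IsFaceDir d x' v y) :
    x = x' := h.rotate.unique h'.rotate

section sides

variable {S : V → V → Prop} {u x y z y₁ y₂ : V}

/-- In this lemma and the next two, one turns at `v` inside the side, from the incoming boundary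
edge to the outgoing one, meeting only interior edges in between. With at most two of them the faces
of this turn are determined. -/
theorem IsSide.local_zero (hS : IsSide G d S) (hu : bdry S u v) (hw : bdry S v w)
    (hw' : ∀ x, bdry S v x → x = w) (h : interior S v = ∅) : G.IsFaceDir d u v w := by
  obtain ⟨x, hx⟩ := exists_isFaceDir d (hS.adj hu.1)
  rcases hS.step hw' hu.1 hx with rfl | h1
  · exact hx
  · rw [h] at h1; exact h1.elim

theorem IsSide.local_one (hS : IsSide G d S) (hu : bdry S u v) (hw : bdry S v w)
    (hw' : ∀ x, bdry S v x → x = w) (h : interior S v = {y}) :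
    G.IsFaceDir d u v y ∧ G.IsFaceDir d y v w := by
  have hy : y ∈ interior S v := by rw [h]; rfl
  have huy : u ≠ y := by rintro rfl; exact hu.2 hy.1
  obtain ⟨x, hx⟩ := exists_isFaceDir d (hS.adj hu.1)
  obtain ⟨x', hx'⟩ := exists_isFaceDir d (hS.adj hy.2)
  have h1 := hS.step hw' hu.1 hx
  have h2 := hS.step hw' hy.2 hx'
  rw [h] at h1 h2
  rcases h2 with rfl | rfl
  · rcases h1 with rfl | rfl
    · exact (huy (hx.prev_unique hx')).elim
    · exact ⟨hx, hx'⟩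
  · exact (hx'.ne₁₃ rfl).elim

theorem IsSide.local_two (hS : IsSide G d S) (hu : bdry S u v) (hw : bdry S v w)
    (hw' : ∀ x, bdry S v x → x = w) (h : (interior S v).ncard = 2) :
    ∃ y₁ y₂, interior S v = {y₁, y₂} ∧
      G.IsFaceDir d u v y₁ ∧ G.IsFaceDir d y₁ v y₂ ∧ G.IsFaceDir d y₂ v w := by
  have key : ∀ y₁ y₂, y₁ ≠ y₂ → interior S v = {y₁, y₂} → G.IsFaceDir d u v y₁ →
      G.IsFaceDir d y₁ v y₂ ∧ G.IsFaceDir d y₂ v w := by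
    intro y₁ y₂ hne h hx
    have hy₁ : y₁ ∈ interior S v := by rw [h]; simp
    have hy₂ : y₂ ∈ interior S v := by rw [h]; simp
    obtain ⟨x₁, hx₁⟩ := exists_isFaceDir d (hS.adj hy₁.2)
    obtain ⟨x₂, hx₂⟩ := exists_isFaceDir d (hS.adj hy₂.2)
    have h1 := hS.step hw' hy₁.2 hx₁
    have h2 := hS.step hw' hy₂.2 hx₂
    rw [h] at h1 h2
    have hu₂ : x₂ ≠ y₁ := by
      rintro rfl
      exact hu.2 ((hx.prev_unique hx₂) ▸ hy₂.1)
    rcases h2 with rfl | rfl | rfl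
    · rcases h1 with rfl | rfl | rfl
      · exact (hne (hx₁.prev_unique hx₂)).elim
      · exact (hx₁.ne₁₃ rfl).elim
      · exact ⟨hx₁, hx₂⟩
    · exact (hu₂ rfl).elim
    · exact (hx₂.ne₁₃ rfl).elim
  obtain ⟨y₁, y₂, hne, h⟩ := Set.ncard_eq_two.1 h
  obtain ⟨x, hx⟩ := exists_isFaceDir d (hS.adj hu.1)
  have h1 := hS.step hw' hu.1 hx
  have hy₁ : y₁ ∈ interior S v := by rw [h]; simp
  have hy₂ : y₂ ∈ interior S v := by rw [h]; simp
  have h' : interior S v = {y₂, y₁} := by rw [h, Set.pair_comm]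
  rw [h] at h1
  rcases h1 with rfl | rfl | rfl
  -- If the turn reached `w` at once, the two interior edges would have to follow each other in a
  -- closed chain of length 2 around `v`.
  · obtain ⟨x₁, hx₁⟩ := exists_isFaceDir d (hS.adj hy₁.2)
    obtain ⟨x₂, hx₂⟩ := exists_isFaceDir d (hS.adj hy₂.2)
    have h1 := hS.step hw' hy₁.2 hx₁
    have h2 := hS.step hw' hy₂.2 hx₂
    rw [h] at h1 h2
    have e1 : x₁ ≠ x := by rintro rfl; exact hu.2 ((hx.prev_unique hx₁) ▸ hy₁.1)
    have e2 : x₂ ≠ x := by rintro rfl; exact hu.2 ((hx.prev_unique hx₂) ▸ hy₂.1)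
    rcases h1 with rfl | rfl | rfl
    · exact (e1 rfl).elim
    · exact (hx₁.ne₁₃ rfl).elim
    · rcases h2 with rfl | rfl | rfl
      · exact (e2 rfl).elim
      · exact (not_close_two hx₁ hx₂).elim
      · exact (hx₂.ne₁₃ rfl).elim
  · exact ⟨_, _, h, hx, key _ _ hne h hx⟩
  · exact ⟨_, _, h', hx, key _ _ hne.symm h' hx⟩

/-- The part of a side formed by the faces that avoid `X`. -/
def avoid (G : DualFullerene V) (d : Bool) (S : V → V → Prop) (X : Set V) (x y : V) : Prop :=
  S x y ∧ x ∉ X ∧ y ∉ X ∧ ∀ z, G.IsFaceDir d x y z → z ∉ X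

theorem IsSide.avoid (hS : IsSide G d S) (X : Set V) : IsSide G d (G.avoid d S X) where
  adj h := hS.adj h.1
  face := by
    rintro x y z ⟨h1, h2, h3, h4⟩ hf
    refine ⟨hS.face h1 hf, h3, h4 _ hf, fun w hw => ?_⟩
    rwa [hw.unique hf.rotate]

end sides

end DualFullerene

namespace DualFullerene

variable {V : Type u} {G : DualFullerene V} {d : Bool} {a b c v w : V}

section sides

variable {S : V → V → Prop} {x y z : V}

theorem IsSide.eq_of_in (ha : ∀ x, bdry S x b → x = a) (hx : S x b) :
    x = a ∨ x ∈ interior S b := by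
  by_cases h : S b x
  · exact Or.inr ⟨h, hx⟩
  · exact Or.inl (ha _ ⟨hx, h⟩)

theorem exists_of_bdry_avoid {X : Set V} (h : bdry (G.avoid d S X) x y) :
    bdry S x y ∨ S y x ∧ ∃ z ∈ X, G.IsFaceDir d x z y := by
  obtain ⟨⟨h1, hx, hy, hz⟩, h2⟩ := h
  by_cases h3 : S y x
  · right
    refine ⟨h3, ?_⟩
    by_contra hcon
    exact h2 ⟨h3, hy, hx, fun z hf hzX => hcon ⟨z, hzX, hf.rotate⟩⟩
  · exact Or.inl ⟨h1, h3⟩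

/-- The only face of the side at `b` is `a b c`; without it the boundary path `a b c` becomes the
edge `a c`. Since `c a` is not a boundary edge, that edge was interior before. -/
theorem IsSide.bdry_avoid_zero (hS : IsSide G d S) (ha : bdry S a b) (ha' : ∀ x, bdry S x b → x = a)
    (hI : interior S b = ∅) (hF : G.IsFaceDir d a b c) (hca : ¬ bdry S c a) :
    bdry (G.avoid d S {b}) x y ↔ (x = a ∧ y = c) ∨ (bdry S x y ∧ x ≠ b ∧ y ≠ b) := by
  have hSca : S c a := hS.face (hS.face ha.1 hF) hF.rotate
  have hSac : S a c := by by_contra h; exact hca ⟨hSca, h⟩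
  constructor
  · intro h
    rcases exists_of_bdry_avoid h with h1 | ⟨h1, z, rfl, hf⟩
    · exact Or.inr ⟨h1, h.1.2.1, h.1.2.2.1⟩
    · left
      have hxz := hS.face h1 hf.rotate₂
      rcases IsSide.eq_of_in ha' hxz with rfl | h2
      · exact ⟨rfl, hf.unique hF⟩
      · rw [hI] at h2; exact h2.elim
  · rintro (⟨rfl, rfl⟩ | ⟨h, hx, hy⟩)
    · refine ⟨⟨hSac, hF.ne₁₂, hF.ne₂₃.symm, ?_⟩, fun h => h.2.2.2 _ hF.rotate₂ rfl⟩
      rintro z hz rfl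
      exact not_close_two hF hz.rotate
    · refine ⟨⟨h.1, hx, hy, ?_⟩, fun h' => h.2 h'.1⟩
      rintro z hz rfl
      have hyz := hS.face h.1 hz
      rcases IsSide.eq_of_in ha' hyz with rfl | h2
      · rw [hz.rotate.unique hF] at h
        exact hca h
      · rw [hI] at h2; exact h2.elim

/-- The faces `a b w` and `w b c` are removed, which pushes the boundary path `a b c` across `b` to
`a w c`. -/
theorem IsSide.bdry_avoid_one (hS : IsSide G d S) (ha : bdry S a b) (ha' : ∀ x, bdry S x b → x = a)
    (hc : bdry S b c) (hI : interior S b = {w}) (hF : G.IsFaceDir d a b w)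
    (hF' : G.IsFaceDir d w b c) (hwa : ¬ bdry S w a) (hcw : ¬ bdry S c w) :
    bdry (G.avoid d S {b}) x y ↔
      (x = a ∧ y = w) ∨ (x = w ∧ y = c) ∨ (bdry S x y ∧ x ≠ b ∧ y ≠ b) := by
  have hSwa : S w a := hS.face (hS.face ha.1 hF) hF.rotate
  have hSaw : S a w := by by_contra h; exact hwa ⟨hSwa, h⟩
  have hScw : S c w := hS.face hc.1 hF'.rotate
  have hSwc : S w c := by by_contra h; exact hcw ⟨hScw, h⟩
  constructor
  · intro h
    rcases exists_of_bdry_avoid h with h1 | ⟨h1, z, rfl, hf⟩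
    · exact Or.inr (Or.inr ⟨h1, h.1.2.1, h.1.2.2.1⟩)
    · have hxz := hS.face h1 hf.rotate₂
      rcases IsSide.eq_of_in ha' hxz with rfl | h2
      · exact Or.inl ⟨rfl, hf.unique hF⟩
      · rw [hI] at h2
        obtain rfl := h2
        exact Or.inr (Or.inl ⟨rfl, hf.unique hF'⟩)
  · rintro (⟨rfl, rfl⟩ | ⟨rfl, rfl⟩ | ⟨h, hx, hy⟩)
    · refine ⟨⟨hSaw, hF.ne₁₂, hF.ne₂₃.symm, ?_⟩, fun h => h.2.2.2 _ hF.rotate₂ rfl⟩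
      rintro z hz rfl
      exact not_close_two hF hz.rotate
    · refine ⟨⟨hSwc, hF'.ne₁₂, hF'.ne₂₃.symm, ?_⟩, fun h => h.2.2.2 _ hF'.rotate₂ rfl⟩
      rintro z hz rfl
      exact not_close_two hF' hz.rotate
    · refine ⟨⟨h.1, hx, hy, ?_⟩, fun h' => h.2 h'.1⟩
      rintro z hz rfl
      have hyz := hS.face h.1 hz
      rcases IsSide.eq_of_in ha' hyz with rfl | h2
      · rw [hz.rotate.unique hF] at h
        exact hwa h
      · rw [hI] at h2
        obtain rfl := h2
        rw [hz.rotate.unique hF'] at h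
        exact hcw h

/-- All boundary vertices are removed at once. With exactly two interior edges at `z`, what remains
of its faces is the edge from `y₁ z` to `y₂ z` of an inner closed curve. By `hne` no inner edge is
run through in both directions, so none of them cancels. -/
theorem IsSide.bdry_avoid_all (hS : IsSide G d S) {X : Set V} {y₁ y₂ : V → V}
    (hX : ∀ x y, bdry S x y → x ∈ X ∧ y ∈ X)
    (hI : ∀ z ∈ X, interior S z = {y₁ z, y₂ z} ∧ G.IsFaceDir d (y₁ z) z (y₂ z) ∧
      ∃ w ∈ X, G.IsFaceDir d (y₂ z) z w)
    (hy : ∀ z ∈ X, y₁ z ∉ X ∧ y₂ z ∉ X)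
    (hne : ∀ z ∈ X, ∀ v ∈ X, ¬ (y₁ z = y₂ v ∧ y₂ z = y₁ v)) :
    bdry (G.avoid d S X) x y ↔ ∃ v ∈ X, x = y₁ v ∧ y = y₂ v := by
  have key : ∀ z ∈ X, ∀ x y, x ∉ X → y ∉ X → S x z → G.IsFaceDir d x z y →
      x = y₁ z ∧ y = y₂ z := by
    intro z hz x y hx hy hS' hf
    have h1 : x ∈ interior S z := by
      refine ⟨?_, hS'⟩
      by_contra h
      exact hx (hX x z ⟨hS', h⟩).1
    rw [(hI z hz).1] at h1
    rcases h1 with rfl | rfl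
    · exact ⟨rfl, hf.unique (hI z hz).2.1⟩
    · obtain ⟨w, hw, hf'⟩ := (hI z hz).2.2
      rw [hf.unique hf'] at hy
      exact (hy hw).elim
  constructor
  · intro h
    rcases exists_of_bdry_avoid h with h1 | ⟨h1, z, hz, hf⟩
    · exact (h.1.2.1 (hX _ _ h1).1).elim
    · exact ⟨z, hz, key z hz x y h.1.2.1 h.1.2.2.1 (hS.face h1 hf.rotate₂) hf⟩
  · rintro ⟨v, hv, rfl, rfl⟩
    obtain ⟨h1, h2, -⟩ := hI v hv
    have hv2 : y₂ v ∈ interior S v := by rw [h1]; simp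
    have hS21 := hS.face hv2.1 h2.rotate
    have hS12 : S (y₁ v) (y₂ v) := by
      by_contra h
      exact (hy v hv).2 (hX _ _ ⟨hS21, h⟩).1
    refine ⟨⟨hS12, (hy v hv).1, (hy v hv).2, fun z hf hz => ?_⟩, fun h => h.2.2.2 _ h2.rotate₂ hv⟩
    have := key z hz _ _ (hy v hv).2 (hy v hv).1 (hS.face hS12 hf) hf.rotate
    exact hne z hz v hv ⟨this.1.symm, this.2.symm⟩

end sides

theorem degree_le_six (G : DualFullerene V) (v : V) : G.degree v ≤ 6 := by
  rcases G.degree_eq v with h | h <;> omega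

/-- The bound 6 on the degrees keeps the number of interior edges under control when a curve is
pushed inwards. -/
theorem ncard_add_card_le {I : Set V} {T : Finset V} (hI : ∀ x ∈ I, G.graph.Adj v x)
    (hT : ∀ x ∈ T, G.graph.Adj v x ∧ x ∉ I) : I.ncard + T.card ≤ 6 := by
  have := G.finite
  refine le_trans ?_ (G.degree_le_six v)
  rw [RotationSystem.degree, ← Set.ncard_coe_finset, ← Set.ncard_union_eq]
  · refine Set.ncard_le_ncard ?_ (Set.toFinite _)
    rintro x (hx | hx)
    · exact hI x hx
    · exact (hT x hx).1
  · exact Set.disjoint_left.2 fun x hx hx' => (hT x hx').2 hx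

/-- The boundary of the side is the triangle `a b c`. -/
def IsTriangle (S : V → V → Prop) (a b c : V) : Prop :=
  ∀ x y, bdry S x y ↔ (x = a ∧ y = b) ∨ (x = b ∧ y = c) ∨ (x = c ∧ y = a)

/-- The boundary of the side is the quadrilateral `a b c e`. -/
def IsQuad (S : V → V → Prop) (a b c e : V) : Prop :=
  a ≠ c ∧ b ≠ e ∧
  ∀ x y, bdry S x y ↔ (x = a ∧ y = b) ∨ (x = b ∧ y = c) ∨ (x = c ∧ y = e) ∨ (x = e ∧ y = a)

/-- The quadrilateral `a b c e` consists of two triangles. -/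
def SplitQuad (G : DualFullerene V) (d : Bool) (a b c e : V) : Prop :=
  (G.IsFaceDir d a b c ∧ G.IsFaceDir d a c e) ∨ (G.IsFaceDir d b c e ∧ G.IsFaceDir d b e a)

theorem SplitQuad.turn {e : V} (h : SplitQuad G d b c e a) : SplitQuad G d a b c e := by
  rcases h with h | h
  · exact Or.inr h
  · exact Or.inl ⟨h.2.rotate, h.1.rotate₂⟩

theorem IsTriangle.turn {S : V → V → Prop} (h : IsTriangle S a b c) : IsTriangle S b c a := by
  intro x y; rw [h x y]; tauto

theorem IsQuad.turn {S : V → V → Prop} {e : V} (h : IsQuad S a b c e) : IsQuad S b c e a := by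
  refine ⟨h.2.1, h.1.symm, fun x y => ?_⟩; rw [h.2.2 x y]; tauto

theorem ncard_avoid_lt {S : V → V → Prop} {X : Set V} (G : DualFullerene V) (hbX : b ∈ X)
    (h : S a b) : {p : V × V | G.avoid d S X p.1 p.2}.ncard < {p : V × V | S p.1 p.2}.ncard := by
  have := G.finite
  refine Set.ncard_lt_ncard ⟨fun p hp => hp.1, fun hsub => ?_⟩ (Set.toFinite _)
  exact (hsub (a := (a, b)) h).2.2.1 hbX

theorem ncard_interior_avoid_le {S : V → V → Prop} {X : Set V} (G : DualFullerene V) (v : V) :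
    (interior (G.avoid d S X) v).ncard ≤ (interior S v).ncard := by
  have := G.finite
  exact Set.ncard_le_ncard (fun p hp => ⟨hp.1.1, hp.2.1⟩) (Set.toFinite _)

theorem ncard_interior_avoid_lt {S : V → V → Prop} {X : Set V} (G : DualFullerene V)
    (h : w ∈ interior S v) (h' : ¬ (G.avoid d S X v w ∧ G.avoid d S X w v)) :
    (interior (G.avoid d S X) v).ncard < (interior S v).ncard := by
  have := G.finite
  exact Set.ncard_lt_ncard ⟨fun p hp => ⟨hp.1.1, hp.2.1⟩, fun hsub => h' (hsub h)⟩ (Set.toFinite _)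

end DualFullerene

/-! ### Short closed curves with few interior edges at their vertices. -/

namespace DualFullerene

variable {V : Type u} {G : DualFullerene V} {d : Bool} {a b c e v w : V}

/-- Triangles that bound a smaller side with few interior edges are faces. -/
def TriangleHyp (G : DualFullerene V) (d : Bool) (S : V → V → Prop) : Prop :=
  ∀ S', IsSide G d S' → {p : V × V | S' p.1 p.2}.ncard < {p : V × V | S p.1 p.2}.ncard →
    ∀ a b c, IsTriangle S' a b c →
      (interior S' a).ncard + (interior S' b).ncard + (interior S' c).ncard ≤ 6 →
      G.IsFaceDir d a b c

/-- Quadrilaterals that bound a smaller side with few interior edges are split. -/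
def QuadHyp (G : DualFullerene V) (d : Bool) (S : V → V → Prop) : Prop :=
  ∀ S', IsSide G d S' → {p : V × V | S' p.1 p.2}.ncard < {p : V × V | S p.1 p.2}.ncard →
    ∀ a b c e, IsQuad S' a b c e →
      (interior S' a).ncard + (interior S' b).ncard + (interior S' c).ncard +
        (interior S' e).ncard ≤ 8 →
      SplitQuad G d a b c e

variable {S : V → V → Prop}

/-- Without interior edges at `b` the face there is the triangle itself. With one, to `w`, the curve
is pushed to `a w c`: the interior edge at `b` goes, `a` and `c` lose one each, and `w` brings at
most `6 - 3`, so the bound 6 persists. By induction `a w c` is a face, and then `w` has degree 3. -/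
theorem IsTriangle.face_of_ncard_le_one (hS : IsSide G d S) (ih : TriangleHyp G d S)
    (h : IsTriangle S a b c) (hb : (interior S b).ncard ≤ 1)
    (he : (interior S a).ncard + (interior S b).ncard + (interior S c).ncard ≤ 6) :
    G.IsFaceDir d a b c := by
  classical
  have := G.finite
  have hab : bdry S a b := (h a b).2 (by simp)
  have hbc : bdry S b c := (h b c).2 (by simp)
  have hca : bdry S c a := (h c a).2 (by simp)
  have nab := (hS.adj hab.1).ne
  have nbc := (hS.adj hbc.1).ne
  have nca := (hS.adj hca.1).ne
  have ha' : ∀ x, bdry S x b → x = a := fun x hx => by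
    rcases (h _ _).1 hx with h | h | h
    · exact h.1
    · exact (nbc h.2).elim
    · exact (nab h.2.symm).elim
  have hc' : ∀ x, bdry S b x → x = c := fun x hx => by
    rcases (h _ _).1 hx with h | h | h
    · exact (nab h.1.symm).elim
    · exact h.2
    · exact (nbc h.1).elim
  rcases Nat.le_one_iff_eq_zero_or_eq_one.1 hb with h0 | h1
  · exact hS.local_zero hab hbc hc' ((Set.ncard_eq_zero).1 h0)
  · obtain ⟨w, hw⟩ := Set.ncard_eq_one.1 h1
    have hwb : w ∈ interior S b := by rw [hw]; rfl
    have nwa : w ≠ a := by rintro rfl; exact hab.2 hwb.1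
    have nwc : w ≠ c := by rintro rfl; exact hbc.2 hwb.2
    have nwb : w ≠ b := (hS.adj hwb.1).ne.symm
    obtain ⟨f1, f2⟩ := hS.local_one hab hbc hc' hw
    have hb := fun x y => hS.bdry_avoid_one (x := x) (y := y) hab ha' hbc hw f1 f2
      (fun h' => by
        rcases (h _ _).1 h' with h' | h' | h'
        exacts [nwa h'.1, nwb h'.1, nwc h'.1])
      (fun h' => by
        rcases (h _ _).1 h' with h' | h' | h'
        exacts [nwb h'.2, nwc h'.2, nwa h'.2])
    have htri : IsTriangle (G.avoid d S {b}) a w c := by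
      intro x y
      rw [hb x y, h x y]
      constructor
      · rintro (h' | h' | ⟨h' | h' | h', h1, h2⟩)
        · exact Or.inl h'
        · exact Or.inr (Or.inl h')
        · exact (h2 h'.2).elim
        · exact (h1 h'.1).elim
        · exact Or.inr (Or.inr h')
      · rintro (h' | h' | ⟨rfl, rfl⟩)
        · exact Or.inl h'
        · exact Or.inr (Or.inl h')
        · exact Or.inr (Or.inr ⟨Or.inr (Or.inr ⟨rfl, rfl⟩), nbc.symm, nab⟩)
    have haw := (hb a w).2 (by simp)
    have hwc := (hb w c).2 (by simp)
    have e1 := ncard_interior_avoid_lt (d := d) (X := {b}) G (v := a) (w := w)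
      ⟨haw.1.1, hS.face (hS.face hab.1 f1) f1.rotate⟩ (fun h => haw.2 h.2)
    have e2 := ncard_interior_avoid_lt (d := d) (X := {b}) G (v := c) (w := w)
      ⟨hS.face hbc.1 f2.rotate, hwc.1.1⟩ (fun h => hwc.2 h.1)
    have e3 := ncard_add_card_le (v := w) (I := interior (G.avoid d S {b}) w) (T := {a, b, c})
      (fun x hx => hS.adj hx.1.1) (by
        intro x hx
        simp only [Finset.mem_insert, Finset.mem_singleton] at hx
        rcases hx with rfl | rfl | rfl
        · exact ⟨f1.rotate₂.adj, fun h => haw.2 h.1⟩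
        · exact ⟨f2.adj, fun h => h.1.2.2.1 rfl⟩
        · exact ⟨f2.rotate₂.adj.symm, fun h => hwc.2 h.2⟩)
    rw [Finset.card_eq_three.2 ⟨a, b, c, nab, nca.symm, nbc, rfl⟩] at e3
    have := ih _ (hS.avoid {b}) (ncard_avoid_lt G rfl hab.1) a w c htri (by omega)
    exact (not_close_three this f2.rotate₂ f1.rotate).elim

/-- Removing all faces at the boundary leaves an inner triangle. Each of its vertices has two
neighbours on the outer and two on the inner triangle, hence at most two interior edges. By
induction the inner triangle is a face, and its vertices have degree 4. -/
theorem IsTriangle.face_of_ncard_eq_two (hS : IsSide G d S) (ih : TriangleHyp G d S)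
    (h : IsTriangle S a b c) (h2 : ∀ z, z = a ∨ z = b ∨ z = c → (interior S z).ncard = 2) :
    False := by
  classical
  have := G.finite
  have hab : bdry S a b := (h a b).2 (by simp)
  have hbc : bdry S b c := (h b c).2 (by simp)
  have hca : bdry S c a := (h c a).2 (by simp)
  have nab := (hS.adj hab.1).ne
  have nbc := (hS.adj hbc.1).ne
  have nca := (hS.adj hca.1).ne
  obtain ⟨w₁, x₂, hIa, fa₁, fa₂, fa₃⟩ := hS.local_two hca hab
    (fun x hx => by rcases (h _ _).1 hx with h | h | h <;> simp_all) (h2 a (by simp))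
  obtain ⟨w₂, x₃, hIb, fb₁, fb₂, fb₃⟩ := hS.local_two hab hbc
    (fun x hx => by rcases (h _ _).1 hx with h | h | h <;> simp_all) (h2 b (by simp))
  obtain ⟨w₃, x₁, hIc, fc₁, fc₂, fc₃⟩ := hS.local_two hbc hca
    (fun x hx => by rcases (h _ _).1 hx with h | h | h <;> simp_all) (h2 c (by simp))
  -- The faces at the three boundary edges are seen from both ends, so the six interior edges lead
  -- to only three names.
  obtain rfl := fa₃.rotate.unique fb₁
  obtain rfl := fb₃.rotate.unique fc₁
  obtain rfl := fc₃.rotate.unique fa₁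
  have hmem : ∀ {z x y : V}, interior S z = {x, y} → x ∈ interior S z ∧ y ∈ interior S z := by
    rintro z x y h; rw [h]; simp
  have ia := hmem hIa
  have ib := hmem hIb
  have ic := hmem hIc
  have hn : ∀ {z x : V}, x ∈ interior S z → ¬ bdry S z x ∧ ¬ bdry S x z ∧ x ≠ z :=
    fun h => ⟨fun h' => h'.2 h.2, fun h' => h'.2 h.1, (hS.adj h.1).ne.symm⟩
  have n1 : x₁ ≠ a ∧ x₁ ≠ b ∧ x₁ ≠ c := ⟨(hn ia.1).2.2,
    fun h => (hn ia.1).1 (h ▸ hab), fun h => (hn ia.1).2.1 (h ▸ hca)⟩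
  have n2 : x₂ ≠ a ∧ x₂ ≠ b ∧ x₂ ≠ c := ⟨(hn ia.2).2.2, (hn ib.1).2.2,
    fun h => (hn ia.2).2.1 (h ▸ hca)⟩
  have n3 : x₃ ≠ a ∧ x₃ ≠ b ∧ x₃ ≠ c := ⟨fun h => (hn ib.2).2.1 (h ▸ hab), (hn ib.2).2.2,
    (hn ic.1).2.2⟩
  have n12 := fa₂.ne₁₃
  have n23 := fb₂.ne₁₃
  have n31 := fc₂.ne₁₃
  let X : Set V := {z | z = a ∨ z = b ∨ z = c}
  let y₁ : V → V := fun z => if z = a then x₁ else if z = b then x₂ else x₃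
  let y₂ : V → V := fun z => if z = a then x₂ else if z = b then x₃ else x₁
  have a1 : y₁ a = x₁ := by simp [y₁]
  have a2 : y₂ a = x₂ := by simp [y₂]
  have b1 : y₁ b = x₂ := by simp [y₁, nab.symm]
  have b2 : y₂ b = x₃ := by simp [y₂, nab.symm]
  have c1 : y₁ c = x₃ := by simp [y₁, nca, nbc.symm]
  have c2 : y₂ c = x₁ := by simp [y₂, nca, nbc.symm]
  have hX : ∀ x y, bdry (G.avoid d S X) x y ↔ ∃ v ∈ X, x = y₁ v ∧ y = y₂ v := by
    intro x y
    refine hS.bdry_avoid_all (fun x y hxy => ?_) ?_ ?_ ?_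
    · rcases (h _ _).1 hxy with ⟨rfl, rfl⟩ | ⟨rfl, rfl⟩ | ⟨rfl, rfl⟩ <;> simp [X]
    · rintro z (rfl | rfl | rfl)
      · rw [a1, a2]; exact ⟨hIa, fa₂, _, Or.inr (Or.inl rfl), fa₃⟩
      · rw [b1, b2]; exact ⟨hIb, fb₂, _, Or.inr (Or.inr rfl), fb₃⟩
      · rw [c1, c2]; exact ⟨hIc, fc₂, _, Or.inl rfl, fc₃⟩
    · rintro z (rfl | rfl | rfl)
      · rw [a1, a2]; simp [X, n1, n2]
      · rw [b1, b2]; simp [X, n3, n2]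
      · rw [c1, c2]; simp [X, n1, n3]
    · have m12 := n12.symm
      have m23 := n23.symm
      have m31 := n31.symm
      clear_value y₁ y₂
      clear h hn hmem hIa hIb hIc h2
      rintro z (rfl | rfl | rfl) v (rfl | rfl | rfl) <;>
        simp only [a1, a2, b1, b2, c1, c2] <;> rintro ⟨h1, h2⟩ <;>
        first | exact n12 h1 | exact n23 h1 | exact n31 h1 | exact m12 h1 | exact m23 h1 |
          exact m31 h1 | exact n12 h2 | exact n23 h2 | exact n31 h2
  have htri : IsTriangle (G.avoid d S X) x₁ x₂ x₃ := by
    intro x y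
    rw [hX x y]
    simp only [X, Set.mem_ofPred_eq, exists_eq_or_imp, exists_eq_left, a1, a2, b1, b2, c1, c2]
  have h12 := (htri x₁ x₂).2 (by simp)
  have h23 := (htri x₂ x₃).2 (by simp)
  have h31 := (htri x₃ x₁).2 (by simp)
  have hcard : ∀ p q z z' x : V, z ∈ X → z' ∈ X → z ≠ z' → p ∉ X → q ∉ X → p ≠ q →
      bdry (G.avoid d S X) p x → bdry (G.avoid d S X) x q → G.graph.Adj x z → G.graph.Adj x z' →
      (interior (G.avoid d S X) x).ncard ≤ 2 := by
    intro p q z z' x hz hz' hzz hp hq hpq hpx hxq hxz hxz'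
    have := ncard_add_card_le (v := x) (I := interior (G.avoid d S X) x) (T := {z, z', p, q})
      (fun y hy => hS.adj hy.1.1) (by
        intro y hy
        simp only [Finset.mem_insert, Finset.mem_singleton] at hy
        rcases hy with rfl | rfl | rfl | rfl
        · exact ⟨hxz, fun h => h.1.2.2.1 hz⟩
        · exact ⟨hxz', fun h => h.1.2.2.1 hz'⟩
        · exact ⟨(hS.adj hpx.1.1).symm, fun h => hpx.2 h.1⟩
        · exact ⟨hS.adj hxq.1.1, fun h => hxq.2 h.2⟩)
    have h4 : ({z, z', p, q} : Finset V).card = 4 := by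
      rw [Finset.card_insert_of_notMem, Finset.card_insert_of_notMem, Finset.card_pair hpq]
      · simp only [Finset.mem_insert, Finset.mem_singleton, not_or]
        exact ⟨fun h => hp (h ▸ hz'), fun h => hq (h ▸ hz')⟩
      · simp only [Finset.mem_insert, Finset.mem_singleton, not_or]
        exact ⟨hzz, fun h => hp (h ▸ hz), fun h => hq (h ▸ hz)⟩
    omega
  have ha : a ∈ X := Or.inl rfl
  have hb : b ∈ X := Or.inr (Or.inl rfl)
  have hc : c ∈ X := Or.inr (Or.inr rfl)
  have e1 := hcard x₃ x₂ c a x₁ hc ha nca (by simp [X, n3]) (by simp [X, n2]) n23.symm h31 h12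
    (hS.adj ic.2.2) (hS.adj ia.1.2)
  have e2 := hcard x₁ x₃ a b x₂ ha hb nab (by simp [X, n1]) (by simp [X, n3]) n31.symm h12 h23
    (hS.adj ia.2.2) (hS.adj ib.1.2)
  have e3 := hcard x₂ x₁ b c x₃ hb hc nbc (by simp [X, n2]) (by simp [X, n1]) n12.symm h23 h31
    (hS.adj ib.2.2) (hS.adj ic.1.2)
  have := ih _ (hS.avoid X) (ncard_avoid_lt G hb hab.1) _ _ _ htri (by omega)
  exact not_close_four this fb₂.rotate₂ fa₃.rotate₂ fa₂.rotate

/-- Without interior edges at `b` the face `a b c` is cut off; a triangle with total at most `8 - 2`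
remains and is a face. One interior edge is the diagonal if it ends at `e`. Otherwise the curve is
pushed to `a w c e`, the bound 8 persists for the same reason as for triangles, and in either
splitting of this quadrilateral `w` would have degree 3 or 4. -/
theorem IsQuad.split_of_ncard_le_one (hS : IsSide G d S) (iht : TriangleHyp G d S)
    (ih : QuadHyp G d S) (h : IsQuad S a b c e) (hb : (interior S b).ncard ≤ 1)
    (he : (interior S a).ncard + (interior S b).ncard + (interior S c).ncard +
      (interior S e).ncard ≤ 8) :
    SplitQuad G d a b c e := by
  classical
  have := G.finite
  obtain ⟨nac, nbe, h⟩ := h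
  have hab : bdry S a b := (h a b).2 (by simp)
  have hbc : bdry S b c := (h b c).2 (by simp)
  have hce : bdry S c e := (h c e).2 (by simp)
  have hea : bdry S e a := (h e a).2 (by simp)
  have nab := (hS.adj hab.1).ne
  have nbc := (hS.adj hbc.1).ne
  have nce := (hS.adj hce.1).ne
  have nea := (hS.adj hea.1).ne
  have ha' : ∀ x, bdry S x b → x = a := fun x hx => by
    rcases (h _ _).1 hx with h | h | h | h
    · exact h.1
    · exact (nbc h.2).elim
    · exact (nbe h.2).elim
    · exact (nab h.2.symm).elim
  have hc' : ∀ x, bdry S b x → x = c := fun x hx => by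
    rcases (h _ _).1 hx with h | h | h | h
    · exact (nab h.1.symm).elim
    · exact h.2
    · exact (nbc h.1).elim
    · exact (nbe h.1).elim
  rcases Nat.le_one_iff_eq_zero_or_eq_one.1 hb with h0 | h1
  · have hI := (Set.ncard_eq_zero).1 h0
    have hF := hS.local_zero hab hbc hc' hI
    have hb := fun x y => hS.bdry_avoid_zero (x := x) (y := y) hab ha' hI hF
      (fun h' => by
        rcases (h _ _).1 h' with h' | h' | h' | h'
        exacts [nac h'.1.symm, nac h'.2, nea h'.2.symm, nce h'.1])
    have htri : IsTriangle (G.avoid d S {b}) a c e := by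
      intro x y
      rw [hb x y, h x y]
      constructor
      · rintro (h' | ⟨h' | h' | h', h1, h2⟩)
        · exact Or.inl h'
        · exact (h2 h'.2).elim
        · exact (h1 h'.1).elim
        · exact Or.inr h'
      · rintro (h' | ⟨rfl, rfl⟩ | ⟨rfl, rfl⟩)
        · exact Or.inl h'
        · exact Or.inr ⟨by simp, nbc.symm, nbe.symm⟩
        · exact Or.inr ⟨by simp, nbe.symm, nab⟩
    have hac := (hb a c).2 (by simp)
    have hca := hS.face (hS.face hab.1 hF) hF.rotate
    have e1 := ncard_interior_avoid_lt (d := d) (X := {b}) G (v := a) (w := c)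
      ⟨hac.1.1, hca⟩ (fun h => hac.2 h.2)
    have e2 := ncard_interior_avoid_lt (d := d) (X := {b}) G (v := c) (w := a)
      ⟨hca, hac.1.1⟩ (fun h => hac.2 h.1)
    have e3 := ncard_interior_avoid_le (d := d) (S := S) (X := {b}) G e
    exact Or.inl ⟨hF, iht _ (hS.avoid {b}) (ncard_avoid_lt G rfl hab.1) a c e htri (by omega)⟩
  · obtain ⟨w, hw⟩ := Set.ncard_eq_one.1 h1
    have hwb : w ∈ interior S b := by rw [hw]; rfl
    have nwa : w ≠ a := by rintro rfl; exact hab.2 hwb.1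
    have nwc : w ≠ c := by rintro rfl; exact hbc.2 hwb.2
    have nwb : w ≠ b := (hS.adj hwb.1).ne.symm
    obtain ⟨f1, f2⟩ := hS.local_one hab hbc hc' hw
    by_cases hwe : w = e
    · subst hwe
      exact Or.inr ⟨f2.rotate, f1.rotate⟩
    have hb := fun x y => hS.bdry_avoid_one (x := x) (y := y) hab ha' hbc hw f1 f2
      (fun h' => by
        rcases (h _ _).1 h' with h' | h' | h' | h'
        exacts [nwa h'.1, nwb h'.1, nwc h'.1, hwe h'.1])
      (fun h' => by
        rcases (h _ _).1 h' with h' | h' | h' | h'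
        exacts [nwb h'.2, nwc h'.2, hwe h'.2, nwa h'.2])
    have hquad : IsQuad (G.avoid d S {b}) a w c e := by
      refine ⟨nac, hwe, fun x y => ?_⟩
      rw [hb x y, h x y]
      constructor
      · rintro (h' | h' | ⟨h' | h' | h', h1, h2⟩)
        · exact Or.inl h'
        · exact Or.inr (Or.inl h')
        · exact (h2 h'.2).elim
        · exact (h1 h'.1).elim
        · exact Or.inr (Or.inr h')
      · rintro (h' | h' | ⟨rfl, rfl⟩ | ⟨rfl, rfl⟩)
        · exact Or.inl h'
        · exact Or.inr (Or.inl h')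
        · exact Or.inr (Or.inr ⟨by simp, nbc.symm, nbe.symm⟩)
        · exact Or.inr (Or.inr ⟨by simp, nbe.symm, nab⟩)
    have haw := (hb a w).2 (by simp)
    have hwc := (hb w c).2 (by simp)
    have e1 := ncard_interior_avoid_lt (d := d) (X := {b}) G (v := a) (w := w)
      ⟨haw.1.1, hS.face (hS.face hab.1 f1) f1.rotate⟩ (fun h => haw.2 h.2)
    have e2 := ncard_interior_avoid_lt (d := d) (X := {b}) G (v := c) (w := w)
      ⟨hS.face hbc.1 f2.rotate, hwc.1.1⟩ (fun h => hwc.2 h.1)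
    have e4 := ncard_interior_avoid_le (d := d) (S := S) (X := {b}) G e
    have e3 := ncard_add_card_le (v := w) (I := interior (G.avoid d S {b}) w) (T := {a, b, c})
      (fun x hx => hS.adj hx.1.1) (by
        intro x hx
        simp only [Finset.mem_insert, Finset.mem_singleton] at hx
        rcases hx with rfl | rfl | rfl
        · exact ⟨f1.rotate₂.adj, fun h => haw.2 h.1⟩
        · exact ⟨f2.adj, fun h => h.1.2.2.1 rfl⟩
        · exact ⟨f2.rotate₂.adj.symm, fun h => hwc.2 h.2⟩)
    rw [Finset.card_eq_three.2 ⟨a, b, c, nab, nac, nbc, rfl⟩] at e3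
    rcases ih _ (hS.avoid {b}) (ncard_avoid_lt G rfl hab.1) a w c e hquad (by omega) with h | h
    · exact (not_close_three h.1 f2.rotate₂ f1.rotate).elim
    · exact (not_close_four h.2.rotate₂ h.1.rotate₂ f2.rotate₂ f1.rotate).elim

/-- As for triangles, the inner quadrilateral inherits the bound. When it is split by a diagonal, a
vertex off the diagonal has two neighbours on the inner and two on the outer curve, hence degree 4.
-/
theorem IsQuad.split_of_ncard_eq_two (hS : IsSide G d S)
    (ih : QuadHyp G d S) (h : IsQuad S a b c e)
    (h2 : ∀ z, z = a ∨ z = b ∨ z = c ∨ z = e → (interior S z).ncard = 2) : False := by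
  classical
  have := G.finite
  obtain ⟨nac, nbe, h⟩ := h
  have hab : bdry S a b := (h a b).2 (by simp)
  have hbc : bdry S b c := (h b c).2 (by simp)
  have hce : bdry S c e := (h c e).2 (by simp)
  have hea : bdry S e a := (h e a).2 (by simp)
  have nab := (hS.adj hab.1).ne
  have nbc := (hS.adj hbc.1).ne
  have nce := (hS.adj hce.1).ne
  have nea := (hS.adj hea.1).ne
  obtain ⟨w₁, x₂, hIa, fa₁, fa₂, fa₃⟩ := hS.local_two hea hab
    (fun x hx => by rcases (h _ _).1 hx with h | h | h | h <;> simp_all) (h2 a (by simp))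
  obtain ⟨w₂, x₃, hIb, fb₁, fb₂, fb₃⟩ := hS.local_two hab hbc
    (fun x hx => by rcases (h _ _).1 hx with h | h | h | h <;> simp_all) (h2 b (by simp))
  obtain ⟨w₃, x₄, hIc, fc₁, fc₂, fc₃⟩ := hS.local_two hbc hce
    (fun x hx => by rcases (h _ _).1 hx with h | h | h | h <;> simp_all) (h2 c (by simp))
  obtain ⟨w₄, x₁, hIe, fe₁, fe₂, fe₃⟩ := hS.local_two hce hea
    (fun x hx => by rcases (h _ _).1 hx with h | h | h | h <;> simp_all) (h2 e (by simp))
  obtain rfl := fa₃.rotate.unique fb₁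
  obtain rfl := fb₃.rotate.unique fc₁
  obtain rfl := fc₃.rotate.unique fe₁
  obtain rfl := fe₃.rotate.unique fa₁
  have hmem : ∀ {z x y : V}, interior S z = {x, y} → x ∈ interior S z ∧ y ∈ interior S z := by
    rintro z x y h; rw [h]; simp
  have ia := hmem hIa
  have ib := hmem hIb
  have ic := hmem hIc
  have ie := hmem hIe
  have hn : ∀ {z x : V}, x ∈ interior S z → ∀ y, y = z ∨ bdry S z y ∨ bdry S y z → x ≠ y := by
    rintro z x h y (rfl | h' | h') rfl
    · exact (hS.adj h.1).ne rfl
    · exact h'.2 h.2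
    · exact h'.2 h.1
  have n1 : x₁ ≠ a ∧ x₁ ≠ b ∧ x₁ ≠ c ∧ x₁ ≠ e := ⟨hn ia.1 _ (by simp), hn ia.1 _ (by simp [hab]),
    hn ie.2 _ (by simp [hce]), hn ie.2 _ (by simp)⟩
  have n2 : x₂ ≠ a ∧ x₂ ≠ b ∧ x₂ ≠ c ∧ x₂ ≠ e := ⟨hn ia.2 _ (by simp), hn ib.1 _ (by simp),
    hn ib.1 _ (by simp [hbc]), hn ia.2 _ (by simp [hea])⟩
  have n3 : x₃ ≠ a ∧ x₃ ≠ b ∧ x₃ ≠ c ∧ x₃ ≠ e := ⟨hn ib.2 _ (by simp [hab]), hn ib.2 _ (by simp),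
    hn ic.1 _ (by simp), hn ic.1 _ (by simp [hce])⟩
  have n4 : x₄ ≠ a ∧ x₄ ≠ b ∧ x₄ ≠ c ∧ x₄ ≠ e := ⟨hn ie.1 _ (by simp [hea]),
    hn ic.2 _ (by simp [hbc]), hn ic.2 _ (by simp), hn ie.1 _ (by simp)⟩
  have n12 := fa₂.ne₁₃
  have n23 := fb₂.ne₁₃
  have n34 := fc₂.ne₁₃
  have n41 := fe₂.ne₁₃
  have n13 : x₁ ≠ x₃ := by
    rintro rfl
    exact not_close_three fb₂.rotate₂ fa₃.rotate₂ fa₂.rotate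
  have n24 : x₂ ≠ x₄ := by
    rintro rfl
    exact not_close_three fc₂.rotate₂ fb₃.rotate₂ fb₂.rotate
  let X : Set V := {z | z = a ∨ z = b ∨ z = c ∨ z = e}
  let y₁ : V → V := fun z => if z = a then x₁ else if z = b then x₂ else if z = c then x₃ else x₄
  let y₂ : V → V := fun z => if z = a then x₂ else if z = b then x₃ else if z = c then x₄ else x₁
  have a1 : y₁ a = x₁ := by simp [y₁]
  have a2 : y₂ a = x₂ := by simp [y₂]
  have b1 : y₁ b = x₂ := by simp [y₁, nab.symm]
  have b2 : y₂ b = x₃ := by simp [y₂, nab.symm]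
  have c1 : y₁ c = x₃ := by simp [y₁, nac.symm, nbc.symm]
  have c2 : y₂ c = x₄ := by simp [y₂, nac.symm, nbc.symm]
  have e1 : y₁ e = x₄ := by simp [y₁, nea, nbe.symm, nce.symm]
  have e2 : y₂ e = x₁ := by simp [y₂, nea, nbe.symm, nce.symm]
  have hX : ∀ x y, bdry (G.avoid d S X) x y ↔ ∃ v ∈ X, x = y₁ v ∧ y = y₂ v := by
    intro x y
    refine hS.bdry_avoid_all (fun x y hxy => ?_) ?_ ?_ ?_
    · rcases (h _ _).1 hxy with ⟨rfl, rfl⟩ | ⟨rfl, rfl⟩ | ⟨rfl, rfl⟩ | ⟨rfl, rfl⟩ <;> simp [X]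
    · rintro z (rfl | rfl | rfl | rfl)
      · rw [a1, a2]; exact ⟨hIa, fa₂, _, Or.inr (Or.inl rfl), fa₃⟩
      · rw [b1, b2]; exact ⟨hIb, fb₂, _, Or.inr (Or.inr (Or.inl rfl)), fb₃⟩
      · rw [c1, c2]; exact ⟨hIc, fc₂, _, Or.inr (Or.inr (Or.inr rfl)), fc₃⟩
      · rw [e1, e2]; exact ⟨hIe, fe₂, _, Or.inl rfl, fe₃⟩
    · rintro z (rfl | rfl | rfl | rfl)
      · rw [a1, a2]; simp [X, n1, n2]
      · rw [b1, b2]; simp [X, n3, n2]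
      · rw [c1, c2]; simp [X, n4, n3]
      · rw [e1, e2]; simp [X, n1, n4]
    · have m12 := n12.symm
      have m23 := n23.symm
      have m34 := n34.symm
      have m41 := n41.symm
      have m13 := n13.symm
      have m24 := n24.symm
      clear_value y₁ y₂
      clear h hn hmem hIa hIb hIc hIe h2
      rintro z (rfl | rfl | rfl | rfl) v (rfl | rfl | rfl | rfl) <;>
        simp only [a1, a2, b1, b2, c1, c2, e1, e2] <;> rintro ⟨h1, h2⟩ <;>
        first | exact n12 h1 | exact n23 h1 | exact n34 h1 | exact n41 h1 | exact m12 h1 |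
          exact m23 h1 | exact m34 h1 | exact m41 h1 | exact n13 h1 | exact n24 h1 | exact m13 h1 |
          exact m24 h1 | exact n13 h2 | exact n24 h2 | exact m13 h2 | exact m24 h2
  have hquad : IsQuad (G.avoid d S X) x₁ x₂ x₃ x₄ := by
    refine ⟨n13, n24, fun x y => ?_⟩
    rw [hX x y]
    simp only [X, Set.mem_ofPred_eq, exists_eq_or_imp, exists_eq_left, a1, a2, b1, b2, c1, c2, e1,
      e2]
  obtain ⟨-, -, hq⟩ := id hquad
  have h12 := (hq x₁ x₂).2 (by simp)
  have h23 := (hq x₂ x₃).2 (by simp)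
  have h34 := (hq x₃ x₄).2 (by simp)
  have h41 := (hq x₄ x₁).2 (by simp)
  have hcard : ∀ p q z z' x : V, z ∈ X → z' ∈ X → z ≠ z' → p ∉ X → q ∉ X → p ≠ q →
      bdry (G.avoid d S X) p x → bdry (G.avoid d S X) x q → G.graph.Adj x z → G.graph.Adj x z' →
      (interior (G.avoid d S X) x).ncard ≤ 2 := by
    intro p q z z' x hz hz' hzz hp hq hpq hpx hxq hxz hxz'
    have := ncard_add_card_le (v := x) (I := interior (G.avoid d S X) x) (T := {z, z', p, q})
      (fun y hy => hS.adj hy.1.1) (by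
        intro y hy
        simp only [Finset.mem_insert, Finset.mem_singleton] at hy
        rcases hy with rfl | rfl | rfl | rfl
        · exact ⟨hxz, fun h => h.1.2.2.1 hz⟩
        · exact ⟨hxz', fun h => h.1.2.2.1 hz'⟩
        · exact ⟨(hS.adj hpx.1.1).symm, fun h => hpx.2 h.1⟩
        · exact ⟨hS.adj hxq.1.1, fun h => hxq.2 h.2⟩)
    have h4 : ({z, z', p, q} : Finset V).card = 4 := by
      rw [Finset.card_insert_of_notMem, Finset.card_insert_of_notMem, Finset.card_pair hpq]
      · simp only [Finset.mem_insert, Finset.mem_singleton, not_or]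
        exact ⟨fun h => hp (h ▸ hz'), fun h => hq (h ▸ hz')⟩
      · simp only [Finset.mem_insert, Finset.mem_singleton, not_or]
        exact ⟨hzz, fun h => hp (h ▸ hz), fun h => hq (h ▸ hz)⟩
    omega
  have ha : a ∈ X := Or.inl rfl
  have hb : b ∈ X := Or.inr (Or.inl rfl)
  have hc : c ∈ X := Or.inr (Or.inr (Or.inl rfl))
  have hE : e ∈ X := Or.inr (Or.inr (Or.inr rfl))
  have i1 := hcard x₄ x₂ e a x₁ hE ha nea (by simp [X, n4]) (by simp [X, n2]) n24.symm h41 h12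
    (hS.adj ie.2.2) (hS.adj ia.1.2)
  have i2 := hcard x₁ x₃ a b x₂ ha hb nab (by simp [X, n1]) (by simp [X, n3]) n13 h12 h23
    (hS.adj ia.2.2) (hS.adj ib.1.2)
  have i3 := hcard x₂ x₄ b c x₃ hb hc nbc (by simp [X, n2]) (by simp [X, n4]) n24 h23 h34
    (hS.adj ib.2.2) (hS.adj ic.1.2)
  have i4 := hcard x₃ x₁ c e x₄ hc hE nce (by simp [X, n3]) (by simp [X, n1]) n13.symm h34 h41
    (hS.adj ic.2.2) (hS.adj ie.1.2)
  rcases ih _ (hS.avoid X) (ncard_avoid_lt G hb hab.1) _ _ _ _ hquad (by omega) with h | h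
  · exact not_close_four h.1 fb₂.rotate₂ fa₃.rotate₂ fa₂.rotate
  · exact not_close_four h.1 fc₂.rotate₂ fb₃.rotate₂ fb₂.rotate

/-- Induction on the size of the side. The bounds 6 and 8 mean two interior edges per boundary
vertex on average, so either some vertex has at most one or all have exactly two. -/
theorem IsSide.face_and_split (n : ℕ) : ∀ S, IsSide G d S → {p : V × V | S p.1 p.2}.ncard = n →
    (∀ a b c, IsTriangle S a b c →
      (interior S a).ncard + (interior S b).ncard + (interior S c).ncard ≤ 6 →
      G.IsFaceDir d a b c) ∧
    ∀ a b c e, IsQuad S a b c e →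
      (interior S a).ncard + (interior S b).ncard + (interior S c).ncard +
        (interior S e).ncard ≤ 8 →
      SplitQuad G d a b c e := by
  induction n using Nat.strong_induction_on with
  | _ n ih =>
    intro S hS hn
    have iht : TriangleHyp G d S := fun S' hS' hlt => (ih _ (hn ▸ hlt) S' hS' rfl).1
    have ihq : QuadHyp G d S := fun S' hS' hlt => (ih _ (hn ▸ hlt) S' hS' rfl).2
    constructor
    · intro a b c h he
      by_cases h1 : (interior S a).ncard ≤ 1
      · exact (h.turn.turn.face_of_ncard_le_one hS iht h1 (by omega)).rotate
      by_cases h2 : (interior S b).ncard ≤ 1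
      · exact h.face_of_ncard_le_one hS iht h2 (by omega)
      by_cases h3 : (interior S c).ncard ≤ 1
      · exact (h.turn.face_of_ncard_le_one hS iht h3 (by omega)).rotate₂
      refine (h.face_of_ncard_eq_two hS iht ?_).elim
      rintro z (rfl | rfl | rfl) <;> omega
    · intro a b c e h he
      by_cases h1 : (interior S a).ncard ≤ 1
      · exact (h.turn.turn.turn.split_of_ncard_le_one hS iht ihq h1 (by omega)).turn.turn.turn.turn.turn.turn.turn
      by_cases h2 : (interior S b).ncard ≤ 1
      · exact h.split_of_ncard_le_one hS iht ihq h2 (by omega)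
      by_cases h3 : (interior S c).ncard ≤ 1
      · exact (h.turn.split_of_ncard_le_one hS iht ihq h3 (by omega)).turn
      by_cases h4 : (interior S e).ncard ≤ 1
      · exact (h.turn.turn.split_of_ncard_le_one hS iht ihq h4 (by omega)).turn.turn
      refine (h.split_of_ncard_eq_two hS ihq ?_).elim
      rintro z (rfl | rfl | rfl | rfl) <;> omega

end DualFullerene

/-! ### Absence of separating triangles and quadrilaterals. -/

namespace DualFullerene

variable {V : Type u} {G : DualFullerene V} {d : Bool} {a b c e v w : V}

theorem IsSide.compl {S : V → V → Prop} (hS : IsSide G d S) :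
    IsSide G d (fun x y => G.graph.Adj x y ∧ ¬ S x y) where
  adj h := h.1
  face h hf := ⟨hf.rotate.adj, fun h' => h.2 (hS.face (hS.face h' hf.rotate) hf.rotate₂)⟩

theorem IsSide.bdry_compl {S : V → V → Prop} (hS : IsSide G d S) {x y : V} :
    bdry (fun x y => G.graph.Adj x y ∧ ¬ S x y) x y ↔ bdry S y x := by
  constructor
  · rintro ⟨⟨h1, h2⟩, h3⟩
    exact ⟨by_contra fun h => h3 ⟨h1.symm, h⟩, h2⟩
  · rintro ⟨h1, h2⟩
    exact ⟨⟨(hS.adj h1).symm, h2⟩, fun h => h.2 h1⟩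

/-- Two of the at most six edges at `v` belong to the curve, and each other edge is interior to at
most one side. On average over the two sides this is two interior edges per vertex, which is why one
side always satisfies the bound of `face_and_split`. -/
theorem IsSide.ncard_interior_add {S : V → V → Prop} (hS : IsSide G d S) (hu : bdry S a v)
    (hw : bdry S v w) : (interior S v).ncard +
      (interior (fun x y => G.graph.Adj x y ∧ ¬ S x y) v).ncard ≤ 4 := by
  classical
  have := G.finite
  rw [← Set.ncard_union_eq]
  · have := ncard_add_card_le (v := v) (I := interior S v ∪
      interior (fun x y => G.graph.Adj x y ∧ ¬ S x y) v) (T := {a, w}) (by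
        rintro x (h | h)
        · exact hS.adj h.1
        · exact h.1.1) (by
        intro x hx
        simp only [Finset.mem_insert, Finset.mem_singleton] at hx
        rcases hx with rfl | rfl
        · exact ⟨(hS.adj hu.1).symm, fun h => h.elim (fun h => hu.2 h.1) fun h => h.2.2 hu.1⟩
        · exact ⟨hS.adj hw.1, fun h => h.elim (fun h => hw.2 h.2) fun h => h.1.2 hw.1⟩)
    have hne : a ≠ w := by rintro rfl; exact hu.2 hw.1
    rw [Finset.card_pair hne] at this
    omega
  · exact Set.disjoint_left.2 fun x hx hx' => hx'.1.2 hx.1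

/-- Three mutually adjacent vertices form a face. -/
theorem face_of_adj (d : Bool) (hab : G.graph.Adj a b) (hbc : G.graph.Adj b c)
    (hca : G.graph.Adj c a) : G.IsFaceDir d a b c ∨ G.IsFaceDir d a c b := by
  have nab := hab.ne
  have nbc := hbc.ne
  have nca := hca.ne
  have key : G.IsFaceDir true a b c ∨ G.IsFaceDir true a c b := by
    let R : V → V → Prop := fun x y => (x = a ∧ y = b) ∨ (x = b ∧ y = c) ∨ (x = c ∧ y = a)
    have hR : IsCycleRel G R := by
      refine ⟨?_, ?_, ?_, ?_, ?_, ?_⟩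
      · rintro x y (⟨rfl, rfl⟩ | ⟨rfl, rfl⟩ | ⟨rfl, rfl⟩) <;> assumption
      · rintro x y z (⟨rfl, rfl⟩ | ⟨rfl, rfl⟩ | ⟨rfl, rfl⟩) (⟨h, rfl⟩ | ⟨h, rfl⟩ | ⟨h, rfl⟩) <;>
          first | rfl | exact absurd h (by assumption) | exact absurd h.symm (by assumption)
      · rintro x y z (⟨rfl, rfl⟩ | ⟨rfl, rfl⟩ | ⟨rfl, rfl⟩) (⟨rfl, h⟩ | ⟨rfl, h⟩ | ⟨rfl, h⟩) <;>
          first | rfl | exact absurd h (by assumption) | exact absurd h.symm (by assumption)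
      · rintro x y (⟨rfl, rfl⟩ | ⟨rfl, rfl⟩ | ⟨rfl, rfl⟩)
        · exact ⟨c, by simp [R]⟩
        · exact ⟨a, by simp [R]⟩
        · exact ⟨b, by simp [R]⟩
      · rintro x y (⟨rfl, rfl⟩ | ⟨rfl, rfl⟩ | ⟨rfl, rfl⟩)
        · exact ⟨c, by simp [R]⟩
        · exact ⟨a, by simp [R]⟩
        · exact ⟨b, by simp [R]⟩
      · rintro x y (⟨rfl, rfl⟩ | ⟨rfl, rfl⟩ | ⟨rfl, rfl⟩) (⟨h1, h2⟩ | ⟨h1, h2⟩ | ⟨h1, h2⟩) <;>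
          first | exact nab h1 | exact nbc h1 | exact nca h1 | exact nab h1.symm | exact nbc h1.symm |
            exact nca h1.symm | exact nab h2 | exact nbc h2 | exact nca h2 | exact nab h2.symm |
            exact nbc h2.symm | exact nca h2.symm
    obtain ⟨S, hS, hSab, hstep, hbd⟩ := exists_side hR (a := a) (b := b) (by simp [R])
    have hSbc : S b c := hstep a b c (by simp [R]) (by simp [R]) hSab
    have hSca : S c a := hstep b c a (by simp [R]) (by simp [R]) hSbc
    have hfw : ∀ x y, R x y → S x y := by
      rintro x y (⟨rfl, rfl⟩ | ⟨rfl, rfl⟩ | ⟨rfl, rfl⟩) <;> assumption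
    have hS' : ∀ x y, bdry S x y ↔ R x y := by
      intro x y
      constructor
      · intro h
        rcases (hbd x y (hS.adj h.1)).1 (by simp [h.1, h.2]) with h' | h'
        · exact h'
        · exact (h.2 (hfw _ _ h')).elim
      · intro h
        have := (hbd x y (hR.adj h)).2 (Or.inl h)
        exact ⟨hfw _ _ h, this.1 (hfw _ _ h)⟩
    have i1 := hS.ncard_interior_add (a := c) (v := a) (w := b) ((hS' _ _).2 (by simp [R]))
      ((hS' _ _).2 (by simp [R]))
    have i2 := hS.ncard_interior_add (a := a) (v := b) (w := c) ((hS' _ _).2 (by simp [R]))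
      ((hS' _ _).2 (by simp [R]))
    have i3 := hS.ncard_interior_add (a := b) (v := c) (w := a) ((hS' _ _).2 (by simp [R]))
      ((hS' _ _).2 (by simp [R]))
    -- Both sides together have at most `3 * 4` interior edges at the triangle, so if this side
    -- exceeds 6, the complementary one, which runs along the triangle backwards, does not.
    by_cases h6 : (interior S a).ncard + (interior S b).ncard + (interior S c).ncard ≤ 6
    · exact Or.inl ((IsSide.face_and_split _ S hS rfl).1 a b c hS' h6)
    · refine Or.inr ((IsSide.face_and_split _ _ hS.compl rfl).1 a c b (fun x y => ?_) (by omega))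
      rw [hS.bdry_compl, hS' y x]
      simp only [R]
      tauto
  cases d
  · exact key.symm
  · exact key

/-- A closed walk of length 4 on distinct vertices bounds two triangles with a common edge. -/
theorem split_of_adj (d : Bool) (hab : G.graph.Adj a b) (hbc : G.graph.Adj b c)
    (hce : G.graph.Adj c e) (hea : G.graph.Adj e a) (nac : a ≠ c) (nbe : b ≠ e) :
    SplitQuad G d a b c e ∨ SplitQuad G d a e c b := by
  have nab := hab.ne
  have nbc := hbc.ne
  have nce := hce.ne
  have nea := hea.ne
  have key : SplitQuad G true a b c e ∨ SplitQuad G true a e c b := by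
    let R : V → V → Prop := fun x y =>
      (x = a ∧ y = b) ∨ (x = b ∧ y = c) ∨ (x = c ∧ y = e) ∨ (x = e ∧ y = a)
    have hR : IsCycleRel G R := by
      refine ⟨?_, ?_, ?_, ?_, ?_, ?_⟩
      · rintro x y (⟨rfl, rfl⟩ | ⟨rfl, rfl⟩ | ⟨rfl, rfl⟩ | ⟨rfl, rfl⟩) <;> assumption
      · rintro x y z (⟨rfl, rfl⟩ | ⟨rfl, rfl⟩ | ⟨rfl, rfl⟩ | ⟨rfl, rfl⟩)
          (⟨h, rfl⟩ | ⟨h, rfl⟩ | ⟨h, rfl⟩ | ⟨h, rfl⟩) <;>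
          first | rfl | exact absurd h (by assumption) | exact absurd h.symm (by assumption)
      · rintro x y z (⟨rfl, rfl⟩ | ⟨rfl, rfl⟩ | ⟨rfl, rfl⟩ | ⟨rfl, rfl⟩)
          (⟨rfl, h⟩ | ⟨rfl, h⟩ | ⟨rfl, h⟩ | ⟨rfl, h⟩) <;>
          first | rfl | exact absurd h (by assumption) | exact absurd h.symm (by assumption)
      · rintro x y (⟨rfl, rfl⟩ | ⟨rfl, rfl⟩ | ⟨rfl, rfl⟩ | ⟨rfl, rfl⟩)
        · exact ⟨c, by simp [R]⟩
        · exact ⟨e, by simp [R]⟩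
        · exact ⟨a, by simp [R]⟩
        · exact ⟨b, by simp [R]⟩
      · rintro x y (⟨rfl, rfl⟩ | ⟨rfl, rfl⟩ | ⟨rfl, rfl⟩ | ⟨rfl, rfl⟩)
        · exact ⟨e, by simp [R]⟩
        · exact ⟨a, by simp [R]⟩
        · exact ⟨b, by simp [R]⟩
        · exact ⟨c, by simp [R]⟩
      · rintro x y (⟨rfl, rfl⟩ | ⟨rfl, rfl⟩ | ⟨rfl, rfl⟩ | ⟨rfl, rfl⟩)
          (⟨h1, h2⟩ | ⟨h1, h2⟩ | ⟨h1, h2⟩ | ⟨h1, h2⟩) <;>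
          first | exact absurd h1 (by assumption) | exact absurd h1.symm (by assumption) |
            exact absurd h2 (by assumption) | exact absurd h2.symm (by assumption)
    obtain ⟨S, hS, hSab, hstep, hbd⟩ := exists_side hR (a := a) (b := b) (by simp [R])
    have hSbc : S b c := hstep a b c (by simp [R]) (by simp [R]) hSab
    have hSce : S c e := hstep b c e (by simp [R]) (by simp [R]) hSbc
    have hSea : S e a := hstep c e a (by simp [R]) (by simp [R]) hSce
    have hfw : ∀ x y, R x y → S x y := by
      rintro x y (⟨rfl, rfl⟩ | ⟨rfl, rfl⟩ | ⟨rfl, rfl⟩ | ⟨rfl, rfl⟩) <;> assumption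
    have hS' : ∀ x y, bdry S x y ↔ R x y := by
      intro x y
      constructor
      · intro h
        rcases (hbd x y (hS.adj h.1)).1 (by simp [h.1, h.2]) with h' | h'
        · exact h'
        · exact (h.2 (hfw _ _ h')).elim
      · intro h
        have := (hbd x y (hR.adj h)).2 (Or.inl h)
        exact ⟨hfw _ _ h, this.1 (hfw _ _ h)⟩
    have i1 := hS.ncard_interior_add (a := e) (v := a) (w := b) ((hS' _ _).2 (by simp [R]))
      ((hS' _ _).2 (by simp [R]))
    have i2 := hS.ncard_interior_add (a := a) (v := b) (w := c) ((hS' _ _).2 (by simp [R]))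
      ((hS' _ _).2 (by simp [R]))
    have i3 := hS.ncard_interior_add (a := b) (v := c) (w := e) ((hS' _ _).2 (by simp [R]))
      ((hS' _ _).2 (by simp [R]))
    have i4 := hS.ncard_interior_add (a := c) (v := e) (w := a) ((hS' _ _).2 (by simp [R]))
      ((hS' _ _).2 (by simp [R]))
    by_cases h8 : (interior S a).ncard + (interior S b).ncard + (interior S c).ncard +
        (interior S e).ncard ≤ 8
    · exact Or.inl ((IsSide.face_and_split _ S hS rfl).2 a b c e ⟨nac, nbe, hS'⟩ h8)
    · refine Or.inr ((IsSide.face_and_split _ _ hS.compl rfl).2 a e c b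
        ⟨nac, nbe.symm, fun x y => ?_⟩ (by omega))
      rw [hS.bdry_compl, hS' y x]
      simp only [R]
      tauto
  have flip : ∀ a b c e, SplitQuad G true a b c e → SplitQuad G false a e c b := by
    rintro a b c e (⟨h1, h2⟩ | ⟨h1, h2⟩)
    · exact Or.inl ⟨isFaceDir_not.2 h2, isFaceDir_not.2 h1⟩
    · exact Or.inr ⟨isFaceDir_not'.2 h1, isFaceDir_not.2 h2.rotate.rotate.rotate.rotate⟩
  cases d
  · exact key.symm.imp (flip _ _ _ _) (flip _ _ _ _)
  · exact key

end DualFullerene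

/-! ### Combinatorics of the two patches, on formal labels. -/

theorem SmallFace.map {α : Type u} {β : Type v} {f g : ℕ → α} (φ : α → β) {x : OpKind} {a b c : α}
    (h : SmallFace f g x a b c) : SmallFace (φ ∘ f) (φ ∘ g) x (φ a) (φ b) (φ c) := by
  induction h with
  | L_up h => exact .L_up h
  | L_down h => exact .L_down h
  | B_down₁ h => exact .B_down₁ h
  | B_up₁ h => exact .B_up₁ h
  | B_down₂ h h' => exact .B_down₂ h h'
  | B_up₂ h h' => exact .B_up₂ h h'
  | rotate _ ih => exact ih.rotate

theorem SmallFace.exists_of_map {α : Type u} {β : Type v} {f g : ℕ → α} (φ : α → β) {x : OpKind}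
    {a b c : β} (h : SmallFace (φ ∘ f) (φ ∘ g) x a b c) :
    ∃ a' b' c', SmallFace f g x a' b' c' ∧ φ a' = a ∧ φ b' = b ∧ φ c' = c := by
  induction h with
  | L_up h => exact ⟨_, _, _, .L_up h, rfl, rfl, rfl⟩
  | L_down h => exact ⟨_, _, _, .L_down h, rfl, rfl, rfl⟩
  | B_down₁ h => exact ⟨_, _, _, .B_down₁ h, rfl, rfl, rfl⟩
  | B_up₁ h => exact ⟨_, _, _, .B_up₁ h, rfl, rfl, rfl⟩
  | B_down₂ h h' => exact ⟨_, _, _, .B_down₂ h h', rfl, rfl, rfl⟩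
  | B_up₂ h h' => exact ⟨_, _, _, .B_up₂ h h', rfl, rfl, rfl⟩
  | rotate _ ih =>
    obtain ⟨a, b, c, h, h1, h2, h3⟩ := ih
    exact ⟨b, c, a, h.rotate, h2, h3, h1⟩

theorem LargeFace.map {α : Type u} {β : Type v} {f g p : ℕ → α} (φ : α → β) {x : OpKind}
    {a b c : α} (h : LargeFace f g p x a b c) :
    LargeFace (φ ∘ f) (φ ∘ g) (φ ∘ p) x (φ a) (φ b) (φ c) := by
  induction h with
  | start => exact .start
  | L_f h => exact .L_f h
  | L_g h => exact .L_g h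
  | L_pf h => exact .L_pf h
  | L_pg h => exact .L_pg h
  | L_stop => exact LargeFace.L_stop
  | B_f₁ h => exact .B_f₁ h
  | B_g₁ h => exact .B_g₁ h
  | B_pf₁ h => exact .B_pf₁ h
  | B_pg₁ h => exact .B_pg₁ h
  | B_turn₁ => exact .B_turn₁
  | B_turn₂ => exact .B_turn₂
  | B_pf₂ h h' => exact .B_pf₂ h h'
  | B_f₂ h h' => exact .B_f₂ h h'
  | B_pg₂ h h' => exact .B_pg₂ h h'
  | B_g₂ h h' => exact .B_g₂ h h'
  | B_stop => exact LargeFace.B_stop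
  | rotate _ ih => exact ih.rotate

theorem LargeFace.exists_of_map {α : Type u} {β : Type v} {f g p : ℕ → α} (φ : α → β) {x : OpKind}
    {a b c : β} (h : LargeFace (φ ∘ f) (φ ∘ g) (φ ∘ p) x a b c) :
    ∃ a' b' c', LargeFace f g p x a' b' c' ∧ φ a' = a ∧ φ b' = b ∧ φ c' = c := by
  induction h with
  | start => exact ⟨_, _, _, .start, rfl, rfl, rfl⟩
  | L_f h => exact ⟨_, _, _, .L_f h, rfl, rfl, rfl⟩
  | L_g h => exact ⟨_, _, _, .L_g h, rfl, rfl, rfl⟩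
  | L_pf h => exact ⟨_, _, _, .L_pf h, rfl, rfl, rfl⟩
  | L_pg h => exact ⟨_, _, _, .L_pg h, rfl, rfl, rfl⟩
  | L_stop => exact ⟨_, _, _, LargeFace.L_stop, rfl, rfl, rfl⟩
  | B_f₁ h => exact ⟨_, _, _, .B_f₁ h, rfl, rfl, rfl⟩
  | B_g₁ h => exact ⟨_, _, _, .B_g₁ h, rfl, rfl, rfl⟩
  | B_pf₁ h => exact ⟨_, _, _, .B_pf₁ h, rfl, rfl, rfl⟩
  | B_pg₁ h => exact ⟨_, _, _, .B_pg₁ h, rfl, rfl, rfl⟩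
  | B_turn₁ => exact ⟨_, _, _, .B_turn₁, rfl, rfl, rfl⟩
  | B_turn₂ => exact ⟨_, _, _, .B_turn₂, rfl, rfl, rfl⟩
  | B_pf₂ h h' => exact ⟨_, _, _, .B_pf₂ h h', rfl, rfl, rfl⟩
  | B_f₂ h h' => exact ⟨_, _, _, .B_f₂ h h', rfl, rfl, rfl⟩
  | B_pg₂ h h' => exact ⟨_, _, _, .B_pg₂ h h', rfl, rfl, rfl⟩
  | B_g₂ h h' => exact ⟨_, _, _, .B_g₂ h h', rfl, rfl, rfl⟩
  | B_stop => exact ⟨_, _, _, LargeFace.B_stop, rfl, rfl, rfl⟩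
  | rotate _ ih =>
    obtain ⟨a, b, c, h, h1, h2, h3⟩ := ih
    exact ⟨b, c, a, h.rotate, h2, h3, h1⟩

/-- The names of the vertices of a patch. -/
inductive PatchLabel where
  | f (k : ℕ) : PatchLabel
  | g (k : ℕ) : PatchLabel
  | p (k : ℕ) : PatchLabel

namespace PatchLabel

/-- The vertex with a given name. -/
def val {α : Type u} (F G P : ℕ → α) : PatchLabel → α
  | f k => F k
  | g k => G k
  | p k => P k

/-- The labels of boundary vertices. -/
def IsBdry (x : OpKind) : PatchLabel → Prop
  | f k => k < x.sizeF
  | g k => k < x.sizeG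
  | p _ => False

/-- The labels of inner vertices. -/
def IsInner (x : OpKind) : PatchLabel → Prop
  | f _ => False
  | g _ => False
  | p k => k ≤ x.length

/-- The elements `B`, `C` are consecutive in a list. -/
def Consec {α : Type u} (B C : α) : List α → Prop
  | [] => False
  | [_] => False
  | x :: y :: l => (B = x ∧ C = y) ∨ Consec B C (y :: l)

/-- The label `A` is that of a boundary vertex; its neighbours in the initial patch are
`M, ms, N`, in this order, and those in the extended patch are `M, ls, N`. -/
inductive Corner : OpKind → PatchLabel → PatchLabel → List PatchLabel → List PatchLabel →
    PatchLabel → Prop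
  | L_f₀ {i k : ℕ} (h : k = 0) : Corner (.L i) (f k) (f 1) [] [p 0] (g 0)
  | L_f {i k : ℕ} (h : 1 ≤ k) (h' : k ≤ i + 1) :
      Corner (.L i) (f k) (f (k + 1)) [g k, g (k - 1)] [p k, p (k - 1)] (f (k - 1))
  | L_f₁ {i k : ℕ} (h : k = i + 2) :
      Corner (.L i) (f k) (g (i + 2)) [g (i + 1)] [p (i + 1)] (f (i + 1))
  | L_g₀ {i k : ℕ} (h : k = 0) : Corner (.L i) (g k) (f 0) [f 1] [p 0] (g 1)
  | L_g {i k : ℕ} (h : 1 ≤ k) (h' : k ≤ i + 1) :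
      Corner (.L i) (g k) (g (k - 1)) [f k, f (k + 1)] [p (k - 1), p k] (g (k + 1))
  | L_g₁ {i k : ℕ} (h : k = i + 2) :
      Corner (.L i) (g k) (g (i + 1)) [] [p (i + 1)] (f (i + 2))
  | B_f₀ {i j k : ℕ} (h : k = 0) : Corner (.B i j) (f k) (f 1) [g 1] [p 0] (g 0)
  | B_f₁ {i j k : ℕ} (h : 1 ≤ k) (h' : k ≤ i) :
      Corner (.B i j) (f k) (f (k + 1)) [g (k + 1), g k] [p k, p (k - 1)] (f (k - 1))
  | B_f₂ {i j k : ℕ} (h : k = i + 1) :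
      Corner (.B i j) (f k) (f (k + 1)) [g (k + 2), g (k + 1), g k] [p (k + 1), p k, p (k - 1)]
        (f (k - 1))
  | B_f₃ {i j k : ℕ} (h : i + 2 ≤ k) (h' : k ≤ i + j + 1) :
      Corner (.B i j) (f k) (f (k + 1)) [g (k + 2), g (k + 1)] [p (k + 1), p k] (f (k - 1))
  | B_f₄ {i j k : ℕ} (h : k = i + j + 2) :
      Corner (.B i j) (f k) (g (k + 2)) [g (k + 1)] [p k] (f (k - 1))
  | B_g₀ {i j k : ℕ} (h : k = 0) : Corner (.B i j) (g k) (f 0) [] [p 0] (g 1)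
  | B_g₁ {i j k : ℕ} (h : 1 ≤ k) (h' : k ≤ i + 1) :
      Corner (.B i j) (g k) (g (k - 1)) [f (k - 1), f k] [p (k - 1), p k] (g (k + 1))
  | B_g₂ {i j k : ℕ} (h : k = i + 2) :
      Corner (.B i j) (g k) (g (k - 1)) [f (k - 1)] [p (k - 1)] (g (k + 1))
  | B_g₃ {i j k : ℕ} (h : i + 3 ≤ k) (h' : k ≤ i + j + 3) :
      Corner (.B i j) (g k) (g (k - 1)) [f (k - 2), f (k - 1)] [p (k - 2), p (k - 1)] (g (k + 1))
  | B_g₄ {i j k : ℕ} (h : k = i + j + 4) :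
      Corner (.B i j) (g k) (g (k - 1)) [] [p (k - 2)] (f (k - 2))

variable {x : OpKind} {A B C M N : PatchLabel} {ms ls : List PatchLabel}

theorem exists_corner (h : A.IsBdry x) : ∃ M ms ls N, Corner x A M ms ls N := by
  cases A with
  | f k =>
    cases x with
    | L i =>
      have h : k < i + 3 := h
      rcases (by omega : k = 0 ∨ (1 ≤ k ∧ k ≤ i + 1) ∨ k = i + 2) with h | h | h
      · exact ⟨_, _, _, _, .L_f₀ h⟩
      · exact ⟨_, _, _, _, .L_f h.1 h.2⟩
      · exact ⟨_, _, _, _, .L_f₁ h⟩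
    | B i j =>
      have h : k < i + j + 3 := h
      rcases (by omega : k = 0 ∨ (1 ≤ k ∧ k ≤ i) ∨ k = i + 1 ∨ (i + 2 ≤ k ∧ k ≤ i + j + 1) ∨
        k = i + j + 2) with h | h | h | h | h
      · exact ⟨_, _, _, _, .B_f₀ h⟩
      · exact ⟨_, _, _, _, .B_f₁ h.1 h.2⟩
      · exact ⟨_, _, _, _, .B_f₂ h⟩
      · exact ⟨_, _, _, _, .B_f₃ h.1 h.2⟩
      · exact ⟨_, _, _, _, .B_f₄ h⟩
  | g k =>
    cases x with
    | L i =>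
      have h : k < i + 3 := h
      rcases (by omega : k = 0 ∨ (1 ≤ k ∧ k ≤ i + 1) ∨ k = i + 2) with h | h | h
      · exact ⟨_, _, _, _, .L_g₀ h⟩
      · exact ⟨_, _, _, _, .L_g h.1 h.2⟩
      · exact ⟨_, _, _, _, .L_g₁ h⟩
    | B i j =>
      have h : k < i + j + 5 := h
      rcases (by omega : k = 0 ∨ (1 ≤ k ∧ k ≤ i + 1) ∨ k = i + 2 ∨ (i + 3 ≤ k ∧ k ≤ i + j + 3) ∨
        k = i + j + 4) with h | h | h | h | h
      · exact ⟨_, _, _, _, .B_g₀ h⟩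
      · exact ⟨_, _, _, _, .B_g₁ h.1 h.2⟩
      · exact ⟨_, _, _, _, .B_g₂ h⟩
      · exact ⟨_, _, _, _, .B_g₃ h.1 h.2⟩
      · exact ⟨_, _, _, _, .B_g₄ h⟩
  | p k => exact h.elim

/-- Together with `Corner.small_of_consec` this shows that `Corner` lists the complete link of a
boundary vertex inside the initial patch. The three clauses of `key` treat the three positions in a
triangle, so that the induction survives `rotate`. -/
theorem Corner.consec_small (hA : Corner x A M ms ls N) (h : SmallFace f g x B A C) :
    Consec B C (M :: ms ++ [N]) := by
  have key : ∀ A B C, SmallFace f g x A B C →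
      (∀ M ms ls N, Corner x B M ms ls N → Consec A C (M :: ms ++ [N])) ∧
      (∀ M ms ls N, Corner x C M ms ls N → Consec B A (M :: ms ++ [N])) ∧
      (∀ M ms ls N, Corner x A M ms ls N → Consec C B (M :: ms ++ [N])) := by
    clear hA h
    intro A B C h
    induction h with
    | rotate _ ih => exact ⟨ih.2.1, ih.2.2, ih.1⟩
    | _ =>
      refine ⟨?_, ?_, ?_⟩ <;> intro M ms ls N hc <;> cases hc <;>
        simp only [Consec, List.cons_append, List.nil_append, PatchLabel.f.injEq,
          PatchLabel.g.injEq, reduceCtorEq, false_and, and_false, or_false, false_or,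
          true_and, and_true, and_self, true_or, or_true] <;> omega
  exact (key _ _ _ h).1 _ _ _ _ hA

theorem Corner.consec_large (hA : Corner x A M ms ls N) (h : LargeFace f g p x B A C) :
    Consec B C (M :: ls ++ [N]) := by
  have key : ∀ A B C, LargeFace f g p x A B C →
      (∀ M ms ls N, Corner x B M ms ls N → Consec A C (M :: ls ++ [N])) ∧
      (∀ M ms ls N, Corner x C M ms ls N → Consec B A (M :: ls ++ [N])) ∧
      (∀ M ms ls N, Corner x A M ms ls N → Consec C B (M :: ls ++ [N])) := by
    clear hA h
    intro A B C h
    induction h with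
    | rotate _ ih => exact ⟨ih.2.1, ih.2.2, ih.1⟩
    | _ =>
      refine ⟨?_, ?_, ?_⟩ <;> intro M ms ls N hc <;> cases hc <;>
        simp only [Consec, List.cons_append, List.nil_append, PatchLabel.f.injEq,
          PatchLabel.g.injEq, PatchLabel.p.injEq, reduceCtorEq, false_and, and_false, or_false,
          false_or, true_and, and_true, and_self, true_or, or_true] <;> omega
  exact (key _ _ _ h).1 _ _ _ _ hA

theorem Corner.small_of_consec (hA : Corner x A M ms ls N) (h : Consec B C (M :: ms ++ [N])) :
    SmallFace f g x B A C := by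
  cases hA with
  | L_f₀ h₁ =>
    subst h₁
    simp only [Consec, List.cons_append, List.nil_append, or_false] at h
    rcases h with ⟨rfl, rfl⟩
    · exact (SmallFace.L_up (k := 0) (by omega)).rotate.rotate
  | L_f h₁ h₂ =>
    obtain ⟨k, rfl⟩ := Nat.exists_eq_add_of_le' h₁
    simp only [Consec, List.cons_append, List.nil_append, or_false, Nat.add_sub_cancel] at h
    rcases h with ⟨rfl, rfl⟩ | ⟨rfl, rfl⟩ | ⟨rfl, rfl⟩
    · exact (SmallFace.L_up (k := k + 1) (by omega)).rotate.rotate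
    · exact (SmallFace.L_down (k := k) (by omega)).rotate
    · exact (SmallFace.L_up (k := k) (by omega)).rotate
  | L_f₁ h₁ =>
    subst h₁
    simp only [Consec, List.cons_append, List.nil_append, or_false] at h
    rcases h with ⟨rfl, rfl⟩ | ⟨rfl, rfl⟩
    · exact (SmallFace.L_down (k := _) (by omega)).rotate
    · exact (SmallFace.L_up (k := _) (by omega)).rotate
  | L_g₀ h₁ =>
    subst h₁
    simp only [Consec, List.cons_append, List.nil_append, or_false] at h
    rcases h with ⟨rfl, rfl⟩ | ⟨rfl, rfl⟩
    · exact SmallFace.L_up (k := 0) (by omega)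
    · exact (SmallFace.L_down (k := 0) (by omega)).rotate.rotate
  | L_g h₁ h₂ =>
    obtain ⟨k, rfl⟩ := Nat.exists_eq_add_of_le' h₁
    simp only [Consec, List.cons_append, List.nil_append, or_false, Nat.add_sub_cancel] at h
    rcases h with ⟨rfl, rfl⟩ | ⟨rfl, rfl⟩ | ⟨rfl, rfl⟩
    · exact SmallFace.L_down (k := k) (by omega)
    · exact SmallFace.L_up (k := k + 1) (by omega)
    · exact (SmallFace.L_down (k := k + 1) (by omega)).rotate.rotate
  | L_g₁ h₁ =>
    subst h₁
    simp only [Consec, List.cons_append, List.nil_append, or_false] at h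
    rcases h with ⟨rfl, rfl⟩
    · exact SmallFace.L_down (k := _) (by omega)
  | B_f₀ h₁ =>
    subst h₁
    simp only [Consec, List.cons_append, List.nil_append, or_false] at h
    rcases h with ⟨rfl, rfl⟩ | ⟨rfl, rfl⟩
    · exact (SmallFace.B_up₁ (k := 0) (by omega)).rotate.rotate
    · exact (SmallFace.B_down₁ (k := 0) (by omega)).rotate.rotate
  | B_f₁ h₁ h₂ =>
    obtain ⟨k, rfl⟩ := Nat.exists_eq_add_of_le' h₁
    simp only [Consec, List.cons_append, List.nil_append, or_false, Nat.add_sub_cancel] at h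
    rcases h with ⟨rfl, rfl⟩ | ⟨rfl, rfl⟩ | ⟨rfl, rfl⟩
    · exact (SmallFace.B_up₁ (k := k + 1) (by omega)).rotate.rotate
    · exact (SmallFace.B_down₁ (k := k + 1) (by omega)).rotate.rotate
    · exact (SmallFace.B_up₁ (k := k) (by omega)).rotate
  | B_f₂ h₁ =>
    subst h₁
    simp only [Consec, List.cons_append, List.nil_append, or_false, Nat.add_sub_cancel] at h
    rcases h with ⟨rfl, rfl⟩ | ⟨rfl, rfl⟩ | ⟨rfl, rfl⟩ | ⟨rfl, rfl⟩
    · exact (SmallFace.B_up₂ (k := _) (by omega) (by omega)).rotate.rotate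
    · exact (SmallFace.B_down₂ (k := _) (by omega) (by omega)).rotate.rotate
    · exact (SmallFace.B_down₁ (k := _) (by omega)).rotate.rotate
    · exact (SmallFace.B_up₁ (k := _) (by omega)).rotate
  | B_f₃ h₁ h₂ =>
    rename_i i j k
    obtain ⟨k, rfl⟩ := Nat.exists_eq_add_of_le' (show 1 ≤ k by omega)
    simp only [Consec, List.cons_append, List.nil_append, or_false, Nat.add_sub_cancel] at h
    rcases h with ⟨rfl, rfl⟩ | ⟨rfl, rfl⟩ | ⟨rfl, rfl⟩
    · exact (SmallFace.B_up₂ (k := k + 1) (by omega) (by omega)).rotate.rotate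
    · exact (SmallFace.B_down₂ (k := k + 1) (by omega) (by omega)).rotate.rotate
    · exact (SmallFace.B_up₂ (k := k) (by omega) (by omega)).rotate
  | B_f₄ h₁ =>
    rename_i i j k
    obtain ⟨k, rfl⟩ := Nat.exists_eq_add_of_le' (show 1 ≤ k by omega)
    simp only [Consec, List.cons_append, List.nil_append, or_false, Nat.add_sub_cancel] at h
    rcases h with ⟨rfl, rfl⟩ | ⟨rfl, rfl⟩
    · exact (SmallFace.B_down₂ (k := k + 1) (by omega) (by omega)).rotate.rotate
    · exact (SmallFace.B_up₂ (k := k) (by omega) (by omega)).rotate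
  | B_g₀ h₁ =>
    subst h₁
    simp only [Consec, List.cons_append, List.nil_append, or_false] at h
    rcases h with ⟨rfl, rfl⟩
    · exact SmallFace.B_down₁ (k := 0) (by omega)
  | B_g₁ h₁ h₂ =>
    obtain ⟨k, rfl⟩ := Nat.exists_eq_add_of_le' h₁
    simp only [Consec, List.cons_append, List.nil_append, or_false, Nat.add_sub_cancel] at h
    rcases h with ⟨rfl, rfl⟩ | ⟨rfl, rfl⟩ | ⟨rfl, rfl⟩
    · exact (SmallFace.B_down₁ (k := k) (by omega)).rotate
    · exact SmallFace.B_up₁ (k := k) (by omega)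
    · exact SmallFace.B_down₁ (k := k + 1) (by omega)
  | B_g₂ h₁ =>
    subst h₁
    simp only [Consec, List.cons_append, List.nil_append, or_false] at h
    rcases h with ⟨rfl, rfl⟩ | ⟨rfl, rfl⟩
    · exact (SmallFace.B_down₁ (k := _) (by omega)).rotate
    · exact SmallFace.B_down₂ (k := _) (by omega) (by omega)
  | B_g₃ h₁ h₂ =>
    rename_i i j k
    obtain ⟨k, rfl⟩ := Nat.exists_eq_add_of_le' (show 2 ≤ k by omega)
    simp only [Consec, List.cons_append, List.nil_append, or_false, Nat.add_sub_cancel] at h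
    rcases h with ⟨rfl, rfl⟩ | ⟨rfl, rfl⟩ | ⟨rfl, rfl⟩
    · exact (SmallFace.B_down₂ (k := k) (by omega) (by omega)).rotate
    · exact SmallFace.B_up₂ (k := k) (by omega) (by omega)
    · exact SmallFace.B_down₂ (k := k + 1) (by omega) (by omega)
  | B_g₄ h₁ =>
    rename_i i j k
    obtain ⟨k, rfl⟩ := Nat.exists_eq_add_of_le' (show 2 ≤ k by omega)
    simp only [Consec, List.cons_append, List.nil_append, or_false, Nat.add_sub_cancel] at h
    rcases h with ⟨rfl, rfl⟩
    · exact (SmallFace.B_down₂ (k := k) (by omega) (by omega)).rotate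

theorem Corner.large_of_consec (hA : Corner x A M ms ls N) (h : Consec B C (M :: ls ++ [N])) :
    LargeFace f g p x B A C := by
  cases hA with
  | L_f₀ h₁ =>
    subst h₁
    simp only [Consec, List.cons_append, List.nil_append, or_false] at h
    rcases h with ⟨rfl, rfl⟩ | ⟨rfl, rfl⟩
    · exact (LargeFace.L_f (k := 0) (by omega)).rotate.rotate
    · exact LargeFace.start.rotate.rotate
  | L_f h₁ h₂ =>
    obtain ⟨k, rfl⟩ := Nat.exists_eq_add_of_le' h₁
    simp only [Consec, List.cons_append, List.nil_append, or_false, Nat.add_sub_cancel] at h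
    rcases h with ⟨rfl, rfl⟩ | ⟨rfl, rfl⟩ | ⟨rfl, rfl⟩
    · exact (LargeFace.L_f (k := k + 1) (by omega)).rotate.rotate
    · exact (LargeFace.L_pf (k := k) (by omega)).rotate
    · exact (LargeFace.L_f (k := k) (by omega)).rotate
  | L_f₁ h₁ =>
    subst h₁
    simp only [Consec, List.cons_append, List.nil_append, or_false] at h
    rcases h with ⟨rfl, rfl⟩ | ⟨rfl, rfl⟩
    · exact LargeFace.L_stop
    · exact (LargeFace.L_f (k := _) (by omega)).rotate
  | L_g₀ h₁ =>
    subst h₁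
    simp only [Consec, List.cons_append, List.nil_append, or_false] at h
    rcases h with ⟨rfl, rfl⟩ | ⟨rfl, rfl⟩
    · exact LargeFace.start
    · exact (LargeFace.L_g (k := 0) (by omega)).rotate.rotate
  | L_g h₁ h₂ =>
    obtain ⟨k, rfl⟩ := Nat.exists_eq_add_of_le' h₁
    simp only [Consec, List.cons_append, List.nil_append, or_false, Nat.add_sub_cancel] at h
    rcases h with ⟨rfl, rfl⟩ | ⟨rfl, rfl⟩ | ⟨rfl, rfl⟩
    · exact LargeFace.L_g (k := k) (by omega)
    · exact LargeFace.L_pg (k := k) (by omega)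
    · exact (LargeFace.L_g (k := k + 1) (by omega)).rotate.rotate
  | L_g₁ h₁ =>
    subst h₁
    simp only [Consec, List.cons_append, List.nil_append, or_false] at h
    rcases h with ⟨rfl, rfl⟩ | ⟨rfl, rfl⟩
    · exact LargeFace.L_g (k := _) (by omega)
    · exact LargeFace.L_stop.rotate.rotate
  | B_f₀ h₁ =>
    subst h₁
    simp only [Consec, List.cons_append, List.nil_append, or_false] at h
    rcases h with ⟨rfl, rfl⟩ | ⟨rfl, rfl⟩
    · exact (LargeFace.B_f₁ (k := 0) (by omega)).rotate.rotate
    · exact LargeFace.start.rotate.rotate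
  | B_f₁ h₁ h₂ =>
    obtain ⟨k, rfl⟩ := Nat.exists_eq_add_of_le' h₁
    simp only [Consec, List.cons_append, List.nil_append, or_false, Nat.add_sub_cancel] at h
    rcases h with ⟨rfl, rfl⟩ | ⟨rfl, rfl⟩ | ⟨rfl, rfl⟩
    · exact (LargeFace.B_f₁ (k := k + 1) (by omega)).rotate.rotate
    · exact (LargeFace.B_pf₁ (k := k) (by omega)).rotate
    · exact (LargeFace.B_f₁ (k := k) (by omega)).rotate
  | B_f₂ h₁ =>
    subst h₁
    simp only [Consec, List.cons_append, List.nil_append, or_false, Nat.add_sub_cancel] at h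
    rcases h with ⟨rfl, rfl⟩ | ⟨rfl, rfl⟩ | ⟨rfl, rfl⟩ | ⟨rfl, rfl⟩
    · exact (LargeFace.B_f₂ (k := _) (by omega) (by omega)).rotate.rotate
    · exact (LargeFace.B_pf₂ (k := _) (by omega) (by omega)).rotate
    · exact (LargeFace.B_pf₁ (k := _) (by omega)).rotate
    · exact (LargeFace.B_f₁ (k := _) (by omega)).rotate
  | B_f₃ h₁ h₂ =>
    rename_i i j k
    obtain ⟨k, rfl⟩ := Nat.exists_eq_add_of_le' (show 1 ≤ k by omega)
    simp only [Consec, List.cons_append, List.nil_append, or_false, Nat.add_sub_cancel] at h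
    rcases h with ⟨rfl, rfl⟩ | ⟨rfl, rfl⟩ | ⟨rfl, rfl⟩
    · exact (LargeFace.B_f₂ (k := k + 1) (by omega) (by omega)).rotate.rotate
    · exact (LargeFace.B_pf₂ (k := k + 1) (by omega) (by omega)).rotate
    · exact (LargeFace.B_f₂ (k := k) (by omega) (by omega)).rotate
  | B_f₄ h₁ =>
    rename_i i j k
    obtain ⟨k, rfl⟩ := Nat.exists_eq_add_of_le' (show 1 ≤ k by omega)
    simp only [Consec, List.cons_append, List.nil_append, or_false, Nat.add_sub_cancel] at h
    rcases h with ⟨rfl, rfl⟩ | ⟨rfl, rfl⟩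
    · obtain rfl : k = i + j + 1 := by omega
      exact LargeFace.B_stop
    · exact (LargeFace.B_f₂ (k := k) (by omega) (by omega)).rotate
  | B_g₀ h₁ =>
    subst h₁
    simp only [Consec, List.cons_append, List.nil_append, or_false] at h
    rcases h with ⟨rfl, rfl⟩ | ⟨rfl, rfl⟩
    · exact LargeFace.start
    · exact (LargeFace.B_g₁ (k := 0) (by omega)).rotate.rotate
  | B_g₁ h₁ h₂ =>
    obtain ⟨k, rfl⟩ := Nat.exists_eq_add_of_le' h₁
    simp only [Consec, List.cons_append, List.nil_append, or_false, Nat.add_sub_cancel] at h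
    rcases h with ⟨rfl, rfl⟩ | ⟨rfl, rfl⟩ | ⟨rfl, rfl⟩
    · exact LargeFace.B_g₁ (k := k) (by omega)
    · exact LargeFace.B_pg₁ (k := k) (by omega)
    · rcases Nat.lt_or_eq_of_le h₂ with h | h
      · exact (LargeFace.B_g₁ (k := k + 1) (by omega)).rotate.rotate
      · obtain rfl := Nat.succ.inj h
        exact LargeFace.B_turn₁.rotate.rotate
  | B_g₂ h₁ =>
    subst h₁
    simp only [Consec, List.cons_append, List.nil_append, or_false] at h
    rcases h with ⟨rfl, rfl⟩ | ⟨rfl, rfl⟩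
    · exact LargeFace.B_turn₁
    · exact LargeFace.B_turn₂.rotate.rotate
  | B_g₃ h₁ h₂ =>
    rename_i i j k
    obtain ⟨k, rfl⟩ := Nat.exists_eq_add_of_le' (show 2 ≤ k by omega)
    simp only [Consec, List.cons_append, List.nil_append, or_false, Nat.add_sub_cancel] at h
    rcases h with ⟨rfl, rfl⟩ | ⟨rfl, rfl⟩ | ⟨rfl, rfl⟩
    · rcases Nat.lt_or_eq_of_le h₁ with h | h
      · obtain ⟨k, rfl⟩ := Nat.exists_eq_add_of_le' (show 1 ≤ k by omega)
        exact LargeFace.B_g₂ (k := k) (by omega) (by omega)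
      · obtain rfl : k = i + 1 := by omega
        exact LargeFace.B_turn₂
    · exact LargeFace.B_pg₂ (k := k) (by omega) (by omega)
    · exact (LargeFace.B_g₂ (k := k) (by omega) (by omega)).rotate.rotate
  | B_g₄ h₁ =>
    rename_i i j k
    obtain ⟨k, rfl⟩ := Nat.exists_eq_add_of_le' (show 2 ≤ k by omega)
    simp only [Consec, List.cons_append, List.nil_append, or_false, Nat.add_sub_cancel] at h
    rcases h with ⟨rfl, rfl⟩ | ⟨rfl, rfl⟩
    · obtain rfl : k = i + j + 2 := by omega
      exact LargeFace.B_g₂ (k := _) (by omega) (by omega)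
    · obtain rfl : k = i + j + 2 := by omega
      exact LargeFace.B_stop.rotate.rotate

end PatchLabel

namespace PatchLabel

variable {x : OpKind} {A B C D M N : PatchLabel} {ms ls : List PatchLabel}

theorem Corner.isBdry_small (hA : Corner x A M ms ls N) (h : B ∈ M :: ms ++ [N]) : B.IsBdry x := by
  cases hA <;> simp only [List.cons_append, List.nil_append, List.mem_cons, List.not_mem_nil,
    or_false] at h <;> rcases h with rfl | rfl | rfl | rfl | rfl <;>
    simp only [IsBdry, OpKind.sizeF, OpKind.sizeG] <;> omega

theorem Corner.isBdry (hA : Corner x A M ms ls N) : A.IsBdry x := by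
  cases hA <;> simp only [IsBdry, OpKind.sizeF, OpKind.sizeG] <;> omega

theorem Corner.isInner_large (hA : Corner x A M ms ls N) (h : B ∈ ls) : B.IsInner x := by
  cases hA <;> simp only [List.mem_cons, List.not_mem_nil, or_false] at h <;>
    rcases h with rfl | rfl | rfl <;> simp only [IsInner, OpKind.length] <;> omega

theorem Corner.nodup_small (hA : Corner x A M ms ls N) : (M :: ms ++ [N]).Nodup := by
  cases hA <;> simp <;> omega

theorem Corner.nodup_large (hA : Corner x A M ms ls N) : ls.Nodup := by
  cases hA <;> simp <;> omega

theorem Corner.ne_nil (hA : Corner x A M ms ls N) : ls ≠ [] := by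
  cases hA <;> simp

/-- Exchanging the patches replaces `ms` by `ls` in the link of a boundary vertex. This keeps the
degree except at the two ends, where a path vertex appears and nothing disappears. -/
theorem Corner.length_eq (hA : Corner x A M ms ls N) (h₁ : A ≠ x.firstEnd f g)
    (h₂ : A ≠ x.lastEnd f g) : ls.length = ms.length := by
  cases hA <;> simp [OpKind.firstEnd, OpKind.lastEnd] at h₁ h₂ ⊢ <;> omega

theorem Corner.of_end (hA : Corner x A M ms ls N)
    (h : A = x.firstEnd f g ∨ A = x.lastEnd f g) : ms = [] ∧ ls.length = 1 := by
  cases hA <;> simp [OpKind.firstEnd, OpKind.lastEnd] at h ⊢ <;> omega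

/-- In the extended patch the ends of a former diagonal have a common neighbour on the path. If they
were also adjacent, the three vertices would form a face, which yields the contradiction in
`IsPatch.not_adj_of_mem`. -/
theorem Corner.exists_common (hA : Corner x A M ms ls N) (h : D ∈ ms) :
    ∃ P ∈ ls, ∃ Y, LargeFace f g p x P D Y ∨ LargeFace f g p x D P Y := by
  cases hA with
  | L_f₀ h₁ | L_g₁ h₁ | B_g₀ h₁ | B_g₄ h₁ => exact (List.not_mem_nil h).elim
  | L_f h₁ h₂ =>
    obtain ⟨k, rfl⟩ := Nat.exists_eq_add_of_le' h₁
    simp only [List.mem_cons, List.not_mem_nil, or_false, Nat.add_sub_cancel] at h ⊢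
    rcases h with rfl | rfl
    · exact ⟨_, Or.inl rfl, _, Or.inl (LargeFace.L_g (by omega)).rotate.rotate⟩
    · exact ⟨_, Or.inr rfl, _, Or.inl (LargeFace.L_g (by omega)).rotate.rotate⟩
  | L_f₁ h₁ =>
    obtain rfl := List.mem_singleton.1 h
    exact ⟨_, List.mem_singleton.2 rfl, _, Or.inl (LargeFace.L_g (by omega)).rotate.rotate⟩
  | L_g₀ h₁ =>
    obtain rfl := List.mem_singleton.1 h
    exact ⟨_, List.mem_singleton.2 rfl, _, Or.inl (LargeFace.L_f (k := 0) (by omega)).rotate⟩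
  | L_g h₁ h₂ =>
    obtain ⟨k, rfl⟩ := Nat.exists_eq_add_of_le' h₁
    simp only [List.mem_cons, List.not_mem_nil, or_false, Nat.add_sub_cancel] at h ⊢
    rcases h with rfl | rfl
    · exact ⟨_, Or.inl rfl, _, Or.inl (LargeFace.L_f (by omega)).rotate⟩
    · exact ⟨_, Or.inr rfl, _, Or.inl (LargeFace.L_f (by omega)).rotate⟩
  | B_f₀ h₁ =>
    obtain rfl := List.mem_singleton.1 h
    exact ⟨_, List.mem_singleton.2 rfl, _, Or.inl (LargeFace.B_pg₁ (k := 0) (by omega))⟩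
  | B_f₁ h₁ h₂ =>
    obtain ⟨k, rfl⟩ := Nat.exists_eq_add_of_le' h₁
    simp only [List.mem_cons, List.not_mem_nil, or_false, Nat.add_sub_cancel] at h ⊢
    rcases h with rfl | rfl
    · exact ⟨_, Or.inl rfl, _, Or.inl (LargeFace.B_pg₁ (by omega))⟩
    · exact ⟨_, Or.inr rfl, _, Or.inl (LargeFace.B_pg₁ (by omega))⟩
  | B_f₂ h₁ =>
    subst h₁
    simp only [List.mem_cons, List.not_mem_nil, or_false, Nat.add_sub_cancel] at h ⊢
    rcases h with rfl | rfl | rfl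
    · exact ⟨_, Or.inl rfl, _, Or.inl (LargeFace.B_g₂ (by omega) (by omega)).rotate.rotate⟩
    · exact ⟨_, Or.inr (Or.inl rfl), _, Or.inl LargeFace.B_turn₂.rotate.rotate⟩
    · exact ⟨_, Or.inr (Or.inr rfl), _, Or.inl (LargeFace.B_pg₁ (by omega))⟩
  | B_f₃ h₁ h₂ =>
    rename_i i j k
    obtain ⟨k, rfl⟩ := Nat.exists_eq_add_of_le' (show 1 ≤ k by omega)
    simp only [List.mem_cons, List.not_mem_nil, or_false] at h ⊢
    rcases h with rfl | rfl
    · exact ⟨_, Or.inl rfl, _, Or.inl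
        (LargeFace.B_g₂ (k := k + 1) (by omega) (by omega)).rotate.rotate⟩
    · exact ⟨_, Or.inr rfl, _, Or.inl (LargeFace.B_g₂ (k := k) (by omega) (by omega)).rotate.rotate⟩
  | B_f₄ h₁ =>
    rename_i i j k
    obtain ⟨k, rfl⟩ := Nat.exists_eq_add_of_le' (show 1 ≤ k by omega)
    obtain rfl := List.mem_singleton.1 h
    exact ⟨_, List.mem_singleton.2 rfl, _,
      Or.inl (LargeFace.B_g₂ (k := k) (by omega) (by omega)).rotate.rotate⟩
  | B_g₁ h₁ h₂ =>
    obtain ⟨k, rfl⟩ := Nat.exists_eq_add_of_le' h₁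
    simp only [List.mem_cons, List.not_mem_nil, or_false, Nat.add_sub_cancel] at h ⊢
    rcases h with rfl | rfl
    · exact ⟨_, Or.inl rfl, _, Or.inr (LargeFace.B_f₁ (by omega))⟩
    · exact ⟨_, Or.inr rfl, _, Or.inl (LargeFace.B_pf₁ (by omega)).rotate⟩
  | B_g₂ h₁ =>
    subst h₁
    obtain rfl := List.mem_singleton.1 h
    exact ⟨_, List.mem_singleton.2 rfl, _, Or.inl (LargeFace.B_pf₁ (by omega)).rotate⟩
  | B_g₃ h₁ h₂ =>
    rename_i i j k
    obtain ⟨k, rfl⟩ := Nat.exists_eq_add_of_le' (show 2 ≤ k by omega)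
    simp only [List.mem_cons, List.not_mem_nil, or_false] at h ⊢
    rcases h with rfl | rfl
    · exact ⟨_, Or.inl rfl, _,
        Or.inr (LargeFace.B_pf₂ (k := k) (by omega) (by omega)).rotate.rotate⟩
    · exact ⟨_, Or.inr rfl, _, Or.inl (LargeFace.B_f₂ (k := k) (by omega) (by omega)).rotate⟩

theorem small_isBdry (h : SmallFace f g x A B C) : A.IsBdry x ∧ B.IsBdry x ∧ C.IsBdry x := by
  induction h with
  | rotate _ ih => exact ⟨ih.2.1, ih.2.2, ih.1⟩
  | _ =>
    simp only [IsBdry, OpKind.sizeF, OpKind.sizeG]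
    omega

theorem large_valid (h : LargeFace f g p x A B C) :
    (A.IsBdry x ∨ A.IsInner x) ∧ (B.IsBdry x ∨ B.IsInner x) ∧ (C.IsBdry x ∨ C.IsInner x) := by
  induction h with
  | rotate _ ih => exact ⟨ih.2.1, ih.2.2, ih.1⟩
  | @start x =>
    cases x <;> simp only [IsBdry, IsInner, OpKind.sizeF, OpKind.sizeG, OpKind.length] <;> omega
  | _ =>
    simp only [IsBdry, IsInner, OpKind.sizeF, OpKind.sizeG, OpKind.length]
    omega

theorem not_isInner (h : A.IsBdry x) : ¬ A.IsInner x := by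
  cases A <;> simp_all [IsBdry, IsInner]

theorem Consec.mem_left {α : Type u} {B C : α} {l : List α} (h : Consec B C l) : B ∈ l := by
  match l, h with
  | x :: y :: l, Or.inl h => simp [h.1]
  | x :: y :: l, Or.inr h => exact List.mem_cons_of_mem _ (Consec.mem_left h)

theorem Consec.mem_right {α : Type u} {B C : α} {l : List α} (h : Consec B C l) : C ∈ l.tail := by
  match l, h with
  | x :: y :: l, Or.inl h => simp [h.2]
  | x :: y :: l, Or.inr h => exact List.mem_of_mem_tail (Consec.mem_right h)

theorem Consec.mem_dropLast {α : Type u} {B C N : α} {l : List α} (h : Consec B C (l ++ [N])) :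
    B ∈ l := by
  match l, h with
  | [x], Or.inl h => simp [h.1]
  | x :: y :: l, Or.inl h => simp [h.1]
  | x :: y :: l, Or.inr h =>
    exact List.mem_cons_of_mem _ (Consec.mem_dropLast (N := N) (l := y :: l) h)

theorem Consec.unique {α : Type u} {B C C' : α} {l : List α} (hl : l.Nodup) (h : Consec B C l)
    (h' : Consec B C' l) : C = C' := by
  match l, h, h' with
  | x :: y :: l, Or.inl h, Or.inl h' => rw [h.2, h'.2]
  | x :: y :: l, Or.inl h, Or.inr h' =>
    exact ((List.nodup_cons.1 hl).1 (h.1 ▸ h'.mem_left)).elim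
  | x :: y :: l, Or.inr h, Or.inl h' =>
    exact ((List.nodup_cons.1 hl).1 (h'.1 ▸ h.mem_left)).elim
  | x :: y :: l, Or.inr h, Or.inr h' => exact Consec.unique (List.nodup_cons.1 hl).2 h h'

theorem exists_consec_left {α : Type u} {B N : α} {l : List α} (h : B ∈ l) :
    ∃ C, Consec B C (l ++ [N]) := by
  induction l with
  | nil => exact (List.not_mem_nil h).elim
  | cons x l ih =>
    rcases List.mem_cons.1 h with rfl | h
    · cases l with
      | nil => exact ⟨N, Or.inl ⟨rfl, rfl⟩⟩
      | cons y l => exact ⟨y, Or.inl ⟨rfl, rfl⟩⟩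
    · obtain ⟨C, hC⟩ := ih h
      refine ⟨C, ?_⟩
      cases l with
      | nil => exact (List.not_mem_nil h).elim
      | cons y l => exact Or.inr hC

theorem exists_consec_right {α : Type u} {C M : α} {l : List α} (h : C ∈ l) :
    ∃ B, Consec B C (M :: l) := by
  induction l generalizing M with
  | nil => exact (List.not_mem_nil h).elim
  | cons x l ih =>
    rcases List.mem_cons.1 h with rfl | h
    · exact ⟨M, Or.inl ⟨rfl, rfl⟩⟩
    · obtain ⟨B, hB⟩ := ih (M := x) h
      exact ⟨B, Or.inr hB⟩

theorem reflTransGen_consec {α : Type u} {C M : α} {l : List α} (h : C ∈ M :: l) :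
    Relation.ReflTransGen (fun B C => Consec B C (M :: l)) M C := by
  induction l generalizing M with
  | nil => rw [List.mem_singleton.1 h]
  | cons x l ih =>
    rcases List.mem_cons.1 h with rfl | h
    · exact .refl
    · refine Relation.ReflTransGen.head (b := x) (Or.inl ⟨rfl, rfl⟩) ?_
      exact Relation.ReflTransGen.mono (fun _ _ h => Or.inr h) _ _ (ih h)

end PatchLabel

/-! ### Dual fullerenes from systems of oriented triangles. -/

namespace DualFullerene

/-- The oriented triangles of a triangulation of a closed surface. -/
structure IsTriangleSystem {V : Type u} (T : V → V → V → Prop) : Prop where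
  rotate : ∀ {a b c}, T a b c → T b c a
  unique : ∀ {a b c c'}, T a b c → T a b c' → c = c'
  symm : ∀ {a b c}, T a b c → ∃ c', T b a c'
  ne : ∀ {a b c}, T a b c → a ≠ b
  link : ∀ v, ∃ m, ∀ w, (∃ c, T w v c) → Relation.ReflTransGen (fun a b => T a v b) m w
  connected : ∀ u v, Relation.ReflTransGen (fun a b => ∃ c, T a b c) u v

namespace IsTriangleSystem

variable {V : Type u} {T : V → V → V → Prop} (hT : IsTriangleSystem T)
include hT

theorem nbr_of {a v b : V} (h : T a v b) : ∃ c, T b v c := hT.symm (hT.rotate h)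

/-- The successor map on the finitely many neighbours of `v` is injective, so all its orbits are
periodic. Hence from `w` one comes back to the distinguished neighbour `m`, and from there to `w'`.
-/
theorem link_symm [Finite V] {v w w' : V} (h : ∃ c, T w v c) (h' : ∃ c, T w' v c) :
    Relation.ReflTransGen (fun a b => T a v b) w w' := by
  obtain ⟨m, hm⟩ := hT.link v
  refine Relation.ReflTransGen.trans (b := m) ?_ (hm w' h')
  have hmn : ∃ c, T m v c := by
    rcases (Relation.ReflTransGen.cases_head (hm w h)) with rfl | ⟨c, hc, -⟩
    · exact h
    · exact ⟨c, hc⟩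
  let f : {w // ∃ c, T w v c} → {w // ∃ c, T w v c} := fun w =>
    ⟨w.2.choose, hT.nbr_of w.2.choose_spec⟩
  have hf : ∀ w, T w.1 v (f w).1 := fun w => w.2.choose_spec
  have hinj : Function.Injective f := by
    intro a b hab
    have h1 := hT.rotate (hf a)
    have h2 := hT.rotate (hf b)
    rw [← hab] at h2
    exact Subtype.ext (hT.unique h1 h2)
  have key : ∀ w, Relation.ReflTransGen (fun a b => T a v b) m w → ∀ h : ∃ c, T w v c,
      ∃ k, f^[k] ⟨m, hmn⟩ = ⟨w, h⟩ := by
    intro w hw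
    induction hw with
    | refl => exact fun _ => ⟨0, rfl⟩
    | tail _ h1 ih =>
      intro h
      obtain ⟨k, hk⟩ := ih ⟨_, h1⟩
      refine ⟨k + 1, ?_⟩
      rw [Function.iterate_succ_apply', hk]
      exact Subtype.ext (hT.unique (hf _) h1)
  obtain ⟨k, hk⟩ := key w (hm w h) h
  obtain ⟨n, hn, hp⟩ := hinj.mem_periodicPts (⟨m, hmn⟩ : {w // ∃ c, T w v c})
  have hiter : ∀ (j : ℕ) (z : {w // ∃ c, T w v c}),
      Relation.ReflTransGen (fun a b => T a v b) z.1 (f^[j] z).1 := by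
    intro j z
    induction j with
    | zero => exact .refl
    | succ j ih => rw [Function.iterate_succ_apply']; exact ih.tail (hf _)
  have hback : f^[n * k - k] ⟨w, h⟩ = ⟨m, hmn⟩ := by
    rw [← hk, ← Function.iterate_add_apply, Nat.sub_add_cancel (Nat.le_mul_of_pos_left k hn)]
    exact (hp.mul_const k)
  have := hiter (n * k - k) ⟨w, h⟩
  rwa [hback] at this

theorem mirror [Finite V] : IsTriangleSystem fun a b c => T a c b where
  rotate h := hT.rotate (hT.rotate h)
  unique h h' := hT.unique (hT.rotate (hT.rotate h)) (hT.rotate (hT.rotate h'))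
  symm h := by
    obtain ⟨c, hc⟩ := hT.symm (hT.rotate (hT.rotate h))
    exact ⟨c, hT.rotate hc⟩
  ne h := (hT.ne (hT.rotate (hT.rotate h))).symm
  link v := by
    by_cases hv : ∃ m c, T m v c
    · obtain ⟨m, hm⟩ := hv
      refine ⟨m, fun w ⟨c, hc⟩ => ?_⟩
      obtain ⟨c, hc⟩ := hT.symm (hT.rotate (hT.rotate hc))
      have h := hT.link_symm ⟨c, hc⟩ hm
      rw [← Relation.reflTransGen_swap] at h
      refine Relation.ReflTransGen.mono (fun a b h => ?_) _ _ h
      exact hT.rotate (hT.rotate h)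
    · refine ⟨v, fun w ⟨c, hc⟩ => (hv ?_).elim⟩
      exact ⟨c, _, hT.rotate hc⟩
  connected u v := by
    refine Relation.ReflTransGen.mono (fun a b h => ?_) _ _ (hT.connected u v)
    obtain ⟨c, hc⟩ := h
    obtain ⟨c', hc'⟩ := hT.symm hc
    exact ⟨c', hT.rotate hc'⟩

/-- The rotation at `v` sends `w` to the third vertex of the triangle on the directed edge `w v`.
Planarity is not shown geometrically: it follows from the count of 5-vertices by `isPlane_iff`. -/
theorem exists_dualFullerene_aux [Finite V] [Nonempty V]
    (hdeg : ∀ v, {w | ∃ c, T v w c}.ncard = 5 ∨ {w | ∃ c, T v w c}.ncard = 6)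
    (hcount : {v | {w | ∃ c, T v w c}.ncard = 5}.ncard = 12) :
    ∃ G : DualFullerene V, ∀ a b c, G.IsFaceDir true a b c ↔ T a b c := by
  classical
  let gr : SimpleGraph V :=
    { Adj := fun v w => ∃ c, T v w c
      symm := ⟨fun v w ⟨c, hc⟩ => hT.symm hc⟩
      loopless := ⟨fun v ⟨c, hc⟩ => hT.ne hc rfl⟩ }
  have hadj : ∀ {v w}, gr.Adj v w → ∃ c, T w v c := fun h => h.symm
  let rot : V → V → V := fun v w => if h : ∃ c, T w v c then h.choose else w
  have hrot : ∀ {v w}, gr.Adj v w → T w v (rot v w) := by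
    intro v w h
    simp only [rot, dif_pos (hadj h)]
    exact (hadj h).choose_spec
  let M : RotationSystem V :=
    { graph := gr
      finite := inferInstance
      connected := by
        refine { preconnected := fun u v => ?_ }
        rw [SimpleGraph.reachable_iff_reflTransGen]
        exact hT.connected u v
      rot := rot
      rot_adj := fun h => ⟨_, hT.rotate (hrot h)⟩
      rot_cyclic := by
        intro v w w' h h'
        have := hT.link_symm (hadj h) (hadj h')
        clear h'
        induction this with
        | refl => exact ⟨0, rfl⟩
        | tail _ h1 ih =>
          obtain ⟨k, hk⟩ := ih
          refine ⟨k + 1, ?_⟩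
          rw [Function.iterate_succ_apply', hk]
          exact hT.unique (hrot (hT.symm h1)) h1 }
  have hface : ∀ a b c, (gr.Adj a b ∧ rot b a = c) ↔ T a b c := by
    intro a b c
    constructor
    · rintro ⟨h, rfl⟩
      exact hrot h.symm
    · intro h
      exact ⟨⟨c, h⟩, hT.unique (hrot (hT.symm h)) h⟩
  have htri : M.IsTriangulation := by
    rintro ⟨⟨a, b⟩, h⟩
    have h1 := hrot h.symm
    have h2 := (hface _ _ _).2 (hT.rotate h1)
    have h3 := (hface _ _ _).2 (hT.rotate (hT.rotate h1))
    have e2 : rot (rot b a) b = a := h2.2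
    have e3 : rot a (rot b a) = b := h3.2
    apply SimpleGraph.Dart.ext
    simp only [RotationSystem.faceNext, Function.iterate_succ_apply, Function.iterate_zero, id, M,
      e2, e3]
  refine ⟨{ toRotationSystem := M, plane := (M.isPlane_iff htri hdeg).2 hcount,
            triangulation := htri, degree_eq := hdeg }, fun a b c => hface a b c⟩

theorem exists_dualFullerene [Finite V] [Nonempty V] (d : Bool)
    (hdeg : ∀ v, {w | ∃ c, T v w c}.ncard = 5 ∨ {w | ∃ c, T v w c}.ncard = 6)
    (hcount : {v | {w | ∃ c, T v w c}.ncard = 5}.ncard = 12) :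
    ∃ G : DualFullerene V, ∀ a b c, G.IsFaceDir d a b c ↔ T a b c := by
  cases d
  · have h : ∀ v, {w | ∃ c, T v c w} = {w | ∃ c, T v w c} := by
      intro v
      ext w
      constructor
      · rintro ⟨c, hc⟩
        exact hT.symm (hT.rotate (hT.rotate hc))
      · rintro ⟨c, hc⟩
        obtain ⟨c', hc'⟩ := hT.symm hc
        exact ⟨c', hT.rotate hc'⟩
    obtain ⟨G, hG⟩ := hT.mirror.exists_dualFullerene_aux (by simpa only [h] using hdeg)
      (by simpa only [h] using hcount)
    exact ⟨G, fun a b c => hG a c b⟩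
  · exact hT.exists_dualFullerene_aux hdeg hcount

end IsTriangleSystem

end DualFullerene

/-! ### From an embedded extended patch to a reduction. -/

open PatchLabel


/-- The links of the inner vertices of the extended patch. -/
theorem LargeFace.exists_link {α : Type u} (f g p : ℕ → α) {x : OpKind} {k : ℕ}
    (hk : k ≤ x.length) :
    ((k = 0 ∨ k = x.length) ∧ ∃ a b c e h, LargeFace f g p x a (p k) b ∧
      LargeFace f g p x b (p k) c ∧ LargeFace f g p x c (p k) e ∧ LargeFace f g p x e (p k) h ∧
      LargeFace f g p x h (p k) a) ∨
    ((0 < k ∧ k < x.length) ∧ ∃ a b c e h l, LargeFace f g p x a (p k) b ∧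
      LargeFace f g p x b (p k) c ∧ LargeFace f g p x c (p k) e ∧ LargeFace f g p x e (p k) h ∧
      LargeFace f g p x h (p k) l ∧ LargeFace f g p x l (p k) a) := by
  cases x with
  | L i =>
    have hk : k ≤ i + 1 := hk
    rcases (by omega : k = 0 ∨ (0 < k ∧ k < i + 1) ∨ k = i + 1) with rfl | h | rfl
    · exact Or.inl ⟨Or.inl rfl, g 0, f 0, f 1, p 1, g 1, LargeFace.start.rotate,
        .L_f (k := 0) (by omega), (LargeFace.L_pf (k := 0) (by omega)).rotate.rotate,
        (LargeFace.L_pg (k := 0) (by omega)).rotate.rotate,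
        (LargeFace.L_g (k := 0) (by omega)).rotate⟩
    · obtain ⟨l, rfl⟩ := Nat.exists_eq_add_of_le' h.1
      exact Or.inr ⟨h, f (l + 1), f (l + 2), p (l + 2), g (l + 2), g (l + 1), p l,
        .L_f (k := l + 1) (by omega),
        (LargeFace.L_pf (k := l + 1) (by omega)).rotate.rotate,
        (LargeFace.L_pg (k := l + 1) (by omega)).rotate.rotate,
        (LargeFace.L_g (k := l + 1) (by omega)).rotate, (LargeFace.L_pg (k := l) (by omega)).rotate,
        .L_pf (k := l) (by omega)⟩
    · exact Or.inl ⟨Or.inr rfl, f (i + 1), f (i + 2), g (i + 2), g (i + 1), p i, .L_f (by omega),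
        LargeFace.L_stop.rotate, (LargeFace.L_g (k := i + 1) (by omega)).rotate,
        (LargeFace.L_pg (k := i) (by omega)).rotate, .L_pf (k := i) (by omega)⟩
  | B i j =>
    have hk : k ≤ i + j + 2 := hk
    rcases (by omega : k = 0 ∨ (0 < k ∧ k ≤ i) ∨ k = i + 1 ∨ (i + 1 < k ∧ k < i + j + 2) ∨
      k = i + j + 2) with rfl | h | rfl | h | rfl
    · exact Or.inl ⟨Or.inl rfl, g 0, f 0, f 1, p 1, g 1, LargeFace.start.rotate,
        .B_f₁ (k := 0) (by omega), (LargeFace.B_pf₁ (k := 0) (by omega)).rotate.rotate,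
        (LargeFace.B_pg₁ (k := 0) (by omega)).rotate.rotate,
        (LargeFace.B_g₁ (k := 0) (by omega)).rotate⟩
    · obtain ⟨l, rfl⟩ := Nat.exists_eq_add_of_le' h.1
      exact Or.inr ⟨⟨h.1, by simp only [OpKind.length]; omega⟩,
        f (l + 1), f (l + 2), p (l + 2), g (l + 2), g (l + 1), p l,
        .B_f₁ (k := l + 1) (by omega),
        (LargeFace.B_pf₁ (k := l + 1) (by omega)).rotate.rotate,
        (LargeFace.B_pg₁ (k := l + 1) (by omega)).rotate.rotate,
        (LargeFace.B_g₁ (k := l + 1) (by omega)).rotate,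
        (LargeFace.B_pg₁ (k := l) (by omega)).rotate, .B_pf₁ (k := l) (by omega)⟩
    · exact Or.inr ⟨⟨by omega, by simp only [OpKind.length]; omega⟩,
        p i, f (i + 1), p (i + 2), g (i + 3), g (i + 2), g (i + 1), .B_pf₁ (k := i) (by omega),
        (LargeFace.B_pf₂ (k := i + 1) (by omega) (by omega)).rotate.rotate,
        (LargeFace.B_pg₂ (k := i + 1) (by omega) (by omega)).rotate.rotate,
        LargeFace.B_turn₂.rotate, LargeFace.B_turn₁.rotate,
        (LargeFace.B_pg₁ (k := i) (by omega)).rotate⟩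
    · obtain ⟨l, rfl⟩ := Nat.exists_eq_add_of_le' (show 1 ≤ k by omega)
      exact Or.inr ⟨⟨by omega, by simp only [OpKind.length]; omega⟩,
        f l, f (l + 1), p (l + 2), g (l + 3), g (l + 2), p l,
        .B_f₂ (k := l) (by omega) (by omega),
        (LargeFace.B_pf₂ (k := l + 1) (by omega) (by omega)).rotate.rotate,
        (LargeFace.B_pg₂ (k := l + 1) (by omega) (by omega)).rotate.rotate,
        (LargeFace.B_g₂ (k := l) (by omega) (by omega)).rotate,
        (LargeFace.B_pg₂ (k := l) (by omega) (by omega)).rotate,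
        .B_pf₂ (k := l) (by omega) (by omega)⟩
    · exact Or.inl ⟨Or.inr rfl, f (i + j + 1), f (i + j + 2), g (i + j + 4), g (i + j + 3),
        p (i + j + 1), .B_f₂ (by omega) (by omega), LargeFace.B_stop.rotate,
        (LargeFace.B_g₂ (k := i + j + 1) (by omega) (by omega)).rotate,
        (LargeFace.B_pg₂ (k := i + j + 1) (by omega) (by omega)).rotate,
        .B_pf₂ (k := i + j + 1) (by omega) (by omega)⟩

namespace PatchLabel

theorem small_ne {x : OpKind} {A B C : PatchLabel} (h : SmallFace f g x A B C) : A ≠ B := by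
  have : A ≠ B ∧ B ≠ C ∧ C ≠ A := by
    induction h with
    | rotate _ ih => exact ⟨ih.2.1, ih.2.2, ih.1⟩
    | _ => simp
  exact this.1

theorem small_connected {x : OpKind} {A : PatchLabel} (h : A.IsBdry x) :
    Relation.ReflTransGen (fun A B => ∃ C,
      SmallFace f g x A B C ∨ SmallFace f g x B A C) (g 0) A := by
  cases x with
  | L i =>
    have hg : ∀ k, k < i + 3 → Relation.ReflTransGen (fun A B => ∃ C,
        SmallFace f g (.L i) A B C ∨ SmallFace f g (.L i) B A C) (g 0) (g k) := by
      intro k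
      induction k with
      | zero => exact fun _ => .refl
      | succ k ih =>
        intro hk
        exact (ih (by omega)).tail ⟨_, Or.inl (.L_down (by omega))⟩
    cases A with
    | f k =>
      have h : k < i + 3 := h
      rcases Nat.eq_zero_or_pos k with rfl | hk
      · exact (hg 0 (by omega)).tail ⟨_, Or.inr (.L_up (by omega))⟩
      · obtain ⟨k, rfl⟩ := Nat.exists_eq_add_of_le' hk
        exact (hg k (by omega)).tail ⟨_, Or.inl (SmallFace.L_up (by omega)).rotate⟩
    | g k => exact hg k h
    | p k => exact h.elim
  | B i j =>
    have hg : ∀ k, k < i + j + 5 → Relation.ReflTransGen (fun A B => ∃ C,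
        SmallFace f g (.B i j) A B C ∨ SmallFace f g (.B i j) B A C) (g 0) (g k) := by
      intro k
      induction k with
      | zero => exact fun _ => .refl
      | succ k ih =>
        intro hk
        refine (ih (by omega)).tail ?_
        by_cases h1 : k ≤ i + 1
        · exact ⟨_, Or.inl (SmallFace.B_down₁ h1).rotate⟩
        · obtain ⟨k, rfl⟩ := Nat.exists_eq_add_of_le' (show 1 ≤ k by omega)
          exact ⟨_, Or.inl (SmallFace.B_down₂ (k := k) (by omega) (by omega)).rotate⟩
    cases A with
    | f k =>
      have h : k < i + j + 3 := h
      by_cases h1 : k ≤ i + 1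
      · exact (hg k (by omega)).tail ⟨_, Or.inr (.B_down₁ h1)⟩
      · exact (hg (k + 1) (by omega)).tail ⟨_, Or.inr (.B_down₂ (by omega) (by omega))⟩
    | g k => exact hg k h
    | p k => exact h.elim

end PatchLabel

namespace DualFullerene

variable {W : Type u} {G : DualFullerene W} {d : Bool} {x : OpKind} {f g p : ℕ → W}
  {a b c v w w' : W}

theorem Cyc5.face_cases {e h : W} (hc : Cyc5 G d v a b c e h) (hw : G.IsFaceDir d w v w') :
    (w = a ∧ w' = b) ∨ (w = b ∧ w' = c) ∨ (w = c ∧ w' = e) ∨ (w = e ∧ w' = h) ∨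
      (w = h ∧ w' = a) := by
  rcases hc.mem hw.adj.symm with rfl | rfl | rfl | rfl | rfl
  · simp [hw.unique hc.f₁]
  · simp [hw.unique hc.f₂]
  · simp [hw.unique hc.f₃]
  · simp [hw.unique hc.f₄]
  · simp [hw.unique hc.f₅]

theorem Cyc6.face_cases {e h l : W} (hc : Cyc6 G d v a b c e h l) (hw : G.IsFaceDir d w v w') :
    (w = a ∧ w' = b) ∨ (w = b ∧ w' = c) ∨ (w = c ∧ w' = e) ∨ (w = e ∧ w' = h) ∨
      (w = h ∧ w' = l) ∨ (w = l ∧ w' = a) := by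
  rcases hc.mem hw.adj.symm with rfl | rfl | rfl | rfl | rfl | rfl
  · simp [hw.unique hc.f₁]
  · simp [hw.unique hc.f₂]
  · simp [hw.unique hc.f₃]
  · simp [hw.unique hc.f₄]
  · simp [hw.unique hc.f₅]
  · simp [hw.unique hc.f₆]

theorem adj_iff_exists_face (d : Bool) : G.graph.Adj v w ↔ ∃ c, G.IsFaceDir d v w c :=
  ⟨exists_isFaceDir d, fun ⟨_, h⟩ => h.adj⟩

/-- The extended patch of an operation occurs in `G`. -/
structure IsPatch (G : DualFullerene W) (d : Bool) (x : OpKind) (f g p : ℕ → W) : Prop where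
  f_injOn : Set.InjOn f {k | k < x.sizeF}
  g_injOn : Set.InjOn g {k | k < x.sizeG}
  f_ne_g : ∀ k l, k < x.sizeF → l < x.sizeG → f k ≠ g l
  p_injOn : Set.InjOn p {k | k ≤ x.length}
  p_ne_f : ∀ k l, k ≤ x.length → l < x.sizeF → p k ≠ f l
  p_ne_g : ∀ k l, k ≤ x.length → l < x.sizeG → p k ≠ g l
  face : ∀ a b c, LargeFace f g p x a b c → G.IsFaceDir d a b c

namespace IsPatch

variable (hP : IsPatch G d x f g p) {A B C D M N : PatchLabel} {ms ls : List PatchLabel}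
include hP

theorem val_inj (hA : A.IsBdry x ∨ A.IsInner x) (hB : B.IsBdry x ∨ B.IsInner x)
    (h : A.val f g p = B.val f g p) : A = B := by
  cases A with
  | f k =>
    have hA : k < x.sizeF := hA.elim id False.elim
    cases B with
    | f l => rw [hP.f_injOn hA (hB.elim id False.elim) h]
    | g l => exact (hP.f_ne_g k l hA (hB.elim id False.elim) h).elim
    | p l => exact (hP.p_ne_f l k (hB.elim False.elim id) hA h.symm).elim
  | g k =>
    have hA : k < x.sizeG := hA.elim id False.elim
    cases B with
    | f l => exact (hP.f_ne_g l k (hB.elim id False.elim) hA h.symm).elim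
    | g l => rw [hP.g_injOn hA (hB.elim id False.elim) h]
    | p l => exact (hP.p_ne_g l k (hB.elim False.elim id) hA h.symm).elim
  | p k =>
    have hA : k ≤ x.length := hA.elim False.elim id
    cases B with
    | f l => exact (hP.p_ne_f k l hA (hB.elim id False.elim) h).elim
    | g l => exact (hP.p_ne_g k l hA (hB.elim id False.elim) h).elim
    | p l => rw [hP.p_injOn hA (hB.elim False.elim id) h]

theorem not_inner_val (hA : A.IsBdry x) : ¬ ∃ k ≤ x.length, p k = A.val f g p := by
  rintro ⟨k, hk, h⟩
  have := hP.val_inj (A := .p k) (Or.inr hk) (Or.inl hA) h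
  subst this
  exact hA

/-- The triangles of the patch at `p k` already close up to a cycle of five or six, which is the
whole link, so there is no other face at `p k`. -/
theorem large_of_face {k : ℕ} (hk : k ≤ x.length) (h : G.IsFaceDir d w (p k) w') :
    LargeFace f g p x w (p k) w' := by
  rcases LargeFace.exists_link f g p hk with ⟨-, a, b, c, e, r, h1, h2, h3, h4, h5⟩ |
    ⟨-, a, b, c, e, r, s, h1, h2, h3, h4, h5, h6⟩
  · have hc : Cyc5 G d (p k) a b c e r :=
      ⟨hP.face _ _ _ h1, hP.face _ _ _ h2, hP.face _ _ _ h3, hP.face _ _ _ h4, hP.face _ _ _ h5⟩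
    rcases hc.face_cases h with ⟨rfl, rfl⟩ | ⟨rfl, rfl⟩ | ⟨rfl, rfl⟩ | ⟨rfl, rfl⟩ | ⟨rfl, rfl⟩ <;>
      assumption
  · have hc : Cyc6 G d (p k) a b c e r s :=
      ⟨hP.face _ _ _ h1, hP.face _ _ _ h2, hP.face _ _ _ h3, hP.face _ _ _ h4, hP.face _ _ _ h5,
        hP.face _ _ _ h6⟩
    rcases hc.face_cases h with ⟨rfl, rfl⟩ | ⟨rfl, rfl⟩ | ⟨rfl, rfl⟩ | ⟨rfl, rfl⟩ | ⟨rfl, rfl⟩ |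
      ⟨rfl, rfl⟩ <;> assumption

theorem large_of_face' (hw : ∃ k ≤ x.length, p k = a ∨ p k = b ∨ p k = c)
    (h : G.IsFaceDir d a b c) : LargeFace f g p x a b c := by
  obtain ⟨k, hk, rfl | rfl | rfl⟩ := hw
  · exact (hP.large_of_face hk h.rotate₂).rotate
  · exact hP.large_of_face hk h
  · exact (hP.large_of_face hk h.rotate).rotate.rotate

theorem degree_end {k : ℕ} (hk : k = 0 ∨ k = x.length) : G.degree (p k) = 5 := by
  rcases LargeFace.exists_link f g p (x := x) (k := k) (by omega) with
    ⟨-, a, b, c, e, r, h1, h2, h3, h4, h5⟩ | ⟨h, -⟩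
  · exact Cyc5.degree ⟨hP.face _ _ _ h1, hP.face _ _ _ h2, hP.face _ _ _ h3, hP.face _ _ _ h4,
      hP.face _ _ _ h5⟩
  · omega

theorem degree_inner {k : ℕ} (hk : 0 < k) (hk' : k < x.length) : G.degree (p k) = 6 := by
  rcases LargeFace.exists_link f g p (x := x) (k := k) (by omega) with
    ⟨h, -⟩ | ⟨-, a, b, c, e, r, s, h1, h2, h3, h4, h5, h6⟩
  · omega
  · exact Cyc6.degree ⟨hP.face _ _ _ h1, hP.face _ _ _ h2, hP.face _ _ _ h3, hP.face _ _ _ h4,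
      hP.face _ _ _ h5, hP.face _ _ _ h6⟩

theorem exists_labels_large (h : LargeFace f g p x a b c) :
    ∃ A B C, LargeFace PatchLabel.f PatchLabel.g PatchLabel.p x A B C ∧ A.val f g p = a ∧
      B.val f g p = b ∧ C.val f g p = c :=
  LargeFace.exists_of_map (PatchLabel.val f g p) h

theorem exists_labels_small (h : SmallFace f g x a b c) :
    ∃ A B C, SmallFace PatchLabel.f PatchLabel.g x A B C ∧ A.val f g p = a ∧ B.val f g p = b ∧
      C.val f g p = c :=
  SmallFace.exists_of_map (PatchLabel.val f g p) h

theorem face_val (h : LargeFace PatchLabel.f PatchLabel.g PatchLabel.p x A B C) :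
    G.IsFaceDir d (A.val f g p) (B.val f g p) (C.val f g p) :=
  hP.face _ _ _ (h.map (PatchLabel.val f g p))

theorem consec_of_small (hA : Corner x A M ms ls N) (h : SmallFace f g x b (A.val f g p) c) :
    ∃ B C, Consec B C (M :: ms ++ [N]) ∧ B.val f g p = b ∧ C.val f g p = c := by
  obtain ⟨B, A', C, h', h1, h2, h3⟩ := hP.exists_labels_small h
  obtain rfl := hP.val_inj (Or.inl (small_isBdry h').2.1) (Or.inl hA.isBdry) h2
  exact ⟨B, C, hA.consec_small h', h1, h3⟩

theorem consec_of_large (hA : Corner x A M ms ls N) (h : LargeFace f g p x b (A.val f g p) c) :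
    ∃ B C, Consec B C (M :: ls ++ [N]) ∧ B.val f g p = b ∧ C.val f g p = c := by
  obtain ⟨B, A', C, h', h1, h2, h3⟩ := hP.exists_labels_large h
  obtain rfl := hP.val_inj (large_valid h').2.1 (Or.inl hA.isBdry) h2
  exact ⟨B, C, hA.consec_large h', h1, h3⟩

theorem small_of_consec (hA : Corner x A M ms ls N) (h : Consec B C (M :: ms ++ [N])) :
    SmallFace f g x (B.val f g p) (A.val f g p) (C.val f g p) :=
  (hA.small_of_consec h).map (PatchLabel.val f g p)

theorem face_of_consec (hA : Corner x A M ms ls N) (h : Consec B C (M :: ls ++ [N])) :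
    G.IsFaceDir d (B.val f g p) (A.val f g p) (C.val f g p) :=
  hP.face_val (hA.large_of_consec h)

/-- The face that follows the predecessor `M` of a boundary vertex. -/
theorem exists_face_pred (hA : Corner x A M ms ls N) :
    ∃ k ≤ x.length, G.IsFaceDir d (M.val f g p) (A.val f g p) (p k) := by
  obtain ⟨P, ls', rfl⟩ := List.exists_cons_of_ne_nil hA.ne_nil
  have h := hP.face_of_consec hA (B := M) (C := P) (Or.inl ⟨rfl, rfl⟩)
  have hi := hA.isInner_large (B := P) (by simp)
  cases P with
  | f k => exact hi.elim
  | g k => exact hi.elim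
  | p k => exact ⟨k, hi, h⟩

theorem exists_face_succ (hA : Corner x A M ms ls N) :
    ∃ k ≤ x.length, G.IsFaceDir d (p k) (A.val f g p) (N.val f g p) := by
  obtain ⟨B, hB⟩ := exists_consec_right (C := N) (M := M) (l := ls ++ [N]) (by simp)
  have h := hP.face_of_consec hA hB
  have h2 : B ∈ M :: ls := hB.mem_dropLast (l := M :: ls)
  have hne : B ≠ M := by
    rintro rfl
    obtain ⟨P, ls', rfl⟩ := List.exists_cons_of_ne_nil hA.ne_nil
    have h3 : Consec B P (B :: (P :: ls') ++ [N]) := Or.inl ⟨rfl, rfl⟩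
    have hN := hA.isBdry_small (B := N) (by simp)
    have h4 := (hP.face_of_consec hA h3).unique h
    have := hP.val_inj (Or.inr (hA.isInner_large (B := P) (by simp))) (Or.inl hN) h4
    subst this
    exact not_isInner hN (hA.isInner_large (by simp))
  have hi := hA.isInner_large (B := B) ((List.mem_cons.1 h2).resolve_left hne)
  cases B with
  | f k => exact hi.elim
  | g k => exact hi.elim
  | p k => exact ⟨k, hi, h⟩

/-- A boundary vertex followed by an inner vertex is the predecessor. -/
theorem eq_pred (hA : Corner x A M ms ls N) {k : ℕ} (hk : k ≤ x.length) (hB : B.IsBdry x)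
    (h : G.IsFaceDir d (B.val f g p) (A.val f g p) (p k)) : B = M := by
  obtain ⟨B', C, hc, h1, h2⟩ := hP.consec_of_large hA
    (hP.large_of_face' ⟨k, hk, Or.inr (Or.inr rfl)⟩ h)
  have hm : B' ∈ M :: ls := hc.mem_dropLast (l := M :: ls)
  rcases List.mem_cons.1 hm with rfl | hm
  · exact hP.val_inj (Or.inl hB) (Or.inl (hA.isBdry_small (by simp))) h1.symm
  · have := hP.val_inj (Or.inl hB) (Or.inr (hA.isInner_large hm)) h1.symm
    subst this
    exact (not_isInner hB (hA.isInner_large hm)).elim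

theorem eq_succ (hA : Corner x A M ms ls N) {k : ℕ} (hk : k ≤ x.length) (hB : B.IsBdry x)
    (h : G.IsFaceDir d (p k) (A.val f g p) (B.val f g p)) : B = N := by
  obtain ⟨B', C, hc, h1, h2⟩ := hP.consec_of_large hA
    (hP.large_of_face' ⟨k, hk, Or.inl rfl⟩ h)
  have hm : C ∈ ls ++ [N] := hc.mem_right
  rcases List.mem_append.1 hm with hm | hm
  · have := hP.val_inj (Or.inl hB) (Or.inr (hA.isInner_large hm)) h2.symm
    subst this
    exact (not_isInner hB (hA.isInner_large hm)).elim
  · rw [List.mem_singleton.1 hm] at h2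
    exact hP.val_inj (Or.inl hB) (Or.inl (hA.isBdry_small (by simp))) h2.symm

omit hP in
theorem pred_ne_succ (hA : Corner x A M ms ls N) : M ≠ N := by
  have := hA.nodup_small
  rintro rfl
  simp at this

omit hP in
theorem mem_ms_symm (hA : Corner x A M ms ls N) (hD : D ∈ ms) {M' N' : PatchLabel}
    {ms' ls' : List PatchLabel} (hA' : Corner x D M' ms' ls' N') : A ∈ ms' := by
  obtain ⟨X, hX⟩ := exists_consec_right (C := D) (M := M) (l := ms ++ [N]) (by simp [hD])
  obtain ⟨Y, hY⟩ := exists_consec_left (B := D) (N := N) (l := M :: ms) (by simp [hD])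
  have h1 := hA'.consec_small ((hA.small_of_consec hX).rotate.rotate.rotate.rotate)
  have h2 := hA'.consec_small ((hA.small_of_consec hY).rotate.rotate)
  have h3 : A ∈ M' :: ms' := Consec.mem_dropLast (l := M' :: ms') h1
  have h4 : A ∈ ms' ++ [N'] := h2.mem_right
  have hn := hA'.nodup_small
  rcases List.mem_cons.1 h3 with rfl | h3
  · exact ((List.nodup_cons.1 (by simpa using hn : (A :: (ms' ++ [N'])).Nodup)).1 h4).elim
  · exact h3

/-- The ends of a diagonal of the initial patch are not adjacent in `G`. -/
theorem not_adj_of_mem (hA : Corner x A M ms ls N) (hD : D ∈ ms) :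
    ¬ G.graph.Adj (A.val f g p) (D.val f g p) := by
  intro hadj
  have hDb : D.IsBdry x := hA.isBdry_small (by simp [hD])
  obtain ⟨M', ms', ls', N', hA'⟩ := exists_corner hDb
  have hms := mem_ms_symm hA hD hA'
  have hn := hA'.nodup_small
  obtain ⟨P, hP1, Y, hY⟩ := hA.exists_common hD
  have hPi := hA.isInner_large hP1
  obtain ⟨k, hk, rfl⟩ : ∃ k ≤ x.length, P = .p k := by
    cases P with
    | f k => exact hPi.elim
    | g k => exact hPi.elim
    | p k => exact ⟨k, hPi, rfl⟩
  have hPD : G.graph.Adj (p k) (D.val f g p) := by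
    rcases hY with hY | hY
    · exact (hP.face_val hY).adj
    · exact (hP.face_val hY).adj.symm
  obtain ⟨Z, hZ⟩ := exists_consec_left (B := PatchLabel.p k) (N := N) (l := M :: ls) (by simp [hP1])
  have hAP : G.graph.Adj (p k) (A.val f g p) := (hP.face_of_consec hA hZ).adj
  -- Triangles do not separate, so `A`, `D` and the path vertex would form a face. Then `A` would be
  -- one of the two boundary neighbours of `D`, while a diagonal puts it strictly between them.
  rcases face_of_adj d hAP hadj hPD.symm with h | h
  · have := hP.eq_pred hA' hk hA.isBdry h.rotate
    subst this
    simp [hms] at hn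
  · have := hP.eq_succ hA' hk hA.isBdry h
    subst this
    simp only [List.cons_append, List.nodup_cons] at hn
    rw [List.nodup_append] at hn
    exact hn.2.2.2 A hms A (by simp) rfl

end IsPatch

end DualFullerene

namespace DualFullerene

theorem degree_eq_ncard {V : Type u} (G : DualFullerene V) (d : Bool) (v : V) :
    G.degree v = {w | ∃ c, G.IsFaceDir d v w c}.ncard := by
  rw [RotationSystem.degree]
  congr 1
  ext w
  exact adj_iff_exists_face d

theorem exists_adj {V : Type u} (G : DualFullerene V) (v : V) : ∃ w, G.graph.Adj v w := by
  have h : (G.graph.neighborSet v).ncard ≠ 0 := by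
    change G.degree v ≠ 0
    rcases G.degree_eq v with h | h <;> omega
  exact Set.nonempty_of_ncard_ne_zero h

variable {W : Type u} {G : DualFullerene W} {d : Bool} {x : OpKind} {f g p : ℕ → W}
  {a b c v w w' : W}

/-- The vertices outside the path `p`. -/
abbrev Outer (x : OpKind) (p : ℕ → W) : Type u := {w : W // ¬ ∃ k ≤ x.length, p k = w}

/-- The faces that remain or appear when the extended patch is replaced by the initial patch. -/
def ReducedFace (G : DualFullerene W) (d : Bool) (x : OpKind) (f g p : ℕ → W)
    (a b c : Outer x p) : Prop :=
  G.IsFaceDir d a.1 b.1 c.1 ∨ SmallFace f g x a.1 b.1 c.1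

namespace IsPatch

variable (hP : IsPatch G d x f g p) {A B C D M N : PatchLabel} {ms ls : List PatchLabel}
include hP

omit hP in
theorem ne_of_outer {B : PatchLabel} (h : ¬ ∃ k ≤ x.length, p k = B.val f g p) :
    ¬ B.IsInner x := by
  cases B with
  | f k => exact id
  | g k => exact id
  | p k => exact fun hk => h ⟨k, hk, rfl⟩

/-- A directed edge of an initial triangle is either a boundary edge, whose face of `G` on that side
contains a path vertex, or a diagonal, which is not an edge of `G`. -/
theorem not_small_of_face {a b c : Outer x p} {c' : W} (h : G.IsFaceDir d a.1 b.1 c.1)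
    (h' : SmallFace f g x a.1 b.1 c') : False := by
  obtain ⟨a, ha⟩ := a
  obtain ⟨b, hb⟩ := b
  obtain ⟨A, B, C, hs, rfl, rfl, -⟩ := hP.exists_labels_small h'
  obtain ⟨M, ms, ls, N, hB⟩ := exists_corner (small_isBdry hs).2.1
  have hm : A ∈ M :: ms := Consec.mem_dropLast (l := M :: ms) (hB.consec_small hs)
  rcases List.mem_cons.1 hm with rfl | hm
  · obtain ⟨k, hk, hf⟩ := hP.exists_face_pred hB
    exact c.2 ⟨k, hk, hf.unique h⟩
  · exact hP.not_adj_of_mem hB hm h.adj.symm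

theorem label_of_face_inner (hv : ¬ ∃ k ≤ x.length, p k = v) {k : ℕ} (hk : k ≤ x.length)
    (h : G.IsFaceDir d (p k) v w) : ∃ A : PatchLabel, A.IsBdry x ∧ A.val f g p = v := by
  obtain ⟨B, A, C, h', -, rfl, -⟩ := hP.exists_labels_large
    (hP.large_of_face' ⟨k, hk, Or.inl rfl⟩ h)
  exact ⟨A, (large_valid h').2.1.resolve_right (ne_of_outer hv), rfl⟩

/-- Crossing an edge leads from an outer face to an outer face and from an initial triangle to an
initial triangle, except at the boundary edges of the patch, where the two kinds meet. -/
theorem reducedFace_symm : ∀ {a b c : Outer x p}, ReducedFace G d x f g p a b c →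
    ∃ c', ReducedFace G d x f g p b a c' := by
  rintro ⟨a, ha⟩ ⟨b, hb⟩ ⟨c, hc⟩ (h | h)
  · obtain ⟨c', hf⟩ := exists_isFaceDir d h.adj.symm
    by_cases hc' : ∃ k ≤ x.length, p k = c'
    · obtain ⟨k, hk, rfl⟩ := hc'
      obtain ⟨A, hA, rfl⟩ := hP.label_of_face_inner hb hk hf.rotate₂
      obtain ⟨B, C, D, hl, h1, h2, h3⟩ := hP.exists_labels_large
        (hP.large_of_face' ⟨k, hk, Or.inr (Or.inr rfl)⟩ hf)
      have hC : C.IsBdry x := (large_valid hl).2.1.resolve_right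
          (ne_of_outer (by rw [h2]; exact ha))
      obtain ⟨M, ms, ls, N, hcor⟩ := exists_corner hC
      subst h2
      obtain rfl := hP.eq_pred hcor hk hA hf
      obtain ⟨Y, hY⟩ := exists_consec_left (B := A) (N := N) (l := A :: ms) (by simp)
      have hYm : Y ∈ ms ++ [N] := hY.mem_right
      have := hP.small_of_consec hcor hY
      exact ⟨⟨Y.val f g p, hP.not_inner_val (hcor.isBdry_small (List.mem_cons_of_mem _ hYm))⟩,
        Or.inr this⟩
    · exact ⟨⟨c', hc'⟩, Or.inl hf⟩
  · obtain ⟨A, B, C, hs, rfl, rfl, rfl⟩ := hP.exists_labels_small h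
    obtain ⟨M, ms, ls, N, hB⟩ := exists_corner (small_isBdry hs).2.1
    have hm : A ∈ M :: ms := Consec.mem_dropLast (l := M :: ms) (hB.consec_small hs)
    by_cases hAM : A = M
    · subst hAM
      obtain ⟨k, hk, hf⟩ := hP.exists_face_pred hB
      obtain ⟨c', hf'⟩ := exists_isFaceDir d hf.adj.symm
      refine ⟨⟨c', ?_⟩, Or.inl hf'⟩
      rintro ⟨l, hl, rfl⟩
      obtain ⟨M', ms', ls', N', hA⟩ := exists_corner (small_isBdry hs).1
      obtain rfl := hP.eq_pred hA hl (small_isBdry hs).2.1 hf'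
      obtain rfl := hP.eq_succ hA hk (small_isBdry hs).2.1 hf.rotate₂
      exact pred_ne_succ hA rfl
    · have hm := (List.mem_cons.1 hm).resolve_left hAM
      obtain ⟨X, hX⟩ := exists_consec_right (C := A) (M := M) (l := ms ++ [N]) (by simp [hm])
      have hXm : X ∈ M :: ms := hX.mem_dropLast (l := M :: ms)
      have hXb := hB.isBdry_small (B := X) (by
        simp only [List.cons_append, List.mem_cons, List.mem_append] at hXm ⊢; tauto)
      exact ⟨⟨X.val f g p, hP.not_inner_val hXb⟩, Or.inr (hP.small_of_consec hB hX).rotate⟩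

theorem isTriangleSystem : IsTriangleSystem (ReducedFace G d x f g p) where
  rotate h := h.imp (fun h => h.rotate) fun h => h.rotate
  unique := by
    rintro a b c c' (h | h) (h' | h')
    · exact Subtype.ext (h.unique h')
    · exact (hP.not_small_of_face h h').elim
    · exact (hP.not_small_of_face h' h).elim
    · obtain ⟨A, B, C, hs, h1, h2, h3⟩ := hP.exists_labels_small h
      obtain ⟨M, ms, ls, N, hB⟩ := exists_corner (small_isBdry hs).2.1
      obtain ⟨A', B', C', hs', h1', h2', h3'⟩ := hP.exists_labels_small h'
      obtain rfl := hP.val_inj (Or.inl (small_isBdry hs).1) (Or.inl (small_isBdry hs').1)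
        (h1.trans h1'.symm)
      obtain rfl := hP.val_inj (Or.inl (small_isBdry hs).2.1) (Or.inl (small_isBdry hs').2.1)
        (h2.trans h2'.symm)
      obtain rfl := (hB.consec_small hs).unique hB.nodup_small (hB.consec_small hs')
      exact Subtype.ext (h3.symm.trans h3')
  symm := hP.reducedFace_symm
  ne := by
    rintro ⟨a, ha⟩ ⟨b, hb⟩ ⟨c, hc⟩ (h | h) heq
    · exact h.adj.ne (congrArg Subtype.val heq)
    · obtain ⟨A, B, C, hs, rfl, rfl, rfl⟩ := hP.exists_labels_small h
      exact small_ne hs (hP.val_inj (Or.inl (small_isBdry hs).1) (Or.inl (small_isBdry hs).2.1)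
        (congrArg Subtype.val heq))
  link := by
    rintro ⟨v, hv⟩
    by_cases hA : ∃ A : PatchLabel, A.IsBdry x ∧ A.val f g p = v
    · obtain ⟨A, hA, rfl⟩ := hA
      obtain ⟨M, ms, ls, N, hcor⟩ := exists_corner hA
      have hMb : M.IsBdry x := hcor.isBdry_small (by simp)
      have hM := hP.not_inner_val hMb
      have hsmall : ∀ B (hB : B ∈ M :: ms ++ [N]), Relation.ReflTransGen
          (fun a b => ReducedFace G d x f g p a ⟨A.val f g p, hv⟩ b) ⟨M.val f g p, hM⟩
          ⟨B.val f g p, hP.not_inner_val (hcor.isBdry_small hB)⟩ := by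
        intro B hB
        have := reflTransGen_consec (M := M) (l := ms ++ [N]) hB
        have key : ∀ B, Relation.ReflTransGen (fun B C => Consec B C (M :: (ms ++ [N]))) M B →
            ∀ hB : ¬ ∃ k ≤ x.length, p k = B.val f g p, Relation.ReflTransGen
            (fun a b => ReducedFace G d x f g p a ⟨A.val f g p, hv⟩ b) ⟨M.val f g p, hM⟩
            ⟨B.val f g p, hB⟩ := by
          intro B h
          induction h with
          | refl => exact fun _ => .refl
          | tail _ h1 ih =>
            intro hB
            have hb := hP.not_inner_val (hcor.isBdry_small h1.mem_left)
            exact (ih hb).tail (Or.inr (hP.small_of_consec hcor h1))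
        exact key B this _
      refine ⟨⟨M.val f g p, hM⟩, ?_⟩
      rintro ⟨w, hw⟩ ⟨⟨c, hc⟩, h | h⟩
      · obtain ⟨k, hk, hf⟩ := hP.exists_face_pred hcor
        -- Rotate in `G` from `M`. Path vertices carry no claim, and the first vertex after the path
        -- is `N`, which has been reached from `M` through the initial patch.
        have := mem_of_closed d (S := {w | ∀ hw : ¬ ∃ k ≤ x.length, p k = w, Relation.ReflTransGen
            (fun a b => ReducedFace G d x f g p a ⟨A.val f g p, hv⟩ b) ⟨M.val f g p, hM⟩ ⟨w, hw⟩})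
            hf.adj.symm (fun _ => .refl) (by
              intro y hy z hf hz
              by_cases hyi : ∃ k ≤ x.length, p k = y
              · obtain ⟨k, hk, rfl⟩ := hyi
                obtain ⟨B, C, hc, h1, rfl⟩ := hP.consec_of_large hcor
                  (hP.large_of_face' ⟨k, hk, Or.inl rfl⟩ hf)
                have hCm : C ∈ ls ++ [N] := hc.mem_right
                have hC : C = N := by
                  rcases List.mem_append.1 hCm with h | h
                  · exact (ne_of_outer hz (hcor.isInner_large h)).elim
                  · exact List.mem_singleton.1 h
                subst hC
                exact hsmall C (by simp)
              · exact (hy hyi).tail (Or.inl hf)) h.adj.symm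
        exact this hw
      · obtain ⟨B, C, hc, rfl, -⟩ := hP.consec_of_small hcor h
        exact hsmall B hc.mem_left
    · have hout : ∀ w, G.graph.Adj v w → ¬ ∃ k ≤ x.length, p k = w := by
        rintro w h ⟨k, hk, rfl⟩
        obtain ⟨c, hf⟩ := exists_isFaceDir d h.symm
        exact hA (hP.label_of_face_inner hv hk hf)
      obtain ⟨m, hm⟩ := G.exists_adj v
      refine ⟨⟨m, hout m hm⟩, ?_⟩
      rintro ⟨w, hw⟩ ⟨⟨c, hc⟩, h | h⟩
      · have := mem_of_closed d (S := {w | ∃ hw, Relation.ReflTransGen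
          (fun a b => ReducedFace G d x f g p a ⟨v, hv⟩ b) ⟨m, hout m hm⟩ ⟨w, hw⟩})
          hm ⟨hout m hm, .refl⟩ (by
            rintro y ⟨hy, hr⟩ z hf
            exact ⟨hout z hf.rotate.adj, hr.tail (Or.inl hf)⟩) h.adj.symm
        exact this.2
      · obtain ⟨A, B, C, hs, -, h2, -⟩ := hP.exists_labels_small h
        exact (hA ⟨B, (small_isBdry hs).2.1, h2⟩).elim
  connected := by
    have hsym : ∀ {a b : Outer x p}, (∃ c, ReducedFace G d x f g p a b c) →
        ∃ c, ReducedFace G d x f g p b a c := fun ⟨c, h⟩ => hP.reducedFace_symm h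
    have h0 : (PatchLabel.g 0).IsBdry x := by
      cases x <;> simp only [IsBdry, OpKind.sizeG] <;> omega
    have hbd : ∀ A : PatchLabel, A.IsBdry x → ∀ h, Relation.ReflTransGen
        (fun a b : Outer x p => ∃ c, ReducedFace G d x f g p a b c)
        ⟨_, hP.not_inner_val h0⟩ ⟨A.val f g p, h⟩ := by
      intro A hA
      have := small_connected hA
      clear hA
      induction this with
      | refl => exact fun _ => .refl
      | tail _ h1 ih =>
        intro h
        obtain ⟨C, h1 | h1⟩ := h1
        · have hv := small_isBdry h1
          exact (ih (hP.not_inner_val hv.1)).tail ⟨⟨_, hP.not_inner_val hv.2.2⟩,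
            Or.inr (h1.map (PatchLabel.val f g p))⟩
        · have hv := small_isBdry h1
          exact (ih (hP.not_inner_val hv.2.1)).tail (hsym ⟨⟨_, hP.not_inner_val hv.2.2⟩,
            Or.inr (h1.map (PatchLabel.val f g p))⟩)
    have hstep : ∀ u v, G.graph.Adj u v → (∀ hu, Relation.ReflTransGen
        (fun a b : Outer x p => ∃ c, ReducedFace G d x f g p a b c)
        ⟨_, hP.not_inner_val h0⟩ ⟨u, hu⟩) → ∀ hv, Relation.ReflTransGen
        (fun a b : Outer x p => ∃ c, ReducedFace G d x f g p a b c)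
        ⟨_, hP.not_inner_val h0⟩ ⟨v, hv⟩ := by
      intro u v h hu hv
      obtain ⟨c, hf⟩ := exists_isFaceDir d h
      by_cases hi : ∃ k ≤ x.length, p k = u ∨ p k = v ∨ p k = c
      · obtain ⟨A, B, C, hl, -, rfl, -⟩ := hP.exists_labels_large (hP.large_of_face' hi hf)
        exact hbd B ((large_valid hl).2.1.resolve_right (ne_of_outer hv)) hv
      · exact (hu fun ⟨k, hk, h⟩ => hi ⟨k, hk, Or.inl h⟩).tail
          ⟨⟨c, fun ⟨k, hk, h⟩ => hi ⟨k, hk, Or.inr (Or.inr h)⟩⟩, Or.inl hf⟩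
    have hall : ∀ u : Outer x p, Relation.ReflTransGen
        (fun a b : Outer x p => ∃ c, ReducedFace G d x f g p a b c)
        ⟨_, hP.not_inner_val h0⟩ u := by
      rintro ⟨u, hu⟩
      have := G.eq_of_forall_adj (fun w => ∀ hw, Relation.ReflTransGen
        (fun a b : Outer x p => ∃ c, ReducedFace G d x f g p a b c)
        ⟨_, hP.not_inner_val h0⟩ ⟨w, hw⟩)
        (fun u v h => propext ⟨hstep u v h, hstep v u h.symm⟩)
        ((PatchLabel.g 0).val f g p) u
      exact (cast this fun _ => .refl) hu
    exact fun u v => (Relation.ReflTransGen.mono (fun a b h => hsym h) _ _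
      (Relation.reflTransGen_swap.2 (hall u))).trans (hall v)

/-- The neighbours of a vertex that is not on the boundary of the patch do not change. -/
theorem nbrs_of_not_bdry {v : Outer x p} (hv : ∀ A : PatchLabel, A.IsBdry x → A.val f g p ≠ v.1) :
    {w | ∃ c, ReducedFace G d x f g p v w c}.ncard = G.degree v.1 := by
  have hout : ∀ w, G.graph.Adj v.1 w → ¬ ∃ k ≤ x.length, p k = w := by
    rintro w h ⟨k, hk, rfl⟩
    obtain ⟨c, hf⟩ := exists_isFaceDir d h.symm
    obtain ⟨A, hA, h⟩ := hP.label_of_face_inner v.2 hk hf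
    exact hv A hA h
  rw [G.degree_eq_ncard d, ← Set.ncard_image_of_injective _ Subtype.val_injective]
  congr 1
  ext w
  constructor
  · rintro ⟨⟨w, hw⟩, ⟨c, h | h⟩, rfl⟩
    · exact ⟨c, h⟩
    · obtain ⟨A, B, C, hs, h1, -, -⟩ := hP.exists_labels_small h
      exact (hv A (small_isBdry hs).1 h1).elim
  · rintro ⟨c, hf⟩
    exact ⟨⟨w, hout w hf.adj⟩, ⟨⟨c, hout c hf.rotate₂.adj.symm⟩, Or.inl hf⟩, rfl⟩

omit hP in
theorem mem_link {B : PatchLabel} (h : B ∈ ms) : B ∈ M :: ms ++ [N] := by simp [h]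

/-- The link loses `ls` and gains `ms`. The vertices of `ms` are really new neighbours because the
ends of a diagonal are not adjacent in `G`. -/
theorem nbrs_of_corner [Finite W] (hA : Corner x A M ms ls N) (hv : ¬ ∃ k ≤ x.length,
    p k = A.val f g p) :
    {w | ∃ c, ReducedFace G d x f g p ⟨A.val f g p, hv⟩ w c}.ncard + ls.length =
      G.degree (A.val f g p) + ms.length := by
  classical
  have hAb := hA.isBdry
  have hset : Subtype.val '' {w | ∃ c, ReducedFace G d x f g p ⟨A.val f g p, hv⟩ w c} =
      (G.graph.neighborSet (A.val f g p) \ ((ls.map (PatchLabel.val f g p)).toFinset : Set W)) ∪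
        ((ms.map (PatchLabel.val f g p)).toFinset : Set W) := by
    ext w
    simp only [Set.mem_image, Set.mem_union, Set.mem_sdiff, List.coe_toFinset, List.mem_map]
    constructor
    · rintro ⟨⟨w, hw⟩, ⟨c, h | h⟩, rfl⟩
      · refine Or.inl ⟨h.adj, ?_⟩
        rintro ⟨B, hB, rfl⟩
        exact ne_of_outer hw (hA.isInner_large hB)
      · obtain ⟨A', B, C, hs, h1, rfl, -⟩ := hP.exists_labels_small h
        obtain rfl := hP.val_inj (Or.inl (small_isBdry hs).1) (Or.inl hAb) h1
        have hm : B ∈ ms ++ [N] := (hA.consec_small hs.rotate.rotate).mem_right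
        rcases List.mem_append.1 hm with hm | hm
        · exact Or.inr ⟨B, hm, rfl⟩
        · obtain rfl := List.mem_singleton.1 hm
          obtain ⟨k, hk, hf⟩ := hP.exists_face_succ hA
          refine Or.inl ⟨hf.rotate.adj, ?_⟩
          rintro ⟨B', hB', h⟩
          have := hP.val_inj (Or.inr (hA.isInner_large hB')) (Or.inl (small_isBdry hs).2.1) h
          subst this
          exact not_isInner (small_isBdry hs).2.1 (hA.isInner_large hB')
    · rintro (⟨hadj, hw⟩ | ⟨D, hD, rfl⟩)
      · have hwo : ¬ ∃ k ≤ x.length, p k = w := by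
          rintro ⟨k, hk, rfl⟩
          obtain ⟨c, hf⟩ := exists_isFaceDir d (hadj : G.graph.Adj _ _).symm
          obtain ⟨B, C, hc, h1, -⟩ := hP.consec_of_large hA
            (hP.large_of_face' ⟨k, hk, Or.inl rfl⟩ hf)
          have hB : B ∈ M :: ls := hc.mem_dropLast (l := M :: ls)
          rcases List.mem_cons.1 hB with rfl | hB
          · exact hP.not_inner_val (hA.isBdry_small (B := B) (by simp)) ⟨k, hk, h1.symm⟩
          · exact hw ⟨B, hB, h1⟩
        refine ⟨⟨w, hwo⟩, ?_, rfl⟩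
        obtain ⟨c, hf⟩ := exists_isFaceDir d (hadj : G.graph.Adj _ _)
        by_cases hc : ∃ k ≤ x.length, p k = c
        · obtain ⟨k, hk, rfl⟩ := hc
          obtain ⟨B, C, hc, h1, h2⟩ := hP.consec_of_large hA
            (hP.large_of_face' ⟨k, hk, Or.inl rfl⟩ hf.rotate₂)
          have hC : C ∈ ls ++ [N] := hc.mem_right
          have hC : C = N := by
            rcases List.mem_append.1 hC with h | h
            · exact (hw ⟨C, h, h2⟩).elim
            · exact List.mem_singleton.1 h
          subst hC
          obtain ⟨X, hX⟩ := exists_consec_right (C := C) (M := M) (l := ms ++ [C]) (by simp)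
          have := (hP.small_of_consec hA hX).rotate
          rw [h2] at this
          exact ⟨⟨X.val f g p, hP.not_inner_val (hA.isBdry_small hX.mem_left)⟩, Or.inr this⟩
        · exact ⟨⟨c, hc⟩, Or.inl hf⟩
      · obtain ⟨X, hX⟩ := exists_consec_right (C := D) (M := M) (l := ms ++ [N]) (by simp [hD])
        exact ⟨⟨D.val f g p, hP.not_inner_val (hA.isBdry_small (mem_link hD))⟩,
          ⟨⟨X.val f g p, hP.not_inner_val (hA.isBdry_small hX.mem_left)⟩,
            Or.inr (hP.small_of_consec hA hX).rotate⟩, rfl⟩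
  have hcls : ((ls.map (PatchLabel.val f g p)).toFinset).card = ls.length := by
    rw [List.toFinset_card_of_nodup, List.length_map]
    refine List.Nodup.map_on ?_ hA.nodup_large
    intro B hB C hC h
    exact hP.val_inj (Or.inr (hA.isInner_large hB)) (Or.inr (hA.isInner_large hC)) h
  have hcms : ((ms.map (PatchLabel.val f g p)).toFinset).card = ms.length := by
    rw [List.toFinset_card_of_nodup, List.length_map]
    refine List.Nodup.map_on ?_ ?_
    · intro B hB C hC h
      exact hP.val_inj (Or.inl (hA.isBdry_small (mem_link hB)))
        (Or.inl (hA.isBdry_small (mem_link hC))) h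
    · have := hA.nodup_small
      simp only [List.cons_append, List.nodup_cons, List.nodup_append] at this
      exact this.2.1
  have hsub : ((ls.map (PatchLabel.val f g p)).toFinset : Set W) ⊆
      G.graph.neighborSet (A.val f g p) := by
    intro w hw
    simp only [List.coe_toFinset, List.mem_map] at hw
    obtain ⟨B, hB, rfl⟩ := hw
    obtain ⟨Y, hY⟩ := exists_consec_left (B := B) (N := N) (l := M :: ls) (by simp [hB])
    exact (hP.face_of_consec hA hY).adj.symm
  rw [← Set.ncard_image_of_injective _ Subtype.val_injective, hset, Set.ncard_union_eq,
    Set.ncard_coe_finset, hcms]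
  · have := Set.ncard_sdiff_add_ncard_of_subset hsub
    rw [Set.ncard_coe_finset, hcls] at this
    have h' : G.degree (A.val f g p) = (G.graph.neighborSet (A.val f g p)).ncard := rfl
    omega
  · refine Set.disjoint_left.2 fun w hw hw' => ?_
    simp only [List.coe_toFinset, List.mem_map] at hw'
    obtain ⟨D, hD, rfl⟩ := hw'
    exact hP.not_adj_of_mem hA hD hw.1

end IsPatch

end DualFullerene

namespace DualFullerene

variable {W : Type u} {G : DualFullerene W} {d : Bool} {x : OpKind} {f g p : ℕ → W}
  {a b c v w w' : W}

theorem _root_.OpKind.firstEnd_map {α : Type u} {β : Type v} (φ : α → β) (f g : ℕ → α)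
    (x : OpKind) : φ (x.firstEnd f g) = x.firstEnd (φ ∘ f) (φ ∘ g) := by
  cases x <;> rfl

theorem _root_.OpKind.lastEnd_map {α : Type u} {β : Type v} (φ : α → β) (f g : ℕ → α)
    (x : OpKind) : φ (x.lastEnd f g) = x.lastEnd (φ ∘ f) (φ ∘ g) := by
  cases x <;> rfl

theorem _root_.PatchLabel.firstEnd_isBdry (x : OpKind) :
    (x.firstEnd PatchLabel.f PatchLabel.g).IsBdry x := by
  cases x <;> simp only [OpKind.firstEnd, IsBdry, OpKind.sizeF, OpKind.sizeG] <;> omega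

theorem _root_.PatchLabel.lastEnd_isBdry (x : OpKind) :
    (x.lastEnd PatchLabel.f PatchLabel.g).IsBdry x := by
  cases x <;> simp only [OpKind.lastEnd, IsBdry, OpKind.sizeG] <;> omega

theorem _root_.PatchLabel.firstEnd_ne_lastEnd (x : OpKind) :
    x.firstEnd PatchLabel.f PatchLabel.g ≠ x.lastEnd PatchLabel.f PatchLabel.g := by
  cases x <;> simp [OpKind.firstEnd, OpKind.lastEnd]

namespace IsPatch

variable (hP : IsPatch G d x f g p) {A B C D M N : PatchLabel} {ms ls : List PatchLabel}
include hP

/-- A vertex of the boundary, as a vertex outside the path. -/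
theorem exists_lift : ∃ f' g' : ℕ → Outer x p, ∀ A : PatchLabel, A.IsBdry x → ∀ p' : ℕ → Outer x p,
    (A.val f' g' p').1 = A.val f g p := by
  classical
  have h0 : (PatchLabel.g 0).IsBdry x := by
    cases x <;> simp only [IsBdry, OpKind.sizeG] <;> omega
  have h0' := hP.not_inner_val h0
  refine ⟨fun k => if h : ¬ ∃ l ≤ x.length, p l = f k then ⟨f k, h⟩ else ⟨_, h0'⟩,
    fun k => if h : ¬ ∃ l ≤ x.length, p l = g k then ⟨g k, h⟩ else ⟨_, h0'⟩, fun A hA p' => ?_⟩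
  cases A with
  | f k =>
    have := hP.not_inner_val hA
    simp only [PatchLabel.val] at this ⊢
    rw [dif_pos this]
  | g k =>
    have := hP.not_inner_val hA
    simp only [PatchLabel.val] at this ⊢
    rw [dif_pos this]
  | p k => exact hA.elim

omit hP in
theorem firstEnd_val : (x.firstEnd PatchLabel.f PatchLabel.g).val f g p = x.firstEnd f g :=
  OpKind.firstEnd_map _ _ _ x

omit hP in
theorem lastEnd_val : (x.lastEnd PatchLabel.f PatchLabel.g).val f g p = x.lastEnd f g :=
  OpKind.lastEnd_map _ _ _ x

theorem ncard_reducedFace (v : Outer x p) (n₁ : v.1 ≠ x.firstEnd f g)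
    (n₂ : v.1 ≠ x.lastEnd f g) :
    {w | ∃ c, ReducedFace G d x f g p v w c}.ncard = G.degree v.1 := by
  have hfin := G.finite
  obtain ⟨v, hv⟩ := v
  by_cases hA : ∃ A : PatchLabel, A.IsBdry x ∧ A.val f g p = v
  · obtain ⟨A, hA, rfl⟩ := hA
    obtain ⟨M, ms, ls, N, hcor⟩ := exists_corner hA
    have := hP.nbrs_of_corner hcor hv
    have := hcor.length_eq (by rintro rfl; exact n₁ firstEnd_val)
      (by rintro rfl; exact n₂ lastEnd_val)
    simp only
    omega
  · exact hP.nbrs_of_not_bdry fun B hB h => hA ⟨B, hB, h⟩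

theorem ncard_reducedFace_end (v : Outer x p)
    (h : v.1 = x.firstEnd f g ∨ v.1 = x.lastEnd f g) :
    {w | ∃ c, ReducedFace G d x f g p v w c}.ncard + 1 = G.degree v.1 := by
  have hfin := G.finite
  obtain ⟨v, hv⟩ := v
  obtain ⟨A, hA, rfl⟩ : ∃ A : PatchLabel, (A = x.firstEnd PatchLabel.f PatchLabel.g ∨
      A = x.lastEnd PatchLabel.f PatchLabel.g) ∧ A.val f g p = v :=
    h.elim (fun h => ⟨_, Or.inl rfl, firstEnd_val.trans h.symm⟩)
      fun h => ⟨_, Or.inr rfl, lastEnd_val.trans h.symm⟩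
  have hA' : A.IsBdry x := by
    rcases hA with rfl | rfl
    exacts [firstEnd_isBdry x, lastEnd_isBdry x]
  obtain ⟨M, ms, ls, N, hcor⟩ := exists_corner hA'
  have := hP.nbrs_of_corner hcor hv
  obtain ⟨rfl, h⟩ := hcor.of_end hA
  simp only [List.length_nil] at this
  simp only
  omega

/-- The source of the reductions constructed below. In the reduced triangle system the degrees of
the remaining vertices drop by one at the two ends of the patch and nowhere else. The two ends of
the path leave the set of 5-vertices and the two ends of the patch enter it, so there are still
twelve and the system is plane. -/
theorem exists_reduction (h₁ : G.degree (x.firstEnd f g) = 6)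
    (h₂ : G.degree (x.lastEnd f g) = 6) :
    ∃ R : Reduction G, R.expansion.kind = x := by
  classical
  have hfin := G.finite
  have hT := hP.isTriangleSystem
  have e₁ : (x.firstEnd PatchLabel.f PatchLabel.g).val f g p = x.firstEnd f g :=
    firstEnd_val
  have e₂ : (x.lastEnd PatchLabel.f PatchLabel.g).val f g p = x.lastEnd f g :=
    lastEnd_val
  have b₁ := PatchLabel.firstEnd_isBdry x
  have b₂ := PatchLabel.lastEnd_isBdry x
  have hdeg := hP.ncard_reducedFace
  have hdeg' : ∀ v : Outer x p, v.1 = x.firstEnd f g ∨ v.1 = x.lastEnd f g →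
      {w | ∃ c, ReducedFace G d x f g p v w c}.ncard = 5 := by
    intro v h
    have := hP.ncard_reducedFace_end v h
    rcases h with h | h <;> rw [h] at this <;> omega
  have hd56 : ∀ v : Outer x p, {w | ∃ c, ReducedFace G d x f g p v w c}.ncard = 5 ∨
      {w | ∃ c, ReducedFace G d x f g p v w c}.ncard = 6 := by
    intro v
    by_cases h : v.1 = x.firstEnd f g ∨ v.1 = x.lastEnd f g
    · exact Or.inl (hdeg' v h)
    · rw [hdeg v (fun h' => h (Or.inl h')) fun h' => h (Or.inr h')]
      exact G.degree_eq _
  have hlen : 0 < x.length := by cases x <;> simp [OpKind.length]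
  have hne : p 0 ≠ p x.length := fun h => by
    have := hP.p_injOn (Nat.zero_le _ : 0 ≤ x.length) (le_refl x.length) h
    omega
  have o₁ : ¬ ∃ k ≤ x.length, p k = x.firstEnd f g := e₁ ▸ hP.not_inner_val b₁
  have o₂ : ¬ ∃ k ≤ x.length, p k = x.lastEnd f g := e₂ ▸ hP.not_inner_val b₂
  have hne' : x.firstEnd f g ≠ x.lastEnd f g := by
    rw [← e₁, ← e₂]
    exact fun h => PatchLabel.firstEnd_ne_lastEnd x (hP.val_inj (Or.inl b₁) (Or.inl b₂) h)
  have hcount : {v : Outer x p | {w | ∃ c,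
    ReducedFace G d x f g p v w c}.ncard = 5}.ncard = 12 := by
    have hset : Subtype.val '' {v : Outer x p |
        {w | ∃ c, ReducedFace G d x f g p v w c}.ncard = 5} =
        ({w | G.degree w = 5} \ {p 0, p x.length}) ∪ {x.firstEnd f g, x.lastEnd f g} := by
      ext w
      constructor
      · rintro ⟨⟨w, hw⟩, h, rfl⟩
        by_cases h' : w = x.firstEnd f g ∨ w = x.lastEnd f g
        · exact Or.inr h'
        · refine Or.inl ⟨?_, ?_⟩
          · exact (hdeg ⟨w, hw⟩ (fun h => h' (Or.inl h)) fun h => h' (Or.inr h)).symm.trans h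
          · rintro (rfl | rfl)
            · exact hw ⟨0, Nat.zero_le _, rfl⟩
            · exact hw ⟨_, le_refl _, rfl⟩
      · rintro (⟨h, h'⟩ | rfl | rfl)
        · have hw : ¬ ∃ k ≤ x.length, p k = w := by
            rintro ⟨k, hk, rfl⟩
            have k0 : k ≠ 0 := by rintro rfl; exact h' (Or.inl rfl)
            have k1 : k ≠ x.length := by rintro rfl; exact h' (Or.inr rfl)
            have := hP.degree_inner (Nat.pos_of_ne_zero k0) (lt_of_le_of_ne hk k1)
            have h : G.degree (p k) = 5 := h
            omega
          have h : G.degree w = 5 := h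
          refine ⟨⟨w, hw⟩, ?_, rfl⟩
          refine (hdeg ⟨w, hw⟩ ?_ ?_).trans h
          · rintro rfl; omega
          · rintro rfl; omega
        · exact ⟨⟨_, o₁⟩, hdeg' _ (Or.inl rfl), rfl⟩
        · exact ⟨⟨_, o₂⟩, hdeg' _ (Or.inr rfl), rfl⟩
    rw [← Set.ncard_image_of_injective _ Subtype.val_injective, hset, Set.ncard_union_eq,
      Set.ncard_pair hne']
    · have hsub : {p 0, p x.length} ⊆ {w | G.degree w = 5} := by
        rintro w (rfl | rfl)
        · exact hP.degree_end (Or.inl rfl)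
        · exact hP.degree_end (Or.inr rfl)
      have := Set.ncard_sdiff_add_ncard_of_subset hsub
      rw [Set.ncard_pair hne, G.ncard_five] at this
      omega
    · refine Set.disjoint_left.2 fun w hw hw' => ?_
      have h : G.degree w = 5 := hw.1
      rcases hw' with rfl | rfl <;> omega
  have : Nonempty (Outer x p) := ⟨⟨_, o₁⟩⟩
  obtain ⟨H, hH⟩ := hT.exists_dualFullerene d hd56 hcount
  obtain ⟨f', g', hlift⟩ := hP.exists_lift
  have hlift' : ∀ A : PatchLabel, A.IsBdry x ∨ A.IsInner x →
      A.val (Subtype.val ∘ f') (Subtype.val ∘ g') p = A.val f g p := by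
    rintro A (hA | hA)
    · rw [← hlift A hA f']
      cases A with
      | f k => rfl
      | g k => rfl
      | p k => exact hA.elim
    · cases A with
      | f k => exact hA.elim
      | g k => exact hA.elim
      | p k => rfl
  have hsmall : ∀ a b c, SmallFace f' g' x a b c ↔ SmallFace f g x a.1 b.1 c.1 := by
    intro a b c
    constructor
    · intro h
      obtain ⟨A, B, C, hs, rfl, rfl, rfl⟩ := SmallFace.exists_of_map
        (f := PatchLabel.f) (g := PatchLabel.g) (PatchLabel.val f' g' f') h
      have hv := small_isBdry hs
      rw [hlift A hv.1, hlift B hv.2.1, hlift C hv.2.2]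
      exact hs.map (PatchLabel.val f g p)
    · intro h
      obtain ⟨A, B, C, hs, h1, h2, h3⟩ := hP.exists_labels_small h
      have hv := small_isBdry hs
      rw [← hlift A hv.1 f'] at h1
      rw [← hlift B hv.2.1 f'] at h2
      rw [← hlift C hv.2.2 f'] at h3
      rw [← Subtype.ext h1, ← Subtype.ext h2, ← Subtype.ext h3]
      exact hs.map (PatchLabel.val f' g' f')
  have hlarge : ∀ a b c, LargeFace (Subtype.val ∘ f') (Subtype.val ∘ g') p x a b c ↔
      LargeFace f g p x a b c := by
    intro a b c
    constructor
    · intro h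
      obtain ⟨A, B, C, hs, rfl, rfl, rfl⟩ := LargeFace.exists_of_map
        (f := PatchLabel.f) (g := PatchLabel.g) (p := PatchLabel.p)
        (PatchLabel.val (Subtype.val ∘ f') (Subtype.val ∘ g') p) h
      have hv := large_valid hs
      rw [hlift' A hv.1, hlift' B hv.2.1, hlift' C hv.2.2]
      exact hs.map (PatchLabel.val f g p)
    · intro h
      obtain ⟨A, B, C, hs, rfl, rfl, rfl⟩ := hP.exists_labels_large h
      have hv := large_valid hs
      rw [← hlift' A hv.1, ← hlift' B hv.2.1, ← hlift' C hv.2.2]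
      exact hs.map (PatchLabel.val (Subtype.val ∘ f') (Subtype.val ∘ g') p)
  have hf : ∀ k, k < x.sizeF → (f' k).1 = f k := fun k hk => hlift (.f k) hk f'
  have hg : ∀ k, k < x.sizeG → (g' k).1 = g k := fun k hk => hlift (.g k) hk f'
  have hHdeg : ∀ v, H.degree v = {w | ∃ c, ReducedFace G d x f g p v w c}.ncard := by
    intro v
    rw [H.degree_eq_ncard d]
    simp only [hH]
  have hfirst : (x.firstEnd f' g').1 = x.firstEnd f g := by
    rw [← e₁, ← hlift _ b₁ f']
    exact congrArg Subtype.val (OpKind.firstEnd_map (PatchLabel.val f' g' f')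
      PatchLabel.f PatchLabel.g x).symm
  have hlast : (x.lastEnd f' g').1 = x.lastEnd f g := by
    rw [← e₂, ← hlift _ b₂ f']
    exact congrArg Subtype.val (OpKind.lastEnd_map (PatchLabel.val f' g' f')
      PatchLabel.f PatchLabel.g x).symm
  refine ⟨⟨Outer x p, H, ?_⟩, ?_⟩
  · exact
      { kind := x
        dir := d
        f := f'
        g := g'
        p := p
        old := Subtype.val
        old_injective := Subtype.val_injective
        f_injOn := fun k hk l hl h => hP.f_injOn hk hl (by
          rw [← hf k hk, ← hf l hl, h])
        g_injOn := fun k hk l hl h => hP.g_injOn hk hl (by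
          rw [← hg k hk, ← hg l hl, h])
        f_ne_g := fun k l hk hl h => hP.f_ne_g k l hk hl (by
          rw [← hf k hk, ← hg l hl, h])
        p_injOn := hP.p_injOn
        new_iff := fun w => by
          rw [Subtype.range_coe_subtype]
          simp
        small_isFace := fun a b c h => (hH a b c).2 (Or.inr ((hsmall a b c).1 h))
        isFace_iff := fun a b c => by
          rw [hlarge]
          constructor
          · intro h
            by_cases hi : ∃ k ≤ x.length, p k = a ∨ p k = b ∨ p k = c
            · exact Or.inr (hP.large_of_face' hi h)
            · refine Or.inl ⟨⟨a, fun ⟨k, hk, h⟩ => hi ⟨k, hk, Or.inl h⟩⟩,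
                ⟨b, fun ⟨k, hk, h⟩ => hi ⟨k, hk, Or.inr (Or.inl h)⟩⟩,
                ⟨c, fun ⟨k, hk, h⟩ => hi ⟨k, hk, Or.inr (Or.inr h)⟩⟩,
                (hH _ _ _).2 (Or.inl h), fun hs => ?_, rfl, rfl, rfl⟩
              exact hP.not_small_of_face
                (c := ⟨c, fun ⟨k, hk, h⟩ => hi ⟨k, hk, Or.inr (Or.inr h)⟩⟩) h ((hsmall _ _ _).1 hs)
          · rintro (⟨a₀, b₀, c₀, h, hn, rfl, rfl, rfl⟩ | h)
            · exact ((hH _ _ _).1 h).resolve_right fun h => hn ((hsmall _ _ _).2 h)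
            · exact hP.face _ _ _ h
        first_old := by rw [hHdeg]; exact hdeg' _ (Or.inl hfirst)
        last_old := by rw [hHdeg]; exact hdeg' _ (Or.inr hlast)
        first_new := hP.degree_end (Or.inl rfl)
        last_new := hP.degree_end (Or.inr rfl)
        inner_new := fun k hk hk' => hP.degree_inner hk hk' }
  · rfl

end IsPatch

end DualFullerene

/-! ### Effect of an expansion on degrees and links. -/

namespace PatchLabel

theorem Consec.map {α : Type u} {β : Type v} (ψ : α → β) {B C : α} {l : List α}
    (h : Consec B C l) : Consec (ψ B) (ψ C) (l.map ψ) := by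
  match l, h with
  | x :: y :: l, Or.inl h => exact Or.inl ⟨congrArg ψ h.1, congrArg ψ h.2⟩
  | x :: y :: l, Or.inr h => exact Or.inr (Consec.map ψ h)

/-- Applied to `ms` and `ls`, it gives the relabelling that carries the initial link of a vertex of
unchanged degree to the extended one. -/
theorem exists_map_eq {α : Type u} {l l' : List α} (hl : l.Nodup) (h : l'.length = l.length) :
    ∃ ψ : α → α, (∀ B, B ∉ l → ψ B = B) ∧ l.map ψ = l' := by
  classical
  induction l generalizing l' with
  | nil => exact ⟨id, fun _ _ => rfl, (List.length_eq_zero_iff.1 h).symm⟩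
  | cons a l ih =>
    obtain ⟨a', l', rfl⟩ : ∃ a' m, l' = a' :: m := by
      cases l' with
      | nil => simp at h
      | cons a' l' => exact ⟨_, _, rfl⟩
    obtain ⟨ψ, h1, h2⟩ := ih (List.nodup_cons.1 hl).2 (l' := l') (by simpa using h)
    refine ⟨Function.update ψ a a', fun B hB => ?_, ?_⟩
    · rw [Function.update_of_ne (fun h => hB (by simp [h]))]
      exact h1 B fun h => hB (List.mem_cons_of_mem _ h)
    · rw [List.map_cons, Function.update_self, ← h2]
      congr 1
      refine List.map_congr_left fun b hb => Function.update_of_ne ?_ _ _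
      rintro rfl
      exact (List.nodup_cons.1 hl).1 hb

end PatchLabel

namespace DualFullerene

theorem IsPatch.inner_of_large {W : Type u} {f g p : ℕ → W} {x : OpKind} {a b c : W}
    (h : LargeFace f g p x a b c) : ∃ k ≤ x.length, p k = a ∨ p k = b ∨ p k = c := by
  induction h with
  | rotate _ ih =>
    obtain ⟨k, hk, h⟩ := ih
    exact ⟨k, hk, by tauto⟩
  | start => exact ⟨0, Nat.zero_le _, by simp⟩
  | _ => first
    | exact ⟨_, by simp only [OpKind.length]; omega, Or.inl rfl⟩
    | exact ⟨_, by simp only [OpKind.length]; omega, Or.inr (Or.inl rfl)⟩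
    | exact ⟨_, by simp only [OpKind.length]; omega, Or.inr (Or.inr rfl)⟩

end DualFullerene

namespace Expansion

variable {V : Type u} {W : Type v} {G : DualFullerene V} {G' : DualFullerene W}
  (E : Expansion G G') {a b c v w : V}

theorem old_ne_p (v : V) : ¬ ∃ k ≤ E.kind.length, E.p k = E.old v :=
  fun h => (E.new_iff _).1 h ⟨v, rfl⟩

theorem isPatch : G'.IsPatch E.dir E.kind (E.old ∘ E.f) (E.old ∘ E.g) E.p where
  f_injOn _ hk _ hl h := E.f_injOn hk hl (E.old_injective h)
  g_injOn _ hk _ hl h := E.g_injOn hk hl (E.old_injective h)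
  f_ne_g k l hk hl h := E.f_ne_g k l hk hl (E.old_injective h)
  p_injOn := E.p_injOn
  p_ne_f k _ hk _ h := E.old_ne_p _ ⟨k, hk, h⟩
  p_ne_g k _ hk _ h := E.old_ne_p _ ⟨k, hk, h⟩
  face a b c h := (E.isFace_iff a b c).2 (Or.inr h)

theorem exists_old {w : W} (h : ¬ ∃ k ≤ E.kind.length, E.p k = w) : ∃ v, E.old v = w := by
  by_contra h'
  exact h ((E.new_iff w).2 h')

theorem isFaceDir_of_old (h : G'.IsFaceDir E.dir (E.old a) (E.old b) (E.old c)) :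
    G.IsFaceDir E.dir a b c ∧ ¬ SmallFace E.f E.g E.kind a b c := by
  rcases (E.isFace_iff _ _ _).1 h with ⟨a', b', c', h', hs, h1, h2, h3⟩ | h
  · obtain rfl := E.old_injective h1
    obtain rfl := E.old_injective h2
    obtain rfl := E.old_injective h3
    exact ⟨h', hs⟩
  · obtain ⟨k, hk, h | h | h⟩ := DualFullerene.IsPatch.inner_of_large h
    exacts [(E.old_ne_p _ ⟨k, hk, h⟩).elim, (E.old_ne_p _ ⟨k, hk, h⟩).elim,
      (E.old_ne_p _ ⟨k, hk, h⟩).elim]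

theorem isFaceDir_old (h : G.IsFaceDir E.dir a b c)
    (hs : ¬ SmallFace E.f E.g E.kind a b c) :
    G'.IsFaceDir E.dir (E.old a) (E.old b) (E.old c) :=
  (E.isFace_iff _ _ _).2 (Or.inl ⟨a, b, c, h, hs, rfl, rfl, rfl⟩)

theorem small_old : SmallFace (E.old ∘ E.f) (E.old ∘ E.g) E.kind (E.old a) (E.old b) (E.old c) ↔
    SmallFace E.f E.g E.kind a b c := by
  constructor
  · intro h
    obtain ⟨a', b', c', h, h1, h2, h3⟩ := SmallFace.exists_of_map E.old h
    rwa [← E.old_injective h1, ← E.old_injective h2, ← E.old_injective h3]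
  · exact fun h => h.map E.old

/-- Reducing `G'` at the patch of the expansion gives back `G`, so the degree counts made for
reductions apply to expansions. -/
theorem reducedFace_old : DualFullerene.ReducedFace G' E.dir E.kind (E.old ∘ E.f) (E.old ∘ E.g) E.p
    ⟨E.old a, E.old_ne_p a⟩ ⟨E.old b, E.old_ne_p b⟩ ⟨E.old c, E.old_ne_p c⟩ ↔
      G.IsFaceDir E.dir a b c := by
  constructor
  · rintro (h | h)
    · exact (E.isFaceDir_of_old h).1
    · exact E.small_isFace _ _ _ (E.small_old.1 h)
  · intro h
    by_cases hs : SmallFace E.f E.g E.kind a b c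
    · exact Or.inr (E.small_old.2 hs)
    · exact Or.inl (E.isFaceDir_old h hs)

theorem ncard_reducedFace (v : V) :
    {w | ∃ c, DualFullerene.ReducedFace G' E.dir E.kind (E.old ∘ E.f) (E.old ∘ E.g) E.p
      ⟨E.old v, E.old_ne_p v⟩ w c}.ncard = G.degree v := by
  rw [G.degree_eq_ncard E.dir, ← Set.ncard_image_of_injective _ E.old_injective,
    ← Set.ncard_image_of_injective _ Subtype.val_injective]
  congr 1
  ext w
  constructor
  · rintro ⟨⟨w, hw⟩, ⟨⟨c, hc⟩, h⟩, rfl⟩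
    obtain ⟨w, rfl⟩ := E.exists_old hw
    obtain ⟨c, rfl⟩ := E.exists_old hc
    exact ⟨w, ⟨c, E.reducedFace_old.1 h⟩, rfl⟩
  · rintro ⟨w, ⟨c, h⟩, rfl⟩
    exact ⟨_, ⟨_, E.reducedFace_old.2 h⟩, rfl⟩

theorem firstEnd_old : E.kind.firstEnd (E.old ∘ E.f) (E.old ∘ E.g) =
    E.old (E.kind.firstEnd E.f E.g) :=
  (OpKind.firstEnd_map _ _ _ _).symm

theorem lastEnd_old : E.kind.lastEnd (E.old ∘ E.f) (E.old ∘ E.g) =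
    E.old (E.kind.lastEnd E.f E.g) :=
  (OpKind.lastEnd_map _ _ _ _).symm

theorem degree_old (h₁ : v ≠ E.kind.firstEnd E.f E.g) (h₂ : v ≠ E.kind.lastEnd E.f E.g) :
    G'.degree (E.old v) = G.degree v := by
  rw [← E.ncard_reducedFace v, E.isPatch.ncard_reducedFace]
  · rw [E.firstEnd_old]
    exact fun h => h₁ (E.old_injective h)
  · rw [E.lastEnd_old]
    exact fun h => h₂ (E.old_injective h)

theorem degree_old_end (h : v = E.kind.firstEnd E.f E.g ∨ v = E.kind.lastEnd E.f E.g) :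
    G'.degree (E.old v) = 6 := by
  have h' := E.isPatch.ncard_reducedFace_end ⟨E.old v, E.old_ne_p v⟩
    (by rw [E.firstEnd_old, E.lastEnd_old]; exact h.imp (congrArg _) (congrArg _))
  rw [E.ncard_reducedFace v] at h'
  simp only at h'
  have := E.first_old
  have := E.last_old
  rcases h with rfl | rfl <;> omega

/-- Degrees of old vertices never decrease: only the two ends of the patch change, and they become
6-vertices. -/
theorem degree_of_old (h : G'.degree (E.old v) = 5) : G.degree v = 5 := by
  rw [← h, E.degree_old]
  · rintro rfl
    rw [E.degree_old_end (Or.inl rfl)] at h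
    omega
  · rintro rfl
    rw [E.degree_old_end (Or.inr rfl)] at h
    omega

/-- At a vertex whose degree does not change, the rotation changes only by the replacement of
the other ends of diagonals of the initial patch by vertices of the path. -/
theorem exists_link_map (h₁ : v ≠ E.kind.firstEnd E.f E.g) (h₂ : v ≠ E.kind.lastEnd E.f E.g) :
    ∃ φ : V → W, (∀ w c, G.IsFaceDir E.dir w v c → G'.IsFaceDir E.dir (φ w) (E.old v) (φ c)) ∧
      ∀ w, φ w = E.old w ∨ ((∃ k ≤ E.kind.length, φ w = E.p k) ∧
        (∃ c, SmallFace E.f E.g E.kind v w c) ∧ ∃ c, SmallFace E.f E.g E.kind w v c) := by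
  classical
  have hP := E.isPatch
  by_cases hA : ∃ A : PatchLabel, A.IsBdry E.kind ∧ A.val (E.old ∘ E.f) (E.old ∘ E.g) E.p = E.old v
  · obtain ⟨A, hA, hAv⟩ := hA
    obtain ⟨M, ms, ls, N, hcor⟩ := exists_corner hA
    have hl := hcor.length_eq (by
      rintro rfl
      rw [DualFullerene.IsPatch.firstEnd_val, E.firstEnd_old] at hAv
      exact h₁ (E.old_injective hAv).symm) (by
      rintro rfl
      rw [DualFullerene.IsPatch.lastEnd_val, E.lastEnd_old] at hAv
      exact h₂ (E.old_injective hAv).symm)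
    have hn := hcor.nodup_small
    simp only [List.cons_append, List.nodup_cons, List.nodup_append, List.mem_append,
      List.mem_singleton, not_or] at hn
    obtain ⟨ψ, hψ, hψ'⟩ := exists_map_eq hn.2.1 hl
    have hmap : (M :: ms ++ [N]).map ψ = M :: ls ++ [N] := by
      simp only [List.cons_append, List.map_cons, List.map_append, List.map_nil, hψ']
      rw [hψ M hn.1.1, hψ N fun h => hn.2.2.2 N h N rfl rfl]
    have hsm : ∀ w c, SmallFace E.f E.g E.kind w v c → ∃ B C, Consec B C (M :: ms ++ [N]) ∧
        B.val (E.old ∘ E.f) (E.old ∘ E.g) E.p = E.old w ∧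
        C.val (E.old ∘ E.f) (E.old ∘ E.g) E.p = E.old c := by
      intro w c h
      refine hP.consec_of_small hcor ?_
      rw [hAv]
      exact E.small_old.2 h
    have hsm' : ∀ {B C} {w c : V}, Consec B C (M :: ms ++ [N]) →
        B.val (E.old ∘ E.f) (E.old ∘ E.g) E.p = E.old w →
        C.val (E.old ∘ E.f) (E.old ∘ E.g) E.p = E.old c →
        SmallFace E.f E.g E.kind w v c := by
      intro B C w c h h1 h2
      have := hP.small_of_consec hcor h
      rw [h1, h2, hAv] at this
      exact E.small_old.1 this
    have hval : ∀ {B}, B ∈ M :: ms ++ [N] → ∃ w,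
      B.val (E.old ∘ E.f) (E.old ∘ E.g) E.p = E.old w := by
      intro B hB
      obtain ⟨w, hw⟩ := E.exists_old (hP.not_inner_val (hcor.isBdry_small hB))
      exact ⟨w, hw.symm⟩
    -- Only the other ends of diagonals at `v` are moved, each to the path vertex that takes its
    -- place in the link.
    let φ : V → W := fun w => if h : ∃ B ∈ ms, B.val (E.old ∘ E.f) (E.old ∘ E.g) E.p = E.old w then
      (ψ h.choose).val (E.old ∘ E.f) (E.old ∘ E.g) E.p else E.old w
    have hφ : ∀ {B} {w : V}, B ∈ M :: ms ++ [N] →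
        B.val (E.old ∘ E.f) (E.old ∘ E.g) E.p = E.old w →
        φ w = (ψ B).val (E.old ∘ E.f) (E.old ∘ E.g) E.p := by
      intro B w hB hw
      by_cases h : ∃ B ∈ ms, B.val (E.old ∘ E.f) (E.old ∘ E.g) E.p = E.old w
      · simp only [φ, dif_pos h]
        rw [hP.val_inj (Or.inl (hcor.isBdry_small (B := h.choose) (by simp [h.choose_spec.1])))
          (Or.inl (hcor.isBdry_small hB)) (h.choose_spec.2.trans hw.symm)]
      · simp only [φ, dif_neg h]
        rw [hψ B fun hB => h ⟨B, hB, hw⟩, hw]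
    refine ⟨φ, fun w c hf => ?_, fun w => ?_⟩
    · by_cases hs : SmallFace E.f E.g E.kind w v c
      · obtain ⟨B, C, hBC, h1, h2⟩ := hsm _ _ hs
        rw [hφ hBC.mem_left h1, hφ (List.mem_of_mem_tail hBC.mem_right) h2, ← hAv]
        refine hP.face_of_consec hcor ?_
        rw [← hmap]
        exact hBC.map ψ
      · have hw : φ w = E.old w := by
          refine dif_neg ?_
          rintro ⟨B, hB, hw⟩
          obtain ⟨C, hC⟩ := exists_consec_left (B := B) (N := N) (l := M :: ms) (by simp [hB])
          obtain ⟨c', hc'⟩ := hval (List.mem_of_mem_tail hC.mem_right)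
          have := hsm' hC hw hc'
          rw [(E.small_isFace _ _ _ this).unique hf] at this
          exact hs this
        have hc : φ c = E.old c := by
          refine dif_neg ?_
          rintro ⟨C, hC, hc⟩
          obtain ⟨B, hB⟩ := exists_consec_right (C := C) (M := M) (l := ms ++ [N]) (by simp [hC])
          obtain ⟨w', hw'⟩ := hval hB.mem_left
          have := hsm' hB hw' hc
          rw [(E.small_isFace _ _ _ this).prev_unique hf] at this
          exact hs this
        rw [hw, hc]
        exact E.isFaceDir_old hf hs
    · by_cases h : ∃ B ∈ ms, B.val (E.old ∘ E.f) (E.old ∘ E.g) E.p = E.old w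
      · obtain ⟨B, hB, hw⟩ := h
        right
        rw [hφ (B := B) (by simp [hB]) hw]
        have hi := hcor.isInner_large (B := ψ B) (by rw [← hψ']; exact List.mem_map_of_mem hB)
        obtain ⟨C, hC⟩ := exists_consec_left (B := B) (N := N) (l := M :: ms) (by simp [hB])
        obtain ⟨c, hc⟩ := hval (List.mem_of_mem_tail hC.mem_right)
        obtain ⟨D, hD⟩ := exists_consec_right (C := B) (M := M) (l := ms ++ [N]) (by simp [hB])
        obtain ⟨d, hd⟩ := hval hD.mem_left
        refine ⟨?_, ⟨d, (hsm' hD hd hw).rotate⟩, ⟨c, hsm' hC hw hc⟩⟩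
        generalize ψ B = D at hi
        cases D with
        | f k => exact hi.elim
        | g k => exact hi.elim
        | p k => exact ⟨k, hi, rfl⟩
      · exact Or.inl (dif_neg h)
  · refine ⟨E.old, fun w c h => E.isFaceDir_old h fun hs => ?_, fun w => Or.inl rfl⟩
    obtain ⟨A, B, C, hs, -, h2, -⟩ := hP.exists_labels_small (E.small_old.2 hs)
    exact hA ⟨B, (small_isBdry hs).2.1, h2⟩

end Expansion

/-! ### Reductions of length one and two, read off from links. -/

namespace DualFullerene

variable {W : Type u} {G : DualFullerene W} {d : Bool} {x : OpKind} {f g p : ℕ → W}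

theorem IsPatch.of_nodup (hn : ((List.range x.sizeF).map f ++ ((List.range x.sizeG).map g ++
    (List.range (x.length + 1)).map p)).Nodup)
    (face : ∀ a b c, LargeFace f g p x a b c → G.IsFaceDir d a b c) : IsPatch G d x f g p := by
  rw [List.nodup_append, List.nodup_append] at hn
  obtain ⟨hf, ⟨hg, hp, hgp⟩, hfg⟩ := hn
  simp only [List.mem_map, List.mem_range, List.mem_append] at hgp hfg
  have key : ∀ {n : ℕ} {q : ℕ → W}, ((List.range n).map q).Nodup → ∀ k < n, ∀ l < n,
      q k = q l → k = l := fun h k hk l hl hkl =>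
    List.inj_on_of_nodup_map h (List.mem_range.2 hk) (List.mem_range.2 hl) hkl
  exact
    { f_injOn := fun k hk l hl h => key hf k hk l hl h
      g_injOn := fun k hk l hl h => key hg k hk l hl h
      f_ne_g := fun k l hk hl => hfg _ ⟨k, hk, rfl⟩ _ (Or.inl ⟨l, hl, rfl⟩)
      p_injOn := fun k hk l hl h => key hp k (Nat.lt_succ_of_le hk) l (Nat.lt_succ_of_le hl) h
      p_ne_f := fun k l hk hl => (hfg _ ⟨l, hl, rfl⟩ _ (Or.inr ⟨k, by omega, rfl⟩)).symm
      p_ne_g := fun k l hk hl => (hgp _ ⟨l, hl, rfl⟩ _ ⟨k, by omega, rfl⟩).symm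
      face := face }

theorem isFaceDir_of_large_L {i : ℕ} (h₀ : G.IsFaceDir d (f 0) (g 0) (p 0))
    (h₁ : ∀ k ≤ i + 1, G.IsFaceDir d (f k) (p k) (f (k + 1)))
    (h₂ : ∀ k ≤ i + 1, G.IsFaceDir d (g k) (g (k + 1)) (p k))
    (h₃ : ∀ k ≤ i, G.IsFaceDir d (p k) (p (k + 1)) (f (k + 1)))
    (h₄ : ∀ k ≤ i, G.IsFaceDir d (p k) (g (k + 1)) (p (k + 1)))
    (h₅ : G.IsFaceDir d (g (i + 2)) (f (i + 2)) (p (i + 1))) {a b c : W}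
    (h : LargeFace f g p (.L i) a b c) : G.IsFaceDir d a b c := by
  generalize hx : OpKind.L i = x at h
  induction h with
  | rotate _ ih => exact (ih hx).rotate
  | start => exact h₀
  | L_f h => cases hx; exact h₁ _ h
  | L_g h => cases hx; exact h₂ _ h
  | L_pf h => cases hx; exact h₃ _ h
  | L_pg h => cases hx; exact h₄ _ h
  | L_stop => cases hx; exact h₅
  | _ => cases hx

theorem isFaceDir_of_large_B {i j : ℕ} (h₀ : G.IsFaceDir d (f 0) (g 0) (p 0))
    (h₁ : ∀ k ≤ i, G.IsFaceDir d (f k) (p k) (f (k + 1)))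
    (h₂ : ∀ k ≤ i, G.IsFaceDir d (g k) (g (k + 1)) (p k))
    (h₃ : ∀ k ≤ i, G.IsFaceDir d (p k) (p (k + 1)) (f (k + 1)))
    (h₄ : ∀ k ≤ i, G.IsFaceDir d (p k) (g (k + 1)) (p (k + 1)))
    (h₅ : G.IsFaceDir d (g (i + 1)) (g (i + 2)) (p (i + 1)))
    (h₆ : G.IsFaceDir d (g (i + 2)) (g (i + 3)) (p (i + 1)))
    (h₇ : ∀ k, i + 1 ≤ k → k ≤ i + j + 1 → G.IsFaceDir d (p k) (p (k + 1)) (f k))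
    (h₈ : ∀ k, i + 1 ≤ k → k ≤ i + j + 1 → G.IsFaceDir d (f k) (p (k + 1)) (f (k + 1)))
    (h₉ : ∀ k, i + 1 ≤ k → k ≤ i + j + 1 → G.IsFaceDir d (p k) (g (k + 2)) (p (k + 1)))
    (h₁₀ : ∀ k, i + 1 ≤ k → k ≤ i + j + 1 → G.IsFaceDir d (g (k + 2)) (g (k + 3)) (p (k + 1)))
    (h₁₁ : G.IsFaceDir d (g (i + j + 4)) (f (i + j + 2)) (p (i + j + 2))) {a b c : W}
    (h : LargeFace f g p (.B i j) a b c) : G.IsFaceDir d a b c := by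
  generalize hx : OpKind.B i j = x at h
  induction h with
  | rotate _ ih => exact (ih hx).rotate
  | start => exact h₀
  | B_f₁ h => cases hx; exact h₁ _ h
  | B_g₁ h => cases hx; exact h₂ _ h
  | B_pf₁ h => cases hx; exact h₃ _ h
  | B_pg₁ h => cases hx; exact h₄ _ h
  | B_turn₁ => cases hx; exact h₅
  | B_turn₂ => cases hx; exact h₆
  | B_pf₂ h h' => cases hx; exact h₇ _ h h'
  | B_f₂ h h' => cases hx; exact h₈ _ h h'
  | B_pg₂ h h' => cases hx; exact h₉ _ h h'
  | B_g₂ h h' => cases hx; exact h₁₀ _ h h'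
  | B_stop => cases hx; exact h₁₁
  | _ => cases hx

variable {u v w a₁ a₂ a₃ a₄ b₁ b₂ b₃ b₄ c₁ c₂ c₃ c₄ : W}

theorem Cyc5.nodup_cons (h : Cyc5 G d v a₁ a₂ a₃ a₄ b₁) : [v, a₁, a₂, a₃, a₄, b₁].Nodup := by
  refine List.nodup_cons.2 ⟨?_, h.nodup⟩
  simp [h.f₁.ne₂₃, h.f₂.ne₂₃, h.f₃.ne₂₃, h.f₄.ne₂₃, h.f₅.ne₂₃]

theorem Cyc6.nodup_cons (h : Cyc6 G d v a₁ a₂ a₃ a₄ b₁ b₂) :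
    [v, a₁, a₂, a₃, a₄, b₁, b₂].Nodup := by
  refine List.nodup_cons.2 ⟨?_, h.nodup⟩
  simp [h.f₁.ne₂₃, h.f₂.ne₂₃, h.f₃.ne₂₃, h.f₄.ne₂₃, h.f₅.ne₂₃, h.f₆.ne₂₃]

/-- Two vertices at distance two with a further common neighbour. -/
theorem face_of_common (d : Bool) {x : W} (huv : G.graph.Adj u v) (hvw : G.graph.Adj v w)
    (hux : G.graph.Adj u x) (hwx : G.graph.Adj w x) (huw : u ≠ w) (hvx : v ≠ x) :
    G.IsFaceDir d u v w ∨ G.IsFaceDir d w v u ∨ (G.IsFaceDir d u v x ∧ G.IsFaceDir d x v w) ∨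
      (G.IsFaceDir d w v x ∧ G.IsFaceDir d x v u) := by
  rcases split_of_adj d huv hvw hwx hux.symm huw hvx with (h | h) | (h | h)
  · exact Or.inl h.1
  · exact Or.inr (Or.inr (Or.inl ⟨h.2.rotate₂, h.1.rotate₂⟩))
  · exact Or.inr (Or.inl h.2.rotate)
  · exact Or.inr (Or.inr (Or.inr ⟨h.1.rotate, h.2⟩))

/-- The vertices of the patch need not be assumed distinct. A common neighbour of the adjacent
vertices `u` and `v` forms a face with them, so there are only two of these, one on each side of the
edge. -/
theorem exists_reduction_L₀ (hu : Cyc5 G d u v a₁ a₂ a₃ a₄) (hv : Cyc5 G d v u b₁ b₂ b₃ b₄)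
    (ha : G.degree a₃ = 6) (hb : G.degree b₃ = 6) : ∃ R : Reduction G, R.expansion.kind = .L 0 := by
  obtain rfl := hv.f₁.unique hu.f₅.rotate
  obtain rfl := hu.f₁.unique hv.f₅.rotate
  have key : ∀ x, G.graph.Adj u x → G.graph.Adj v x → x = a₁ ∨ x = b₁ := by
    intro x hx hy
    rcases face_of_adj d hu.f₁.adj.symm hy hx.symm with h | h
    · exact Or.inr (h.unique hv.f₁)
    · exact Or.inl (h.rotate₂.unique hu.f₁)
  have h1 := hu.nodup_cons
  have h2 := hv.nodup_cons
  simp only [List.nodup_cons, List.mem_cons, List.not_mem_nil, or_false, not_or, List.nodup_nil,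
    not_false_eq_true, and_true] at h1 h2
  have k2 : a₂ ≠ b₂ := by
    rintro rfl
    have := key a₂ hu.f₃.adj.symm hv.f₃.adj.symm
    grind
  have k3 : a₂ ≠ b₃ := by
    rintro rfl
    have := key a₂ hu.f₃.adj.symm hv.f₄.adj.symm
    grind
  have k4 : a₃ ≠ b₂ := by
    rintro rfl
    have := key a₃ hu.f₄.adj.symm hv.f₃.adj.symm
    grind
  have k5 : a₃ ≠ b₃ := by
    rintro rfl
    have := key a₃ hu.f₄.adj.symm hv.f₄.adj.symm
    grind
  have hP : IsPatch G d (.L 0) (fun | 0 => a₃ | 1 => b₁ | _ => b₂)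
      (fun | 0 => a₂ | 1 => a₁ | _ => b₃) (fun | 0 => u | _ => v) := by
    refine IsPatch.of_nodup (show [a₃, b₁, b₂, a₂, a₁, b₃, u, v].Nodup by
      simp only [List.nodup_cons, List.mem_cons, List.not_mem_nil, or_false, not_or, List.nodup_nil,
        not_false_eq_true, and_true]
      and_intros <;> grind) fun a b c =>
      isFaceDir_of_large_L hu.f₃.rotate₂ ?_ ?_ ?_ ?_ hv.f₃.rotate₂
    · intro k hk
      interval_cases k
      exacts [hu.f₄, hv.f₂]
    · intro k hk
      interval_cases k
      exacts [hu.f₂.rotate₂, hv.f₄.rotate₂]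
    · intro k hk
      interval_cases k
      exact hv.f₁
    · intro k hk
      interval_cases k
      exact hv.f₅.rotate₂
  exact hP.exists_reduction ha hb

/-- The vertices `u` and `w` are opposite in the link of `v`. An edge between them or a second
common neighbour would, by the absence of separating triangles and quadrilaterals, bring them closer
in this link. -/
theorem nodup_L₁ (hu : Cyc5 G d u v a₁ a₂ a₃ a₄) (hv : Cyc6 G d v u c₁ c₂ w c₃ c₄)
    (hw : Cyc5 G d w v b₁ b₂ b₃ b₄) :
    [a₃, a₄, b₁, b₂, a₂, a₁, b₄, b₃, u, v, w].Nodup := by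
  obtain rfl := hu.f₅.rotate.unique hv.f₁
  obtain rfl := hu.f₁.unique hv.f₆.rotate
  obtain rfl := hv.f₃.rotate.unique hw.f₁
  obtain rfl := hw.f₅.rotate.unique hv.f₄
  have h1 := hu.nodup_cons
  have h2 := hw.nodup_cons
  have h3 := hv.nodup_cons
  simp only [List.nodup_cons, List.mem_cons, List.not_mem_nil, or_false, not_or, List.nodup_nil,
    not_false_eq_true, and_true] at h1 h2 h3
  have key : ∀ x, G.graph.Adj u x → G.graph.Adj w x → x = v := by
    intro x hx hy
    by_contra hne
    rcases face_of_common d hv.f₁.adj hv.f₄.adj.symm hx hy (by grind) (Ne.symm hne) with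
      h | h | h | h
    · have := h.unique hv.f₁
      grind
    · have := h.unique hv.f₄
      grind
    · obtain rfl := h.1.unique hv.f₁
      have := h.2.unique hv.f₂
      grind
    · obtain rfl := h.1.unique hv.f₄
      have := h.2.unique hv.f₅
      grind
  have huw : ¬ G.graph.Adj u w := by
    intro h
    rcases face_of_adj d hv.f₁.adj hv.f₄.adj.symm h.symm with h | h
    · have := h.unique hv.f₁
      grind
    · have := h.rotate.unique hv.f₄
      grind
  have k1 := fun h => key a₁ hu.f₂.adj.symm h
  have k2 := fun h => key a₂ hu.f₃.adj.symm h
  have k3 := fun h => key a₃ hu.f₄.adj.symm h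
  have k4 := fun h => key a₄ hu.f₅.adj.symm h
  have l1 := hw.f₂.adj.symm
  have l2 := hw.f₃.adj.symm
  have l3 := hw.f₄.adj.symm
  have l4 := hw.f₅.adj.symm
  have m1 := hu.f₂.adj.symm
  have m2 := hu.f₃.adj.symm
  have m3 := hu.f₄.adj.symm
  have m4 := hu.f₅.adj.symm
  have hwu : ¬ G.graph.Adj w u := fun h => huw h.symm
  simp only [List.nodup_cons, List.mem_cons, List.not_mem_nil, or_false, not_or, List.nodup_nil,
    not_false_eq_true, and_true]
  and_intros <;> grind

theorem exists_reduction_L₁ (hu : Cyc5 G d u v a₁ a₂ a₃ a₄) (hv : Cyc6 G d v u c₁ c₂ w c₃ c₄)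
    (hw : Cyc5 G d w v b₁ b₂ b₃ b₄) (ha : G.degree a₃ = 6) (hb : G.degree b₃ = 6) :
    ∃ R : Reduction G, R.expansion.kind = .L 1 := by
  have hn := nodup_L₁ hu hv hw
  obtain rfl := hu.f₅.rotate.unique hv.f₁
  obtain rfl := hu.f₁.unique hv.f₆.rotate
  obtain rfl := hv.f₃.rotate.unique hw.f₁
  obtain rfl := hw.f₅.rotate.unique hv.f₄
  have hP : IsPatch G d (.L 1) (fun | 0 => a₃ | 1 => a₄ | 2 => c₂ | _ => b₂)
      (fun | 0 => a₂ | 1 => a₁ | 2 => b₄ | _ => b₃) (fun | 0 => u | 1 => v | _ => w) := by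
    refine IsPatch.of_nodup hn fun a b c =>
      isFaceDir_of_large_L hu.f₃.rotate₂ ?_ ?_ ?_ ?_ hw.f₃.rotate₂
    · intro k hk
      interval_cases k
      exacts [hu.f₄, hv.f₂, hw.f₂]
    · intro k hk
      interval_cases k
      exacts [hu.f₂.rotate₂, hv.f₅.rotate₂, hw.f₄.rotate₂]
    · intro k hk
      interval_cases k
      exacts [hv.f₁, hv.f₃.rotate]
    · intro k hk
      interval_cases k
      exacts [hv.f₆.rotate₂, hv.f₄.rotate]
  exact hP.exists_reduction ha hb

/-- Now `u` and `w` are two steps apart in the link of `v`, so besides `v` they have exactly the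
common neighbour `a₄` between them. The vertex `c₃` of the patch lies in neither of their links and
is separated from those by its non-adjacency to `u` and `w`. -/
theorem exists_reduction_B₀₀ (hu : Cyc5 G d u v a₁ a₂ a₃ a₄) (hv : Cyc6 G d v u c₁ w c₂ c₃ c₄)
    (hw : Cyc5 G d w v b₁ b₂ b₃ b₄) (ha : G.degree a₂ = 6) (hb : G.degree b₃ = 6) :
    ∃ R : Reduction G, R.expansion.kind = .B 0 0 := by
  obtain rfl := hu.f₅.rotate.unique hv.f₁
  obtain rfl := hu.f₁.unique hv.f₆.rotate
  obtain rfl := hv.f₂.rotate.unique hw.f₁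
  obtain rfl := hw.f₅.rotate.unique hv.f₃
  have h1 := hu.nodup_cons
  have h2 := hw.nodup_cons
  have h3 := hv.nodup_cons
  simp only [List.nodup_cons, List.mem_cons, List.not_mem_nil, or_false, not_or, List.nodup_nil,
    not_false_eq_true, and_true] at h1 h2 h3
  have key : ∀ x, G.graph.Adj u x → G.graph.Adj w x → x = v ∨ x = a₄ := by
    intro x hx hy
    by_contra hne
    rcases face_of_common d hv.f₁.adj hv.f₃.adj.symm hx hy (by grind) (by grind) with
      h | h | h | h
    · have := h.unique hv.f₁
      grind
    · have := h.unique hv.f₃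
      grind
    · have := h.1.unique hv.f₁
      grind
    · have := h.1.unique hv.f₃
      subst this
      have := h.2.unique hv.f₄
      grind
  have huw : ¬ G.graph.Adj u w := by
    intro h
    rcases face_of_adj d hv.f₁.adj hv.f₃.adj.symm h.symm with h | h
    · have := h.unique hv.f₁
      grind
    · have := h.rotate.unique hv.f₃
      grind
  have huc : ¬ G.graph.Adj u c₃ := by
    intro h
    rcases face_of_adj d hv.f₁.adj hv.f₅.adj.symm h.symm with h | h
    · have := h.unique hv.f₁
      grind
    · have := h.rotate.unique hv.f₅
      grind
  have hwc : ¬ G.graph.Adj w c₃ := by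
    intro h
    rcases face_of_adj d hv.f₃.adj hv.f₅.adj.symm h.symm with h | h
    · have := h.unique hv.f₃
      grind
    · have := h.rotate.unique hv.f₅
      grind
  have k1 := fun h => key a₁ hu.f₂.adj.symm h
  have k2 := fun h => key a₂ hu.f₃.adj.symm h
  have k3 := fun h => key a₃ hu.f₄.adj.symm h
  have l1 := hw.f₂.adj.symm
  have l2 := hw.f₃.adj.symm
  have l3 := hw.f₄.adj.symm
  have l4 := hw.f₅.adj.symm
  have m1 := hu.f₂.adj.symm
  have m2 := hu.f₃.adj.symm
  have m3 := hu.f₄.adj.symm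
  have m4 := hu.f₅.adj.symm
  have hwu : ¬ G.graph.Adj w u := fun h => huw h.symm
  have hP : IsPatch G d (.B 0 0) (fun | 0 => a₃ | 1 => a₄ | _ => b₂)
      (fun | 0 => a₂ | 1 => a₁ | 2 => c₃ | 3 => b₄ | _ => b₃)
      (fun | 0 => u | 1 => v | _ => w) := by
    refine IsPatch.of_nodup (show [a₃, a₄, b₂, a₂, a₁, c₃, b₄, b₃, u, v, w].Nodup by
      simp only [List.nodup_cons, List.mem_cons, List.not_mem_nil, or_false, not_or, List.nodup_nil,
        not_false_eq_true, and_true]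
      and_intros <;> grind) fun a b c =>
      isFaceDir_of_large_B hu.f₃.rotate₂ ?_ ?_ ?_ ?_ hv.f₅.rotate₂ hv.f₄.rotate₂ ?_ ?_ ?_ ?_
        hw.f₃.rotate₂
    · intro k hk
      interval_cases k
      exact hu.f₄
    · intro k hk
      interval_cases k
      exact hu.f₂.rotate₂
    · intro k hk
      interval_cases k
      exact hv.f₁
    · intro k hk
      interval_cases k
      exact hv.f₆.rotate₂
    · intro k hk hk'
      interval_cases k
      exact hv.f₂.rotate
    · intro k hk hk'
      interval_cases k
      exact hw.f₂
    · intro k hk hk'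
      interval_cases k
      exact hv.f₃.rotate
    · intro k hk hk'
      interval_cases k
      exact hw.f₄.rotate₂
  exact hP.exists_reduction ha hb

end DualFullerene

/-! ### Short reductions along a straight strip. -/

namespace DualFullerene

variable {W : Type u} {G : DualFullerene W} {d : Bool}

section short

variable {u v w a₁ a₂ a₃ a₄ b₁ b₂ b₃ b₄ c₁ c₂ c₃ c₄ : W}

/-- There is a reduction of length at most `n`. -/
def HasRed (G : DualFullerene W) (n : ℕ) : Prop :=
  ∃ R : Reduction G, R.length ≤ n

theorem hasRed_of_kind {x : OpKind} {n : ℕ} (h : ∃ R : Reduction G, R.expansion.kind = x)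
    (hn : x.length ≤ n) : HasRed G n := by
  obtain ⟨R, rfl⟩ := h
  exact ⟨R, hn⟩

/-- A straight path admits two positions of the patch, mirror images of each other, with different
pairs of end vertices. It suffices that one of these pairs has degree 6. -/
theorem hasRed_L₀ (hu : Cyc5 G d u v a₁ a₂ a₃ a₄) (hv : Cyc5 G d v u b₁ b₂ b₃ b₄)
    (h : (G.degree a₂ = 6 ∧ G.degree b₂ = 6) ∨ (G.degree a₃ = 6 ∧ G.degree b₃ = 6)) :
    HasRed G 2 := by
  rcases h with h | h
  · exact hasRed_of_kind (exists_reduction_L₀ hu.flip hv.flip h.1 h.2) (by simp [OpKind.length])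
  · exact hasRed_of_kind (exists_reduction_L₀ hu hv h.1 h.2) (by simp [OpKind.length])

theorem hasRed_L₁ (hu : Cyc5 G d u v a₁ a₂ a₃ a₄) (hv : Cyc6 G d v u c₁ c₂ w c₃ c₄)
    (hw : Cyc5 G d w v b₁ b₂ b₃ b₄)
    (h : (G.degree a₂ = 6 ∧ G.degree b₂ = 6) ∨ (G.degree a₃ = 6 ∧ G.degree b₃ = 6)) :
    HasRed G 2 := by
  rcases h with h | h
  · exact hasRed_of_kind (exists_reduction_L₁ hu.flip hv.flip hw.flip h.1 h.2)
      (by simp [OpKind.length])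
  · exact hasRed_of_kind (exists_reduction_L₁ hu hv hw h.1 h.2) (by simp [OpKind.length])

theorem hasRed_B₀₀ (hu : Cyc5 G d u v a₁ a₂ a₃ a₄) (hv : Cyc6 G d v u c₁ w c₂ c₃ c₄)
    (hw : Cyc5 G d w v b₁ b₂ b₃ b₄) (ha : G.degree a₂ = 6) (hb : G.degree b₃ = 6) :
    HasRed G 2 :=
  hasRed_of_kind (exists_reduction_B₀₀ hu hv hw ha hb) (by simp [OpKind.length])

theorem length_le_degree {l : List W} (hl : l.Nodup) (h : ∀ x ∈ l, G.graph.Adj v x) :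
    l.length ≤ G.degree v := by
  classical
  have hfin := G.finite
  rw [← List.toFinset_card_of_nodup hl, ← Set.ncard_coe_finset]
  refine Set.ncard_le_ncard (fun x hx => ?_) (Set.toFinite _)
  exact h x (by simpa using hx)

end short

/-- A straight strip of triangles on both sides of a path `p` that starts at a vertex of degree 5,
with `A` on the left and `B` on the right. -/
structure Ray (G : DualFullerene W) (d : Bool) (s : ℕ) (p A B : ℕ → W) : Prop where
  start : G.IsFaceDir d (A 0) (B 0) (p 0)
  fA : ∀ k ≤ s, G.IsFaceDir d (A k) (p k) (A (k + 1))
  fB : ∀ k ≤ s, G.IsFaceDir d (B k) (B (k + 1)) (p k)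
  fpA : ∀ k ≤ s, G.IsFaceDir d (p k) (p (k + 1)) (A (k + 1))
  fpB : ∀ k ≤ s, G.IsFaceDir d (p k) (B (k + 1)) (p (k + 1))
  A_inj : ∀ k ≤ s + 1, ∀ l ≤ s + 1, A k = A l → k = l
  B_inj : ∀ k ≤ s + 1, ∀ l ≤ s + 1, B k = B l → k = l
  p_inj : ∀ k ≤ s + 1, ∀ l ≤ s + 1, p k = p l → k = l
  A_ne_B : ∀ k ≤ s + 1, ∀ l ≤ s + 1, A k ≠ B l
  p_ne_A : ∀ k ≤ s + 1, ∀ l ≤ s + 1, p k ≠ A l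
  p_ne_B : ∀ k ≤ s + 1, ∀ l ≤ s + 1, p k ≠ B l

namespace Ray

variable {s k : ℕ} {p A B : ℕ → W} (r : Ray G d s p A B)
include r

theorem flip : Ray G (!d) s p B A where
  start := (isFaceDir_not'.2 r.start).rotate
  fA k hk := (isFaceDir_not'.2 (r.fB k hk)).rotate₂
  fB k hk := (isFaceDir_not'.2 (r.fA k hk)).rotate₂
  fpA k hk := (isFaceDir_not'.2 (r.fpB k hk)).rotate₂
  fpB k hk := (isFaceDir_not'.2 (r.fpA k hk)).rotate₂
  A_inj := r.B_inj
  B_inj := r.A_inj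
  p_inj := r.p_inj
  A_ne_B k hk l hl h := r.A_ne_B l hl k hk h.symm
  p_ne_A := r.p_ne_B
  p_ne_B := r.p_ne_A

theorem cyc5 : Cyc5 G d (p 0) (A 0) (A 1) (p 1) (B 1) (B 0) :=
  ⟨r.fA 0 (by omega), (r.fpA 0 (by omega)).rotate₂, (r.fpB 0 (by omega)).rotate₂,
    (r.fB 0 (by omega)).rotate, r.start.rotate⟩

theorem cyc6 (hk : k + 1 ≤ s) : Cyc6 G d (p (k + 1)) (p k) (A (k + 1)) (A (k + 2)) (p (k + 2))
    (B (k + 2)) (B (k + 1)) :=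
  ⟨r.fpA k (by omega), r.fA (k + 1) hk, (r.fpA (k + 1) hk).rotate₂, (r.fpB (k + 1) hk).rotate₂,
    (r.fB (k + 1) hk).rotate, (r.fpB k (by omega)).rotate⟩

theorem degree_p (h1 : 1 ≤ k) (hk : k ≤ s) : G.degree (p k) = 6 := by
  obtain ⟨k, rfl⟩ := Nat.exists_eq_add_of_le' h1
  exact (r.cyc6 hk).degree

/-- The link of an inner vertex of degree 5 of the side `A`. -/
theorem exists_cyc5_A (hk : k + 1 ≤ s) (h : G.degree (A (k + 1)) = 5) :
    ∃ o, Cyc5 G d (A (k + 1)) (p k) (A k) o (A (k + 2)) (p (k + 1)) := by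
  have h1 := (r.fA k (by omega)).rotate
  obtain ⟨b, o, e, f, hc⟩ := exists_cyc5 d h h1.adj.symm
  obtain rfl := hc.f₁.unique h1
  obtain rfl := hc.f₅.prev_unique (r.fpA k (by omega)).rotate
  obtain rfl := hc.f₄.prev_unique (r.fA (k + 1) hk).rotate₂
  exact ⟨o, hc⟩

/-- The edge from `A (k + 1)` to `A (k + 2)` is the path of an `L_0` reduction whose patch ends at
`A k` and `p (k + 2)`. -/
theorem hasRed_of_run (hk : k + 1 ≤ s) (h₁ : G.degree (A (k + 1)) = 5)
    (h₂ : G.degree (A (k + 2)) = 5) (h₀ : G.degree (A k) = 6) (hp : G.degree (p (k + 2)) = 6) :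
    HasRed G 2 := by
  obtain ⟨o, hc⟩ := r.exists_cyc5_A hk h₁
  have h1 := (r.fA (k + 1) hk).rotate
  obtain ⟨b, x, y, z, hc'⟩ := exists_cyc5 d h₂ h1.adj.symm
  obtain rfl := hc'.f₁.unique h1
  obtain rfl := hc'.f₅.prev_unique (r.fpA (k + 1) hk).rotate
  exact hasRed_L₀ hc.turn.turn.turn hc'.turn (Or.inr ⟨h₀, hp⟩)

theorem not_adj_p {j : ℕ} (hj : j ≤ s) (hjk : j + 1 < k) (hk : k ≤ s + 1) :
    ¬ G.graph.Adj (p j) (A k) := by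
  intro h
  cases j with
  | zero =>
    rcases r.cyc5.mem h with h | h | h | h | h
    · exact absurd (r.A_inj _ hk _ (by omega) h) (by omega)
    · exact absurd (r.A_inj _ hk _ (by omega) h) (by omega)
    · exact r.p_ne_A _ (by omega) _ hk h.symm
    · exact r.A_ne_B _ hk _ (by omega) h
    · exact r.A_ne_B _ hk _ (by omega) h
  | succ j =>
    rcases (r.cyc6 hj).mem h with h | h | h | h | h | h
    · exact r.p_ne_A _ (by omega) _ hk h.symm
    · exact absurd (r.A_inj _ hk _ (by omega) h) (by omega)
    · exact absurd (r.A_inj _ hk _ (by omega) h) (by omega)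
    · exact r.p_ne_A _ (by omega) _ hk h.symm
    · exact r.A_ne_B _ hk _ (by omega) h
    · exact r.A_ne_B _ hk _ (by omega) h

section outer

variable {i : ℕ} {o : W} (hi : i + 2 ≤ s)
  (hc : Cyc5 G d (A (i + 2)) (p (i + 1)) (A (i + 1)) o (A (i + 3)) (p (i + 2)))
include hi hc

theorem outer_ne_p {j : ℕ} (hj : j ≤ i + 2) : o ≠ p j := by
  rintro rfl
  have h := hc.nodup
  rcases (by omega : j ≤ i ∨ j = i + 1 ∨ j = i + 2) with h | rfl | rfl
  · exact r.not_adj_p (by omega) (k := i + 2) (by omega) (by omega) hc.f₃.adj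
  · simp at h
  · simp at h

/-- A vertex inside the side `A` has four neighbours on the strip. As `o` it would also be adjacent
to `A (i + 1)`, `A (i + 2)` and `A (i + 3)`, seven in all unless it is close to these. The first
vertex `A 0` has only three known neighbours, so for `i ≠ 0` the count does not exclude it; that
case is used in `hasRed_of_outer_eq_A`. -/
theorem outer_ne_A {j : ℕ} (h0 : j ≠ 0 ∨ i = 0) (hj : j ≤ i + 3) : o ≠ A j := by
  rintro rfl
  have h := hc.nodup
  have hne : ∀ {k l}, k ≤ i + 3 → l ≤ i + 3 → k ≠ l → A k ≠ A l := fun hk hl h e =>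
    h (r.A_inj _ (by omega) _ (by omega) e)
  rcases (by omega : j + 2 ≤ i + 1 ∨ j = i ∨ j = i + 1 ∨ j = i + 2 ∨ j = i + 3) with
    hj | rfl | rfl | rfl | rfl
  · obtain ⟨j, rfl⟩ := Nat.exists_eq_add_of_le' (show 1 ≤ j by omega)
    have := length_le_degree (G := G) (v := A (j + 1))
      (l := [p j, p (j + 1), A j, A (j + 2), A (i + 1), A (i + 2), A (i + 3)]) (by
        have n1 : p j ≠ p (j + 1) := fun e =>
          absurd (r.p_inj _ (by omega) _ (by omega) e) (by omega)
        have n2 : ∀ {k l}, k ≤ i + 2 → l ≤ i + 3 → p k ≠ A l := fun hk hl =>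
          r.p_ne_A _ (by omega) _ (by omega)
        simp only [List.nodup_cons, List.mem_cons, List.not_mem_nil, or_false, not_or,
          List.nodup_nil, not_false_eq_true, and_true]
        and_intros <;> first
          | exact n1
          | exact n2 (by omega) (by omega)
          | exact hne (by omega) (by omega) (by omega)) (by
        simp only [List.forall_mem_cons, List.not_mem_nil, false_implies, implies_true, and_true]
        exact ⟨(r.fA j (by omega)).rotate.adj.symm, (r.fA (j + 1) (by omega)).adj,
          (r.fA j (by omega)).rotate₂.adj, (r.fA (j + 1) (by omega)).rotate₂.adj.symm,
          hc.f₂.rotate₂.adj, hc.f₃.adj, hc.f₃.rotate₂.adj.symm⟩)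
    have := G.degree_le_six (A (j + 1))
    simp at *
    omega
  -- Here `o = A i`, and the link of `A (i + 1)` would close after four vertices.
  · exact not_close_four (v := A (j + 1)) (r.fA (j + 1) (by omega)).rotate₂
      (r.fpA j (by omega)).rotate (r.fA j (by omega)).rotate hc.f₂.rotate₂
  · simp at h
  · exact hc.f₂.ne₂₃ rfl
  · simp at h

theorem outer_ne_B {j : ℕ} (hj : j ≤ i + 2) (h0 : j ≠ 0) : o ≠ B j := by
  rintro rfl
  have hne : ∀ {k l}, k ≤ i + 3 → l ≤ i + 3 → k ≠ l → A k ≠ A l := fun hk hl h e =>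
    h (r.A_inj _ (by omega) _ (by omega) e)
  obtain ⟨j, rfl⟩ := Nat.exists_eq_add_of_le' (show 1 ≤ j by omega)
  have := length_le_degree (G := G) (v := B (j + 1))
    (l := [p j, p (j + 1), B j, B (j + 2), A (i + 1), A (i + 2), A (i + 3)]) (by
      have n1 : p j ≠ p (j + 1) := fun e =>
        absurd (r.p_inj _ (by omega) _ (by omega) e) (by omega)
      have n4 : B j ≠ B (j + 2) := fun e =>
        absurd (r.B_inj _ (by omega) _ (by omega) e) (by omega)
      have n2 : ∀ {k l}, k ≤ i + 2 → l ≤ i + 3 → p k ≠ A l := fun hk hl =>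
        r.p_ne_A _ (by omega) _ (by omega)
      have n3 : ∀ {k l}, k ≤ i + 2 → l ≤ i + 3 → p k ≠ B l := fun hk hl =>
        r.p_ne_B _ (by omega) _ (by omega)
      have n5 : ∀ {k l}, k ≤ i + 3 → l ≤ i + 3 → B k ≠ A l := fun hk hl e =>
        r.A_ne_B _ (by omega) _ (by omega) e.symm
      simp only [List.nodup_cons, List.mem_cons, List.not_mem_nil, or_false, not_or,
        List.nodup_nil, not_false_eq_true, and_true]
      and_intros <;> first
        | exact n1
        | exact n4
        | exact n2 (by omega) (by omega)
        | exact n3 (by omega) (by omega)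
        | exact n5 (by omega) (by omega)
        | exact hne (by omega) (by omega) (by omega)) (by
      simp only [List.forall_mem_cons, List.not_mem_nil, false_implies, implies_true, and_true]
      exact ⟨(r.fpB j (by omega)).adj.symm, (r.fB (j + 1) (by omega)).rotate₂.adj.symm,
        (r.fB j (by omega)).adj.symm, (r.fB (j + 1) (by omega)).adj,
        hc.f₂.rotate₂.adj, hc.f₃.adj, hc.f₃.rotate₂.adj.symm⟩)
  have := G.degree_le_six (B (j + 1))
  simp at *
  omega

-- The consecutive neighbours `y, p 0, z` and the consecutive neighbours `A (i + 1), A (i + 2), A (i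
-- + 3)` exhaust the six neighbours of `o`, so the middle ones `p 0` and `A (i + 2)` are opposite.
omit r hi in
theorem link_of_outer {y z : W} (hy : G.IsFaceDir d y o (p 0)) (hz : G.IsFaceDir d (p 0) o z)
    (hn : [y, p 0, z, A (i + 1), A (i + 2), A (i + 3)].Nodup) :
    ∃ x₁ x₂ x₃, Cyc6 G d o (p 0) z x₁ (A (i + 2)) x₂ x₃ := by
  have h6 : G.degree o = 6 := by
    have := length_le_degree (G := G) (v := o) hn (by
      simp only [List.forall_mem_cons, List.not_mem_nil, false_implies, implies_true, and_true]
      exact ⟨hy.adj.symm, hy.rotate.adj, hz.rotate.adj, hc.f₂.rotate₂.adj, hc.f₃.adj,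
        hc.f₃.rotate₂.adj.symm⟩)
    have := G.degree_eq o
    simp at *
    omega
  obtain ⟨b, x₁, w, x₂, x₃, hc6⟩ := exists_cyc6 d h6 hy.rotate.adj
  obtain rfl := hc6.f₁.unique hz
  obtain rfl := hc6.f₆.prev_unique hy
  have e1 := hc.f₂.rotate
  have e2 := hc.f₃.rotate₂
  simp only [List.nodup_cons, List.mem_cons, List.not_mem_nil, or_false, not_or,
    List.nodup_nil, not_false_eq_true, and_true] at hn
  rcases hc6.mem hc.f₃.adj with h | h | h | h | h | h
  · grind
  · grind
  · rw [h] at e2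
    have := hc6.f₂.prev_unique e2
    grind
  · exact ⟨_, _, _, h ▸ hc6⟩
  · rw [h] at e1
    have := hc6.f₅.unique e1
    grind
  · grind

/-- The path `p 0, A 0, A (i + 2)` is then straight. It belongs to an `L_1` reduction whose patch
ends at `p 1` and `p (i + 2)`, inner vertices of the strip, of degree 6. The case `o = B 0` below is
of the same kind. -/
theorem hasRed_of_outer_eq_A (h0 : i ≠ 0) (ho : o = A 0) : HasRed G 2 := by
  have hne : ∀ {k l}, k ≤ i + 3 → l ≤ i + 3 → k ≠ l → A k ≠ A l := fun hk hl h e =>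
    h (r.A_inj _ (by omega) _ (by omega) e)
  have n2 : ∀ {k l}, k ≤ i + 2 → l ≤ i + 3 → p k ≠ A l := fun hk hl =>
    r.p_ne_A _ (by omega) _ (by omega)
  have n5 : ∀ {k l}, k ≤ i + 3 → l ≤ i + 3 → A k ≠ B l := fun hk hl e =>
    r.A_ne_B _ (by omega) _ (by omega) e
  have n6 : p 0 ≠ B 0 := r.p_ne_B _ (by omega) _ (by omega)
  obtain ⟨x₁, x₂, x₃, h6⟩ := link_of_outer hc (y := A 1) (z := B 0)
    (ho ▸ (r.fA 0 (by omega)).rotate₂) (ho ▸ r.start.rotate₂) (by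
      simp only [List.nodup_cons, List.mem_cons, List.not_mem_nil, or_false, not_or,
        List.nodup_nil, not_false_eq_true, and_true]
      and_intros <;> first
        | exact n6
        | exact n2 (by omega) (by omega)
        | exact (n2 (by omega) (by omega)).symm
        | exact n5 (by omega) (by omega)
        | exact (n5 (by omega) (by omega)).symm
        | exact hne (by omega) (by omega) (by omega))
  subst ho
  refine hasRed_L₁ r.cyc5 h6 hc.turn.turn (Or.inl ⟨?_, ?_⟩)
  · exact r.degree_p (by omega) (by omega)
  · exact r.degree_p (by omega) (by omega)

theorem hasRed_of_outer_eq_B (ho : o = B 0) : HasRed G 2 := by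
  have hne : ∀ {k l}, k ≤ i + 3 → l ≤ i + 3 → k ≠ l → A k ≠ A l := fun hk hl h e =>
    h (r.A_inj _ (by omega) _ (by omega) e)
  have n2 : ∀ {k l}, k ≤ i + 2 → l ≤ i + 3 → p k ≠ A l := fun hk hl =>
    r.p_ne_A _ (by omega) _ (by omega)
  have n5 : ∀ {k l}, k ≤ i + 3 → l ≤ i + 3 → A k ≠ B l := fun hk hl e =>
    r.A_ne_B _ (by omega) _ (by omega) e
  have n6 : p 0 ≠ B 1 := r.p_ne_B _ (by omega) _ (by omega)
  obtain ⟨x₁, x₂, x₃, h6⟩ := link_of_outer hc (y := A 0) (z := B 1)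
    (ho ▸ r.start) (ho ▸ (r.fB 0 (by omega)).rotate₂) (by
      simp only [List.nodup_cons, List.mem_cons, List.not_mem_nil, or_false, not_or,
        List.nodup_nil, not_false_eq_true, and_true]
      and_intros <;> first
        | exact n6
        | exact n2 (by omega) (by omega)
        | exact (n2 (by omega) (by omega)).symm
        | exact n5 (by omega) (by omega)
        | exact (n5 (by omega) (by omega)).symm
        | exact hne (by omega) (by omega) (by omega))
  subst ho
  refine hasRed_L₁ r.cyc5.turn.turn.turn.turn h6 hc.turn.turn (Or.inr ⟨?_, ?_⟩)
  · exact r.degree_p (by omega) (by omega)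
  · exact r.degree_p (by omega) (by omega)

/-- If the outer neighbour of `A (i + 2)` is not on the strip, the path that turns from
`p (i + 1)` to `A (i + 2)` is that of a reduction. -/
theorem isPatch_of_outer (h0 : o ≠ A 0) (h0' : o ≠ B 0) : IsPatch G d (.B i 0)
    (fun n => if n ≤ i + 1 then A n else o)
    (fun n => if n ≤ i + 2 then B n else if n = i + 3 then p (i + 2) else A (i + 3))
    (fun n => if n ≤ i + 1 then p n else A (i + 2)) := by
  have oA : ∀ {j}, j ≤ i + 3 → o ≠ A j := fun {j} hj h => by
    rcases Nat.eq_zero_or_pos j with rfl | hj'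
    · exact h0 h
    · exact r.outer_ne_A hi hc (Or.inl (by omega)) hj h
  have oB : ∀ {j}, j ≤ i + 2 → o ≠ B j := fun {j} hj h => by
    rcases Nat.eq_zero_or_pos j with rfl | hj'
    · exact h0' h
    · exact r.outer_ne_B hi hc hj (by omega) h
  have op : ∀ {j}, j ≤ i + 2 → o ≠ p j := fun hj => r.outer_ne_p hi hc hj
  have hA : ∀ {k l}, k ≤ i + 3 → l ≤ i + 3 → A k = A l → k = l := fun hk hl h =>
    r.A_inj _ (by omega) _ (by omega) h
  have hB : ∀ {k l}, k ≤ i + 3 → l ≤ i + 3 → B k = B l → k = l := fun hk hl h =>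
    r.B_inj _ (by omega) _ (by omega) h
  have hp : ∀ {k l}, k ≤ i + 3 → l ≤ i + 3 → p k = p l → k = l := fun hk hl h =>
    r.p_inj _ (by omega) _ (by omega) h
  have pA : ∀ {k l}, k ≤ i + 3 → l ≤ i + 3 → p k ≠ A l := fun hk hl =>
    r.p_ne_A _ (by omega) _ (by omega)
  have pB : ∀ {k l}, k ≤ i + 3 → l ≤ i + 3 → p k ≠ B l := fun hk hl =>
    r.p_ne_B _ (by omega) _ (by omega)
  have AB : ∀ {k l}, k ≤ i + 3 → l ≤ i + 3 → A k ≠ B l := fun hk hl =>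
    r.A_ne_B _ (by omega) _ (by omega)
  refine ⟨fun k hk l hl h => ?_, fun k hk l hl h => ?_, fun k l hk hl h => ?_,
    fun k hk l hl h => ?_, fun k l hk hl h => ?_, fun k l hk hl h => ?_, fun a b c h => ?_⟩
  · have hk : k < i + 0 + 3 := hk
    have hl : l < i + 0 + 3 := hl
    split_ifs at h
    · exact hA (by omega) (by omega) h
    · exact (oA (by omega) h.symm).elim
    · exact (oA (by omega) h).elim
    · omega
  · have hk : k < i + 0 + 5 := hk
    have hl : l < i + 0 + 5 := hl
    split_ifs at h
    · exact hB (by omega) (by omega) h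
    · exact (pB (by omega) (by omega) h.symm).elim
    · exact (AB (by omega) (by omega) h.symm).elim
    · exact (pB (by omega) (by omega) h).elim
    · omega
    · exact (pA (by omega) (by omega) h).elim
    · exact (AB (by omega) (by omega) h).elim
    · exact (pA (by omega) (by omega) h.symm).elim
    · omega
  · have hk : k < i + 0 + 3 := hk
    have hl : l < i + 0 + 5 := hl
    split_ifs at h
    · exact AB (by omega) (by omega) h
    · exact pA (by omega) (by omega) h.symm
    · have := hA (by omega) (by omega) h
      omega
    · exact oB (by omega) h
    · exact op (by omega) h
    · exact oA (by omega) h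
  · have hk : k ≤ i + 0 + 2 := hk
    have hl : l ≤ i + 0 + 2 := hl
    split_ifs at h
    · exact hp (by omega) (by omega) h
    · exact (pA (by omega) (by omega) h).elim
    · exact (pA (by omega) (by omega) h.symm).elim
    · omega
  · have hk : k ≤ i + 0 + 2 := hk
    have hl : l < i + 0 + 3 := hl
    split_ifs at h
    · exact pA (by omega) (by omega) h
    · exact op (by omega) h.symm
    · have := hA (by omega) (by omega) h
      omega
    · exact oA (by omega) h.symm
  · have hk : k ≤ i + 0 + 2 := hk
    have hl : l < i + 0 + 5 := hl
    split_ifs at h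
    · exact pB (by omega) (by omega) h
    · have := hp (by omega) (by omega) h
      omega
    · exact pA (by omega) (by omega) h
    · exact AB (by omega) (by omega) h
    · exact pA (by omega) (by omega) h.symm
    · have := hA (by omega) (by omega) h
      omega
  · refine isFaceDir_of_large_B ?_ (fun k hk => ?_) (fun k hk => ?_) (fun k hk => ?_)
      (fun k hk => ?_) ?_ ?_ (fun k hk hk' => ?_) (fun k hk hk' => ?_) (fun k hk hk' => ?_)
      (fun k hk hk' => ?_) ?_ h
    · simpa using r.start
    · simpa [show k ≤ i + 1 by omega, show k ≤ i by omega] using r.fA k (by omega)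
    · simpa [show k ≤ i + 1 by omega, show k ≤ i + 2 by omega] using r.fB k (by omega)
    · simpa [show k ≤ i + 1 by omega, show k ≤ i by omega] using r.fpA k (by omega)
    · simpa [show k ≤ i + 1 by omega, show k ≤ i by omega] using r.fpB k (by omega)
    · simpa using r.fB (i + 1) (by omega)
    · simpa using (r.fpB (i + 1) (by omega)).rotate
    · obtain rfl : k = i + 1 := by omega
      simpa using (r.fA (i + 1) (by omega)).rotate
    · obtain rfl : k = i + 1 := by omega
      simpa using hc.f₂
    · obtain rfl : k = i + 1 := by omega
      simpa using r.fpA (i + 1) (by omega)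
    · obtain rfl : k = i + 1 := by omega
      simpa using (r.fA (i + 2) (by omega)).rotate
    · simpa using hc.f₃.rotate₂

end outer

/-- A vertex of degree 5 on the side of the strip followed by one of degree 6 gives rise to a
short reduction. -/
theorem hasRed_of_side (hk : k + 1 ≤ s) (h₁ : G.degree (A (k + 1)) = 5)
    (h₂ : G.degree (A (k + 2)) = 6) (h₀ : G.degree (B 0) = 6) : HasRed G (max (k + 1) 2) := by
  obtain ⟨o, hc⟩ := r.exists_cyc5_A hk h₁
  have mono : HasRed G 2 → HasRed G (max (k + 1) 2) := fun ⟨R, hR⟩ => ⟨R, hR.trans (by omega)⟩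
  cases k with
  -- The edge from `p 0` to `A 1` carries an `L_0` reduction with patch ends `B 0` and `A 2`.
  | zero => exact mono (hasRed_L₀ r.cyc5.turn hc (Or.inr ⟨h₀, h₂⟩))
  -- The path `p 0, ..., p (i + 1), A (i + 2)` turns off the strip. It has `i + 2 = k + 1` edges and
  -- its patch ends at `B 0` and `A (i + 3)`. It fails to be embedded only if `o` meets the start of
  -- the strip.
  | succ i =>
    by_cases hA : o = A 0
    · by_cases hi : i = 0
      · exact (r.outer_ne_A hk hc (Or.inr hi) (Nat.zero_le _) hA).elim
      · exact mono (r.hasRed_of_outer_eq_A hk hc hi hA)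
    by_cases hB : o = B 0
    · exact mono (r.hasRed_of_outer_eq_B hk hc hB)
    refine hasRed_of_kind ((r.isPatch_of_outer hk hc hA hB).exists_reduction ?_ ?_) ?_
    · simpa [OpKind.firstEnd] using h₀
    · simpa [OpKind.lastEnd] using h₂
    · simp [OpKind.length]

end Ray

end DualFullerene

/-! ### Strips along the path of a patch. -/

namespace DualFullerene

variable {W : Type u} {G : DualFullerene W} {d : Bool} {f g p : ℕ → W} {i j : ℕ}

/-- Half a turn of the straight patch: the two sides are exchanged and the orientation is kept. The
results about one end and one side thus apply to the others. -/
theorem IsPatch.reverse_L (hP : IsPatch G d (.L i) f g p) :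
    IsPatch G d (.L i) (fun k => g (i + 2 - k)) (fun k => f (i + 2 - k))
      (fun k => p (i + 1 - k)) := by
  refine ⟨fun k hk l hl h => ?_, fun k hk l hl h => ?_, fun k l hk hl h => ?_,
    fun k hk l hl h => ?_, fun k l hk hl h => ?_, fun k l hk hl h => ?_, fun a b c h => ?_⟩
  · have hk : k < i + 3 := hk
    have hl : l < i + 3 := hl
    have := hP.g_injOn (show i + 2 - k < i + 3 by omega) (show i + 2 - l < i + 3 by omega) h
    omega
  · have hk : k < i + 3 := hk
    have hl : l < i + 3 := hl
    have := hP.f_injOn (show i + 2 - k < i + 3 by omega) (show i + 2 - l < i + 3 by omega) h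
    omega
  · exact hP.f_ne_g _ _ (show i + 2 - l < i + 3 by omega) (show i + 2 - k < i + 3 by omega) h.symm
  · have hk : k ≤ i + 1 := hk
    have hl : l ≤ i + 1 := hl
    have := hP.p_injOn (show i + 1 - k ≤ i + 1 by omega) (show i + 1 - l ≤ i + 1 by omega) h
    omega
  · exact hP.p_ne_g _ _ (show i + 1 - k ≤ i + 1 by omega) (show i + 2 - l < i + 3 by omega) h
  · exact hP.p_ne_f _ _ (show i + 1 - k ≤ i + 1 by omega) (show i + 2 - l < i + 3 by omega) h
  · have F := fun {a b c} => hP.face a b c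
    refine isFaceDir_of_large_L ?_ (fun k hk => ?_) (fun k hk => ?_) (fun k hk => ?_)
      (fun k hk => ?_) ?_ h
    · exact F LargeFace.L_stop
    · have := (F (.L_g (k := i + 1 - k) (by omega))).rotate
      simp only [show i + 1 - k + 1 = i + 2 - k by omega] at this
      simpa only [show i + 2 - (k + 1) = i + 1 - k by omega] using this
    · have := (F (.L_f (k := i + 1 - k) (by omega))).rotate₂
      simp only [show i + 1 - k + 1 = i + 2 - k by omega] at this
      simpa only [show i + 2 - (k + 1) = i + 1 - k by omega] using this
    · have := (F (.L_pg (k := i - k) (by omega))).rotate₂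
      simp only [show i - k + 1 = i + 1 - k by omega] at this
      simpa only [show i + 2 - (k + 1) = i + 1 - k by omega,
        show i + 1 - (k + 1) = i - k by omega] using this
    · have := (F (.L_pf (k := i - k) (by omega))).rotate
      simp only [show i - k + 1 = i + 1 - k by omega] at this
      simpa only [show i + 2 - (k + 1) = i + 1 - k by omega,
        show i + 1 - (k + 1) = i - k by omega] using this
    · have := F .start
      rwa [show i + 2 - (i + 2) = 0 by omega, show i + 1 - (i + 1) = 0 by omega]

/-- Reading a bent path from its other end amounts to a reflection: each side stays where it is
relative to the bend and the orientation changes. -/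
theorem IsPatch.reverse_B (hP : IsPatch G d (.B i j) f g p) :
    IsPatch G (!d) (.B j i) (fun k => f (i + j + 2 - k)) (fun k => g (i + j + 4 - k))
      (fun k => p (i + j + 2 - k)) := by
  refine ⟨fun k hk l hl h => ?_, fun k hk l hl h => ?_, fun k l hk hl h => ?_,
    fun k hk l hl h => ?_, fun k l hk hl h => ?_, fun k l hk hl h => ?_, fun a b c h => ?_⟩
  · have hk : k < j + i + 3 := hk
    have hl : l < j + i + 3 := hl
    have := hP.f_injOn (show i + j + 2 - k < i + j + 3 by omega)
      (show i + j + 2 - l < i + j + 3 by omega) h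
    omega
  · have hk : k < j + i + 5 := hk
    have hl : l < j + i + 5 := hl
    have := hP.g_injOn (show i + j + 4 - k < i + j + 5 by omega)
      (show i + j + 4 - l < i + j + 5 by omega) h
    omega
  · exact hP.f_ne_g _ _ (show i + j + 2 - k < i + j + 3 by omega)
      (show i + j + 4 - l < i + j + 5 by omega) h
  · have hk : k ≤ j + i + 2 := hk
    have hl : l ≤ j + i + 2 := hl
    have := hP.p_injOn (show i + j + 2 - k ≤ i + j + 2 by omega)
      (show i + j + 2 - l ≤ i + j + 2 by omega) h
    omega
  · exact hP.p_ne_f _ _ (show i + j + 2 - k ≤ i + j + 2 by omega)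
      (show i + j + 2 - l < i + j + 3 by omega) h
  · exact hP.p_ne_g _ _ (show i + j + 2 - k ≤ i + j + 2 by omega)
      (show i + j + 4 - l < i + j + 5 by omega) h
  · have F := fun {a b c} => hP.face a b c
    refine isFaceDir_of_large_B ?_ (fun k hk => ?_) (fun k hk => ?_) (fun k hk => ?_)
      (fun k hk => ?_) ?_ ?_ (fun k hk hk' => ?_) (fun k hk hk' => ?_) (fun k hk hk' => ?_)
      (fun k hk hk' => ?_) ?_ h <;> refine isFaceDir_not'.2 ?_
    · exact (F LargeFace.B_stop).rotate₂
    · have := F (.B_f₂ (k := i + j + 1 - k) (by omega) (by omega))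
      simp only [show i + j + 1 - k + 1 = i + j + 2 - k by omega] at this
      simpa only [show i + j + 2 - (k + 1) = i + j + 1 - k by omega] using this
    · have := (F (.B_g₂ (k := i + j + 1 - k) (by omega) (by omega))).rotate₂
      simp only [show i + j + 1 - k + 1 = i + j + 2 - k by omega,
        show i + j + 1 - k + 2 = i + j + 3 - k by omega,
        show i + j + 1 - k + 3 = i + j + 4 - k by omega] at this
      simpa only [show i + j + 4 - (k + 1) = i + j + 3 - k by omega] using this
    · have := (F (.B_pf₂ (k := i + j + 1 - k) (by omega) (by omega))).rotate₂
      simp only [show i + j + 1 - k + 1 = i + j + 2 - k by omega] at this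
      simpa only [show i + j + 2 - (k + 1) = i + j + 1 - k by omega] using this
    · have := F (.B_pg₂ (k := i + j + 1 - k) (by omega) (by omega))
      simp only [show i + j + 1 - k + 1 = i + j + 2 - k by omega,
        show i + j + 1 - k + 2 = i + j + 3 - k by omega] at this
      simpa only [show i + j + 2 - (k + 1) = i + j + 1 - k by omega,
        show i + j + 4 - (k + 1) = i + j + 3 - k by omega] using this
    · have := (F .B_turn₂).rotate₂
      simpa only [show i + j + 4 - (j + 1) = i + 3 by omega,
        show i + j + 4 - (j + 2) = i + 2 by omega,
        show i + j + 2 - (j + 1) = i + 1 by omega] using this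
    · have := (F .B_turn₁).rotate₂
      simpa only [show i + j + 4 - (j + 3) = i + 1 by omega,
        show i + j + 4 - (j + 2) = i + 2 by omega,
        show i + j + 2 - (j + 1) = i + 1 by omega] using this
    · have := (F (.B_pf₁ (k := i + j + 1 - k) (by omega))).rotate₂
      simp only [show i + j + 1 - k + 1 = i + j + 2 - k by omega] at this
      simpa only [show i + j + 2 - (k + 1) = i + j + 1 - k by omega] using this
    · have := F (.B_f₁ (k := i + j + 1 - k) (by omega))
      simp only [show i + j + 1 - k + 1 = i + j + 2 - k by omega] at this
      simpa only [show i + j + 2 - (k + 1) = i + j + 1 - k by omega] using this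
    · have := F (.B_pg₁ (k := i + j + 1 - k) (by omega))
      simp only [show i + j + 1 - k + 1 = i + j + 2 - k by omega] at this
      simpa only [show i + j + 2 - (k + 1) = i + j + 1 - k by omega,
        show i + j + 4 - (k + 2) = i + j + 2 - k by omega] using this
    · have := (F (.B_g₁ (k := i + j + 1 - k) (by omega))).rotate₂
      simp only [show i + j + 1 - k + 1 = i + j + 2 - k by omega] at this
      simpa only [show i + j + 2 - (k + 1) = i + j + 1 - k by omega,
        show i + j + 4 - (k + 2) = i + j + 2 - k by omega,
        show i + j + 4 - (k + 3) = i + j + 1 - k by omega] using this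
    · have := (F .start).rotate₂
      simpa only [show i + j + 2 - (j + i + 2) = 0 by omega,
        show i + j + 4 - (j + i + 4) = 0 by omega] using this

theorem IsPatch.ray_L (hP : IsPatch G d (.L i) f g p) : Ray G d i p f g where
  start := hP.face _ _ _ .start
  fA k hk := hP.face _ _ _ (.L_f (by omega))
  fB k hk := hP.face _ _ _ (.L_g (by omega))
  fpA k hk := hP.face _ _ _ (.L_pf (by omega))
  fpB k hk := hP.face _ _ _ (.L_pg (by omega))
  A_inj k hk l hl h := hP.f_injOn (show k < i + 3 by omega) (show l < i + 3 by omega) h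
  B_inj k hk l hl h := hP.g_injOn (show k < i + 3 by omega) (show l < i + 3 by omega) h
  p_inj k hk l hl h := hP.p_injOn (show k ≤ i + 1 by omega) (show l ≤ i + 1 by omega) h
  A_ne_B k hk l hl := hP.f_ne_g k l (show k < i + 3 by omega) (show l < i + 3 by omega)
  p_ne_A k hk l hl := hP.p_ne_f k l (show k ≤ i + 1 by omega) (show l < i + 3 by omega)
  p_ne_B k hk l hl := hP.p_ne_g k l (show k ≤ i + 1 by omega) (show l < i + 3 by omega)

/-- The strip that reaches one step beyond the bend. -/
theorem IsPatch.ray_B (hP : IsPatch G d (.B i j) f g p) :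
    Ray G d (i + 1) (fun k => if k ≤ i + 1 then p k else g (i + 3))
      (fun k => if k ≤ i + 1 then f k else p (i + 2)) g := by
  -- Going straight on at the bend `p (i + 1)` leads to `g (i + 3)`, with the next path vertex `p (i
  -- + 2)` on the left.
  have hf : ∀ {k l}, k ≤ i + 1 → l ≤ i + 1 → f k = f l → k = l := fun {k l} hk hl h =>
    hP.f_injOn (show k < i + j + 3 by omega) (show l < i + j + 3 by omega) h
  have hg : ∀ {k l}, k ≤ i + 3 → l ≤ i + 3 → g k = g l → k = l := fun {k l} hk hl h =>
    hP.g_injOn (show k < i + j + 5 by omega) (show l < i + j + 5 by omega) h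
  have hp : ∀ {k l}, k ≤ i + 2 → l ≤ i + 2 → p k = p l → k = l := fun {k l} hk hl h =>
    hP.p_injOn (show k ≤ i + j + 2 by omega) (show l ≤ i + j + 2 by omega) h
  have fg : ∀ {k l}, k ≤ i + 1 → l ≤ i + 3 → f k ≠ g l := fun {k l} hk hl =>
    hP.f_ne_g k l (show k < i + j + 3 by omega) (show l < i + j + 5 by omega)
  have pf : ∀ {k l}, k ≤ i + 2 → l ≤ i + 1 → p k ≠ f l := fun {k l} hk hl =>
    hP.p_ne_f k l (show k ≤ i + j + 2 by omega) (show l < i + j + 3 by omega)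
  have pg : ∀ {k l}, k ≤ i + 2 → l ≤ i + 3 → p k ≠ g l := fun {k l} hk hl =>
    hP.p_ne_g k l (show k ≤ i + j + 2 by omega) (show l < i + j + 5 by omega)
  have F := fun {a b c} => hP.face a b c
  refine ⟨?_, fun k hk => ?_, fun k hk => ?_, fun k hk => ?_, fun k hk => ?_, fun k hk l hl h => ?_,
    fun k hk l hl h => ?_, fun k hk l hl h => ?_, fun k hk l hl h => ?_, fun k hk l hl h => ?_,
    fun k hk l hl h => ?_⟩
  · simpa using F .start
  · rcases Nat.lt_or_ge i k with h | h
    · obtain rfl : k = i + 1 := by omega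
      simpa using (F (.B_pf₂ (k := i + 1) (by omega) (by omega))).rotate₂
    · simpa [h, show k ≤ i + 1 by omega] using F (.B_f₁ h)
  · rcases Nat.lt_or_ge i k with h | h
    · obtain rfl : k = i + 1 := by omega
      simpa using F .B_turn₁
    · simpa [h, show k ≤ i + 1 by omega] using F (.B_g₁ h)
  · rcases Nat.lt_or_ge i k with h | h
    · obtain rfl : k = i + 1 := by omega
      simpa using F (.B_pg₂ (k := i + 1) (by omega) (by omega))
    · simpa [h, show k ≤ i + 1 by omega] using F (.B_pf₁ h)
  · rcases Nat.lt_or_ge i k with h | h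
    · obtain rfl : k = i + 1 := by omega
      simpa using (F .B_turn₂).rotate₂
    · simpa [h, show k ≤ i + 1 by omega] using F (.B_pg₁ h)
  · split_ifs at h
    · exact hf (by omega) (by omega) h
    · exact (pf (by omega) (by omega) h.symm).elim
    · exact (pf (by omega) (by omega) h).elim
    · omega
  · exact hg (by omega) (by omega) h
  · split_ifs at h
    · exact hp (by omega) (by omega) h
    · exact (pg (by omega) (by omega) h).elim
    · exact (pg (by omega) (by omega) h.symm).elim
    · omega
  · split_ifs at h
    · exact fg (by omega) (by omega) h
    · exact pg (by omega) (by omega) h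
  · split_ifs at h
    · exact pf (by omega) (by omega) h
    · have := hp (by omega) (by omega) h
      omega
    · exact fg (by omega) (by omega) h.symm
    · exact pg (by omega) (by omega) h.symm
  · split_ifs at h
    · exact pg (by omega) (by omega) h
    · have := hg (by omega) (by omega) h
      omega

end DualFullerene

/-! ### Degrees forced at the sides and at the start of a strip. -/

namespace DualFullerene

variable {W : Type u} {G : DualFullerene W} {d : Bool}

theorem degree_five {v : W} (h : ¬ G.degree v = 6) : G.degree v = 5 :=
  (G.degree_eq v).resolve_right h

theorem degree_six {v : W} (h : ¬ G.degree v = 5) : G.degree v = 6 :=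
  (G.degree_eq v).resolve_left h

namespace Ray

variable {s : ℕ} {p A B : ℕ → W} (r : Ray G d s p A B)
include r

/-- Going back along the side one reaches the first vertex of the run, at the latest after `A 0`;
there `hasRed_of_run` applies. -/
theorem not_run (hS : ¬ HasRed G 2) (h₀ : G.degree (A 0) = 6) {m : ℕ} (hm : m + 1 ≤ s)
    (h₁ : G.degree (A m) = 5) (h₂ : G.degree (A (m + 1)) = 5) : False := by
  induction m with
  | zero => omega
  | succ m ih =>
    by_cases h : G.degree (A m) = 5
    · exact ih (by omega) h h₁
    · exact hS (r.hasRed_of_run (by omega) h₁ h₂ (degree_six h) (r.degree_p (by omega) hm))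

/-- Go back from `A (m + 1)`: the first vertex of degree 5 met would be followed by one of degree 6,
and turning off to it gives a reduction of length at most `n`. -/
theorem degree_side {n : ℕ} (hS : ¬ HasRed G n) (hn : 2 ≤ n) (h₀ : G.degree (B 0) = 6) {m : ℕ}
    (hm : m ≤ s) (hmn : m ≤ n) (h : G.degree (A (m + 1)) = 6) {k : ℕ} (hk : 1 ≤ k)
    (hkm : k ≤ m + 1) : G.degree (A k) = 6 := by
  induction m with
  | zero =>
    obtain rfl : k = 1 := by omega
    exact h
  | succ m ih =>
    rcases Nat.lt_or_ge (m + 1) k with h' | h'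
    · obtain rfl : k = m + 1 + 1 := by omega
      exact h
    · refine ih (by omega) (by omega) (degree_six fun h5 => hS ?_) h'
      obtain ⟨R, hR⟩ := r.hasRed_of_side hm h5 h h₀
      exact ⟨R, hR.trans (by omega)⟩

/-- The link of the first vertex of the side `A`. -/
theorem exists_cyc6_start (h : G.degree (A 0) = 6) :
    ∃ z₂ z₁ o, Cyc6 G d (A 0) (p 0) (B 0) z₂ z₁ o (A 1) := by
  obtain ⟨b, z₂, z₁, o, e, hc⟩ := exists_cyc6 d h (r.fA 0 (by omega)).adj
  obtain rfl := hc.f₁.unique r.start.rotate₂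
  obtain rfl := hc.f₆.prev_unique (r.fA 0 (by omega)).rotate₂
  exact ⟨_, _, _, hc⟩

theorem exists_cyc5_start (h : G.degree (B 0) = 5) :
    ∃ y z₂, Cyc5 G d (B 0) (p 0) (B 1) y z₂ (A 0) := by
  obtain ⟨b, y, z₂, e, hc⟩ := exists_cyc5 d h r.start.rotate.adj
  obtain rfl := hc.f₁.unique (r.fB 0 (by omega)).rotate₂
  obtain rfl := hc.f₅.prev_unique r.start
  exact ⟨_, _, hc⟩

/-- If `A 1` has degree 5, the absence of reductions of length at most 2 forces one vertex after
another to have degree 5. The resulting cap of 5-vertices closes up and makes `A 2` and `B 1`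
adjacent, although they are opposite in the link of `p 1`. -/
theorem degree_A_one (hs : 1 ≤ s) (hS : ¬ HasRed G 2) (hA₀ : G.degree (A 0) = 6)
    (hB₁ : G.degree (B 1) = 6) (hA₂ : G.degree (A 1) = 5 → G.degree (A 2) = 6) :
    G.degree (A 1) = 6 := by
  refine degree_six fun hA₁ => ?_
  have hA₂ := hA₂ hA₁
  have hp₁ := r.degree_p le_rfl hs
  have cp := r.cyc5
  obtain ⟨z₂, z₁, o, cA⟩ := r.exists_cyc6_start hA₀
  obtain ⟨o', cA₁⟩ := r.exists_cyc5_A hs hA₁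
  obtain rfl := cA₁.f₂.unique cA.f₅.rotate
  -- All the following steps have this pattern: if the vertex had degree 6, the 5-vertices already
  -- found would carry a reduction of length at most 2. Hence it has degree 5 and its link can be
  -- filled in.
  have ho : G.degree o' = 5 := degree_five fun h => hS (hasRed_L₀ cp.turn cA₁ (Or.inl ⟨hB₁, h⟩))
  have hB₀ : G.degree (B 0) = 5 :=
    degree_five fun h => hS (hasRed_L₀ cp.turn cA₁ (Or.inr ⟨h, hA₂⟩))
  obtain ⟨y, z, cB⟩ := r.exists_cyc5_start hB₀
  obtain rfl := cB.f₄.prev_unique cA.f₂.rotate₂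
  have hz₂ : G.degree z = 5 := degree_five fun h =>
    hS (hasRed_L₀ cp.turn.turn.turn.turn cB (Or.inr ⟨hp₁, h⟩))
  obtain ⟨b, c, z', y', co⟩ := exists_cyc5 d ho cA₁.f₃.rotate₂.adj.symm
  obtain rfl := co.f₁.unique cA₁.f₃.rotate₂
  obtain rfl := co.f₂.unique cA₁.f₂.rotate
  obtain rfl := co.f₃.unique cA.f₄.rotate
  have hz₁ : G.degree z' = 5 := degree_five fun h =>
    hS (hasRed_L₀ cA₁.turn.turn co.turn (Or.inl ⟨hp₁, h⟩))
  obtain ⟨b, c, q, e, cz₂⟩ := exists_cyc5 d hz₂ cA.f₂.rotate.adj.symm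
  obtain rfl := cz₂.f₁.unique cA.f₂.rotate
  obtain rfl := cz₂.f₂.unique cB.f₃.rotate
  obtain rfl := cz₂.f₅.prev_unique cA.f₃.rotate₂
  obtain ⟨b, b', w, e', cz₁⟩ := exists_cyc5 d hz₁ cA.f₃.rotate.adj.symm
  obtain rfl := cz₁.f₁.unique cA.f₃.rotate
  obtain rfl := cz₁.f₂.unique cz₂.f₄.rotate
  obtain rfl := cz₁.f₅.prev_unique cA.f₄.rotate₂
  obtain rfl := cz₁.f₄.prev_unique co.f₄.rotate₂
  have hL := hasRed_L₁ co.turn.turn cA.turn.turn.turn.turn cB.turn.turn.turn.turn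
  have hy' : G.degree w = 5 := degree_five fun h => hS (hL (Or.inl ⟨h, hB₁⟩))
  have hy : G.degree c = 5 := degree_five fun h => hS (hL (Or.inr ⟨hA₂, h⟩))
  have hq : G.degree b' = 5 := degree_five fun h => hS (hasRed_L₁ cp cA cz₁ (Or.inl ⟨hp₁, h⟩))
  obtain ⟨x₁, x₂, x₃, m, cy'⟩ := exists_cyc5 d hy' co.f₅.rotate₂.adj.symm
  obtain rfl := cy'.f₁.unique co.f₅.rotate₂
  obtain rfl := cy'.f₂.unique co.f₄.rotate
  obtain rfl := cy'.f₃.unique cz₁.f₃.rotate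
  have hm : G.degree m = 5 := degree_five fun h =>
    hS (hasRed_L₀ co.turn.turn.turn.turn cy'.turn (Or.inr ⟨hA₀, h⟩))
  obtain ⟨y₁, y₂, y₃, m', cq⟩ := exists_cyc5 d hq cz₁.f₃.rotate₂.adj.symm
  obtain rfl := cq.f₁.unique cz₁.f₃.rotate₂
  obtain rfl := cq.f₂.unique cz₁.f₂.rotate₂.rotate₂
  obtain rfl := cq.f₃.unique cz₂.f₃.rotate
  obtain rfl := cq.f₅.prev_unique cy'.f₄.rotate₂
  obtain ⟨v₁, v₂, v₃, m'', cy⟩ := exists_cyc5 d hy cz₂.f₃.rotate₂.adj.symm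
  obtain rfl := cy.f₁.unique cz₂.f₃.rotate₂
  obtain rfl := cy.f₂.unique cB.f₃.rotate₂
  obtain rfl := cy.f₃.unique cB.f₂.rotate
  obtain rfl := cy.f₅.prev_unique cq.f₄.rotate₂
  obtain ⟨w₁, w₂, w₃, w₄, cm⟩ := exists_cyc5 d hm cy'.f₅.rotate₂.adj.symm
  obtain rfl := cm.f₁.unique cy'.f₅.rotate₂
  obtain rfl := cm.f₂.unique cy'.f₄.rotate
  obtain rfl := cm.f₃.unique cq.f₄.rotate
  obtain rfl := cm.f₄.unique cy.f₄.rotate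
  -- The last link contains `A 2` next to `B 1`. With `p 1` they form a triangle, hence a face, but
  -- the faces at `p 1` are known.
  have c6 := r.cyc6 (k := 0) hs
  rcases face_of_adj d c6.f₂.rotate.adj cm.f₅.rotate₂.adj c6.f₆.adj with h | h
  · exact r.p_ne_A 0 (by omega) 2 (by omega) (c6.f₆.unique h.rotate₂)
  · exact r.p_ne_B 2 (by omega) 1 (by omega) (c6.f₃.unique h.rotate₂)

/-- A set of vertices of degree 5 that are not ends of a reduction of length two once `A 0` has
degree 5. -/
def Blocked (G : DualFullerene W) (d : Bool) (u v : W) (l : List W) : Prop :=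
  l.Nodup ∧ ∀ x ∈ l, G.degree x = 5 ∧ x ≠ v ∧
    ∃ a ∈ u :: l, ∃ b ∈ u :: l, ∃ c ∈ u :: l, G.IsFaceDir d a x b ∧ G.IsFaceDir d b x c

/-- If `B 0` has degree 5, the same kind of forcing spreads to the side of `A 0` away from the path.
It produces seven 5-vertices, `B 0` among them, each with three consecutive neighbours among the
seven and `A 0`. In this cluster nothing closes up, so the contradiction has to come from the
parent, through `hb`. -/
theorem degree_B_zero (hs : 1 ≤ s) (hS : ¬ HasRed G 2) (hA₀ : G.degree (A 0) = 6)
    (hB₁ : G.degree (B 1) = 6) (hA₁ : G.degree (A 1) = 6)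
    (hb : ∀ l : List W, l.length = 7 → ¬ Blocked G d (A 0) (p 0) l) :
    G.degree (B 0) = 6 := by
  refine degree_six fun hB₀ => ?_
  have hp₁ := r.degree_p le_rfl hs
  have cp := r.cyc5
  obtain ⟨z₂, z₁, o, cA⟩ := r.exists_cyc6_start hA₀
  obtain ⟨y, z, cB⟩ := r.exists_cyc5_start hB₀
  obtain rfl := cB.f₄.prev_unique cA.f₂.rotate₂
  have hL := hasRed_L₀ cp.turn.turn.turn.turn cB
  have hy : G.degree y = 5 := degree_five fun h => hS (hL (Or.inl ⟨hA₁, h⟩))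
  have hz₂ : G.degree z = 5 := degree_five fun h => hS (hL (Or.inr ⟨hp₁, h⟩))
  obtain ⟨b, c, t, e, cz₂⟩ := exists_cyc5 d hz₂ cA.f₂.rotate.adj.symm
  obtain rfl := cz₂.f₁.unique cA.f₂.rotate
  obtain rfl := cz₂.f₂.unique cB.f₃.rotate
  obtain rfl := cz₂.f₅.prev_unique cA.f₃.rotate₂
  have hz₁ : G.degree e = 5 := degree_five fun h =>
    hS (hasRed_L₀ cB.turn.turn.turn cz₂.turn (Or.inr ⟨hB₁, h⟩))
  have ht : G.degree t = 5 := degree_five fun h => hS (hasRed_B₀₀ cp cA cz₂ hp₁ h)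
  obtain ⟨x₁, u, x₂, x₃, cy⟩ := exists_cyc5 d hy cB.f₂.rotate.adj.symm
  obtain rfl := cy.f₁.unique cB.f₂.rotate
  obtain rfl := cy.f₅.prev_unique cB.f₃.rotate₂
  obtain rfl := cy.f₄.prev_unique cz₂.f₃.rotate₂
  have hu : G.degree u = 5 := degree_five fun h =>
    hS (hasRed_L₀ cB.turn.turn cy (Or.inl ⟨hA₀, h⟩))
  obtain ⟨y₁, y₂, t₁, y₃, cz₁⟩ := exists_cyc5 d hz₁ cA.f₃.rotate.adj.symm
  obtain rfl := cz₁.f₁.unique cA.f₃.rotate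
  obtain rfl := cz₁.f₂.unique cz₂.f₄.rotate
  have ht₁ : G.degree t₁ = 5 := degree_five fun h => hS (hasRed_L₁ cp cA cz₁ (Or.inr ⟨hB₁, h⟩))
  obtain ⟨w₁, w₂, w₃, w₄, ct⟩ := exists_cyc5 d ht cz₂.f₄.rotate₂.adj.symm
  obtain rfl := ct.f₁.unique cz₂.f₄.rotate₂
  obtain rfl := ct.f₂.unique cz₂.f₃.rotate
  obtain rfl := ct.f₃.unique cy.f₃.rotate
  obtain rfl := ct.f₅.prev_unique cz₁.f₃.rotate₂
  -- Of the neighbours of `p 0` only `B 0` has degree 5, so `p 0` has no two consecutive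
  -- 5-neighbours. This distinguishes it from the forced vertices.
  have hp : ∀ {a b : W}, G.IsFaceDir d a (p 0) b → G.degree a = 5 → G.degree b = 5 → False := by
    intro a b h ha hb
    rcases cp.face_cases h with ⟨rfl, rfl⟩ | ⟨rfl, rfl⟩ | ⟨rfl, rfl⟩ | ⟨rfl, rfl⟩ | ⟨rfl, rfl⟩ <;>
      omega
  have hp' : ∀ {x a b : W}, G.IsFaceDir d a x b → G.degree a = 5 → G.degree b = 5 → x ≠ p 0 :=
    fun h ha hb e => hp (e ▸ h) ha hb
  have n₁ := ct.nodup_cons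
  have n₂ := cz₂.nodup_cons
  have n₃ := cy.nodup_cons
  have n₄ := hp' cz₁.f₂ hz₂ ht
  simp only [List.nodup_cons, List.mem_cons, List.not_mem_nil, or_false, not_or, List.nodup_nil,
    not_false_eq_true, and_true] at n₁ n₂ n₃
  have n₅ : w₄ ≠ B 0 := by
    intro h
    have h' := cz₁.f₄.adj
    rw [h] at h'
    rcases cB.mem h' with h | h | h | h | h
    · exact n₄ h
    · rw [h] at hz₁; omega
    · exact n₁.2.1.2.1 h
    · exact n₁.2.1.1 h
    · rw [h] at hz₁; omega
  refine hb [y₂, e, w₁, w₂, w₃, w₄, B 0] rfl ⟨?_, ?_⟩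
  · simp only [List.nodup_cons, List.mem_cons, List.not_mem_nil, or_false, not_or, List.nodup_nil,
    not_false_eq_true, and_true]
    and_intros <;> grind
  · have k : ∀ {x a b c : W}, G.degree x = 5 → x ≠ p 0 → G.IsFaceDir d a x b → G.IsFaceDir d b x c →
        a ∈ A 0 :: [y₂, e, w₁, w₂, w₃, w₄, B 0] → b ∈ A 0 :: [y₂, e, w₁, w₂, w₃, w₄, B 0] →
        c ∈ A 0 :: [y₂, e, w₁, w₂, w₃, w₄, B 0] → G.degree x = 5 ∧ x ≠ p 0 ∧
        ∃ a ∈ A 0 :: [y₂, e, w₁, w₂, w₃, w₄, B 0], ∃ b ∈ A 0 :: [y₂, e, w₁, w₂, w₃, w₄, B 0],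
          ∃ c ∈ A 0 :: [y₂, e, w₁, w₂, w₃, w₄, B 0], G.IsFaceDir d a x b ∧ G.IsFaceDir d b x c :=
      fun h h' h₁ h₂ ha hb hc => ⟨h, h', _, ha, _, hb, _, hc, h₁, h₂⟩
    simp only [List.forall_mem_cons]
    refine ⟨k ht (hp' ct.f₁ hz₁ hz₂) ct.f₁ ct.f₂ ?_ ?_ ?_,
      k hz₁ (hp' cz₁.f₂ hz₂ ht) cz₁.f₂ cz₁.f₃ ?_ ?_ ?_,
      k hz₂ (hp' cz₂.f₃ hy ht) cz₂.f₂ cz₂.f₃ ?_ ?_ ?_,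
      k hy (hp' cy.f₃ hu ht) cy.f₃ cy.f₄ ?_ ?_ ?_,
      k hu (hp' ct.f₄.rotate₂ ht₁ ht) ct.f₄.rotate₂ cy.f₃.rotate₂ ?_ ?_ ?_,
      k ht₁ (hp' cz₁.f₃.rotate hz₁ ht) cz₁.f₃.rotate ct.f₄.rotate ?_ ?_ ?_,
      k hB₀ cB.f₁.ne₁₂.symm cB.f₃ cB.f₄ ?_ ?_ ?_, by simp⟩ <;> simp

end Ray

end DualFullerene

/-! ### Degrees on the boundary of the extended patch. -/

namespace DualFullerene

variable {W : Type u} {G : DualFullerene W} {d : Bool} {f g p : ℕ → W} {i j : ℕ}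

theorem HasRed.mono {m n : ℕ} (h : HasRed G m) (hmn : m ≤ n) : HasRed G n := by
  obtain ⟨R, hR⟩ := h
  exact ⟨R, hR.trans hmn⟩

theorem Ray.Blocked.flip {u v : W} {l : List W} (h : Ray.Blocked G d u v l) :
    Ray.Blocked G (!d) u v l := by
  refine ⟨h.1, fun x hx => ?_⟩
  obtain ⟨h5, hv, a, ha, b, hb, c, hc, h₁, h₂⟩ := h.2 x hx
  exact ⟨h5, hv, c, hc, b, hb, a, ha, isFaceDir_not'.2 h₂, isFaceDir_not'.2 h₁⟩

namespace IsPatch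

section straight

variable (hP : IsPatch G d (.L i) f g p) (hi : 2 ≤ i) (h₁ : G.degree (f 0) = 6)
  (h₂ : G.degree (g (i + 2)) = 6) (hS : ¬ HasRed G i)
include hP hi h₁ h₂ hS

/-- Start from the last 6-vertex before the end of the side. If `g (i + 1)` has degree 5, then `g i`
has degree 6, since by the run lemma read from the end `g (i + 2)` the two cannot both have degree
5. -/
theorem degree_side_L {k : ℕ} (hk : 1 ≤ k) (hki : k ≤ i) : G.degree (g k) = 6 := by
  have hS' : ¬ HasRed G 2 := fun h => hS (h.mono hi)
  have r := hP.ray_L.flip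
  by_cases h : G.degree (g (i + 1)) = 5
  · have r' := hP.reverse_L.ray_L
    have h' : G.degree (g i) = 6 := degree_six fun h' => by
      refine r'.not_run hS' ?_ (m := 1) (by omega) ?_ ?_
      · simpa using h₂
      · simpa [show i + 2 - 1 = i + 1 by omega] using h
      · simpa using h'
    obtain ⟨i, rfl⟩ := Nat.exists_eq_add_of_le' (show 1 ≤ i by omega)
    exact r.degree_side hS (by omega) h₁ (m := i) (by omega) (by omega) h' hk hki
  · exact r.degree_side hS (by omega) h₁ (m := i) (by omega) (by omega) (degree_six h) hk (by omega)

theorem degree_start_L (hb : ∀ l : List W, l.length = 7 → ¬ Ray.Blocked G d (f 0) (p 0) l) :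
    G.degree (f 1) = 6 ∧ G.degree (g 0) = 6 := by
  have hS' : ¬ HasRed G 2 := fun h => hS (h.mono hi)
  have r := hP.ray_L
  have hg := hP.degree_side_L hi h₁ h₂ hS (k := 1) le_rfl (by omega)
  have hf := hP.reverse_L.degree_side_L hi (by simpa using h₂) (by simpa using h₁) hS
    (k := i) (by omega) le_rfl
  have h := r.degree_A_one (by omega) hS' h₁ hg fun _ => by simpa using hf
  exact ⟨h, r.degree_B_zero (by omega) hS' h₁ hg h hb⟩

theorem degree_bdry_L (hb₁ : ∀ l : List W, l.length = 7 → ¬ Ray.Blocked G d (f 0) (p 0) l)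
    (hb₂ : ∀ l : List W, l.length = 7 → ¬ Ray.Blocked G d (g (i + 2)) (p (i + 1)) l) :
    (∀ k < i + 3, G.degree (f k) = 6) ∧ ∀ k < i + 3, G.degree (g k) = 6 := by
  have hP' := hP.reverse_L
  have h₁' : G.degree ((fun k => g (i + 2 - k)) 0) = 6 := by simpa using h₂
  have h₂' : G.degree ((fun k => f (i + 2 - k)) (i + 2)) = 6 := by simpa using h₁
  have s₁ := hP.degree_start_L hi h₁ h₂ hS hb₁
  have s₂ := hP'.degree_start_L hi h₁' h₂' hS hb₂
  simp only [show i + 2 - 1 = i + 1 by omega, show i + 2 - 0 = i + 2 by omega] at s₂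
  constructor
  · intro k hk
    rcases (by omega : k = 0 ∨ k = 1 ∨ (2 ≤ k ∧ k ≤ i + 1) ∨ k = i + 2) with rfl | rfl | h | rfl
    · exact h₁
    · exact s₁.1
    · have := hP'.degree_side_L hi h₁' h₂' hS (k := i + 2 - k) (by omega) (by omega)
      simpa only [show i + 2 - (i + 2 - k) = k by omega] using this
    · exact s₂.2
  · intro k hk
    rcases (by omega : k = 0 ∨ (1 ≤ k ∧ k ≤ i) ∨ k = i + 1 ∨ k = i + 2) with rfl | h | rfl | rfl
    · exact s₁.2
    · exact hP.degree_side_L hi h₁ h₂ hS h.1 h.2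
    · exact s₂.1
    · exact h₂

end straight

section bent

variable (hP : IsPatch G d (.B i j) f g p) (hij : 1 ≤ i + j) (h₁ : G.degree (g 0) = 6)
  (h₂ : G.degree (g (i + j + 4)) = 6) (hS : ¬ HasRed G (i + j + 1))
include hP hij h₁ hS

/-- On the strip that goes straight on at the bend, `f (i + 1)` is followed by `p (i + 2)`, an inner
path vertex of degree 6 because `1 ≤ j`. With degree 5 at `f (i + 1)` the path could turn off there,
with length `max (i + 1) 2 ≤ i + j + 1`. -/
theorem degree_mid_aux (hj : 1 ≤ j) : G.degree (f (i + 1)) = 6 := by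
  refine degree_six fun h => hS (HasRed.mono (hP.ray_B.hasRed_of_side (k := i) le_rfl ?_ ?_ h₁) ?_)
  · simpa using h
  · simpa using hP.degree_inner (k := i + 2) (by omega) (by simp only [OpKind.length]; omega)
  · omega

include h₂

theorem degree_mid : G.degree (f (i + 1)) = 6 := by
  rcases Nat.eq_zero_or_pos j with rfl | hj
  · have := hP.reverse_B.degree_mid_aux (by omega) (by simpa using h₂)
      (by rwa [show 0 + i + 1 = i + 0 + 1 by omega]) (by omega)
    simpa using this
  · exact hP.degree_mid_aux hij h₁ hS hj

theorem degree_f_aux {k : ℕ} (hk : 1 ≤ k) (hki : k ≤ i + 1) : G.degree (f k) = 6 := by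
  have := hP.ray_B.degree_side hS (by omega) h₁ (m := i) (by omega) (by omega)
    (by simpa using hP.degree_mid hij h₁ h₂ hS) hk hki
  simpa [hki] using this

theorem degree_f {k : ℕ} (hk : 1 ≤ k) (hki : k ≤ i + j + 1) : G.degree (f k) = 6 := by
  rcases Nat.lt_or_ge (i + 1) k with h | h
  · have := hP.reverse_B.degree_f_aux (by omega) (by simpa using h₂)
      (by simpa [show i + j + 4 - (j + i + 4) = 0 by omega] using h₁)
      (by rwa [show j + i + 1 = i + j + 1 by omega]) (k := i + j + 2 - k) (by omega) (by omega)
    simpa only [show i + j + 2 - (i + j + 2 - k) = k by omega] using this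
  · exact hP.degree_f_aux hij h₁ h₂ hS hk h

/-- The middle one of the three vertices at the bend and its predecessor do not both have
degree 5. -/
theorem not_bend (h : G.degree (g (i + 1)) = 5) (h' : G.degree (g (i + 2)) = 5) : False := by
  have hS' : ¬ HasRed G 2 := fun h => hS (h.mono (by omega))
  have r := hP.ray_B.flip
  have r' := hP.reverse_B.ray_B.flip
  rw [Bool.not_not] at r'
  have h₀ : G.degree (g i) = 6 := degree_six fun h₀ => r.not_run hS' h₁ le_rfl h₀ h
  -- On the straight continuation `g (i + 3)` plays the part of the next path vertex. With degree 6
  -- it would complete an `L_0` reduction on the edge from `g (i + 1)` to `g (i + 2)`.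
  have h₃ : G.degree (g (i + 3)) = 5 := degree_five fun h₃ =>
    hS' (r.hasRed_of_run (k := i) le_rfl h h' h₀ (by simpa using h₃))
  have h₄ : G.degree (g (i + 4)) = 6 := degree_six fun h₄ => by
    refine r'.not_run hS' (by simpa using h₂) (m := j) (by omega) ?_ ?_
    · simpa [show i + j + 4 - j = i + 4 by omega] using h₄
    · simpa [show i + j + 4 - (j + 1) = i + 3 by omega] using h₃
  obtain ⟨o, c₁⟩ := r.exists_cyc5_A (k := i) le_rfl h
  obtain ⟨o', c₂⟩ := r'.exists_cyc5_A (k := j) le_rfl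
    (by simpa [show i + j + 4 - (j + 1) = i + 3 by omega] using h₃)
  have c := r.cyc6 (k := i) le_rfl
  simp only [show i + 1 ≤ i + 1 by omega, show i ≤ i + 1 by omega, show ¬ i + 2 ≤ i + 1 by omega,
    if_true, if_false] at c c₁
  simp only [show j + 1 ≤ j + 1 by omega, show j ≤ j + 1 by omega,
    if_true, show i + j + 4 - (j + 1) = i + 3 by omega,
    show i + j + 2 - (j + 1) = i + 1 by omega, show i + j + 2 - j = i + 2 by omega,
    show i + j + 4 - j = i + 4 by omega, show i + j + 4 - (j + 2) = i + 2 by omega] at c₂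
  -- The path `g (i + 1), p (i + 1), g (i + 3)` is that of a `B_{0,0}` reduction with patch ends `g
  -- i` and `g (i + 4)`.
  exact hS' (hasRed_B₀₀ c₁.turn.turn.turn.turn c.turn c₂.flip.turn h₀ h₄)

theorem degree_start_B (hb : ∀ l : List W, l.length = 7 → ¬ Ray.Blocked G d (g 0) (p 0) l) :
    G.degree (g 1) = 6 ∧ G.degree (f 0) = 6 := by
  have hS' : ¬ HasRed G 2 := fun h => hS (h.mono (by omega))
  have r := hP.ray_B.flip
  have hf : G.degree (if 1 ≤ i + 1 then f 1 else p (i + 2)) = 6 := by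
    simpa using hP.degree_f hij h₁ h₂ hS (k := 1) le_rfl (by omega)
  have h := r.degree_A_one (by omega) hS' h₁ hf fun h => degree_six fun h' => by
    rcases Nat.eq_zero_or_pos i with rfl | hi
    · exact hP.not_bend hij h₁ h₂ hS h h'
    · exact r.not_run hS' h₁ (m := 1) (by omega) h h'
  refine ⟨h, ?_⟩
  have := r.degree_B_zero (by omega) hS' h₁ hf h fun l hl hB => hb l hl (by simpa using hB.flip)
  simpa using this

theorem degree_g_aux (hb : ∀ l : List W, l.length = 7 → ¬ Ray.Blocked G d (g 0) (p 0) l) {k : ℕ}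
    (hki : k ≤ i + 1) : G.degree (g k) = 6 := by
  rcases Nat.eq_zero_or_pos k with rfl | hk
  · exact h₁
  have r := hP.ray_B.flip
  have h₀ : G.degree (if 0 ≤ i + 1 then f 0 else p (i + 2)) = 6 := by
    simpa using (hP.degree_start_B hij h₁ h₂ hS hb).2
  refine r.degree_side hS (by omega) h₀ (m := i) (by omega) (by omega) ?_ hk hki
  refine degree_six fun h => hS ?_
  refine (r.hasRed_of_side (k := i) le_rfl h ?_ h₀).mono (by omega)
  exact degree_six fun h' => hP.not_bend hij h₁ h₂ hS h h'

theorem degree_bdry_B (hb₁ : ∀ l : List W, l.length = 7 → ¬ Ray.Blocked G d (g 0) (p 0) l)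
    (hb₂ : ∀ l : List W, l.length = 7 →
      ¬ Ray.Blocked G d (g (i + j + 4)) (p (i + j + 2)) l) :
    (∀ k < i + j + 3, G.degree (f k) = 6) ∧
      ∀ k < i + j + 5, k ≠ i + 2 → G.degree (g k) = 6 := by
  have hP' := hP.reverse_B
  have h₁' : G.degree ((fun k => g (i + j + 4 - k)) 0) = 6 := by simpa using h₂
  have h₂' : G.degree ((fun k => g (i + j + 4 - k)) (j + i + 4)) = 6 := by
    simpa [show i + j + 4 - (j + i + 4) = 0 by omega] using h₁
  have hS' : ¬ HasRed G (j + i + 1) := by rwa [show j + i + 1 = i + j + 1 by omega]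
  have hb₂' : ∀ l : List W, l.length = 7 →
      ¬ Ray.Blocked G (!d) (g (i + j + 4)) (p (i + j + 2)) l :=
    fun l hl hB => hb₂ l hl (by simpa using hB.flip)
  constructor
  · intro k hk
    rcases (by omega : k = 0 ∨ (1 ≤ k ∧ k ≤ i + j + 1) ∨ k = i + j + 2) with rfl | h | rfl
    · exact (hP.degree_start_B hij h₁ h₂ hS hb₁).2
    · exact hP.degree_f hij h₁ h₂ hS h.1 h.2
    · exact (hP'.degree_start_B (by omega) h₁' h₂' hS' hb₂').2
  · intro k hk hne
    rcases Nat.lt_or_ge (i + 1) k with h | h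
    · have := hP'.degree_g_aux (by omega) h₁' h₂' hS' hb₂' (k := i + j + 4 - k) (by omega)
      simpa only [show i + j + 4 - (i + j + 4 - k) = k by omega] using this
    · exact hP.degree_g_aux hij h₁ h₂ hS hb₁ h

end bent

end IsPatch

end DualFullerene

/-! ### Paths of reductions of length two, and the count of 5-vertices in the parent. -/

namespace DualFullerene

variable {W : Type u} {G : DualFullerene W} {d : Bool}

/-- Three consecutive ones among the five neighbours of `u` that avoid `v` contain both `a₂` and
`a₃`, the neighbours opposite to `v`. -/
theorem Cyc5.not_consecutive {u v a₁ a₂ a₃ a₄ a b c : W} (hu : Cyc5 G d u v a₁ a₂ a₃ a₄)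
    {S : Set W} (hv : v ∉ S) (hS : a₂ ∉ S ∨ a₃ ∉ S) (h₁ : G.IsFaceDir d a u b)
    (h₂ : G.IsFaceDir d b u c) (ha : a ∈ S) (hb : b ∈ S) (hc : c ∈ S) : False := by
  rcases hu.face_cases h₁ with ⟨rfl, rfl⟩ | ⟨rfl, rfl⟩ | ⟨rfl, rfl⟩ | ⟨rfl, rfl⟩ | ⟨rfl, rfl⟩
  · exact hv ha
  · obtain rfl := h₂.unique hu.f₃
    tauto
  · tauto
  · obtain rfl := h₂.unique hu.f₅
    exact hv hc
  · exact hv hb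

/-- The vertices around a path of length two that is the path of a reduction. -/
inductive Path2 (G : DualFullerene W) (d : Bool) (u v w : W) : Prop
  | straight {a₁ a₂ a₃ a₄ b₁ b₂ b₃ b₄ c₁ c₂ c₃ c₄ : W} (hu : Cyc5 G d u v a₁ a₂ a₃ a₄)
      (hv : Cyc6 G d v u c₁ c₂ w c₃ c₄) (hw : Cyc5 G d w v b₁ b₂ b₃ b₄)
      (h : (G.degree a₂ = 6 ∧ G.degree b₂ = 6) ∨ (G.degree a₃ = 6 ∧ G.degree b₃ = 6)) :
      Path2 G d u v w
  | left {a₁ a₂ a₃ a₄ b₁ b₂ b₃ b₄ c₁ c₂ c₃ c₄ : W} (hu : Cyc5 G d u v a₁ a₂ a₃ a₄)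
      (hv : Cyc6 G d v u c₁ w c₂ c₃ c₄) (hw : Cyc5 G d w v b₁ b₂ b₃ b₄)
      (ha : G.degree a₂ = 6) (hb : G.degree b₃ = 6) : Path2 G d u v w
  | right {a₁ a₂ a₃ a₄ b₁ b₂ b₃ b₄ c₁ c₂ c₃ c₄ : W} (hu : Cyc5 G d u v a₁ a₂ a₃ a₄)
      (hv : Cyc6 G d v u c₁ c₂ c₃ w c₄) (hw : Cyc5 G d w v b₁ b₂ b₃ b₄)
      (ha : G.degree a₃ = 6) (hb : G.degree b₂ = 6) : Path2 G d u v w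

namespace Path2

variable {u v w : W}

theorem flip (h : Path2 G d u v w) : Path2 G (!d) u v w := by
  cases h with
  | straight hu hv hw h => exact .straight hu.flip hv.flip hw.flip h.symm
  | left hu hv hw ha hb => exact .right hu.flip hv.flip hw.flip ha hb
  | right hu hv hw ha hb => exact .left hu.flip hv.flip hw.flip ha hb

theorem symm (h : Path2 G d u v w) : Path2 G d w v u := by
  cases h with
  | straight hu hv hw h =>
    exact .straight hw hv.turn.turn.turn hu (h.imp And.symm And.symm)
  | left hu hv hw ha hb => exact .right hw hv.turn.turn hu hb ha
  | right hu hv hw ha hb => exact .left hw hv.turn.turn.turn.turn hu hb ha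

theorem hasRed (h : Path2 G d u v w) : HasRed G 2 := by
  cases h with
  | straight hu hv hw h => exact hasRed_L₁ hu hv hw h
  | left hu hv hw ha hb => exact hasRed_B₀₀ hu hv hw ha hb
  | right hu hv hw ha hb =>
    exact hasRed_B₀₀ hw hv.turn.turn.turn.turn hu hb ha

theorem data (h : Path2 G d u v w) : G.degree v = 6 ∧ ∃ a₁ a₂ a₃ a₄,
    Cyc5 G d u v a₁ a₂ a₃ a₄ ∧ (G.degree a₂ = 6 ∨ G.degree a₃ = 6) := by
  cases h with
  | straight hu hv hw h => exact ⟨hv.degree, _, _, _, _, hu, h.imp And.left And.left⟩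
  | left hu hv hw ha hb => exact ⟨hv.degree, _, _, _, _, hu, Or.inl ha⟩
  | right hu hv hw ha hb => exact ⟨hv.degree, _, _, _, _, hu, Or.inr ha⟩

theorem degree_left (h : Path2 G d u v w) : G.degree u = 5 := by
  obtain ⟨-, _, _, _, _, hu, -⟩ := h.data
  exact hu.degree

/-- At an end `u` of the path, both the path vertex `v` and one of the two neighbours opposite to
it, the end of the patch, have degree 6. Hence the vertices of a blocked set, all of which have
three consecutive 5-neighbours in the parent, are not ends of reductions of length two. -/
theorem not_consecutive (h : Path2 G d u v w) {a b c : W} (h₁ : G.IsFaceDir d a u b)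
    (h₂ : G.IsFaceDir d b u c) (ha : G.degree a = 5) (hb : G.degree b = 5)
    (hc : G.degree c = 5) : False := by
  obtain ⟨hv, a₁, a₂, a₃, a₄, hu, h6⟩ := h.data
  exact hu.not_consecutive (S := {x | G.degree x = 5}) (by simp [hv])
    (h6.imp (by simp +contextual) (by simp +contextual)) h₁ h₂ ha hb hc

theorem ne (h : Path2 G d u v w) : u ≠ w := by
  cases h with
  | straight hu hv hw h => exact hv.ne₁₄
  | left hu hv hw ha hb => exact hv.ne₁₃
  | right hu hv hw ha hb => exact hv.ne₁₅

end Path2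

end DualFullerene

open DualFullerene

namespace Reduction

variable {W : Type u} {G : DualFullerene W}

theorem exists_path2 (R : Reduction G) (h : R.length = 2) (d : Bool) :
    ∃ u v w, Path2 G d u v w ∧ R.fiveVertices = {u, w} := by
  suffices ∃ u v w, Path2 G R.expansion.dir u v w ∧ R.fiveVertices = {u, w} by
    obtain ⟨u, v, w, h, h'⟩ := this
    by_cases hd : R.expansion.dir = d
    · exact ⟨u, v, w, hd ▸ h, h'⟩
    · refine ⟨u, v, w, ?_, h'⟩
      have := h.flip
      rwa [show (!R.expansion.dir) = d by revert hd; cases R.expansion.dir <;> cases d <;> simp]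
        at this
  have hP := R.expansion.isPatch
  have h₁ := R.expansion.degree_old_end (Or.inl rfl)
  have h₂ := R.expansion.degree_old_end (Or.inr rfl)
  rw [Reduction.length] at h
  rw [Reduction.fiveVertices]
  refine ⟨R.expansion.p 0, R.expansion.p 1, R.expansion.p R.expansion.kind.length, ?_, rfl⟩
  rw [h]
  have F := fun {a b c} => hP.face a b c
  generalize R.expansion.kind = x at *
  cases x with
  | L i =>
    obtain rfl : i = 1 := by simpa [OpKind.length] using h
    refine .straight
      ⟨F (LargeFace.L_pg (k := 0) (by omega)).rotate.rotate,
        F (LargeFace.L_g (k := 0) (by omega)).rotate,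
        F LargeFace.start.rotate, F (LargeFace.L_f (k := 0) (by omega)),
        F (LargeFace.L_pf (k := 0) (by omega)).rotate.rotate⟩
      ⟨F (LargeFace.L_pf (k := 0) (by omega)), F (LargeFace.L_f (k := 1) (by omega)),
        F (LargeFace.L_pf (k := 1) (by omega)).rotate.rotate,
          F (LargeFace.L_pg (k := 1) (by omega)).rotate.rotate,
        F (LargeFace.L_g (k := 1) (by omega)).rotate, F (LargeFace.L_pg (k := 0) (by omega)).rotate⟩
      ⟨F (LargeFace.L_pf (k := 1) (by omega)), F (LargeFace.L_f (k := 2) (by omega)),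
        F LargeFace.L_stop.rotate,
        F (LargeFace.L_g (k := 2) (by omega)).rotate, F (LargeFace.L_pg (k := 1) (by omega)).rotate⟩
      (Or.inr ⟨h₁, h₂⟩)
  | B i j =>
    obtain ⟨rfl, rfl⟩ : i = 0 ∧ j = 0 := by
      simp only [OpKind.length] at h
      omega
    refine .left
      ⟨F (LargeFace.B_pg₁ (k := 0) (by omega)).rotate.rotate,
        F (LargeFace.B_g₁ (k := 0) (by omega)).rotate,
        F LargeFace.start.rotate, F (LargeFace.B_f₁ (k := 0) (by omega)),
        F (LargeFace.B_pf₁ (k := 0) (by omega)).rotate.rotate⟩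
      ⟨F (LargeFace.B_pf₁ (k := 0) (by omega)),
        F (LargeFace.B_pf₂ (k := 1) (by omega) (by omega)).rotate.rotate,
        F (LargeFace.B_pg₂ (k := 1) (by omega) (by omega)).rotate.rotate,
          F LargeFace.B_turn₂.rotate,
        F LargeFace.B_turn₁.rotate, F (LargeFace.B_pg₁ (k := 0) (by omega)).rotate⟩
      ⟨F (LargeFace.B_pf₂ (k := 1) (by omega) (by omega)),
        F (LargeFace.B_f₂ (k := 1) (by omega) (by omega)),
        F LargeFace.B_stop.rotate, F (LargeFace.B_g₂ (k := 1) (by omega) (by omega)).rotate,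
        F (LargeFace.B_pg₂ (k := 1) (by omega) (by omega)).rotate⟩
      h₁ h₂

end Reduction

namespace DualFullerene

variable {W : Type u} {G : DualFullerene W} {d : Bool}

/-- The 5-vertices of three disjoint reductions of length two. -/
theorem exists_path2_ends {R₁ R₂ R₃ : Reduction G} (h₁ : R₁.length = 2) (h₂ : R₂.length = 2)
    (h₃ : R₃.length = 2) (h₁₂ : Disjoint R₁.fiveVertices R₂.fiveVertices)
    (h₁₃ : Disjoint R₁.fiveVertices R₃.fiveVertices)
    (h₂₃ : Disjoint R₂.fiveVertices R₃.fiveVertices) (d : Bool) :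
    ∃ T : Set W, T.ncard = 6 ∧ ∀ x ∈ T, ∃ y z, Path2 G d x y z := by
  have := G.finite
  have key : ∀ R : Reduction G, R.length = 2 → R.fiveVertices.ncard = 2 ∧
      ∀ x ∈ R.fiveVertices, ∃ y z, Path2 G d x y z := by
    intro R hR
    obtain ⟨u, v, w, h, h'⟩ := R.exists_path2 hR d
    rw [h']
    refine ⟨Set.ncard_pair h.ne, fun x hx => ?_⟩
    rcases hx with rfl | rfl
    · exact ⟨_, _, h⟩
    · exact ⟨_, _, h.symm⟩
  refine ⟨R₁.fiveVertices ∪ R₂.fiveVertices ∪ R₃.fiveVertices, ?_, ?_⟩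
  · rw [Set.ncard_union_eq (Set.disjoint_union_left.2 ⟨h₁₃, h₂₃⟩), Set.ncard_union_eq h₁₂,
      (key _ h₁).1, (key _ h₂).1, (key _ h₃).1]
  · rintro x ((h | h) | h)
    exacts [(key _ h₁).2 x h, (key _ h₂).2 x h, (key _ h₃).2 x h]

end DualFullerene

open DualFullerene

namespace Expansion

variable {V : Type u} {W : Type v} {G : DualFullerene V} {G' : DualFullerene W}
  (E : Expansion G G')

theorem cyc5_first : ∃ a b c e, Cyc5 G' E.dir (E.p 0) (E.p 1) a b c e ∧
    (b = E.old (E.kind.firstEnd E.f E.g) ∨ c = E.old (E.kind.firstEnd E.f E.g)) := by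
  rw [← E.firstEnd_old]
  have F := fun {a b c} => E.isPatch.face a b c
  generalize E.kind = x at *
  cases x with
  | L i =>
    exact ⟨_, _, _, _, ⟨F (LargeFace.L_pg (k := 0) (by omega)).rotate.rotate,
      F (LargeFace.L_g (k := 0) (by omega)).rotate, F LargeFace.start.rotate,
      F (LargeFace.L_f (k := 0) (by omega)), F (LargeFace.L_pf (k := 0) (by omega)).rotate.rotate⟩,
      Or.inr rfl⟩
  | B i j =>
    exact ⟨_, _, _, _, ⟨F (LargeFace.B_pg₁ (k := 0) (by omega)).rotate.rotate,
      F (LargeFace.B_g₁ (k := 0) (by omega)).rotate, F LargeFace.start.rotate,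
      F (LargeFace.B_f₁ (k := 0) (by omega)),
      F (LargeFace.B_pf₁ (k := 0) (by omega)).rotate.rotate⟩, Or.inl rfl⟩

theorem cyc5_last : ∃ a b c e,
    Cyc5 G' E.dir (E.p E.kind.length) (E.p (E.kind.length - 1)) a b c e ∧
    (b = E.old (E.kind.lastEnd E.f E.g) ∨ c = E.old (E.kind.lastEnd E.f E.g)) := by
  rw [← E.lastEnd_old]
  have F := fun {a b c} => E.isPatch.face a b c
  generalize E.kind = x at *
  cases x with
  | L i =>
    exact ⟨_, _, _, _, ⟨F (LargeFace.L_pf (k := i) (by omega)),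
      F (LargeFace.L_f (k := i + 1) (by omega)), F LargeFace.L_stop.rotate,
      F (LargeFace.L_g (k := i + 1) (by omega)).rotate,
        F (LargeFace.L_pg (k := i) (by omega)).rotate⟩,
      Or.inr rfl⟩
  | B i j =>
    exact ⟨_, _, _, _, ⟨F (LargeFace.B_pf₂ (k := i + j + 1) (by omega) (by omega)),
      F (LargeFace.B_f₂ (k := i + j + 1) (by omega) (by omega)), F LargeFace.B_stop.rotate,
      F (LargeFace.B_g₂ (k := i + j + 1) (by omega) (by omega)).rotate,
      F (LargeFace.B_pg₂ (k := i + j + 1) (by omega) (by omega)).rotate⟩,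
      Or.inr rfl⟩

theorem ends_ne : E.kind.firstEnd E.f E.g ≠ E.kind.lastEnd E.f E.g := by
  have hf := E.f_ne_g
  have hg := E.g_injOn
  generalize E.kind = x at *
  cases x with
  | L i => exact hf _ _ (by simp [OpKind.sizeF]) (by simp [OpKind.sizeG])
  | B i j =>
    intro h
    have := hg (show 0 < i + j + 5 by omega) (show i + j + 4 < i + j + 5 by omega) h
    omega

/-- The vertices of `l` are old: of the two new 5-vertices, `q` is excluded by the definition of
`Blocked`, and `q'` does not qualify because `q₁` and the opposite neighbour `e₁` have degree 6. In
`G` these vertices and `e₀` have degree 5, so no vertex of `l` comes from an end in `T`, and `6 + 7`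
exceeds 12. -/
theorem not_blocked_of_cyc5 {e₀ e₁ : V} {q q' q₁ a b c e : W} (hc : Cyc5 G' E.dir q' q₁ a b c e)
    (hb : b = E.old e₁ ∨ c = E.old e₁) (he : e₀ ≠ e₁) (he₀ : G.degree e₀ = 5)
    (he₁ : G'.degree (E.old e₁) = 6) (hq₁ : ∃ k ≤ E.kind.length, E.p k = q₁)
    (hd₁ : G'.degree q₁ = 6) (hp : ∀ k ≤ E.kind.length, G'.degree (E.p k) = 5 →
      E.p k = q ∨ E.p k = q') {T : Set V} (hT : T.ncard = 6)
    (hT' : ∀ x ∈ T, ∃ y z, Path2 G E.dir x y z) {l : List W} (hl : l.length = 7) :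
    ¬ Ray.Blocked G' E.dir (E.old e₀) q l := by
  classical
  rintro ⟨hn, h⟩
  have := G.finite
  have hold : ∀ x ∈ l, ∃ v, E.old v = x := by
    intro x hx
    refine E.exists_old ?_
    rintro ⟨k, hk, rfl⟩
    obtain ⟨h5, hxq, a', ha', b', hb', c', hc', h₁, h₂⟩ := h _ hx
    rcases hp k hk h5 with h' | h'
    · exact hxq h'
    · rw [h'] at h₁ h₂
      have hne : E.old e₁ ∉ E.old e₀ :: l := by
        intro hm
        rcases List.mem_cons.1 hm with hm | hm
        · exact he (E.old_injective hm).symm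
        · have := (h _ hm).1
          omega
      refine hc.not_consecutive (S := {x | x ∈ E.old e₀ :: l}) ?_ ?_ h₁ h₂ ha' hb' hc'
      · intro hm
        rcases List.mem_cons.1 hm with hm | hm
        · obtain ⟨m, hm', hm''⟩ := hq₁
          exact E.old_ne_p e₀ ⟨m, hm', hm''.trans hm⟩
        · have := (h _ hm).1
          omega
      · rcases hb with rfl | rfl
        · exact Or.inl hne
        · exact Or.inr hne
  have hold' : ∀ x ∈ E.old e₀ :: l, ∃ v, E.old v = x ∧ G.degree v = 5 := by
    intro x hx
    rcases List.mem_cons.1 hx with rfl | hx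
    · exact ⟨_, rfl, he₀⟩
    · obtain ⟨v, rfl⟩ := hold x hx
      exact ⟨v, rfl, E.degree_of_old (h _ hx).1⟩
  have hL : (E.old ⁻¹' {x | x ∈ l}).ncard = 7 := by
    rw [Set.ncard_preimage_of_injective_subset_range E.old_injective
        (show {x | x ∈ l} ⊆ Set.range E.old from hold), ← hl,
      ← List.toFinset_card_of_nodup hn, ← Set.ncard_coe_finset]
    congr 1
    ext x
    simp
  have hdis : Disjoint T (E.old ⁻¹' {x | x ∈ l}) := by
    rw [Set.disjoint_left]
    intro v hv hvl
    obtain ⟨y, z, hP⟩ := hT' v hv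
    obtain ⟨-, -, a', ha', b', hb', c', hc', h₁, h₂⟩ := h _ hvl
    obtain ⟨a, rfl, ha⟩ := hold' _ ha'
    obtain ⟨b, rfl, hb⟩ := hold' _ hb'
    obtain ⟨c, rfl, hc⟩ := hold' _ hc'
    exact hP.not_consecutive (E.isFaceDir_of_old h₁).1 (E.isFaceDir_of_old h₂).1 ha hb hc
  have hsub : T ∪ E.old ⁻¹' {x | x ∈ l} ⊆ {v | G.degree v = 5} := by
    rintro v (hv | hv)
    · obtain ⟨y, z, hP⟩ := hT' v hv
      exact hP.degree_left
    · exact E.degree_of_old (h _ hv).1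
  have := Set.ncard_le_ncard hsub
  rw [Set.ncard_union_eq hdis, hT, hL, G.ncard_five] at this
  omega

theorem p_eq_of_degree {k : ℕ} (hk : k ≤ E.kind.length) (h : G'.degree (E.p k) = 5) :
    k = 0 ∨ k = E.kind.length := by
  by_contra h'
  have := E.inner_new k (by omega) (by omega)
  omega

variable {T : Set V} (hT : T.ncard = 6) (hT' : ∀ x ∈ T, ∃ y z, Path2 G E.dir x y z)
  (hE : 2 ≤ E.kind.length)
include hT hT' hE

theorem not_blocked_first {l : List W} (hl : l.length = 7) :
    ¬ Ray.Blocked G' E.dir (E.old (E.kind.firstEnd E.f E.g)) (E.p 0) l := by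
  obtain ⟨a, b, c, e, hc, hb⟩ := E.cyc5_last
  refine E.not_blocked_of_cyc5 hc hb E.ends_ne E.first_old (E.degree_old_end (Or.inr rfl))
    ⟨_, by omega, rfl⟩ (E.inner_new _ (by omega) (by omega)) (fun k hk h => ?_) hT hT' hl
  rcases E.p_eq_of_degree hk h with rfl | rfl
  · exact Or.inl rfl
  · exact Or.inr rfl

theorem not_blocked_last {l : List W} (hl : l.length = 7) :
    ¬ Ray.Blocked G' E.dir (E.old (E.kind.lastEnd E.f E.g)) (E.p E.kind.length) l := by
  obtain ⟨a, b, c, e, hc, hb⟩ := E.cyc5_first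
  refine E.not_blocked_of_cyc5 hc hb E.ends_ne.symm E.last_old (E.degree_old_end (Or.inl rfl))
    ⟨1, by omega, rfl⟩ (E.inner_new _ (by omega) (by omega)) (fun k hk h => ?_) hT hT' hl
  rcases E.p_eq_of_degree hk h with rfl | rfl
  · exact Or.inr rfl
  · exact Or.inl rfl

end Expansion

/-! ### Reductions of the parent carried over to the child. -/

namespace DualFullerene

variable {W : Type u} {G : DualFullerene W} {d : Bool}

/-- Distinctness is assumed here. In the application at the bend it is inherited from the path of
length two in `G`. -/
theorem exists_reduction_L₂ {u v w x a₁ a₂ a₃ a₄ b₁ b₂ b₃ b₄ c₁ c₂ c₃ c₄ e₁ e₂ e₃ e₄ : W}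
    (hu : Cyc5 G d u v a₁ a₂ a₃ a₄) (hv : Cyc6 G d v u c₁ c₂ w c₃ c₄)
    (hw : Cyc6 G d w v e₁ e₂ x e₃ e₄) (hx : Cyc5 G d x w b₁ b₂ b₃ b₄)
    (hn : [a₃, a₄, c₂, e₂, b₂, a₂, a₁, c₃, e₃, b₃, u, v, w, x].Nodup)
    (ha : G.degree a₃ = 6) (hb : G.degree b₃ = 6) :
    ∃ R : Reduction G, R.expansion.kind = .L 2 := by
  obtain rfl := hu.f₅.rotate.unique hv.f₁
  obtain rfl := hu.f₁.unique hv.f₆.rotate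
  obtain rfl := hv.f₃.rotate.unique hw.f₁
  obtain rfl := hw.f₆.rotate.unique hv.f₄
  obtain rfl := hw.f₃.rotate.unique hx.f₁
  obtain rfl := hx.f₅.rotate.unique hw.f₄
  have hP : IsPatch G d (.L 2) (fun | 0 => a₃ | 1 => a₄ | 2 => c₂ | 3 => e₂ | _ => b₂)
      (fun | 0 => a₂ | 1 => a₁ | 2 => e₄ | 3 => b₄ | _ => b₃)
      (fun | 0 => u | 1 => v | 2 => w | _ => x) := by
    refine IsPatch.of_nodup hn fun a b c =>
      isFaceDir_of_large_L hu.f₃.rotate₂ ?_ ?_ ?_ ?_ hx.f₃.rotate₂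
    · intro k hk
      interval_cases k
      exacts [hu.f₄, hv.f₂, hw.f₂, hx.f₂]
    · intro k hk
      interval_cases k
      exacts [hu.f₂.rotate₂, hv.f₅.rotate₂, hw.f₅.rotate₂, hx.f₄.rotate₂]
    · intro k hk
      interval_cases k
      exacts [hv.f₁, hw.f₁, hw.f₃.rotate]
    · intro k hk
      interval_cases k
      exacts [hv.f₆.rotate₂, hw.f₆.rotate₂, hw.f₄.rotate]
  exact hP.exists_reduction ha hb

end DualFullerene

open DualFullerene PatchLabel

namespace Expansion

variable {V : Type u} {W : Type v} {G : DualFullerene V} {G' : DualFullerene W}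
  (E : Expansion G G') {u v w a : V}

/-- All boundary vertices of the extended patch have degree 6, except possibly that at the bend. -/
structure BdrySix (E : Expansion G G') : Prop where
  degree_f : ∀ k < E.kind.sizeF, G'.degree (E.old (E.f k)) = 6
  degree_g : ∀ k < E.kind.sizeG, (∀ i j, E.kind = .B i j → k ≠ i + 2) →
    G'.degree (E.old (E.g k)) = 6

variable {E} (hE : E.BdrySix)
include hE

namespace BdrySix

theorem exists_bend {A : PatchLabel} (hA : A.IsBdry E.kind)
    (h : G'.degree (A.val (E.old ∘ E.f) (E.old ∘ E.g) E.p) = 5) :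
    ∃ i j, E.kind = .B i j ∧ A = .g (i + 2) := by
  cases A with
  | f k =>
    have := hE.degree_f k hA
    simp only [PatchLabel.val, Function.comp] at h
    omega
  | g k =>
    by_contra hk
    have := hE.degree_g k hA fun i j h1 h2 => hk ⟨i, j, h1, h2 ▸ rfl⟩
    simp only [PatchLabel.val, Function.comp] at h
    omega
  | p k => exact hA.elim

theorem exists_of_small {b c : V} (hu : G'.degree (E.old u) = 5)
    (h : SmallFace E.f E.g E.kind b u c) : ∃ i j, E.kind = .B i j ∧ u = E.g (i + 2) ∧
      ((b = E.g (i + 1) ∧ c = E.f (i + 1)) ∨ (b = E.f (i + 1) ∧ c = E.g (i + 3))) := by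
  obtain ⟨B, A, C, h', h1, h2, h3⟩ := E.isPatch.exists_labels_small (E.small_old.2 h)
  rw [← h2] at hu
  obtain ⟨i, j, hk, rfl⟩ := hE.exists_bend (small_isBdry h').2.1 hu
  rw [hk] at h'
  have := (Corner.B_g₂ rfl).consec_small h'
  simp only [Consec, List.cons_append, List.nil_append, or_false] at this
  refine ⟨i, j, hk, (E.old_injective h2).symm, ?_⟩
  rcases this with ⟨rfl, rfl⟩ | ⟨rfl, rfl⟩
  · exact Or.inl ⟨(E.old_injective h1).symm, (E.old_injective h3).symm⟩
  · exact Or.inr ⟨(E.old_injective h1).symm, (E.old_injective h3).symm⟩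

/-- A diagonal has initial triangles on both sides. Between its boundary neighbours `g (i + 1)` and
`g (i + 3)`, the vertex `g (i + 2)` has only `f (i + 1)`. -/
theorem exists_of_diagonal {c c' : V} (hu : G'.degree (E.old u) = 5)
    (h : SmallFace E.f E.g E.kind c u v) (h' : SmallFace E.f E.g E.kind v u c') :
    ∃ i j, E.kind = .B i j ∧ u = E.g (i + 2) ∧ v = E.f (i + 1) := by
  obtain ⟨i, j, hk, hu', h1 | h1⟩ := hE.exists_of_small hu h
  · exact ⟨i, j, hk, hu', h1.2⟩
  · obtain ⟨i', j', hk', -, h2 | h2⟩ := hE.exists_of_small hu h'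
    · rw [hk] at hk'
      cases hk'
      have := E.g_injOn (show i + 3 < E.kind.sizeG by rw [hk, OpKind.sizeG]; omega)
        (show i + 1 < E.kind.sizeG by rw [hk, OpKind.sizeG]; omega) (h1.2.symm.trans h2.1)
      omega
    · rw [hk] at hk'
      cases hk'
      exact ⟨i, j, hk, hu', h2.1⟩

/-- An old 5-vertex next to the path can only be the one at the bend, and its only neighbour on the
path is the inner vertex `p (i + 1)`. -/
theorem degree_p {k : ℕ} {b : W} (hk : k ≤ E.kind.length) (hu : G'.degree (E.old u) = 5)
    (h : G'.IsFaceDir E.dir b (E.old u) (E.p k)) : G'.degree (E.p k) = 6 := by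
  obtain ⟨B, A, C, h', h1, h2, h3⟩ := E.isPatch.exists_labels_large
    (E.isPatch.large_of_face' ⟨k, hk, Or.inr (Or.inr rfl)⟩ h)
  have hv := large_valid h'
  obtain rfl := E.isPatch.val_inj (B := .p k) hv.2.2 (Or.inr hk) h3
  have hA : A.IsBdry E.kind := by
    refine hv.2.1.resolve_right fun hA => ?_
    cases A with
    | f k => exact hA
    | g k => exact hA
    | p l => exact E.old_ne_p _ ⟨l, hA, h2⟩
  rw [← h2] at hu
  obtain ⟨i, j, hk', rfl⟩ := hE.exists_bend hA hu
  rw [hk'] at h'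
  have := (Corner.B_g₂ rfl).consec_large h'
  simp only [Consec, List.cons_append, List.nil_append, or_false, PatchLabel.p.injEq, reduceCtorEq,
    and_false] at this
  have hl : E.kind.length = i + j + 2 := by rw [hk', OpKind.length]
  exact E.inner_new k (by omega) (by omega)

/-- The link of `u` changes only at diagonals. By `hb` the vertex `v` is kept. A 6-vertex is either
kept, with its degree, or replaced by a path vertex, which has degree 6 by `degree_p`. -/
theorem cyc5_old {a₁ a₂ a₃ a₄ : V} (hu : Cyc5 G E.dir u v a₁ a₂ a₃ a₄)
    (h₁ : u ≠ E.kind.firstEnd E.f E.g) (h₂ : u ≠ E.kind.lastEnd E.f E.g)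
    (hb : ∀ i j, E.kind = .B i j → u = E.g (i + 2) → v ≠ E.f (i + 1)) :
    ∃ b₁ b₂ b₃ b₄, Cyc5 G' E.dir (E.old u) (E.old v) b₁ b₂ b₃ b₄ ∧
      (G.degree a₂ = 6 → G'.degree b₂ = 6) ∧ (G.degree a₃ = 6 → G'.degree b₃ = 6) := by
  have hu5 := (E.degree_old h₁ h₂).trans hu.degree
  obtain ⟨φ, hφ, hφ'⟩ := E.exists_link_map h₁ h₂
  have hv : φ v = E.old v := (hφ' v).resolve_right fun ⟨_, ⟨c, h⟩, c', h'⟩ => by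
    obtain ⟨i, j, hk, h1, h2⟩ := hE.exists_of_diagonal hu5 h.rotate.rotate h'
    exact hb i j hk h1 h2
  have key : ∀ {a b}, G.IsFaceDir E.dir a u b → G.degree b = 6 → G'.degree (φ b) = 6 := by
    intro a b hf hb
    rcases hφ' b with h | ⟨⟨k, hk, h⟩, -⟩
    · rw [h, E.degree_old, hb]
      · rintro rfl
        have := E.first_old
        omega
      · rintro rfl
        have := E.last_old
        omega
    · have := hφ _ _ hf
      rw [h] at this ⊢
      exact hE.degree_p hk hu5 this
  refine ⟨φ a₁, φ a₂, φ a₃, φ a₄, ⟨hv ▸ hφ _ _ hu.f₁, hφ _ _ hu.f₂, hφ _ _ hu.f₃, hφ _ _ hu.f₄,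
    hv ▸ hφ _ _ hu.f₅⟩, key hu.f₂, key hu.f₃⟩

/-- The middle vertex `v` has degree 6 in `G`, so it is not an end of the patch and its link is only
relabelled. The vertices `u` and `w` keep their places in it, since a diagonal from `v` to a
5-vertex occurs only at the bend. -/
theorem path2_old (hP : Path2 G E.dir u v w)
    (hu₁ : u ≠ E.kind.firstEnd E.f E.g) (hu₂ : u ≠ E.kind.lastEnd E.f E.g)
    (hw₁ : w ≠ E.kind.firstEnd E.f E.g) (hw₂ : w ≠ E.kind.lastEnd E.f E.g)
    (hbu : ∀ i j, E.kind = .B i j → u = E.g (i + 2) → v ≠ E.f (i + 1))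
    (hbw : ∀ i j, E.kind = .B i j → w = E.g (i + 2) → v ≠ E.f (i + 1)) :
    Path2 G' E.dir (E.old u) (E.old v) (E.old w) := by
  have hv6 := hP.data.1
  have hv₁ : v ≠ E.kind.firstEnd E.f E.g := by
    rintro rfl
    have := E.first_old
    omega
  have hv₂ : v ≠ E.kind.lastEnd E.f E.g := by
    rintro rfl
    have := E.last_old
    omega
  obtain ⟨φ, hφ, hφ'⟩ := E.exists_link_map hv₁ hv₂
  have hφu : φ u = E.old u := (hφ' u).resolve_right fun ⟨_, ⟨c, h⟩, c', h'⟩ => by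
    obtain ⟨i, j, hk, h1, h2⟩ := hE.exists_of_diagonal
      ((E.degree_old hu₁ hu₂).trans hP.degree_left) h'.rotate.rotate h
    exact hbu i j hk h1 h2
  have hφw : φ w = E.old w := (hφ' w).resolve_right fun ⟨_, ⟨c, h⟩, c', h'⟩ => by
    obtain ⟨i, j, hk, h1, h2⟩ := hE.exists_of_diagonal
      ((E.degree_old hw₁ hw₂).trans hP.symm.degree_left) h'.rotate.rotate h
    exact hbw i j hk h1 h2
  have hc : ∀ {a₁ a₂ a₃ a₄ a₅ a₆}, Cyc6 G E.dir v a₁ a₂ a₃ a₄ a₅ a₆ →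
      Cyc6 G' E.dir (E.old v) (φ a₁) (φ a₂) (φ a₃) (φ a₄) (φ a₅) (φ a₆) := fun h =>
    ⟨hφ _ _ h.f₁, hφ _ _ h.f₂, hφ _ _ h.f₃, hφ _ _ h.f₄, hφ _ _ h.f₅, hφ _ _ h.f₆⟩
  cases hP with
  | straight hu hv hw h =>
    obtain ⟨_, _, _, _, hu', hu2, hu3⟩ := hE.cyc5_old hu hu₁ hu₂ hbu
    obtain ⟨_, _, _, _, hw', hw2, hw3⟩ := hE.cyc5_old hw hw₁ hw₂ hbw
    have hv' := hc hv
    rw [hφu, hφw] at hv'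
    exact .straight hu' hv' hw' (h.imp (And.imp hu2 hw2) (And.imp hu3 hw3))
  | left hu hv hw ha hb =>
    obtain ⟨_, _, _, _, hu', hu2, -⟩ := hE.cyc5_old hu hu₁ hu₂ hbu
    obtain ⟨_, _, _, _, hw', -, hw3⟩ := hE.cyc5_old hw hw₁ hw₂ hbw
    have hv' := hc hv
    rw [hφu, hφw] at hv'
    exact .left hu' hv' hw' (hu2 ha) (hw3 hb)
  | right hu hv hw ha hb =>
    obtain ⟨_, _, _, _, hu', -, hu3⟩ := hE.cyc5_old hu hu₁ hu₂ hbu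
    obtain ⟨_, _, _, _, hw', hw2, -⟩ := hE.cyc5_old hw hw₁ hw₂ hbw
    have hv' := hc hv
    rw [hφu, hφw] at hv'
    exact .right hu' hv' hw' (hu3 ha) (hw2 hb)

end BdrySix

end Expansion

open DualFullerene PatchLabel

namespace Expansion

variable {V : Type u} {W : Type v} {G : DualFullerene V} {G' : DualFullerene W}
  {E : Expansion G G'} {w : V}

namespace BdrySix

variable (hE : E.BdrySix)
include hE

/-- A reduction of length two whose path crosses the bend leads to a straight reduction of length
three. -/
theorem exists_reduction_of_bend {i j : ℕ} (hk : E.kind = .B i j)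
    (hP : Path2 G E.dir (E.g (i + 2)) (E.f (i + 1)) w)
    (hu₁ : E.g (i + 2) ≠ E.kind.firstEnd E.f E.g) (hu₂ : E.g (i + 2) ≠ E.kind.lastEnd E.f E.g)
    (hw₁ : w ≠ E.kind.firstEnd E.f E.g) (hw₂ : w ≠ E.kind.lastEnd E.f E.g) :
    ∃ R : Reduction G', R.expansion.kind = .L 2 := by
  have hu5 := (E.degree_old hu₁ hu₂).trans hP.degree_left
  have hw5 := (E.degree_old hw₁ hw₂).trans hP.symm.degree_left
  have hne := hP.ne
  have hsF : E.kind.sizeF = i + j + 3 := by rw [hk, OpKind.sizeF]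
  have hS : ∀ {a b c}, SmallFace E.f E.g (.B i j) a b c → G.IsFaceDir E.dir a b c := by
    intro a b c h
    exact E.small_isFace _ _ _ (by rwa [hk])
  have hL : ∀ {a b c}, LargeFace (E.old ∘ E.f) (E.old ∘ E.g) E.p (.B i j) a b c →
      G'.IsFaceDir E.dir a b c := by
    intro a b c h
    exact E.isPatch.face _ _ _ (by rwa [hk])
  have hfw : ∀ k < i + j + 3, w ≠ E.f k := by
    rintro k hk rfl
    have := hE.degree_f k (by omega)
    omega
  -- the rotation at the two ends of the diagonal that crosses the bend
  have s₁ := hS (.B_down₁ (k := i + 1) le_rfl)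
  have s₂ := hS (.B_down₂ (j := j) (k := i + 1) le_rfl (by omega))
  have s₃ := hS (.B_up₁ (j := j) (k := i) le_rfl)
  have s₄ := hS (.B_up₂ (j := j) (k := i + 1) le_rfl (by omega))
  -- The initial patch shows that `f i, g (i + 1), g (i + 2), g (i + 3), f (i + 2)` are consecutive
  -- around `f (i + 1)`. A path from `g (i + 2)` that bends there would end in `f i` or `f (i + 2)`,
  -- which have degree 6.
  cases hP with
  | left hu hv hw ha hb =>
    obtain rfl := hv.f₁.unique s₁.rotate₂
    obtain rfl := hv.f₂.unique s₃.rotate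
    exact (hfw i (by omega) rfl).elim
  | right hu hv hw ha hb =>
    obtain rfl := hv.f₆.prev_unique s₂.rotate₂
    obtain rfl := hv.f₅.prev_unique s₄.rotate₂
    exact (hfw (i + 2) (by omega) rfl).elim
  | @straight a₁ a₂ a₃ a₄ b₁ b₂ b₃ b₄ c₁ c₂ c₃ c₄ hu hv hw h =>
    obtain rfl := hv.f₁.unique s₁.rotate₂
    obtain rfl := hv.f₂.unique s₃.rotate
    obtain rfl := hv.f₆.prev_unique s₂.rotate₂
    obtain rfl := hv.f₅.prev_unique s₄.rotate₂
    have hnL := nodup_L₁ hu hv hw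
    obtain rfl := hu.f₅.rotate.unique hv.f₁
    obtain rfl := hu.f₁.unique hv.f₆.rotate
    obtain rfl := hv.f₃.rotate.unique hw.f₁
    obtain rfl := hw.f₅.rotate.unique hv.f₄
    have hsu : ∀ {b c}, G.IsFaceDir E.dir b (E.g (i + 2)) c → b ≠ E.g (i + 1) → b ≠ E.f (i + 1) →
        G'.IsFaceDir E.dir (E.old b) (E.old (E.g (i + 2))) (E.old c) := by
      intro b c hf h1 h2
      refine E.isFaceDir_old hf fun hs => ?_
      obtain ⟨i', j', hk', -, h' | h'⟩ := hE.exists_of_small hu5 hs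
      all_goals
        rw [hk] at hk'
        cases hk'
      · exact h1 h'.1
      · exact h2 h'.1
    have hsw : ∀ {b c}, G.IsFaceDir E.dir b w c →
        G'.IsFaceDir E.dir (E.old b) (E.old w) (E.old c) := by
      intro b c hf
      refine E.isFaceDir_old hf fun hs => ?_
      obtain ⟨i', j', hk', h', -⟩ := hE.exists_of_small hw5 hs
      rw [hk] at hk'
      cases hk'
      exact hne h'.symm
    have hnu := hu.nodup
    simp only [List.nodup_cons, List.mem_cons, List.not_mem_nil, or_false, not_or, List.nodup_nil,
      not_false_eq_true, and_true] at hnu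
    -- The expansion subdivides the diagonal by `p (i + 1)`. The new path `g (i + 2), p (i + 1), f
    -- (i + 1), w` is straight at both inner vertices.
    have hu' : Cyc5 G' E.dir (E.old (E.g (i + 2))) (E.p (i + 1)) (E.old (E.g (i + 3))) (E.old a₂)
        (E.old a₃) (E.old (E.g (i + 1))) :=
      ⟨(hL LargeFace.B_turn₂).rotate₂, hsu hu.f₂ (by tauto) (by tauto),
        hsu hu.f₃ (by tauto) (by tauto),
        hsu hu.f₄ (by tauto) (by tauto), hL LargeFace.B_turn₁⟩
    have hv' : Cyc6 G' E.dir (E.p (i + 1)) (E.old (E.g (i + 2))) (E.old (E.g (i + 1))) (E.p i)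
        (E.old (E.f (i + 1))) (E.p (i + 2)) (E.old (E.g (i + 3))) :=
      ⟨hL LargeFace.B_turn₁.rotate, hL (LargeFace.B_pg₁ (k := i) le_rfl).rotate,
        hL (.B_pf₁ (k := i) le_rfl),
        (hL (.B_pf₂ (k := i + 1) le_rfl (by omega))).rotate₂,
        (hL (.B_pg₂ (k := i + 1) le_rfl (by omega))).rotate₂, (hL .B_turn₂).rotate⟩
    have hw' : Cyc6 G' E.dir (E.old (E.f (i + 1))) (E.p (i + 1)) (E.p i) (E.old (E.f i)) (E.old w)
        (E.old (E.f (i + 2))) (E.p (i + 2)) :=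
      ⟨(hL (.B_pf₁ (k := i) le_rfl)).rotate, (hL (.B_f₁ (k := i) le_rfl)).rotate,
        (hsw hw.f₁).rotate₂, (hsw hw.f₅).rotate,
        (hL (.B_f₂ (k := i + 1) le_rfl (by omega))).rotate₂,
        (hL (.B_pf₂ (k := i + 1) le_rfl (by omega))).rotate⟩
    have hx' : Cyc5 G' E.dir (E.old w) (E.old (E.f (i + 1))) (E.old (E.f i)) (E.old b₂) (E.old b₃)
        (E.old (E.f (i + 2))) :=
      ⟨hsw hw.f₁, hsw hw.f₂, hsw hw.f₃, hsw hw.f₄, hsw hw.f₅⟩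
    have hpl : ∀ k ≤ i + 2, k ≤ E.kind.length := by
      rw [hk, OpKind.length]
      omega
    have hpn : ([i, i + 1, i + 2].map E.p).Nodup := by
      refine List.Nodup.map_on (fun k hk l hl h => E.p_injOn ?_ ?_ h) (by simp)
      · exact hpl _ (by simp at hk; omega)
      · exact hpl _ (by simp at hl; omega)
    have hn := List.nodup_append.2 ⟨(hnL.map E.old_injective), hpn, by
      intro x hx y hy
      obtain ⟨v, -, rfl⟩ := List.mem_map.1 hx
      obtain ⟨k, hk, rfl⟩ := List.mem_map.1 hy
      exact fun h => E.old_ne_p v ⟨k, hpl k (by simp at hk; omega), h.symm⟩⟩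
    have h6 : ∀ {a}, G.degree a = 6 → G'.degree (E.old a) = 6 := by
      intro a ha
      rw [E.degree_old, ha]
      · rintro rfl
        have := E.first_old
        omega
      · rintro rfl
        have := E.last_old
        omega
    simp only [List.map_cons, List.map_nil, List.cons_append, List.nil_append] at hn
    rcases h with h | h
    · refine exists_reduction_L₂ hu'.flip hv'.flip hw'.flip hx'.flip ?_ (h6 h.1) (h6 h.2)
      clear * - hn
      simp only [List.nodup_cons, List.mem_cons, List.not_mem_nil, or_false, not_or,
        List.nodup_nil, not_false_eq_true, and_true] at hn ⊢
      grind
    · refine exists_reduction_L₂ hu' hv' hw' hx' ?_ (h6 h.1) (h6 h.2)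
      clear * - hn
      simp only [List.nodup_cons, List.mem_cons, List.not_mem_nil, or_false, not_or,
        List.nodup_nil, not_false_eq_true, and_true] at hn ⊢
      grind

end BdrySix

end Expansion

/-! ### Canonicity and conclusion. -/

open DualFullerene

/-- Only the first two entries of the 6-tuple are used, so the strings that break ties play no role.
-/
theorem Reduction.IsCanonical.length_le {W : Type u} {G : DualFullerene W} {R : Reduction G}
    {x₂ x₃ x₄ x₅ : RepTriple W → List ℕ} (hR : R.IsCanonical x₂ x₃ x₄ x₅) (R' : Reduction G) :
    R.length ≤ R'.length ∧
      (R.length = R'.length → R'.expansion.kind.straight ≤ R.expansion.kind.straight) := by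
  have h := hR R'
  simp only [Reduction.sixTuple, Prod.Lex.toLex_le_toLex] at h
  omega

namespace Expansion

variable {V W : Type u} {G : DualFullerene V} {G' : DualFullerene W} {E : Expansion G G'}

theorem bdrySix {T : Set V} (hT : T.ncard = 6) (hT' : ∀ x ∈ T, ∃ y z, Path2 G E.dir x y z)
    (hE : 3 ≤ E.kind.length) (hS : ¬ HasRed G' (E.kind.length - 1)) : E.BdrySix := by
  have hP := E.isPatch
  have h₁ := E.degree_old_end (Or.inl rfl)
  have h₂ := E.degree_old_end (Or.inr rfl)
  have hb₁ := fun l => E.not_blocked_first (l := l) hT hT' (by omega)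
  have hb₂ := fun l => E.not_blocked_last (l := l) hT hT' (by omega)
  suffices (∀ k < E.kind.sizeF, G'.degree (E.old (E.f k)) = 6) ∧
      ∀ k < E.kind.sizeG, (∀ i j, E.kind = .B i j → k ≠ i + 2) →
        G'.degree (E.old (E.g k)) = 6 from ⟨this.1, this.2⟩
  generalize E.kind = x at *
  cases x with
  | L i =>
    have hi : 3 ≤ i + 1 := hE
    have := hP.degree_bdry_L (by omega) h₁ h₂ hS hb₁ hb₂
    exact ⟨this.1, fun k hk _ => this.2 k hk⟩
  | B i j =>
    have hi : 3 ≤ i + j + 2 := hE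
    have := hP.degree_bdry_B (by omega) h₁ h₂ hS hb₁ hb₂
    exact ⟨this.1, fun k hk h => this.2 k hk (h i j rfl)⟩

/-- A reduction of length two of `G` away from the ends of the patch gives a reduction of `G'`. -/
theorem BdrySix.hasRed (hE : E.BdrySix) {u v w : V} (hP : Path2 G E.dir u v w)
    (hu₁ : u ≠ E.kind.firstEnd E.f E.g) (hu₂ : u ≠ E.kind.lastEnd E.f E.g)
    (hw₁ : w ≠ E.kind.firstEnd E.f E.g) (hw₂ : w ≠ E.kind.lastEnd E.f E.g) :
    HasRed G' 2 ∨ ∃ i j, E.kind = .B i j ∧ ∃ R : Reduction G', R.expansion.kind = .L 2 := by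
  by_cases hbu : ∃ i j, E.kind = .B i j ∧ u = E.g (i + 2) ∧ v = E.f (i + 1)
  · obtain ⟨i, j, hk, rfl, rfl⟩ := hbu
    exact Or.inr ⟨i, j, hk, hE.exists_reduction_of_bend hk hP hu₁ hu₂ hw₁ hw₂⟩
  · by_cases hbw : ∃ i j, E.kind = .B i j ∧ w = E.g (i + 2) ∧ v = E.f (i + 1)
    · obtain ⟨i, j, hk, rfl, rfl⟩ := hbw
      exact Or.inr ⟨i, j, hk, hE.exists_reduction_of_bend hk hP.symm hw₁ hw₂ hu₁ hu₂⟩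
    · exact Or.inl (hE.path2_old hP hu₁ hu₂ hw₁ hw₂ (fun i j hk h h' => hbu ⟨i, j, hk, h, h'⟩)
        fun i j hk h h' => hbw ⟨i, j, hk, h, h'⟩).hasRed

end Expansion

theorem exists_avoiding {α : Type u} {s₁ s₂ s₃ : Set α} (h₁₂ : Disjoint s₁ s₂)
    (h₁₃ : Disjoint s₁ s₃) (h₂₃ : Disjoint s₂ s₃) (a b : α) :
    (a ∉ s₁ ∧ b ∉ s₁) ∨ (a ∉ s₂ ∧ b ∉ s₂) ∨ (a ∉ s₃ ∧ b ∉ s₃) := by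
  rw [Set.disjoint_left] at h₁₂ h₁₃ h₂₃
  have := @h₁₂ a
  have := @h₁₃ a
  have := @h₂₃ a
  have := @h₁₂ b
  have := @h₁₃ b
  have := @h₂₃ b
  tauto

/-- If a dual fullerene `G` has three reductions of length 2 with pairwise disjoint sets of
5-vertices, then every canonical child of `G` has a reduction of length at most 2.  Here `x₂, ...,
  x₅`
are the strings used to break ties between reductions that agree in `x₀` and `x₁`; the claim is made
for every choice of them. -/
theorem mainTheorem5 {V W : Type u} (G : DualFullerene V) (G' : DualFullerene W)
    (hG : ∃ R₁ R₂ R₃ : Reduction G,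
      R₁.length = 2 ∧ R₂.length = 2 ∧ R₃.length = 2 ∧
      Disjoint R₁.fiveVertices R₂.fiveVertices ∧
      Disjoint R₁.fiveVertices R₃.fiveVertices ∧
      Disjoint R₂.fiveVertices R₃.fiveVertices)
    (x₂ x₃ x₄ x₅ : RepTriple W → List ℕ)
    (hG' : IsCanonicalChild x₂ x₃ x₄ x₅ G G') :
    ∃ R : Reduction G', R.length ≤ 2 := by
  obtain ⟨R₁, R₂, R₃, h₁, h₂, h₃, h₁₂, h₁₃, h₂₃⟩ := hG
  obtain ⟨E, hc⟩ := hG'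
  by_contra hS
  have hE : 3 ≤ E.kind.length := by
    by_contra h
    exact hS ⟨⟨V, G, E⟩, show E.kind.length ≤ 2 by omega⟩
  obtain ⟨T, hT, hT'⟩ := exists_path2_ends h₁ h₂ h₃ h₁₂ h₁₃ h₂₃ E.dir
  have hb : E.BdrySix := by
    refine Expansion.bdrySix hT hT' hE ?_
    rintro ⟨R, hR⟩
    have : E.kind.length ≤ R.length := (hc.length_le R).1
    omega
  -- Each of the two vertices whose degree grows lies in at most one of the three disjoint sets.
  obtain ⟨R, hR, hR₁, hR₂⟩ : ∃ R : Reduction G, R.length = 2 ∧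
      E.kind.firstEnd E.f E.g ∉ R.fiveVertices ∧ E.kind.lastEnd E.f E.g ∉ R.fiveVertices := by
    rcases exists_avoiding h₁₂ h₁₃ h₂₃ (E.kind.firstEnd E.f E.g) (E.kind.lastEnd E.f E.g) with
      h | h | h
    exacts [⟨R₁, h₁, h⟩, ⟨R₂, h₂, h⟩, ⟨R₃, h₃, h⟩]
  obtain ⟨u, v, w, hP, hRuw⟩ := R.exists_path2 hR E.dir
  simp only [hRuw, Set.mem_insert_iff, Set.mem_singleton_iff, not_or] at hR₁ hR₂
  rcases hb.hasRed hP (Ne.symm hR₁.1) (Ne.symm hR₂.1) (Ne.symm hR₁.2) (Ne.symm hR₂.2) with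
    h | ⟨i, j, hk, R, hR⟩
  · exact hS h
  -- An `L_2` reduction has length 3 and straight part 3, whereas a bent expansion of length 3 has
  -- straight part 2 and all others allowed by `hE` are longer.
  · have h := hc.length_le R
    simp only [Reduction.length, hk, hR, OpKind.length, OpKind.straight] at h hE
    omega
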